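/- **Setting.** Fix $n\ge 0$. A *cup diagram* $\underline\lambda$ is a partition of $\mathbb Z+\frac12$ into blocks of size at most $2$, finitely many of size $2$ (drawn as cups; one-element blocks carry a ray going down), such that if $\{i,j\}$ is a block and $i<k<j$, then $k$ lies in a block $\{k,k'\}$ of size two with $i<k'<j$. Let $\Lambda_n$ be the set of cup diagrams with $n$ cups. For $\lambda\in\Lambda_n$ let $\overline\lambda=\underline\lambda^*$ be the cap diagram with a cap $\{a+1,b+1\}$ for every cup $\{a,b\}$ of $\underline\lambda$ (its rays go up). A *crossingless matching* is a cap diagram $c$ drawn underneath a cup diagram $d$, with the rays of $c$ connected to those of $d$ by an order preserving bijection, such that outside a finite strip there are only vertical lines. A *generalized crossingless matching* $t=t_k\cdots t_1$ is a finite (possibly empty) sequence of crossingless matchings, $t_k$ being the bottom and $t_1$ the top layer; $t^\ddagger$ is its horizontal mirror image (upside down) shifted one to the right. We draw $\underline\lambda$ at the bottom and $\overline\mu$ at the top to form $\underline\lambda t\overline\mu$; similarly we form $t\overline\mu$ and $\underline\lambda t$. A line is *propagating* if it has one end at the bottom and one at the top. If $t\overline\mu$ has neither circles nor non-propagating lines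 ending at the top, its *upper reduction* is the cap diagram topologically equivalent to it; if $\underline\lambda t$ has neither circles nor non-propagating lines ending at the bottom, its *lower reduction* is the cup diagram topologically equivalent to it. Let $G_t$ be the complex vector space whose basis consists of the diagrams $\underline\lambda t\overline\mu$ with $\lambda,\mu\in\Lambda_n$ that contain neither circles nor non-propagating lines ("orientable" diagrams), and let $K_n=G_\emptyset$. A product $(\underline\lambda u\overline\mu)(\underline{\mu'}t\overline\nu)$ with $u=\emptyset$ or $t=\emptyset$ is $0$ if $\mu\ne\mu'$. Otherwise draw the first diagram below the second, connect the rays of $\overline\mu$ with those of $\underline\mu$ by the order preserving bijection that is the identity outside a finite strip, and remove the middle section $\overline\mu\,\underline\mu$ by successive surgeries: choose an outermost remaining cup $\{p<q\}$ of the middle section, the corresponding cap $\{p+1,q+1\}$, and the line between them, with top end $x$ and bottom end $y$, and replace them by three lines connecting $p,q,x$ at the top with $y,p+1,q+1$ at the bottom, respectively. The product is $0$ if one of the intermediate results contains a circle or a non-propagating line, and $\underline\lambda ut\overline\nu$ otherwise. All modules are complex and locally unital, $M=\bigoplus_{\lambda\in\Lambda_n} e_\lambda M$ with $e_\lambda=\underline\lambda\overline\lambda$.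 Let $L(\overline\lambda)$ be the one-dimensional $K_n$-module on which $e_\lambda$ acts as $1$ and all other basis diagrams act as $0$, and put $\theta_tM=G_t\otimes_{K_n}M$. **Theorem.** With these operations $K_n$ is an associative algebra, locally unital with respect to the $e_\lambda$, every $G_t$ is a locally unital $K_n$-$K_n$-bimodule, and every $L(\overline\lambda)$ is a $K_n$-module. Let $t$ be a generalized crossingless matching and $\lambda\in\Lambda_n$. 1. The module $\theta_tL(\overline\lambda)$ is finite dimensional, and in the Grothendieck group of finite dimensional $K_n$-modules $$[\theta_tL(\overline\lambda)]=\sum_\mu[L(\overline\mu)],$$ where the (finite) sum runs over all $\mu\in\Lambda_n$ such that (a) $t^\ddagger\overline\mu$ contains neither circles nor non-propagating lines ending at the top, and (b) $\overline\lambda$ is the upper reduction of $t^\ddagger\overline\mu$. 2. $\theta_tL(\overline\lambda)\neq0$ if and only if $t\overline\lambda$ has neither circles nor non-propagating lines ending at the top and $\overline\lambda$ is the upper reduction of $t^\ddagger t\overline\lambda$. 3. Suppose $\theta_tL(\overline\lambda)\ne0$, and let $\overline\nu$ be the upper reduction of $t\overline\lambda$. Then $\nu\in\Lambda_n$, and $\theta_tL(\overline\lambda)$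 is indecomposable with irreducible head $L(\overline\nu)$. 4. Suppose $\theta_tL(\overline\lambda)\ne0$, and let $\underline{\nu'}$ be the lower reduction of $\underline\lambda t^\ddagger$. Then this lower reduction exists, $\nu'\in\Lambda_n$, and $\theta_tL(\overline\lambda)$ is indecomposable with irreducible socle $L(\overline{\nu'})$. -/

import Mathlib

open scoped TensorProduct

noncomputable section

namespace KhovanovP

/-! ### Cup diagrams, cap diagrams and crossingless matchings

The half-integer `i + 1/2` is represented by the integer `i`. -/

/-- A noncrossing arc diagram: a partition of `ℤ + 1/2` into blocks of size at most two, finitely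
many of size two, such that below (above) each arc there are only arcs.  `partner i` is the other
element of the block of `i`, with `partner i = i` if `i` carries a ray.  It is read either as a cup
diagram (arcs are cups, rays go down) or as a cap diagram (arcs are caps, rays go up). -/
@[ext] structure ArcDiagram where
  partner : ℤ → ℤ
  partner_partner : ∀ i, partner (partner i) = i
  finite_arcs : {i | partner i ≠ i}.Finite
  noncrossing : ∀ i k, i < k → k < partner i →
    partner k ≠ k ∧ i < partner k ∧ partner k < partner i

namespace ArcDiagram

/-- The number of arcs. -/
def arcs (a : ArcDiagram) : ℕ := {i | i < a.partner i}.ncard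

/-- The point `i` carries a ray. -/
def IsRay (a : ArcDiagram) (i : ℤ) : Prop := a.partner i = i

/-- The number of endpoints of arcs to the left of `i`. -/
def below (a : ArcDiagram) (i : ℤ) : ℕ := {k | k < i ∧ a.partner k ≠ k}.ncard

/-- The diagram without arcs. -/
def empty : ArcDiagram where
  partner i := i
  partner_partner _ := rfl
  finite_arcs := by simp
  noncrossing i k h h' := absurd (h.trans h') (lt_irrefl i)

/-- The diagram moved one step to the right. -/
def shift (a : ArcDiagram) : ArcDiagram where
  partner i := a.partner (i - 1) + 1
  partner_partner i := by simp [a.partner_partner]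
  finite_arcs := by
    refine (a.finite_arcs.image (fun i => i + 1)).subset fun i hi => ⟨i - 1, ?_, by simp⟩
    simp only [Set.mem_ofPred_eq] at hi ⊢
    omega
  noncrossing i k h h' := by
    have := a.noncrossing (i - 1) (k - 1) (by omega) (by omega)
    omega

lemma arcs_shift (a : ArcDiagram) : a.shift.arcs = a.arcs := by
  have : {i | i < a.shift.partner i} = (fun i : ℤ => i + 1) '' {i | i < a.partner i} := by
    ext i
    simp only [shift, Set.mem_ofPred_eq, Set.mem_image]
    constructor
    · intro h
      exact ⟨i - 1, by omega, by omega⟩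
    · rintro ⟨j, hj, rfl⟩
      simpa using hj
  rw [arcs, this, Set.ncard_image_of_injective _ (add_left_injective 1), arcs]

/-- `b` arises from `a` by turning some of the arcs of `a` into rays.  Since `b` is again an arc
diagram, an arc can only be removed together with all the arcs around it. -/
def IsSubdiagram (b a : ArcDiagram) : Prop :=
  ∀ i, b.partner i = i ∨ b.partner i = a.partner i

end ArcDiagram

/-- `Λₙ`: the cup diagrams `λ̲` with `n` cups. -/
def Lam (n : ℕ) : Type := {a : ArcDiagram // a.arcs = n}

/-- The cup diagram `λ̲`. -/
def Lam.cup {n : ℕ} (l : Lam n) : ArcDiagram := l.1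

/-- The cap diagram `λ̄`: the mirror image of `λ̲`, shifted one to the right. -/
def Lam.cap {n : ℕ} (l : Lam n) : ArcDiagram := l.1.shift

/-- A crossingless matching: a cap diagram `bot` underneath a cup diagram `top` with the same number
of arcs.  The rays are connected by the order preserving bijection that consists of vertical lines
outside a finite strip, see `Joins`. -/
@[ext] structure Matching where
  bot : ArcDiagram
  top : ArcDiagram
  arcs_eq : bot.arcs = top.arcs

namespace Matching

/-- The ray of `bot` at `i` is connected with the ray of `top` at `j`.  On the rays of an arc diagram
the function `i ↦ i - below i` is an increasing bijection onto `ℤ`, it is the identity far to the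
left, and far to the right it is `i ↦ i - 2 * arcs`; so this is the order preserving bijection which
is the identity outside a finite strip. -/
def Joins (m : Matching) (i j : ℤ) : Prop :=
  m.bot.IsRay i ∧ m.top.IsRay j ∧ i - (m.bot.below i : ℤ) = j - (m.top.below j : ℤ)

/-- The horizontal mirror image, shifted one to the right. -/
def ddag (m : Matching) : Matching where
  bot := m.top.shift
  top := m.bot.shift
  arcs_eq := by simp [ArcDiagram.arcs_shift, m.arcs_eq]

/-- The middle section `μ̄ μ̲`: the cap diagram `μ̄` below the cup diagram `μ̲`, with connected rays. -/
def middle (a : ArcDiagram) : Matching where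
  bot := a.shift
  top := a
  arcs_eq := a.arcs_shift

end Matching

/-- A generalized crossingless matching `t = t_k ⋯ t_1`, as the list `[t_k, …, t_1]`, from the bottom
layer to the top layer. -/
abbrev GenMatching : Type := List Matching

/-- `t‡`, the horizontal mirror image of `t` shifted one to the right. -/
def GenMatching.ddag (t : GenMatching) : GenMatching := (t.map Matching.ddag).reverse

/-! ### Stacked diagrams

The diagram `a t b` is the cup diagram `a` below the layers of `t` below the cap diagram `b`.  The
point `i` on the line between two layers is `(j, i)`, where `j` is the number of layers of `t` that
are below this line.  A diagram `t b` without a cup diagram is regarded as a diagram `a t b` where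
`a` has only rays, and similarly for a diagram `a t`. -/

/-- The pieces of the diagram `a t b` (with harmless loops at rays). -/
inductive Edge (a : ArcDiagram) (t : GenMatching) (b : ArcDiagram) : ℕ × ℤ → ℕ × ℤ → Prop
  | cup (i : ℤ) : Edge a t b (0, i) (0, a.partner i)
  | layerCap {j : ℕ} {m : Matching} (h : t[j]? = some m) (i : ℤ) :
      Edge a t b (j, i) (j, m.bot.partner i)
  | layerCup {j : ℕ} {m : Matching} (h : t[j]? = some m) (i : ℤ) :
      Edge a t b (j + 1, i) (j + 1, m.top.partner i)
  | layerLine {j : ℕ} {m : Matching} (h : t[j]? = some m) {i i' : ℤ} (h' : m.Joins i i') :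
      Edge a t b (j, i) (j + 1, i')
  | cap (i : ℤ) : Edge a t b (t.length, i) (t.length, b.partner i)

/-- Two points lie on the same component (circle or line) of the diagram `a t b`. -/
def Joined (a : ArcDiagram) (t : GenMatching) (b : ArcDiagram) : ℕ × ℤ → ℕ × ℤ → Prop :=
  Relation.EqvGen (Edge a t b)

/-- The diagram contains a circle: a component on which no line ends, neither at the bottom nor at
the top. -/
def HasCircle (a : ArcDiagram) (t : GenMatching) (b : ArcDiagram) : Prop :=
  ∃ (j : ℕ) (i : ℤ), j ≤ t.length ∧
    (∀ x, a.IsRay x → ¬ Joined a t b (j, i) (0, x)) ∧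
    (∀ y, b.IsRay y → ¬ Joined a t b (j, i) (t.length, y))

/-- There is a non-propagating line with both ends at the bottom. -/
def HasBottomLine (a : ArcDiagram) (t : GenMatching) (b : ArcDiagram) : Prop :=
  ∃ x y, x ≠ y ∧ a.IsRay x ∧ a.IsRay y ∧ Joined a t b (0, x) (0, y)

/-- There is a non-propagating line with both ends at the top. -/
def HasTopLine (a : ArcDiagram) (t : GenMatching) (b : ArcDiagram) : Prop :=
  ∃ x y, x ≠ y ∧ b.IsRay x ∧ b.IsRay y ∧ Joined a t b (t.length, x) (t.length, y)

/-- Orientability in the context of `Kₙ`: no circles and no non-propagating lines. -/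
def Orientable (a : ArcDiagram) (t : GenMatching) (b : ArcDiagram) : Prop :=
  ¬ HasCircle a t b ∧ ¬ HasBottomLine a t b ∧ ¬ HasTopLine a t b

/-- The cap diagram `c` is the upper reduction of `t b`: it is topologically equivalent to `t b`,
i.e. all components of `t b` end at the bottom, and two points at the bottom of `t b` are connected
iff they are connected by a cap of `c`. -/
def IsUpperReduction (t : GenMatching) (b c : ArcDiagram) : Prop :=
  ¬ HasCircle .empty t b ∧ ¬ HasTopLine .empty t b ∧
    ∀ x y, x ≠ y → (Joined .empty t b (0, x) (0, y) ↔ c.partner x = y)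

/-- The cup diagram `c` is the lower reduction of `a t`. -/
def IsLowerReduction (a : ArcDiagram) (t : GenMatching) (c : ArcDiagram) : Prop :=
  ¬ HasCircle a t .empty ∧ ¬ HasBottomLine a t .empty ∧
    ∀ x y, x ≠ y → (Joined a t .empty (t.length, x) (t.length, y) ↔ c.partner x = y)

/-! ### The algebra `Kₙ` and the geometric bimodules `G_t` -/

/-- The orientable diagrams `λ̲ t μ̄` with `n` cups and `n` caps. -/
def Basis (n : ℕ) (t : GenMatching) : Type :=
  {p : Lam n × Lam n // Orientable p.1.cup t p.2.cap}

/-- The space `G_t`. -/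
def G (n : ℕ) (t : GenMatching) : Type := Basis n t →₀ ℂ

instance (n : ℕ) (t : GenMatching) : AddCommGroup (G n t) :=
  inferInstanceAs (AddCommGroup (Basis n t →₀ ℂ))

instance (n : ℕ) (t : GenMatching) : Module ℂ (G n t) :=
  inferInstanceAs (Module ℂ (Basis n t →₀ ℂ))

/-- The basis vector of `G_t` given by an orientable diagram. -/
def basisVec {n : ℕ} {t : GenMatching} (p : Basis n t) : G n t := Finsupp.single p (1 : ℂ)

/-- The linear map on `G_t` with prescribed values on the basis. -/
def lift {n : ℕ} {t : GenMatching} {V : Type} [AddCommGroup V] [Module ℂ V] (f : Basis n t → V) :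
    G n t →ₗ[ℂ] V :=
  Finsupp.linearCombination ℂ f

lemma G_induction {n : ℕ} {t : GenMatching} {P : G n t → Prop} (x : G n t) (zero : P 0)
    (add : ∀ x y, P x → P y → P (x + y)) (basis : ∀ (c : ℂ) p, P (c • basisVec p)) : P x := by
  refine Finsupp.induction_linear (motive := P) x zero (fun x y => add x y) fun p c => ?_
  have : (Finsupp.single p c : Basis n t →₀ ℂ) = c • Finsupp.single p (1 : ℂ) := by simp
  exact this ▸ basis c p

/-- The space underlying the algebra `Kₙ`; its multiplication is `lact n []`. -/
abbrev K (n : ℕ) : Type := G n []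

open Classical in
/-- The vector `λ̲ t μ̄` of `G_t`, which is `0` if this diagram is not orientable. -/
def diag {n : ℕ} (t : GenMatching) (l m : Lam n) : G n t :=
  if h : Orientable l.cup t m.cap then basisVec ⟨(l, m), h⟩ else 0

/-- The idempotent `e_λ = λ̲ λ̄`. -/
def e {n : ℕ} (l : Lam n) : K n := diag [] l l

/-- The surgery procedures for `(λ̲ u μ̄)(μ̲ t ν̄)` do not give zero.

The middle section `μ̄ μ̲` of the stacked diagram is removed by iterated surgeries.  One surgery takes
an outermost cup `(p, q)` of the middle section, the corresponding cap `(p + 1, q + 1)` and the line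
between them, ending at `x` at the top and at `y` at the bottom, and replaces these three by lines
which connect `p`, `q`, `x` at the top with `y`, `p + 1`, `q + 1` at the bottom.  So the pictures which
can occur on the way are those with middle section `ρ̄ ρ̲`, where `ρ` arises from `μ` by removing
cups.  The product is zero iff one of the intermediate results is not orientable (which does not
depend on the order of the surgeries), otherwise it is `λ̲ u t ν̄`. -/
def SurgeriesNonzero {n : ℕ} (u t : GenMatching) (l m v : Lam n) : Prop :=
  ∀ r : ArcDiagram, r.IsSubdiagram m.cup → Orientable l.cup (u ++ Matching.middle r :: t) v.cap

open Classical in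
/-- The left action `Kₙ × G_t → G_t`; for `t = []` this is the multiplication of `Kₙ`. -/
def lact (n : ℕ) (t : GenMatching) : K n →ₗ[ℂ] G n t →ₗ[ℂ] G n t :=
  lift fun p : Basis n [] =>
    lift fun q : Basis n t =>
      if p.1.2 = q.1.1 ∧ SurgeriesNonzero [] t p.1.1 p.1.2 q.1.2 then diag t p.1.1 q.1.2 else 0

open Classical in
/-- The right action `G_t × Kₙ → G_t`. -/
def ract (n : ℕ) (t : GenMatching) : G n t →ₗ[ℂ] K n →ₗ[ℂ] G n t :=
  lift fun p : Basis n t =>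
    lift fun q : Basis n [] =>
      if p.1.2 = q.1.1 ∧ SurgeriesNonzero t [] p.1.1 p.1.2 q.1.2 then diag t p.1.1 q.1.2 else 0

/-- The multiplication of `Kₙ`. -/
def mul {n : ℕ} (a b : K n) : K n := lact n [] a b

/-- The two actions make `G_t` a locally unital `Kₙ`-`Kₙ`-bimodule.  For `t = []` this says that
`Kₙ` is an associative algebra, locally unital with respect to the orthogonal idempotents `e_λ`. -/
structure IsBimodule (n : ℕ) (t : GenMatching) : Prop where
  mul_lact : ∀ (a b : K n) (x : G n t), lact n t (mul a b) x = lact n t a (lact n t b x)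
  lact_ract : ∀ (a : K n) (x : G n t) (b : K n),
    ract n t (lact n t a x) b = lact n t a (ract n t x b)
  ract_mul : ∀ (x : G n t) (a b : K n), ract n t x (mul a b) = ract n t (ract n t x a) b
  e_lact_self : ∀ l m : Lam n, lact n t (e l) (diag t l m) = diag t l m
  e_lact_of_ne : ∀ k l m : Lam n, k ≠ l → lact n t (e k) (diag t l m) = 0
  ract_e_self : ∀ l m : Lam n, ract n t (diag t l m) (e m) = diag t l m
  ract_e_of_ne : ∀ l m k : Lam n, m ≠ k → ract n t (diag t l m) (e k) = 0

open Classical in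
/-- The coefficient of `e_λ` in an element of `Kₙ`. -/
def coeff {n : ℕ} (l : Lam n) : K n →ₗ[ℂ] ℂ :=
  lift fun p : Basis n [] => if p.1 = (l, l) then (1 : ℂ) else 0

/-- The coefficient of `e_λ` is a character of `Kₙ` which does not vanish on `e_λ`. -/
structure IsCharacter {n : ℕ} (l : Lam n) : Prop where
  coeff_e : coeff l (e l) = 1
  coeff_mul : ∀ a b : K n, coeff l (mul a b) = coeff l a * coeff l b

/-- The algebra `Kₙ`, the bimodules `G_t` and the modules `L(λ̄)` are well-defined: `Kₙ` is an
associative locally unital algebra (`bimodule []`), each `G_t` is a bimodule, and each `L(λ̄)` is a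
module.  This is not assumed anywhere: it is part of what the theorem asserts. -/
structure WellDefined (n : ℕ) : Prop where
  bimodule : ∀ t : GenMatching, IsBimodule n t
  character : ∀ l : Lam n, IsCharacter l

/-! ### Modules over `Kₙ` -/

/-- A left `Kₙ`-module `M` which is locally unital, `M = ⊕ e_λ M`.  (The sum of the `e_λ M` is direct
because the `e_λ` are orthogonal idempotents.) -/
structure KMod (n : ℕ) where
  carrier : Type
  [addCommGroup : AddCommGroup carrier]
  [module : Module ℂ carrier]
  act : K n →ₗ[ℂ] carrier →ₗ[ℂ] carrier
  act_mul : ∀ (a b : K n) (v : carrier), act (mul a b) v = act a (act b v)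
  locally_unital : ⨆ l : Lam n, LinearMap.range (act (e l)) = ⊤

attribute [instance] KMod.addCommGroup KMod.module

namespace KMod

variable {n : ℕ}

/-- `f` is a homomorphism of `Kₙ`-modules. -/
def IsHom (M N : KMod n) (f : M.carrier →ₗ[ℂ] N.carrier) : Prop :=
  ∀ a v, f (M.act a v) = N.act a (f v)

/-- The subspace `N` is a submodule of `M`. -/
def IsSub (M : KMod n) (N : Submodule ℂ M.carrier) : Prop :=
  ∀ a, ∀ v ∈ N, M.act a v ∈ N

/-- `N` is a maximal proper submodule. -/
def IsMaximalSub (M : KMod n) (N : Submodule ℂ M.carrier) : Prop :=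
  M.IsSub N ∧ N ≠ ⊤ ∧ ∀ N', M.IsSub N' → N ≤ N' → N' = N ∨ N' = ⊤

/-- `N` is a simple submodule. -/
def IsSimpleSub (M : KMod n) (N : Submodule ℂ M.carrier) : Prop :=
  M.IsSub N ∧ N ≠ ⊥ ∧ ∀ N', M.IsSub N' → N' ≤ N → N' = ⊥ ∨ N' = N

/-- The radical, the intersection of the maximal submodules. -/
def radical (M : KMod n) : Submodule ℂ M.carrier := sInf {N | M.IsMaximalSub N}

/-- The socle, the sum of the simple submodules. -/
def socle (M : KMod n) : Submodule ℂ M.carrier := sSup {N | M.IsSimpleSub N}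

/-- The head `M / rad M` is isomorphic to `N`. -/
def HeadIso (M N : KMod n) : Prop :=
  ∃ f : M.carrier →ₗ[ℂ] N.carrier,
    M.IsHom N f ∧ Function.Surjective f ∧ LinearMap.ker f = M.radical

/-- The socle of `M` is isomorphic to `N`. -/
def SocleIso (M N : KMod n) : Prop :=
  ∃ f : N.carrier →ₗ[ℂ] M.carrier,
    N.IsHom M f ∧ Function.Injective f ∧ LinearMap.range f = M.socle

/-- `M` is irreducible. -/
def IsIrreducible (M : KMod n) : Prop :=
  Nontrivial M.carrier ∧ ∀ N, M.IsSub N → N = ⊥ ∨ N = ⊤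

/-- `M` is indecomposable: it is nonzero and not a direct sum of two nonzero submodules. -/
def IsIndecomposable (M : KMod n) : Prop :=
  Nontrivial M.carrier ∧ ∀ A B, M.IsSub A → M.IsSub B → IsCompl A B → A = ⊥ ∨ B = ⊥

/-- `0 → M' → M → M'' → 0` is exact for suitable homomorphisms. -/
def IsExtension (M' M M'' : KMod n) : Prop :=
  ∃ (f : M'.carrier →ₗ[ℂ] M.carrier) (g : M.carrier →ₗ[ℂ] M''.carrier),
    M'.IsHom M f ∧ M.IsHom M'' g ∧
      Function.Injective f ∧ Function.Surjective g ∧ LinearMap.range f = LinearMap.ker g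

end KMod

/-- The finite dimensional `Kₙ`-modules. -/
def FDMod (n : ℕ) : Type 1 := {M : KMod n // FiniteDimensional ℂ M.carrier}

/-- The relations `[M] = [M'] + [M'']` of the Grothendieck group, for short exact sequences
`0 → M' → M → M'' → 0`. -/
def grothendieckRelations (n : ℕ) : AddSubgroup (FreeAbelianGroup (FDMod n)) :=
  AddSubgroup.closure {x | ∃ M' M M'' : FDMod n, KMod.IsExtension M'.1 M.1 M''.1 ∧
    x = FreeAbelianGroup.of M - FreeAbelianGroup.of M' - FreeAbelianGroup.of M''}

/-- The Grothendieck group of the category of finite dimensional `Kₙ`-modules. -/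
abbrev Grothendieck (n : ℕ) : Type 1 := FreeAbelianGroup (FDMod n) ⧸ grothendieckRelations n

/-- The class `[M]` in the Grothendieck group. -/
def cls {n : ℕ} (M : KMod n) (h : FiniteDimensional ℂ M.carrier) : Grothendieck n :=
  QuotientAddGroup.mk (FreeAbelianGroup.of (⟨M, h⟩ : FDMod n))

/-- The one-dimensional module `L(λ̄)`: `e_λ` acts as the identity and all the other orientable circle
diagrams act as zero. -/
def L {n : ℕ} (h : WellDefined n) (l : Lam n) : KMod n where
  carrier := ℂ
  act := (LinearMap.lsmul ℂ ℂ).comp (coeff l)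
  act_mul a b v := by
    simp [(h.character l).coeff_mul, mul_assoc]
  locally_unital := by
    refine top_le_iff.1 (le_trans ?_ (le_iSup _ l))
    intro v _
    exact ⟨v, by simp [(h.character l).coeff_e]⟩

lemma L_finiteDimensional {n : ℕ} (h : WellDefined n) (l : Lam n) :
    FiniteDimensional ℂ (L h l).carrier :=
  inferInstanceAs (FiniteDimensional ℂ ℂ)

/-- The subspace of `G_t ⊗ M` spanned by all `x a ⊗ v - x ⊗ a v` with `a` in `Kₙ`. -/
def balanced {n : ℕ} (t : GenMatching) (M : KMod n) : Submodule ℂ (G n t ⊗[ℂ] M.carrier) :=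
  Submodule.span ℂ {z | ∃ (x : G n t) (a : K n) (v : M.carrier),
    z = ract n t x a ⊗ₜ[ℂ] v - x ⊗ₜ[ℂ] M.act a v}

lemma balanced_le_comap {n : ℕ} (h : WellDefined n) (t : GenMatching) (M : KMod n) (a : K n) :
    balanced t M ≤ (balanced t M).comap ((lact n t a).rTensor M.carrier) := by
  refine Submodule.span_le.2 ?_
  rintro _ ⟨x, b, v, rfl⟩
  refine Submodule.subset_span ⟨lact n t a x, b, v, ?_⟩
  simp [(h.bimodule t).lact_ract]

/-- The action of `a` on `G_t ⊗_{Kₙ} M`, which sends the class of `x ⊗ v` to that of `a x ⊗ v`. -/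
def thetaAct {n : ℕ} (h : WellDefined n) (t : GenMatching) (M : KMod n) (a : K n) :
    ((G n t ⊗[ℂ] M.carrier) ⧸ balanced t M) →ₗ[ℂ] ((G n t ⊗[ℂ] M.carrier) ⧸ balanced t M) :=
  Submodule.mapQ _ _ ((lact n t a).rTensor M.carrier) (balanced_le_comap h t M a)

lemma thetaAct_mk {n : ℕ} (h : WellDefined n) (t : GenMatching) (M : KMod n) (a : K n)
    (x : G n t) (v : M.carrier) :
    thetaAct h t M a (Submodule.Quotient.mk (x ⊗ₜ[ℂ] v)) =
      Submodule.Quotient.mk (lact n t a x ⊗ₜ[ℂ] v) := by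
  simp [thetaAct]

lemma theta_ext {n : ℕ} (t : GenMatching) (M : KMod n) {V : Type} [AddCommGroup V] [Module ℂ V]
    {f g : ((G n t ⊗[ℂ] M.carrier) ⧸ balanced t M) →ₗ[ℂ] V}
    (h : ∀ x v, f (Submodule.Quotient.mk (x ⊗ₜ[ℂ] v)) = g (Submodule.Quotient.mk (x ⊗ₜ[ℂ] v))) :
    f = g := by
  apply Submodule.linearMap_qext
  apply TensorProduct.ext'
  intro x v
  exact h x v

/-- `θ_t M = G_t ⊗_{Kₙ} M`. -/
def theta {n : ℕ} (h : WellDefined n) (t : GenMatching) (M : KMod n) : KMod n where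
  carrier := (G n t ⊗[ℂ] M.carrier) ⧸ balanced t M
  act :=
    { toFun := thetaAct h t M
      map_add' := fun a b => theta_ext t M fun x v => by
        simp only [LinearMap.add_apply, thetaAct_mk, map_add, TensorProduct.add_tmul]
        rfl
      map_smul' := fun c a => theta_ext t M fun x v => by
        simp only [LinearMap.smul_apply, thetaAct_mk, map_smul, RingHom.id_apply]
        rfl }
  act_mul a b v := by
    have : thetaAct h t M (mul a b) = (thetaAct h t M a).comp (thetaAct h t M b) :=
      theta_ext t M fun x v => by
        simp only [LinearMap.comp_apply, thetaAct_mk, (h.bimodule t).mul_lact]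
    exact LinearMap.congr_fun this v
  locally_unital := by
    rw [eq_top_iff]
    rintro z -
    obtain ⟨z, rfl⟩ := Submodule.Quotient.mk_surjective _ z
    induction z using TensorProduct.induction_on with
    | zero => exact Submodule.zero_mem _
    | add z w hz hw => exact Submodule.add_mem _ hz hw
    | tmul x v =>
      induction x using G_induction with
      | zero => rw [TensorProduct.zero_tmul]; exact Submodule.zero_mem _
      | add x y hx hy => rw [TensorProduct.add_tmul]; exact Submodule.add_mem _ hx hy
      | basis c p =>
        have hp : basisVec p = diag t p.1.1 p.1.2 := by
          rw [diag, dif_pos p.2]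
          rfl
        rw [hp]
        refine Submodule.mem_iSup_of_mem p.1.1
          ⟨Submodule.Quotient.mk ((c • diag t p.1.1 p.1.2) ⊗ₜ v), ?_⟩
        change thetaAct h t M (e p.1.1) _ = _
        rw [thetaAct_mk, map_smul, (h.bimodule t).e_lact_self]

end KhovanovP

end

noncomputable section

namespace KhovanovP

/-! ### Arc diagrams: parity and the numbering of the rays -/

namespace ArcDiagram

variable (a : ArcDiagram)

/-! The main difficulty is associativity. By definition a product is nonzero iff all pictures with
middle section `ρ̄ ρ̲`, for the subdiagrams `ρ` of the middle diagram, are orientable. In a triple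
product the pictures form a grid, indexed by pairs of subdiagrams. Each bracketing says that two
adjacent sides of this grid consist of orientable pictures, and each is equivalent to the
orientability of the whole grid (`surg_assoc`), because in an elementary square of two surgeries
three orientable corners force the fourth (`square_orientable`).

The square is a statement about the plane. Arcs join points of opposite parity and lines join points
of equal parity, so the gaps between the points have a chequerboard colouring. A diagram is
orientable iff for each end (bottom or top) and each colour the regions of this colour are connected
once the outer ones at this end are identified (`orientable_iff_total`); the nontrivial direction is
a discrete Jordan curve argument with a signed count of strands (`exists_height`). A surgery changes
the connections inside a hexagon whose corners alternate in colour. If the fourth corner of a square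
failed, the three regions of one colour at the first hexagon would be linked with those at the
second one in the same cyclic order, which planarity forbids. The planarity is expressed by
potentials, a discrete winding number (`square`).

The part `a t` of a diagram may be replaced by its lower reduction, and `t b` by its upper reduction
(`IsLowerReduction.orientable_iff` and its mirror image), so questions on `G_t` become questions on
`Kₙ`. Two facts on `Kₙ` are needed. First, a product of two basis diagrams is an idempotent only if
both factors are this idempotent (`Surg.eq`), since two different cap diagrams are distinguished by
the cup diagrams orientable with them (`exists_distinguishing`); hence `L(λ̄)` is a module. Second,
every basis diagram ending in the cap diagram `b` can be multiplied from the left to the one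
starting with the cup diagram `b.shift` (`surg_shift`).

Now `θ_t L(λ̄)` has the basis `μ̲ t λ̄ ⊗ 1`, where `λ̲` is the lower reduction of `μ̲ t`: a diagram
with another lower reduction `κ̲` is a product with right factor `κ̲ λ̄`, which kills `L(λ̄)`. Basis
diagrams of `Kₙ` send a basis vector to zero or to another one (`isThin_theta`), so a filtration
gives the class in the Grothendieck group; the mirror image turns the index set into the one of the
theorem. If `ν̄` is the upper reduction of `t λ̄`, then `ν̲ t λ̄ ⊗ 1` generates, which yields the
head. For the socle, `surg_shift` is transported through `t` (`exists_socle_weight`): all basis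
vectors can be moved to a single one. -/

lemma partner_inj {i k : ℤ} (h : a.partner i = a.partner k) : i = k := by
  rw [← a.partner_partner i, h, a.partner_partner]

lemma partner_ne {i : ℤ} (h : a.partner i ≠ i) : a.partner (a.partner i) ≠ a.partner i :=
  fun h' => h (a.partner_inj h')

lemma inside {i z : ℤ} (h : i < z) (h' : z < a.partner i) :
    a.partner z ≠ z ∧ i < a.partner z ∧ a.partner z < a.partner i := a.noncrossing i z h h'

/-- An involution without fixed points on a finite set of points of `ℤ` has even cardinality. -/
lemma even_card_of_involution (s : Finset ℤ) (hs : ∀ z ∈ s, a.partner z ∈ s)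
    (hf : ∀ z ∈ s, a.partner z ≠ z) : Even s.card := by
  have : ∑ _z ∈ s, (1 : ZMod 2) = 0 :=
    Finset.sum_involution (fun z _ => a.partner z) (fun _ _ => by decide)
      (fun z hz _ => hf z hz) hs (fun z _ => a.partner_partner z)
  rw [Finset.sum_const, nsmul_eq_mul, mul_one] at this
  exact (ZMod.natCast_eq_zero_iff_even).1 this

lemma even_of_closed {g g' : ℤ} (hg : g ≤ g')
    (h : ∀ z, g ≤ z → z < g' → a.partner z ≠ z ∧ g ≤ a.partner z ∧ a.partner z < g') :
    Even (g' - g) := by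
  have := a.even_card_of_involution (Finset.Ico g g')
    (fun z hz => by
      rw [Finset.mem_Ico] at hz ⊢
      exact (h z hz.1 hz.2).2)
    (fun z hz => (h z (Finset.mem_Ico.1 hz).1 (Finset.mem_Ico.1 hz).2).1)
  rw [Int.card_Ico] at this
  have h2 : (((g' - g).toNat : ℕ) : ℤ) = g' - g := Int.toNat_of_nonneg (by omega)
  rw [← h2]
  exact_mod_cast this

/-- The points strictly under an arc are paired off among themselves. This parity is the source of
the chequerboard colouring of the gaps. -/
lemma odd_of_lt {i : ℤ} (h : i < a.partner i) : Odd (a.partner i - i) := by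
  have := a.even_of_closed (g := i + 1) (g' := a.partner i) (by omega) fun z hz hz' => by
    have := a.inside (i := i) (z := z) (by omega) hz'
    omega
  have h2 := this.add_one
  convert h2 using 1
  ring

lemma odd_partner {i : ℤ} (h : a.partner i ≠ i) : Odd (a.partner i - i) := by
  rcases lt_or_gt_of_ne h with h | h
  · have := a.odd_of_lt (i := a.partner i) (by rwa [a.partner_partner])
    rw [a.partner_partner] at this
    rw [← neg_sub]
    exact this.neg
  · exact a.odd_of_lt h

/-- The number of the ray at `i`. -/
def idx (i : ℤ) : ℤ := i - a.below i

lemma finite_below (i : ℤ) : {k | k < i ∧ a.partner k ≠ k}.Finite :=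
  a.finite_arcs.subset fun _ h => h.2

lemma idx_succ_ray {i : ℤ} (h : a.IsRay i) : a.idx (i + 1) = a.idx i + 1 := by
  have : {k | k < i + 1 ∧ a.partner k ≠ k} = {k | k < i ∧ a.partner k ≠ k} := by
    ext k
    constructor
    · rintro ⟨h1, h2⟩
      refine ⟨lt_of_le_of_ne (by omega) ?_, h2⟩
      rintro rfl
      exact h2 h
    · rintro ⟨h1, h2⟩
      exact ⟨by omega, h2⟩
  simp only [idx, below, this]
  ring

lemma idx_succ_arc {i : ℤ} (h : a.partner i ≠ i) : a.idx (i + 1) = a.idx i := by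
  have : {k | k < i + 1 ∧ a.partner k ≠ k} = insert i {k | k < i ∧ a.partner k ≠ k} := by
    ext k
    simp only [Set.mem_insert_iff, Set.mem_ofPred_eq]
    constructor
    · rintro ⟨h1, h2⟩
      rcases eq_or_ne k i with rfl | h3
      · exact Or.inl rfl
      · exact Or.inr ⟨by omega, h2⟩
    · rintro (rfl | ⟨h1, h2⟩)
      · exact ⟨by omega, h⟩
      · exact ⟨by omega, h2⟩
  simp only [idx, below, this]
  rw [Set.ncard_insert_of_notMem (by simp) (a.finite_below i)]
  push_cast
  ring

lemma idx_le_succ (i : ℤ) : a.idx i ≤ a.idx (i + 1) ∧ a.idx (i + 1) ≤ a.idx i + 1 := by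
  by_cases h : a.partner i = i
  · rw [a.idx_succ_ray h]; omega
  · rw [a.idx_succ_arc h]; omega

lemma idx_mono : Monotone a.idx := monotone_int_of_le_succ fun i => (a.idx_le_succ i).1

lemma idx_lt {i k : ℤ} (h : a.IsRay i) (hk : i < k) : a.idx i < a.idx k := by
  have := a.idx_mono (show i + 1 ≤ k by omega)
  rw [a.idx_succ_ray h] at this
  omega

lemma idx_inj {i k : ℤ} (h : a.IsRay i) (hk : a.IsRay k) (e : a.idx i = a.idx k) : i = k := by
  rcases lt_trichotomy i k with h' | h' | h'
  · have := a.idx_lt h h'; omega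
  · exact h'
  · have := a.idx_lt hk h'; omega

lemma lt_of_idx_lt {i k : ℤ} (h : a.idx i < a.idx k) : i < k := by
  by_contra h'
  have := a.idx_mono (not_lt.1 h')
  omega

lemma idx_eq_of_arcs {g g' : ℤ} (hg : g ≤ g') (h : ∀ z, g ≤ z → z < g' → a.partner z ≠ z) :
    a.idx g' = a.idx g := by
  induction g', hg using Int.leInduction with
  | base => rfl
  | succ k hk ih =>
    rw [a.idx_succ_arc (h k hk (by omega)), ih fun z hz hz' => h z hz (by omega)]

lemma exists_window : ∃ N : ℤ, 0 ≤ N ∧ ∀ i, a.partner i ≠ i → -N ≤ i ∧ i < N := by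
  obtain ⟨u, hu⟩ := a.finite_arcs.bddAbove
  obtain ⟨l, hl⟩ := a.finite_arcs.bddBelow
  refine ⟨max 0 (max (u + 1) (-l)), le_max_left _ _, fun i hi => ?_⟩
  have h1 := hu (show i ∈ {i | a.partner i ≠ i} from hi)
  have h2 := hl (show i ∈ {i | a.partner i ≠ i} from hi)
  omega

lemma idx_left {N : ℤ} (hN : ∀ i, a.partner i ≠ i → -N ≤ i ∧ i < N) {i : ℤ} (h : i ≤ -N) :
    a.idx i = i := by
  have : {k | k < i ∧ a.partner k ≠ k} = ∅ := by
    rw [Set.eq_empty_iff_forall_notMem]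
    rintro k ⟨h1, h2⟩
    have := hN k h2
    omega
  simp [idx, below, this]

lemma ncard_nonray : {i | a.partner i ≠ i}.ncard = 2 * a.arcs := by
  have h1 : {i | a.partner i ≠ i} = {i | i < a.partner i} ∪ {i | a.partner i < i} := by
    ext i
    simp only [Set.mem_ofPred_eq, Set.mem_union]
    omega
  have h2 : {i | a.partner i < i} = a.partner '' {i | i < a.partner i} := by
    ext i
    simp only [Set.mem_ofPred_eq, Set.mem_image]
    constructor
    · intro h
      exact ⟨a.partner i, by rwa [a.partner_partner], a.partner_partner i⟩
    · rintro ⟨k, hk, rfl⟩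
      rwa [a.partner_partner]
  have hf : {i | i < a.partner i}.Finite := a.finite_arcs.subset fun i (hi : i < _) => hi.ne'
  rw [h1, Set.ncard_union_eq _ hf (h2 ▸ hf.image _), h2,
    Set.ncard_image_of_injective _ fun _ _ => a.partner_inj]
  · simp only [arcs]; ring
  · rw [Set.disjoint_left]
    intro i (hi : i < _) (hi' : _ < i)
    omega

lemma idx_right {N : ℤ} (hN : ∀ i, a.partner i ≠ i → -N ≤ i ∧ i < N) {i : ℤ} (h : N ≤ i) :
    a.idx i = i - 2 * a.arcs := by
  have : {k | k < i ∧ a.partner k ≠ k} = {k | a.partner k ≠ k} := by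
    ext k
    simp only [Set.mem_ofPred_eq, and_iff_right_iff_imp]
    intro h2
    have := hN k h2
    omega
  rw [idx, below, this, a.ncard_nonray]
  push_cast
  ring

/-- The function `idx` increases by one at rays, is constant at arcs, and is unbounded in both
directions. The last place where it is at most `v` is therefore a ray with number `v`. -/
lemma exists_ray (v : ℤ) : ∃ i, a.IsRay i ∧ a.idx i = v := by
  obtain ⟨N, hN0, hN⟩ := a.exists_window
  have hne : a.idx (min (-N) v) ≤ v := by
    rw [a.idx_left hN (min_le_left _ _)]
    exact min_le_right _ _
  obtain ⟨i, hi, hmax⟩ := Int.exists_greatest_of_bdd (P := fun i => a.idx i ≤ v)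
    ⟨max N (v + 2 * a.arcs), fun z hz => by
      by_contra h
      push Not at h
      have h1 : N ≤ z := ((le_max_left _ _).trans h.le)
      have h2 : v + 2 * a.arcs < z := ((le_max_right _ _).trans_lt h)
      rw [a.idx_right hN h1] at hz
      omega⟩ ⟨_, hne⟩
  have h1 : v < a.idx (i + 1) := by
    by_contra h
    have := hmax (i + 1) (not_lt.1 h)
    omega
  have h2 := a.idx_le_succ i
  refine ⟨i, ?_, by omega⟩
  by_contra h
  rw [a.idx_succ_arc h] at h1
  omega

/-- The position of the ray with number `v`. -/
def rayAt (v : ℤ) : ℤ := (a.exists_ray v).choose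

lemma isRay_rayAt (v : ℤ) : a.IsRay (a.rayAt v) := (a.exists_ray v).choose_spec.1

lemma idx_rayAt (v : ℤ) : a.idx (a.rayAt v) = v := (a.exists_ray v).choose_spec.2

lemma rayAt_idx {i : ℤ} (h : a.IsRay i) : a.rayAt (a.idx i) = i :=
  a.idx_inj (a.isRay_rayAt _) h (a.idx_rayAt _)

lemma partner_lt_ray {i z : ℤ} (h : a.IsRay i) (hz : z < i) : a.partner z < i := by
  by_contra h'
  rcases (not_lt.1 h').eq_or_lt with h2 | h2
  · have := a.partner_partner z
    rw [← h2, h] at this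
    omega
  · exact (a.inside hz h2).1 h

/-- No arc passes over a ray, so the arcs to its left are complete. Consequently the lines of a
layer join points of equal parity. -/
lemma even_below {i : ℤ} (h : a.IsRay i) : Even (a.below i) := by
  rw [below, Set.ncard_eq_toFinset_card _ (a.finite_below i)]
  refine a.even_card_of_involution _ (fun z hz => ?_) fun z hz => ?_
  · simp only [Set.Finite.mem_toFinset, Set.mem_ofPred_eq] at hz ⊢
    exact ⟨a.partner_lt_ray h hz.1, a.partner_ne hz.2⟩
  · simp only [Set.Finite.mem_toFinset, Set.mem_ofPred_eq] at hz
    exact hz.2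

lemma even_idx_sub {i : ℤ} (h : a.IsRay i) : Even (a.idx i - i) := by
  have : Even ((a.below i : ℕ) : ℤ) := by exact_mod_cast a.even_below h
  simpa [idx] using this

end ArcDiagram

/-! ### Layers -/

/-- The points on the lower (`false`) and the upper (`true`) boundary line of a layer. -/
abbrev Side : Type := Bool × ℤ

/-- A planar layer: a crossingless involution of the points on the two boundary lines, where fixed
points are ends of lines. -/
structure IsLayer (f : Side → Side) : Prop where
  inv : ∀ z, f (f z) = z
  odd : ∀ s i k, f (s, i) = (s, k) → k ≠ i → Odd (k - i)
  even : ∀ s i k, f (s, i) = (!s, k) → Even (k - i)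
  left : ∀ s i k, f (s, i) = (!s, k) → ∀ z < i,
    (∃ w < i, f (s, z) = (s, w)) ∨ ∃ w < k, f (s, z) = (!s, w)
  under : ∀ s i k, f (s, i) = (s, k) → ∀ z, i < z → z < k →
    ∃ w, f (s, z) = (s, w) ∧ w ≠ z ∧ i < w ∧ w < k
  far : ∃ N : ℤ, ∀ z, N < |z.2| → (f z).2 = z.2

lemma isLayer_id : IsLayer id where
  inv _ := rfl
  odd s i k h h' := by simp_all
  even s i k h := by cases s <;> simp_all
  left s i k h := by cases s <;> simp_all
  under s i k h z h1 h2 := by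
    simp at h
    omega
  far := ⟨0, fun _ _ => rfl⟩

/-- The arcs of `a` on the boundary line `s`. -/
def arcSide (s : Bool) (a : ArcDiagram) (z : Side) : Side :=
  if z.1 = s then (s, a.partner z.2) else z

lemma isLayer_arcSide (s : Bool) (a : ArcDiagram) : IsLayer (arcSide s a) where
  inv := by
    rintro ⟨r, i⟩
    by_cases h : r = s <;> simp [arcSide, h, a.partner_partner]
  odd r i k h h' := by
    by_cases hr : r = s
    · simp only [arcSide, hr, if_true, Prod.mk.injEq, true_and] at h
      subst h
      exact a.odd_partner h'
    · simp only [arcSide, hr, if_false, Prod.mk.injEq, true_and] at h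
      omega
  even r i k h := by
    by_cases hr : r = s <;> cases r <;> simp_all [arcSide]
  left r i k h := by
    by_cases hr : r = s <;> cases r <;> simp_all [arcSide]
  under r i k h z h1 h2 := by
    by_cases hr : r = s
    · simp only [arcSide, hr, if_true, Prod.mk.injEq, true_and] at h ⊢
      subst h
      exact ⟨_, rfl, a.inside h1 h2⟩
    · simp only [arcSide, hr, if_false, Prod.mk.injEq, true_and] at h
      omega
  far := by
    obtain ⟨N, -, hN⟩ := a.exists_window
    refine ⟨N, ?_⟩
    rintro ⟨r, i⟩ hi
    have : a.partner i = i := by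
      by_contra h
      have := hN i h
      have := abs_le.2 ⟨this.1, this.2.le⟩
      simp only at hi
      omega
    by_cases h : r = s <;> simp [arcSide, h, this]

namespace Matching

variable (m : Matching)

/-- The arc diagram on the boundary line `s`. -/
def side (s : Bool) : ArcDiagram := if s then m.top else m.bot

lemma arcs_side (s s' : Bool) : (m.side s).arcs = (m.side s').arcs := by
  cases s <;> cases s' <;> simp [side, m.arcs_eq]

open Classical in
/-- The other end of the arc or line which ends at a boundary point. -/
def inv (z : Side) : Side :=
  if (m.side z.1).IsRay z.2 then (!z.1, (m.side (!z.1)).rayAt ((m.side z.1).idx z.2))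
  else (z.1, (m.side z.1).partner z.2)

lemma inv_ray {s : Bool} {i : ℤ} (h : (m.side s).IsRay i) :
    m.inv (s, i) = (!s, (m.side (!s)).rayAt ((m.side s).idx i)) := if_pos h

lemma inv_arc {s : Bool} {i : ℤ} (h : ¬ (m.side s).IsRay i) :
    m.inv (s, i) = (s, (m.side s).partner i) := if_neg h

lemma inv_same {s : Bool} {i k : ℤ} (h : m.inv (s, i) = (s, k)) :
    ¬ (m.side s).IsRay i ∧ (m.side s).partner i = k := by
  by_cases hr : (m.side s).IsRay i
  · rw [m.inv_ray hr] at h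
    cases s <;> simp at h
  · rw [m.inv_arc hr] at h
    exact ⟨hr, by simpa using h⟩

lemma inv_diff {s : Bool} {i k : ℤ} : m.inv (s, i) = (!s, k) ↔
    (m.side s).IsRay i ∧ (m.side !s).IsRay k ∧ (m.side s).idx i = (m.side !s).idx k := by
  constructor
  · intro h
    by_cases hr : (m.side s).IsRay i
    · rw [m.inv_ray hr] at h
      simp only [Prod.mk.injEq, true_and] at h
      subst h
      exact ⟨hr, ArcDiagram.isRay_rayAt _ _, (ArcDiagram.idx_rayAt _ _).symm⟩
    · rw [m.inv_arc hr] at h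
      cases s <;> simp at h
  · rintro ⟨h1, h2, h3⟩
    rw [m.inv_ray h1, h3, ArcDiagram.rayAt_idx _ h2]

lemma inv_ne (z : Side) : m.inv z ≠ z := by
  obtain ⟨s, i⟩ := z
  intro h
  have := m.inv_same h
  exact this.1 this.2

lemma joins_iff {i k : ℤ} : m.Joins i k ↔ m.inv (false, i) = (true, k) := by
  rw [show true = !false from rfl, inv_diff]
  rfl

lemma isLayer_inv : IsLayer m.inv where
  inv := by
    rintro ⟨s, i⟩
    by_cases hr : (m.side s).IsRay i
    · rw [m.inv_ray hr]
      have := (m.inv_diff (s := !s) (i := (m.side (!s)).rayAt ((m.side s).idx i)) (k := i)).2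
      rw [Bool.not_not] at this
      exact this ⟨ArcDiagram.isRay_rayAt _ _, hr, ArcDiagram.idx_rayAt _ _⟩
    · rw [m.inv_arc hr, m.inv_arc, ArcDiagram.partner_partner]
      exact (m.side s).partner_ne hr
  odd s i k h h' := by
    obtain ⟨h1, rfl⟩ := m.inv_same h
    exact ArcDiagram.odd_partner _ h'
  even s i k h := by
    obtain ⟨h1, h2, h3⟩ := m.inv_diff.1 h
    have h4 := (m.side s).even_idx_sub h1
    have h5 := (m.side !s).even_idx_sub h2
    rw [Int.even_sub] at h4 h5 ⊢
    rw [h3] at h4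
    exact h5.symm.trans h4
  left s i k h z hz := by
    obtain ⟨h1, h2, h3⟩ := m.inv_diff.1 h
    by_cases hr : (m.side s).IsRay z
    · right
      refine ⟨_, ?_, m.inv_ray hr⟩
      apply (m.side !s).lt_of_idx_lt
      rw [ArcDiagram.idx_rayAt, ← h3]
      exact ArcDiagram.idx_lt _ hr hz
    · left
      exact ⟨_, (m.side s).partner_lt_ray h1 hz, m.inv_arc hr⟩
  under s i k h z h1 h2 := by
    obtain ⟨h3, rfl⟩ := m.inv_same h
    have := (m.side s).inside h1 h2
    exact ⟨_, m.inv_arc this.1, this⟩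
  far := by
    obtain ⟨N, hN0, hN⟩ := m.bot.exists_window
    obtain ⟨M, hM0, hM⟩ := m.top.exists_window
    have hs : ∀ s i, (m.side s).partner i ≠ i → -(max N M) ≤ i ∧ i < max N M := by
      intro s i h
      cases s
      · have := hN i h; omega
      · have := hM i h; omega
    have hray : ∀ s i, max N M < |i| → (m.side s).IsRay i := by
      intro s i hi
      by_contra h
      have := hs s i h
      have := abs_le.2 ⟨this.1, this.2.le⟩
      omega
    refine ⟨max N M, ?_⟩
    rintro ⟨s, i⟩ hi
    have : m.inv (s, i) = (!s, i) := by
      rw [inv_diff]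
      refine ⟨hray _ _ hi, hray _ _ hi, ?_⟩
      rcases lt_abs.1 hi with h | h
      · rw [ArcDiagram.idx_right _ (hs s) h.le, ArcDiagram.idx_right _ (hs !s) h.le,
          m.arcs_side s !s]
      · simp only at h
        rw [ArcDiagram.idx_left _ (hs s) (by omega), ArcDiagram.idx_left _ (hs !s) (by omega)]
    rw [this]

end Matching

/-! ### Stacks of layers and their strands -/

/-- The layers `0, …, k + 1` of `L` form a stack, where the extreme layers only contain arcs on
their inner boundary lines. -/
structure IsStack (L : ℕ → Side → Side) (k : ℕ) : Prop where
  isLayer : ∀ l, IsLayer (L l)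
  bot : ∀ i, L 0 (false, i) = (false, i)
  top : ∀ i, L (k + 1) (true, i) = (true, i)
  mid : ∀ l, 0 < l → l ≤ k → ∀ z, L l z ≠ z
  beyond : ∀ l, k + 1 < l → ∀ z, L l z = z

/-- The lower boundary line of the layer `l` is the line number `l`, and the upper one is the line
number `l + 1`. -/
def node (l : ℕ) (z : Side) : ℕ × ℤ := (if z.1 then l + 1 else l, z.2)

@[simp] lemma node_true (l : ℕ) (i : ℤ) : node l (true, i) = (l + 1, i) := rfl
@[simp] lemma node_false (l : ℕ) (i : ℤ) : node l (false, i) = (l, i) := rfl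

/-- Two points lie on the same strand. -/
def Conn (L : ℕ → Side → Side) : ℕ × ℤ → ℕ × ℤ → Prop :=
  Relation.EqvGen fun u v => ∃ l z, u = node l z ∧ v = node l (L l z)

namespace Conn

variable {L : ℕ → Side → Side} {u v w : ℕ × ℤ}

lemma refl : Conn L u u := Relation.EqvGen.refl _
lemma symm (h : Conn L u v) : Conn L v u := Relation.EqvGen.symm _ _ h
lemma trans (h : Conn L u v) (h' : Conn L v w) : Conn L u w := Relation.EqvGen.trans _ _ _ h h'
lemma step (l : ℕ) (z : Side) : Conn L (node l z) (node l (L l z)) :=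
  Relation.EqvGen.rel _ _ ⟨l, z, rfl, rfl⟩

/-- A property that is invariant along the strands. -/
lemma iff_of_invariant {P : ℕ × ℤ → Prop} (hP : ∀ l z, P (node l z) ↔ P (node l (L l z)))
    (h : Conn L u v) : P u ↔ P v := by
  induction h with
  | rel _ _ h => obtain ⟨l, z, rfl, rfl⟩ := h; exact hP l z
  | refl => rfl
  | symm _ _ _ ih => exact ih.symm
  | trans _ _ _ _ _ ih ih' => exact ih.trans ih'

end Conn

namespace IsStack

variable {L : ℕ → Side → Side} {k : ℕ}

lemma inv (h : IsStack L k) (l : ℕ) (z : Side) : L l (L l z) = z := (h.isLayer l).inv z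

lemma bot' (h : IsStack L k) (i : ℤ) : (L 0 (true, i)).1 = true := by
  by_contra h'
  have h2 : L 0 (true, i) = (false, (L 0 (true, i)).2) := Prod.ext (by simpa using h') rfl
  have h3 := h.inv 0 (true, i)
  rw [h2, h.bot] at h3
  simp at h3

lemma top' (h : IsStack L k) (i : ℤ) : (L (k + 1) (false, i)).1 = false := by
  by_contra h'
  have h2 : L (k + 1) (false, i) = (true, (L (k + 1) (false, i)).2) := Prod.ext (by simpa using h') rfl
  have h3 := h.inv (k + 1) (false, i)
  rw [h2, h.top] at h3
  simp at h3

/-- The strands respect the range of lines between the extreme layers. -/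
lemma valid_iff (h : IsStack L k) (l : ℕ) (z : Side) :
    (1 ≤ (node l z).1 ∧ (node l z).1 ≤ k + 1) ↔
      (1 ≤ (node l (L l z)).1 ∧ (node l (L l z)).1 ≤ k + 1) := by
  obtain ⟨s, i⟩ := z
  rcases Nat.eq_zero_or_pos l with rfl | h0
  · cases s
    · rw [h.bot]
    · simp [node, h.bot' i]
  rcases lt_trichotomy l (k + 1) with hl | rfl | hl
  · simp only [node]
    split_ifs <;> omega
  · cases s
    · simp [node, h.top' i]
    · rw [h.top]
  · rw [h.beyond l hl]

lemma valid_conn (h : IsStack L k) {u v : ℕ × ℤ} (hc : Conn L u v) :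
    (1 ≤ u.1 ∧ u.1 ≤ k + 1) ↔ (1 ≤ v.1 ∧ v.1 ≤ k + 1) :=
  hc.iff_of_invariant (P := fun u => 1 ≤ u.1 ∧ u.1 ≤ k + 1) h.valid_iff

/-- A common bound for the horizontal extension of all arcs. -/
lemma exists_window (h : IsStack L k) : ∃ N : ℤ, 0 ≤ N ∧ ∀ l z, N < |z.2| → (L l z).2 = z.2 := by
  choose N hN using fun l => (h.isLayer l).far
  have : ∀ m : ℕ, ∃ M : ℤ, 0 ≤ M ∧ ∀ l < m, N l ≤ M := by
    intro m
    induction m with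
    | zero => exact ⟨0, le_rfl, by simp⟩
    | succ m ih =>
      obtain ⟨M, hM0, hM⟩ := ih
      refine ⟨max M (N m), by omega, fun l hl => ?_⟩
      rcases Nat.lt_succ_iff_lt_or_eq.1 hl with h | rfl
      · exact (hM l h).trans (le_max_left _ _)
      · exact le_max_right _ _
  obtain ⟨M, hM0, hM⟩ := this (k + 2)
  refine ⟨M, hM0, fun l z hz => ?_⟩
  by_cases hl : l < k + 2
  · exact hN l z ((hM l hl).trans_lt hz)
  · rw [h.beyond l (by omega)]

/-- An involution that preserves the horizontal coordinate outside the window cannot carry a point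
from inside to outside. -/
lemma window_le (h : IsStack L k) {N M : ℤ} (hN : ∀ l z, N < |z.2| → (L l z).2 = z.2) (hM : N ≤ M)
    {l : ℕ} {z : Side} (hz : |z.2| ≤ M) : |(L l z).2| ≤ M := by
  by_contra h'
  have h1 := hN l (L l z) (by omega)
  rw [h.inv] at h1
  rw [h1] at hz
  exact h' hz

end IsStack

/-! ### Every strand with an end has exactly two ends -/

/-- The passage through a line: the upper side of a layer is the lower side of the next one. -/
def cross (d : ℕ × Side) : ℕ × Side :=
  if d.2.1 then (d.1 + 1, (false, d.2.2)) else if d.1 = 0 then d else (d.1 - 1, (true, d.2.2))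

lemma cross_cross (d : ℕ × Side) : cross (cross d) = d := by
  obtain ⟨l, s, i⟩ := d
  cases s
  · cases l <;> simp [cross]
  · simp [cross]

lemma node_cross (d : ℕ × Side) : node (cross d).1 (cross d).2 = node d.1 d.2 := by
  obtain ⟨l, s, i⟩ := d
  cases s
  · cases l <;> simp [cross, node]
  · simp [cross, node]

lemma eq_or_cross {d d' : ℕ × Side} (h : node d.1 d.2 = node d'.1 d'.2) : d' = d ∨ d' = cross d := by
  obtain ⟨l, s, i⟩ := d
  obtain ⟨l', s', i'⟩ := d'
  cases s <;> cases s' <;> simp [node, cross] at h ⊢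
  · exact Or.inl ⟨h.1.symm, h.2.symm⟩
  · obtain ⟨rfl, rfl⟩ := h
    simp
  · obtain ⟨rfl, rfl⟩ := h
    simp
  · exact ⟨h.1.symm, h.2.symm⟩

/-- The passage through a layer. -/
def through (L : ℕ → Side → Side) (d : ℕ × Side) : ℕ × Side := (d.1, L d.1 d.2)

/-- A strand is followed by alternating two involutions: `cross`, through a boundary line, and `θ`,
through a layer. Since the given end is fixed by `θ`, the involution `θ` reverses its orbit under `F
= θ ∘ cross`. The orbit is finite, hence a cycle of some length `m`, and `θ` fixes its `j`th element
iff `m` divides `2 * j`. As `m` is even, the ends are exactly the elements number `0` and `m / 2`.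
-/
theorem IsStack.two_ends {L : ℕ → Side → Side} {k : ℕ} (h : IsStack L k) {l : ℕ} {z : Side}
    (hv : 1 ≤ (node l z).1 ∧ (node l z).1 ≤ k + 1) (he : L l z = z) :
    ∃ l' z', (l', z') ≠ (l, z) ∧ L l' z' = z' ∧ Conn L (node l z) (node l' z') ∧
      ∀ l'' z'', L l'' z'' = z'' → Conn L (node l z) (node l'' z'') →
        (l'', z'') = (l, z) ∨ (l'', z'') = (l', z') := by
  set θ := through L with hθ
  have hθθ : ∀ d, θ (θ d) = d := fun d => Prod.ext rfl (h.inv _ _)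
  set F : ℕ × Side → ℕ × Side := fun d => θ (cross d) with hF
  set F' : ℕ × Side → ℕ × Side := fun d => cross (θ d) with hF'
  have hF'F : ∀ j d, F'^[j] (F^[j] d) = d := by
    intro j
    induction j with
    | zero => exact fun _ => rfl
    | succ j ih =>
      intro d
      rw [Function.iterate_succ_apply, Function.iterate_succ_apply']
      simp only [hF, hF', hθθ, cross_cross]
      exact ih d
  have hinj : Function.Injective F := fun d d' e => by
    have := congrArg F' e
    simpa [hF, hF', hθθ, cross_cross] using this
  set d0 : ℕ × Side := (l, z) with hd0
  have hd0θ : θ d0 = d0 := Prod.ext rfl he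
  -- passing to the inverse
  have hθF : ∀ j, θ (F^[j] d0) = F'^[j] d0 := by
    intro j
    induction j with
    | zero => exact hd0θ
    | succ j ih =>
      rw [Function.iterate_succ_apply', Function.iterate_succ_apply', ← ih]
      simp only [hF, hF', hθθ]
  -- the orbit is finite
  obtain ⟨N, hN0, hN⟩ := h.exists_window
  have hmem : ∀ j, (1 ≤ (node (F^[j] d0).1 (F^[j] d0).2).1 ∧
      (node (F^[j] d0).1 (F^[j] d0).2).1 ≤ k + 1) ∧ |(F^[j] d0).2.2| ≤ max N |z.2| := by
    intro j
    induction j with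
    | zero => exact ⟨hv, le_max_right _ _⟩
    | succ j ih =>
      rw [Function.iterate_succ_apply']
      generalize F^[j] d0 = d at ih
      have h1 := node_cross d
      simp only [hF]
      constructor
      · rw [← h1] at ih
        exact (h.valid_iff _ _).1 ih.1
      · refine h.window_le hN (le_max_left _ _) ?_
        have : (cross d).2.2 = d.2.2 := congrArg (fun u : ℕ × ℤ => u.2) h1
        rw [this]
        exact ih.2
  have hfin : (Set.range fun j => F^[j] d0).Finite := by
    have hf : (((Set.Iic (k + 1) : Set ℕ) ×ˢ ((Set.univ : Set Bool) ×ˢ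
        Set.Icc (-(max N |z.2|)) (max N |z.2|))) : Set (ℕ × Side)).Finite :=
      (Set.finite_Iic _).prod (Set.finite_univ.prod (Set.finite_Icc _ _))
    refine hf.subset ?_
    rintro _ ⟨j, rfl⟩
    have := hmem j
    refine ⟨?_, Set.mem_univ _, abs_le.1 this.2⟩
    have h1 := this.1.2
    simp only [node] at h1
    simp only [Set.mem_Iic]
    split_ifs at h1 <;> omega
  have hper : d0 ∈ Function.periodicPts F := by
    have : ¬ Function.Injective fun j => F^[j] d0 := fun hi =>
      Set.infinite_range_of_injective hi hfin
    simp only [Function.Injective, not_forall] at this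
    obtain ⟨i, j, hij, hne⟩ := this
    wlog hlt : i < j generalizing i j
    · exact this j i hij.symm (Ne.symm hne) (by omega)
    refine Function.mk_mem_periodicPts (n := j - i) (by omega) ?_
    have : F^[i] (F^[j - i] d0) = F^[i] d0 := by
      rw [← Function.iterate_add_apply, show i + (j - i) = j by omega]
      exact hij.symm
    exact (hinj.iterate i) this
  set m := Function.minimalPeriod F d0 with hm
  have hmpos : 0 < m := Function.minimalPeriod_pos_of_mem_periodicPts hper
  have hdvd : ∀ j, F^[j] d0 = d0 ↔ m ∣ j := fun j => Function.isPeriodicPt_iff_minimalPeriod_dvd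
  -- the ends in the orbit
  have hend : ∀ j, θ (F^[j] d0) = F^[j] d0 ↔ m ∣ 2 * j := by
    intro j
    rw [hθF, ← hdvd, two_mul, Function.iterate_add_apply]
    constructor
    · intro h1
      have h2 := congrArg (F^[j]) h1
      have h3 : F^[j] (F'^[j] d0) = d0 := by
        have h4 : θ (F^[j] d0) = F'^[j] d0 := hθF j
        have hFF' : ∀ j d, F^[j] (F'^[j] d) = d := by
          intro j
          induction j with
          | zero => exact fun _ => rfl
          | succ j ih =>
            intro d
            rw [Function.iterate_succ_apply, Function.iterate_succ_apply']
            simp only [hF, hF', hθθ, cross_cross]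
            exact ih d
        exact hFF' j d0
      rw [← h2, h3]
    · intro h1
      have h2 := hF'F j (F^[j] d0)
      rw [h1] at h2
      exact h2
  have hcrossF : ∀ j, cross (F^[j] d0) = F'^[j + 1] d0 := by
    intro j
    have := hθF (j + 1)
    rw [Function.iterate_succ_apply'] at this
    simp only [hF, hθθ] at this
    exact this
  -- For `m = 2 * j + 1` the `j`th element would be fixed by `cross`, but `cross` only fixes points
  -- on the line number `0`, which the orbit does not meet.
  have heven : Even m := by
    by_contra hodd
    obtain ⟨j, hj⟩ := Nat.not_even_iff_odd.1 hodd
    have h1 : F^[j + 1] (F^[j] d0) = d0 := by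
      rw [← Function.iterate_add_apply, hdvd]
      exact ⟨1, by omega⟩
    have h2 := hF'F (j + 1) (F^[j] d0)
    rw [h1, ← hcrossF] at h2
    have h3 := (hmem j).1
    generalize F^[j] d0 = d at h2 h3
    obtain ⟨l', s', i'⟩ := d
    cases s'
    · simp [node] at h3
      simp [cross, show l' ≠ 0 by omega] at h2
    · simp [cross] at h2
  obtain ⟨r, hr⟩ := heven
  -- the orbit is the strand
  have hconn : ∀ j, Conn L (node l z) (node (F^[j] d0).1 (F^[j] d0).2) := by
    intro j
    induction j with
    | zero => exact Conn.refl
    | succ j ih =>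
      rw [Function.iterate_succ_apply']
      generalize F^[j] d0 = d at ih
      rw [← node_cross d] at ih
      exact ih.trans (Conn.step _ _)
  have hF'mem : ∀ j, ∃ i, F'^[j] d0 = F^[i] d0 := by
    intro j
    -- On a cycle of length `m` the inverse of `F` is its power with exponent `m - 1`.
    refine ⟨(m - 1) * j, ?_⟩
    have h1 : F^[j] (F^[(m - 1) * j] d0) = d0 := by
      rw [← Function.iterate_add_apply, hdvd]
      refine ⟨j, ?_⟩
      obtain ⟨m', hm'⟩ : ∃ m', m = m' + 1 := ⟨m - 1, by omega⟩
      rw [hm']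
      simp only [Nat.add_sub_cancel]
      ring
    have h2 := hF'F j (F^[(m - 1) * j] d0)
    rwa [h1] at h2
  have horbit : ∀ v, Conn L (node l z) v → ∀ d : ℕ × Side, node d.1 d.2 = v → ∃ j, d = F^[j] d0 := by
    have hcl : ∀ d : ℕ × Side, (∃ j, d = F^[j] d0) → ∀ d' : ℕ × Side, node d.1 d.2 = node d'.1 d'.2 →
        ∃ j, d' = F^[j] d0 := by
      rintro d ⟨j, rfl⟩ d' hd'
      rcases eq_or_cross hd' with h1 | h1
      · exact ⟨j, h1⟩
      · rw [hcrossF] at h1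
        obtain ⟨i, hi⟩ := hF'mem (j + 1)
        exact ⟨i, h1.trans hi⟩
    have hstep : ∀ l z, (∀ d : ℕ × Side, node d.1 d.2 = node l z → ∃ j, d = F^[j] d0) →
        ∀ d : ℕ × Side, node d.1 d.2 = node l (L l z) → ∃ j, d = F^[j] d0 := by
      intro l1 z1 h1 d hd
      obtain ⟨j, hj⟩ := h1 (l1, z1) rfl
      refine hcl (l1, L l1 z1) ?_ d hd.symm
      obtain ⟨i, hi⟩ := hF'mem j
      refine ⟨i, ?_⟩
      rw [← hi, ← hθF, ← hj]
      rfl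
    intro v hv
    refine (hv.iff_of_invariant (P := fun v => ∀ d : ℕ × Side, node d.1 d.2 = v → ∃ j, d = F^[j] d0)
      fun l1 z1 => ⟨hstep l1 z1, fun h1 => ?_⟩).1 fun d hd => hcl d0 ⟨0, rfl⟩ d hd.symm
    have := hstep l1 (L l1 z1) h1
    rwa [h.inv] at this
  refine ⟨(F^[r] d0).1, (F^[r] d0).2, ?_, ?_, hconn r, fun l'' z'' h1 h2 => ?_⟩
  · intro h1
    have := (hdvd r).1 h1
    have := Nat.le_of_dvd (by omega) this
    omega
  · exact congrArg Prod.snd ((hend r).2 ⟨1, by omega⟩)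
  · obtain ⟨j, hj⟩ := horbit _ h2 (l'', z'') rfl
    have h3 : m ∣ 2 * j := by
      rw [← hend, ← hj]
      exact Prod.ext rfl h1
    rw [hr, ← two_mul] at h3
    obtain ⟨c, rfl⟩ := Nat.dvd_of_mul_dvd_mul_left (by norm_num) h3
    rw [hj]
    rcases Nat.even_or_odd' c with ⟨c', rfl | rfl⟩
    · left
      rw [hdvd]
      exact ⟨c', by rw [hr]; ring⟩
    · right
      rw [show r * (2 * c' + 1) = r + m * c' by rw [hr]; ring, Function.iterate_add_apply,
        (hdvd (m * c')).2 ⟨c', rfl⟩]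

/-! ### The strands of a stacked diagram -/

/-- The layers of the diagram `a t b`. -/
def layers (a : ArcDiagram) (t : GenMatching) (b : ArcDiagram) (l : ℕ) : Side → Side :=
  ((arcSide true a :: (t.map Matching.inv ++ [arcSide false b]))[l]?).getD id

section

variable {a : ArcDiagram} {t : GenMatching} {b : ArcDiagram}

@[simp] lemma layers_zero : layers a t b 0 = arcSide true a := rfl

lemma layers_succ {j : ℕ} {m : Matching} (h : t[j]? = some m) : layers a t b (j + 1) = m.inv := by
  have : j < t.length := (List.getElem?_eq_some_iff.1 h).1
  simp [layers, List.getElem?_append_left, this, (List.getElem?_eq_some_iff.1 h).2]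

lemma layers_last : layers a t b (t.length + 1) = arcSide false b := by
  simp [layers]

lemma layers_beyond {l : ℕ} (h : t.length + 1 < l) : layers a t b l = id := by
  obtain ⟨l, rfl⟩ : ∃ k, l = k + 1 := ⟨l - 1, by omega⟩
  rw [layers, List.getElem?_eq_none (by simp; omega)]
  rfl

lemma isStack_layers (a : ArcDiagram) (t : GenMatching) (b : ArcDiagram) :
    IsStack (layers a t b) t.length where
  isLayer l := by
    rcases l with _ | l
    · exact isLayer_arcSide _ _
    · rcases lt_trichotomy l t.length with h | rfl | h
      · rw [layers_succ (List.getElem?_eq_getElem h)]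
        exact Matching.isLayer_inv _
      · rw [layers_last]
        exact isLayer_arcSide _ _
      · rw [layers_beyond (by omega)]
        exact isLayer_id
  bot i := by simp [arcSide]
  top i := by rw [layers_last]; simp [arcSide]
  mid l h0 h1 z := by
    obtain ⟨l, rfl⟩ : ∃ k, l = k + 1 := ⟨l - 1, by omega⟩
    rw [layers_succ (List.getElem?_eq_getElem h1)]
    exact Matching.inv_ne _ _
  beyond l h z := by rw [layers_beyond h]; rfl

/-- The cups of `a` form the layer `0` of the stack, so line `j` of the diagram is line `j + 1` of
the stack. The loops of `Edge` at rays correspond to fixed points of the extreme layers, or to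
nothing. -/
lemma joined_iff {p q : ℕ × ℤ} :
    Joined a t b p q ↔ Conn (layers a t b) (p.1 + 1, p.2) (q.1 + 1, q.2) := by
  constructor
  · intro h
    induction h with
    | rel p q h =>
      cases h with
      | cup i =>
        have := Conn.step (L := layers a t b) 0 (true, i)
        simpa [arcSide] using this
      | @layerCap j m h i =>
        have := Conn.step (L := layers a t b) (j + 1) (false, i)
        rw [layers_succ h] at this
        by_cases hr : m.bot.IsRay i
        · rw [show m.bot.partner i = i from hr]
          exact Conn.refl
        · rw [m.inv_arc (s := false) hr] at this
          exact this
      | @layerCup j m h i =>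
        have := Conn.step (L := layers a t b) (j + 1) (true, i)
        rw [layers_succ h] at this
        by_cases hr : m.top.IsRay i
        · rw [show m.top.partner i = i from hr]
          exact Conn.refl
        · rw [m.inv_arc (s := true) hr] at this
          exact this
      | @layerLine j m h i i' h' =>
        have := Conn.step (L := layers a t b) (j + 1) (false, i)
        rw [layers_succ h, m.joins_iff.1 h'] at this
        exact this
      | cap i =>
        have := Conn.step (L := layers a t b) (t.length + 1) (false, i)
        rw [layers_last] at this
        simpa [arcSide] using this
    | refl => exact Conn.refl
    | symm _ _ _ ih => exact ih.symm
    | trans _ _ _ _ _ ih ih' => exact ih.trans ih'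
  -- The truncated subtraction merges the lines `0` and `1` of the stack. This is harmless, since
  -- the points on line `0` are joined to nothing else.
  · suffices H : ∀ u v, Conn (layers a t b) u v → Joined a t b (u.1 - 1, u.2) (v.1 - 1, v.2) from
      fun h => H _ _ h
    intro u v h
    induction h with
    | rel u v h =>
      obtain ⟨l, ⟨s, i⟩, rfl, rfl⟩ := h
      rcases l with _ | l
      · cases s
        · rw [(isStack_layers a t b).bot]
          exact Relation.EqvGen.refl _
        · exact Relation.EqvGen.rel _ _ (Edge.cup i)
      rcases lt_trichotomy l t.length with h | rfl | h
      · have hm := List.getElem?_eq_getElem h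
        rw [layers_succ hm]
        generalize t[l] = m at hm
        by_cases hr : (m.side s).IsRay i
        · have hl := m.inv_ray hr
          rw [hl]
          have hl' := hl
          cases s
          · exact Relation.EqvGen.rel _ _ (Edge.layerLine hm (m.joins_iff.2 hl))
          · refine Relation.EqvGen.symm _ _ (Relation.EqvGen.rel _ _
              (Edge.layerLine hm (m.joins_iff.2 ?_)))
            have := congrArg m.inv hl
            rw [m.isLayer_inv.inv] at this
            exact this.symm
        · rw [m.inv_arc hr]
          cases s
          · exact Relation.EqvGen.rel _ _ (Edge.layerCap hm i)
          · exact Relation.EqvGen.rel _ _ (Edge.layerCup hm i)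
      · rw [layers_last]
        cases s
        · exact Relation.EqvGen.rel _ _ (Edge.cap i)
        · exact Relation.EqvGen.refl _
      · rw [layers_beyond (by omega)]
        exact Relation.EqvGen.refl _
    | refl => exact Relation.EqvGen.refl _
    | symm _ _ _ ih => exact Relation.EqvGen.symm _ _ ih
    | trans _ _ _ _ _ ih ih' => exact Relation.EqvGen.trans _ _ _ ih ih'

namespace Joined

variable {p q r : ℕ × ℤ}

lemma refl : Joined a t b p p := Relation.EqvGen.refl _
lemma symm (h : Joined a t b p q) : Joined a t b q p := Relation.EqvGen.symm _ _ h
lemma trans (h : Joined a t b p q) (h' : Joined a t b q r) : Joined a t b p r :=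
  Relation.EqvGen.trans _ _ _ h h'

end Joined

/-- The ends of lines. -/
lemma eq_end {l : ℕ} {z : Side} (hv : 1 ≤ (node l z).1 ∧ (node l z).1 ≤ t.length + 1)
    (he : layers a t b l z = z) :
    (∃ x, a.IsRay x ∧ (l, z) = (0, (true, x))) ∨
      ∃ y, b.IsRay y ∧ (l, z) = (t.length + 1, (false, y)) := by
  obtain ⟨s, i⟩ := z
  rcases Nat.eq_zero_or_pos l with rfl | h0
  · cases s
    · simp [node] at hv
    · exact Or.inl ⟨i, by simpa [arcSide, ArcDiagram.IsRay] using he, rfl⟩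
  rcases lt_trichotomy l (t.length + 1) with h | rfl | h
  · exact absurd he ((isStack_layers a t b).mid l h0 (by omega) _)
  · cases s
    · rw [layers_last] at he
      exact Or.inr ⟨i, by simpa [arcSide, ArcDiagram.IsRay] using he, rfl⟩
    · simp [node] at hv
  · simp only [node] at hv
    split_ifs at hv <;> omega

/-- A line with an end at the bottom. -/
lemma exists_end_of_bottom {x : ℤ} (hx : a.IsRay x) :
    (∃ x', x' ≠ x ∧ a.IsRay x' ∧ Joined a t b (0, x) (0, x') ∧
      ∀ y, b.IsRay y → ¬ Joined a t b (0, x) (t.length, y)) ∨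
    ∃ y, b.IsRay y ∧ Joined a t b (0, x) (t.length, y) ∧
      (∀ x', a.IsRay x' → Joined a t b (0, x) (0, x') → x' = x) ∧
      ∀ y', b.IsRay y' → Joined a t b (0, x) (t.length, y') → y' = y := by
  have hL := isStack_layers a t b
  have he0 : layers a t b 0 (true, x) = (true, x) := by simpa [arcSide, ArcDiagram.IsRay] using hx
  obtain ⟨l', z', hne, he, hc, hall⟩ := hL.two_ends (l := 0) (z := (true, x)) (by simp) he0
  have heb : ∀ y, b.IsRay y → layers a t b (t.length + 1) (false, y) = (false, y) := fun y hy => by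
    rw [layers_last]; simpa [arcSide, ArcDiagram.IsRay] using hy
  rcases eq_end ((hL.valid_conn hc).1 (by simp)) he with ⟨x', hx', h1⟩ | ⟨y, hy, h1⟩
  · obtain ⟨rfl, rfl⟩ := Prod.mk.inj h1
    refine Or.inl ⟨x', by simpa using hne, hx', joined_iff.2 hc, fun y hy hj => ?_⟩
    have := hall (t.length + 1) (false, y) (heb y hy) (joined_iff.1 hj)
    simp at this
  · obtain ⟨rfl, rfl⟩ := Prod.mk.inj h1
    refine Or.inr ⟨y, hy, joined_iff.2 hc, fun x' hx' hj => ?_, fun y' hy' hj => ?_⟩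
    · have := hall 0 (true, x') (by simpa [arcSide, ArcDiagram.IsRay] using hx') (joined_iff.1 hj)
      simpa using this
    · have := hall (t.length + 1) (false, y') (heb y' hy') (joined_iff.1 hj)
      simpa using this

/-- A line with an end at the top. -/
lemma exists_end_of_top {y : ℤ} (hy : b.IsRay y) :
    (∃ y', y' ≠ y ∧ b.IsRay y' ∧ Joined a t b (t.length, y) (t.length, y') ∧
      (∀ x, a.IsRay x → ¬ Joined a t b (t.length, y) (0, x)) ∧
      ∀ y'', b.IsRay y'' → Joined a t b (t.length, y) (t.length, y'') → y'' = y ∨ y'' = y') ∨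
    ∃ x, a.IsRay x ∧ Joined a t b (t.length, y) (0, x) ∧
      ∀ y', b.IsRay y' → Joined a t b (t.length, y) (t.length, y') → y' = y := by
  have hL := isStack_layers a t b
  have heb : ∀ y, b.IsRay y → layers a t b (t.length + 1) (false, y) = (false, y) := fun y hy => by
    rw [layers_last]; simpa [arcSide, ArcDiagram.IsRay] using hy
  obtain ⟨l', z', hne, he, hc, hall⟩ := hL.two_ends (l := t.length + 1) (z := (false, y)) (by simp)
    (heb y hy)
  rcases eq_end ((hL.valid_conn hc).1 (by simp)) he with ⟨x, hx, h1⟩ | ⟨y', hy', h1⟩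
  · obtain ⟨rfl, rfl⟩ := Prod.mk.inj h1
    refine Or.inr ⟨x, hx, joined_iff.2 hc, fun y' hy' hj => ?_⟩
    have := hall (t.length + 1) (false, y') (heb y' hy') (joined_iff.1 hj)
    simpa using this
  · obtain ⟨rfl, rfl⟩ := Prod.mk.inj h1
    refine Or.inl ⟨y', by simpa using hne, hy', joined_iff.2 hc, fun x hx hj => ?_,
      fun y'' hy'' hj => ?_⟩
    · have := hall 0 (true, x) (by simpa [arcSide, ArcDiagram.IsRay] using hx) (joined_iff.1 hj)
      simp at this
    · have := hall (t.length + 1) (false, y'') (heb y'' hy'') (joined_iff.1 hj)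
      simpa using this

/-- A strand with an end has exactly two ends, so it is propagating iff it meets both boundaries,
and a strand that meets a boundary is not a circle. -/
theorem orientable_iff : Orientable a t b ↔ ∀ j i, j ≤ t.length →
    (∃ x, a.IsRay x ∧ Joined a t b (j, i) (0, x)) ∧
      ∃ y, b.IsRay y ∧ Joined a t b (j, i) (t.length, y) := by
  constructor
  · rintro ⟨h1, h2, h3⟩ j i hj
    have key : (∃ x, a.IsRay x ∧ Joined a t b (j, i) (0, x)) ∨
        ∃ y, b.IsRay y ∧ Joined a t b (j, i) (t.length, y) := by
      by_contra h
      push Not at h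
      exact h1 ⟨j, i, hj, h⟩
    rcases key with ⟨x, hx, hjx⟩ | ⟨y, hy, hjy⟩
    · refine ⟨⟨x, hx, hjx⟩, ?_⟩
      rcases exists_end_of_bottom (t := t) (b := b) hx with ⟨x', hne, hx', hj', -⟩ | ⟨y, hy, hj', -⟩
      · exact absurd ⟨x, x', hne.symm, hx, hx', hj'⟩ h2
      · exact ⟨y, hy, hjx.trans hj'⟩
    · refine ⟨?_, ⟨y, hy, hjy⟩⟩
      rcases exists_end_of_top (a := a) (t := t) hy with ⟨y', hne, hy', hj', -⟩ | ⟨x, hx, hj', -⟩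
      · exact absurd ⟨y, y', hne.symm, hy, hy', hj'⟩ h3
      · exact ⟨x, hx, hjy.trans hj'⟩
  · intro h
    refine ⟨?_, ?_, ?_⟩
    · rintro ⟨j, i, hj, h1, -⟩
      obtain ⟨⟨x, hx, hjx⟩, -⟩ := h j i hj
      exact h1 x hx hjx
    · rintro ⟨x, x', hne, hx, hx', hj⟩
      obtain ⟨-, y, hy, hjy⟩ := h 0 x (Nat.zero_le _)
      rcases exists_end_of_bottom (t := t) (b := b) hx with ⟨_, _, _, _, hno⟩ | ⟨y', _, _, hu, -⟩
      · exact hno y hy hjy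
      · exact hne (hu x' hx' hj).symm
    · rintro ⟨y, y', hne, hy, hy', hj⟩
      obtain ⟨⟨x, hx, hjx⟩, -⟩ := h t.length y le_rfl
      rcases exists_end_of_top (a := a) (t := t) hy with ⟨_, _, _, _, hno, -⟩ | ⟨x', hx', hj', -⟩
      · exact hno x hx hjx
      · rcases exists_end_of_bottom (t := t) (b := b) hx with ⟨_, _, _, _, hno⟩ | ⟨y'', _, _, _, hu⟩
        · exact hno y hy hjx.symm
        · exact hne ((hu y hy hjx.symm).trans (hu y' hy' (hjx.symm.trans hj)).symm)

end

/-! ### Regions of a stack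

The gap `g` on a boundary line lies between the points `g - 1` and `g`. -/

/-- Two gaps are adjacent along an arc or along a line. -/
inductive GapStep (f : Side → Side) : Side → Side → Prop
  | arc {s : Bool} {i k : ℤ} (h : f (s, i) = (s, k)) (hne : k ≠ i) : GapStep f (s, i) (s, k + 1)
  | left {s : Bool} {i k : ℤ} (h : f (s, i) = (!s, k)) : GapStep f (s, i) (!s, k)
  | right {s : Bool} {i k : ℤ} (h : f (s, i) = (!s, k)) : GapStep f (s, i + 1) (!s, k + 1)

lemma IsLayer.gapStep_even {f : Side → Side} (hf : IsLayer f) {x y : Side} (h : GapStep f x y) :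
    Even (y.2 - x.2) := by
  cases h with
  | arc h hne =>
    have := (hf.odd _ _ _ h hne).add_one
    simp only [Int.even_iff] at this ⊢
    omega
  | left h => exact hf.even _ _ _ h
  | right h =>
    have := hf.even _ _ _ h
    simpa using this

/-- The gap `g` on the boundary line `s` is not under an arc. -/
def Outer (f : Side → Side) (s : Bool) (g : ℤ) : Prop :=
  ∀ i k, f (s, i) = (s, k) → ¬ (i < g ∧ g ≤ k)

/-- The extreme layer with the ends at the bottom (`e = false`) or at the top (`e = true`), and its
boundary line. -/
def endLayer (k : ℕ) (e : Bool) : ℕ := if e then k + 1 else 0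

/-- Adjacency of the gaps `g` with `g - c` even, where all those which are connected with the
outside at the end `e` are identified. -/
inductive RootStep (L : ℕ → Side → Side) (k : ℕ) (e : Bool) (c : ℤ) (l : ℕ) : Side → Side → Prop
  | gap {x y : Side} (h : GapStep (L l) x y) (hc : Even (x.2 - c)) : RootStep L k e c l x y
  | root {g g' : ℤ} (hl : l = endLayer k e) (hg : Outer (L l) (!e) g) (hg' : Outer (L l) (!e) g')
      (hc : Even (g - c)) (hc' : Even (g' - c)) : RootStep L k e c l (!e, g) (!e, g')

/-- The gaps are connected by a family of relations in the layers. -/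
def GapConn (R : ℕ → Side → Side → Prop) : ℕ × ℤ → ℕ × ℤ → Prop :=
  Relation.EqvGen fun u v => ∃ l x y, R l x y ∧ u = node l x ∧ v = node l y

/-- All gaps of the given parity are connected. -/
def Total (k : ℕ) (c : ℤ) (R : ℕ → Side → Side → Prop) : Prop :=
  ∀ u v : ℕ × ℤ, 1 ≤ u.1 → u.1 ≤ k + 1 → Even (u.2 - c) → 1 ≤ v.1 → v.1 ≤ k + 1 → Even (v.2 - c) →
    GapConn R u v

/-- Every point is on a strand with an end at `e`. -/
def Reaches (L : ℕ → Side → Side) (k : ℕ) (e : Bool) : Prop :=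
  ∀ u : ℕ × ℤ, 1 ≤ u.1 → u.1 ≤ k + 1 → ∃ x, L (endLayer k e) (!e, x) = (!e, x) ∧
    Conn L u (node (endLayer k e) (!e, x))

section

variable {L : ℕ → Side → Side} {k : ℕ}

lemma IsLayer.outer_of_fixed {f : Side → Side} (hf : IsLayer f) {s : Bool} {x : ℤ}
    (h : f (s, x) = (s, x)) : Outer f s x ∧ Outer f s (x + 1) := by
  constructor <;> rintro i j hij ⟨h1, h2⟩
  · rcases h2.eq_or_lt with rfl | h2
    · have := hf.inv (s, i)
      rw [hij, h] at this
      simp at this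
      omega
    · obtain ⟨w, hw, hne, -⟩ := hf.under _ _ _ hij x h1 h2
      rw [h] at hw
      simp at hw
      exact hne hw.symm
  · rcases (Int.lt_add_one_iff.1 h1).eq_or_lt with rfl | h1
    · rw [h] at hij
      simp at hij
      omega
    · obtain ⟨w, hw, hne, -⟩ := hf.under _ _ _ hij x h1 (by omega)
      rw [h] at hw
      simp at hw
      exact hne hw.symm

/-- The gap of the given parity beside a point. -/
def beside (c i : ℤ) : ℤ := if Even (i - c) then i else i + 1

lemma even_beside (c i : ℤ) : Even (beside c i - c) := by
  simp only [beside]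
  split_ifs with hi
  · exact hi
  · simp only [Int.even_iff] at hi ⊢
    omega

lemma beside_self {c g : ℤ} (h : Even (g - c)) : beside c g = g := if_pos h

/-- The gap of the given colour beside a strand accompanies the strand. Along a line it stays on the
same side of the point; along an arc it changes between left and right, in accordance with the
opposite parities of the two ends. -/
lemma gapConn_beside (hL : IsStack L k) (e : Bool) (c : ℤ) {u v : ℕ × ℤ} (huv : Conn L u v) :
    GapConn (RootStep L k e c) (u.1, beside c u.2) (v.1, beside c v.2) := by
  have hinv : ∀ l z, GapConn (RootStep L k e c) ((node l z).1, beside c z.2)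
      ((node l (L l z)).1, beside c (L l z).2) := by
    rintro l ⟨s, i⟩
    rcases hLz : L l (s, i) with ⟨s', i'⟩
    rcases eq_or_ne s' s with rfl | hs
    · rcases eq_or_ne i' i with rfl | hi
      · exact Relation.EqvGen.refl _
      · have hodd := (hL.isLayer l).odd _ _ _ hLz hi
        have hLz' : L l (s', i') = (s', i) := by rw [← hLz, hL.inv]
        by_cases hp : Even (i - c)
        · have hp' : ¬ Even (i' - c) := by simp only [Int.even_iff, Int.odd_iff] at *; omega
          refine Relation.EqvGen.rel _ _ ⟨l, (s', i), (s', i' + 1), .gap (.arc hLz hi) hp, ?_, ?_⟩ <;>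
            simp [node, beside, hp, hp']
        · have hp' : Even (i' - c) := by simp only [Int.even_iff, Int.odd_iff] at *; omega
          refine Relation.EqvGen.symm _ _ (Relation.EqvGen.rel _ _
            ⟨l, (s', i'), (s', i + 1), .gap (.arc hLz' hi.symm) hp', ?_, ?_⟩) <;>
            simp [node, beside, hp, hp']
    · obtain rfl : s' = !s := by cases s <;> cases s' <;> simp_all
      have heven := (hL.isLayer l).even _ _ _ hLz
      by_cases hp : Even (i - c)
      · have hp' : Even (i' - c) := by simp only [Int.even_iff] at *; omega
        refine Relation.EqvGen.rel _ _ ⟨l, (s, i), (!s, i'), .gap (.left hLz) hp, ?_, ?_⟩ <;>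
            simp [node, beside, hp, hp']
      · have hp' : ¬ Even (i' - c) := by simp only [Int.even_iff] at *; omega
        refine Relation.EqvGen.rel _ _ ⟨l, (s, i + 1), (!s, i' + 1), .gap (.right hLz) ?_, ?_, ?_⟩
        · simp only [Int.even_iff] at *
          omega
        · simp [node, beside, hp]
        · simp [node, beside, hp']
  induction huv with
  | rel u v h => obtain ⟨l, z, rfl, rfl⟩ := h; exact hinv l z
  | refl => exact Relation.EqvGen.refl _
  | symm _ _ _ ih => exact Relation.EqvGen.symm _ _ ih
  | trans _ _ _ _ _ ih ih' => exact Relation.EqvGen.trans _ _ _ ih ih'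

lemma outer_beside (hL : IsStack L k) {e : Bool} (c : ℤ) {x : ℤ}
    (hx : L (endLayer k e) (!e, x) = (!e, x)) : Outer (L (endLayer k e)) (!e) (beside c x) := by
  have := (hL.isLayer _).outer_of_fixed hx
  simp only [beside]
  split_ifs
  · exact this.1
  · exact this.2

/-- A gap is carried along the strand next to it to the end of this strand; there it is outer, and
all outer gaps of its colour are identified. -/
theorem total_of_reaches (hL : IsStack L k) {e : Bool} (h : Reaches L k e) (c : ℤ) :
    Total k c (RootStep L k e c) := by
  intro u v hu hu' hu'' hv hv' hv''
  obtain ⟨x, hx, hux⟩ := h u hu hu'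
  obtain ⟨y, hy, hvy⟩ := h v hv hv'
  have h1 := gapConn_beside hL e c hux
  have h2 := gapConn_beside hL e c hvy
  rw [beside_self hu''] at h1
  rw [beside_self hv''] at h2
  refine Relation.EqvGen.trans _ _ _ h1 (Relation.EqvGen.trans _ _ _ ?_
    (Relation.EqvGen.symm _ _ h2))
  exact Relation.EqvGen.rel _ _ ⟨endLayer k e, (!e, beside c x), (!e, beside c y),
    .root rfl (outer_beside hL c hx) (outer_beside hL c hy) (even_beside c x) (even_beside c y),
    rfl, rfl⟩

/-- The alternating sign. -/
def sgn (z : ℤ) : ℤ := if Even z then 1 else -1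

lemma sgn_add_sgn_of_odd {i j : ℤ} (h : Odd (j - i)) : sgn i + sgn j = 0 := by
  simp only [sgn, Int.even_iff, Int.odd_iff] at h ⊢
  split_ifs <;> omega

lemma sgn_eq_of_even {i j : ℤ} (h : Even (j - i)) : sgn i = sgn j := by
  simp only [sgn]
  rw [Int.even_sub] at h
  simp [h]

/-- A strand invariant set is summed up to zero over a closed interval of a boundary line. -/
lemma IsLayer.sum_eq_zero {f : Side → Side} (hf : IsLayer f) {s : Bool} {χ : ℤ → ℤ} {A B : ℤ}
    (hcl : ∀ z, A ≤ z → z < B → χ z ≠ 0 → ∃ w, f (s, z) = (s, w) ∧ w ≠ z ∧ A ≤ w ∧ w < B)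
    (hχ : ∀ z w, f (s, z) = (s, w) → χ z = χ w) :
    ∑ z ∈ Finset.Ico A B, sgn z * χ z = 0 := by
  classical
  rw [← Finset.sum_filter_of_ne (p := fun z => χ z ≠ 0) (fun z _ h h' => h (by rw [h', mul_zero]))]
  have key : ∀ z ∈ (Finset.Ico A B).filter (fun z => χ z ≠ 0),
      ∃ w, f (s, z) = (s, w) ∧ w ≠ z ∧ A ≤ w ∧ w < B := fun z hz => by
    rw [Finset.mem_filter, Finset.mem_Ico] at hz
    exact hcl z hz.1.1 hz.1.2 hz.2
  refine Finset.sum_involution (fun z _ => (f (s, z)).2) (fun z hz => ?_) (fun z hz _ => ?_)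
    (fun z hz => ?_) (fun z hz => ?_)
  · obtain ⟨w, h1, h2, h3, h4⟩ := key z hz
    simp only [h1]
    rw [← hχ z w h1, ← add_mul, sgn_add_sgn_of_odd (hf.odd _ _ _ h1 h2), zero_mul]
  · obtain ⟨w, h1, h2, h3, h4⟩ := key z hz
    simpa only [h1] using h2
  · obtain ⟨w, h1, h2, h3, h4⟩ := key z hz
    simp only [h1, Finset.mem_filter, Finset.mem_Ico]
    rw [← hχ z w h1]
    exact ⟨⟨h3, h4⟩, (Finset.mem_filter.1 hz).2⟩
  · obtain ⟨w, h1, h2, h3, h4⟩ := key z hz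
    simp only [h1]
    rw [← h1, hf.inv]

lemma sum_Ico_add {A B C : ℤ} (h : A ≤ B) (h' : B ≤ C) (F : ℤ → ℤ) :
    ∑ z ∈ Finset.Ico A B, F z + ∑ z ∈ Finset.Ico B C, F z = ∑ z ∈ Finset.Ico A C, F z := by
  rw [← Finset.sum_union]
  · congr 1
    ext z
    simp only [Finset.mem_union, Finset.mem_Ico]
    omega
  · rw [Finset.disjoint_left]
    intro z hz hz'
    rw [Finset.mem_Ico] at hz hz'
    omega

lemma sum_Ico_succ (i : ℤ) (F : ℤ → ℤ) : ∑ z ∈ Finset.Ico i (i + 1), F z = F i := by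
  have : Finset.Ico i (i + 1) = {i} := by
    ext z
    simp only [Finset.mem_Ico, Finset.mem_singleton]
    omega
  rw [this, Finset.sum_singleton]

/-- The points to the left of a line, on both sides of the layer, are permuted by the involution. In
the signed sum over them the two ends of an arc cancel because their parities differ, and the two
ends of a line cancel because the two sides are counted with opposite weights. -/
lemma IsLayer.sum_line {f : Side → Side} (hf : IsLayer f) {χ : Side → ℤ} {A i k : ℤ} {s : Bool}
    (hA : ∀ z, A ≤ z.2 → A ≤ (f z).2) (hχ : ∀ z, χ z = χ (f z)) (h : f (s, i) = (!s, k))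
    (hfix : ∀ z, f z = z → χ z = 0) :
    ∑ z ∈ Finset.Ico A i, sgn z * χ (s, z) = ∑ z ∈ Finset.Ico A k, sgn z * χ (!s, z) := by
  classical
  let S : Finset Side := (Finset.Ico A i).image (fun z => (s, z)) ∪ (Finset.Ico A k).image fun z => (!s, z)
  let w : Side → ℤ := fun z => (if z.1 = s then 1 else -1) * (sgn z.2 * χ z)
  have hmem : ∀ r z, ((r, z) : Side) ∈ S ↔ A ≤ z ∧ z < if r = s then i else k := by
    intro r z
    cases r <;> cases s <;> simp [S]
  have hback : f (!s, k) = (s, i) := by rw [← h, hf.inv]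
  have hcl : ∀ z ∈ S, f z ∈ S := by
    rintro ⟨r, z⟩ hz
    have h1 := (hmem r z).1 hz
    have h2 := hA (r, z) h1.1
    by_cases hr : r = s
    · subst hr
      rw [if_pos rfl] at h1
      rcases hf.left _ _ _ h z h1.2 with ⟨v, hv, hv'⟩ | ⟨v, hv, hv'⟩
      · rw [hv'] at h2 ⊢
        exact (hmem _ _).2 ⟨h2, by simpa using hv⟩
      · rw [hv'] at h2 ⊢
        exact (hmem _ _).2 ⟨h2, by cases r <;> simpa using hv⟩
    · obtain rfl : r = !s := by cases s <;> cases r <;> simp_all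
      rw [if_neg hr] at h1
      rcases hf.left (!s) k i (by rw [Bool.not_not]; exact hback) z h1.2 with ⟨v, hv, hv'⟩ | ⟨v, hv, hv'⟩
      · rw [hv'] at h2 ⊢
        exact (hmem _ _).2 ⟨h2, by rw [if_neg hr]; exact hv⟩
      · rw [Bool.not_not] at hv'
        rw [hv'] at h2 ⊢
        exact (hmem _ _).2 ⟨h2, by simpa using hv⟩
  have hsum : ∑ z ∈ S, w z = 0 := by
    refine Finset.sum_involution (fun z _ => f z) (fun z hz => ?_) (fun z hz hne hfz => ?_)
      (fun z hz => hcl z hz) (fun z hz => hf.inv z)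
    · obtain ⟨r, z⟩ := z
      simp only [w]
      rw [← hχ (r, z)]
      rcases hfz : f (r, z) with ⟨r', z'⟩
      rcases eq_or_ne r' r with rfl | hr
      · rcases eq_or_ne z' z with rfl | hz'
        · rw [hfix _ hfz]; simp
        · have := sgn_add_sgn_of_odd (hf.odd _ _ _ hfz hz')
          have h3 : sgn z' = - sgn z := by omega
          simp only [h3]
          ring
      · obtain rfl : r' = !r := by cases r <;> cases r' <;> simp_all
        have := sgn_eq_of_even (hf.even _ _ _ hfz)
        rw [this]
        cases r <;> cases s <;> simp
    · apply hne
      simp only [w]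
      rw [hfix z hfz]
      simp
  have hdisj : Disjoint ((Finset.Ico A i).image (fun z => ((s, z) : Side)))
      ((Finset.Ico A k).image fun z => ((!s, z) : Side)) := by
    rw [Finset.disjoint_left]
    rintro ⟨r, z⟩ h1 h2
    rw [Finset.mem_image] at h1 h2
    obtain ⟨_, _, h1⟩ := h1
    obtain ⟨_, _, h2⟩ := h2
    simp only [Prod.mk.injEq] at h1 h2
    have := h1.1.trans h2.1.symm
    cases s <;> simp at this
  rw [Finset.sum_union hdisj, Finset.sum_image (by simp), Finset.sum_image (by simp)] at hsum
  simp only [w] at hsum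
  simp only [Bool.not_eq_self, if_true, if_false, one_mul] at hsum
  rw [Finset.sum_congr rfl (g := fun z => -(sgn z * χ (!s, z))) (s₁ := Finset.Ico A k)
    (fun z _ => by ring), Finset.sum_neg_distrib] at hsum
  omega

/-- The height function of a set of strands without ends at `e`. -/
theorem exists_height (hL : IsStack L k) {e : Bool} {X : ℕ × ℤ → ℤ}
    (hXinv : ∀ l z, X (node l z) = X (node l (L l z)))
    (hfixE : ∀ x, L (endLayer k e) (!e, x) = (!e, x) → X (node (endLayer k e) (!e, x)) = 0) (M : ℤ) :
    ∃ A ≤ M, ∃ H : ℕ × ℤ → ℤ, (∀ v, v.2 ≤ A → H v = 0) ∧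
      (∀ v, A ≤ v.2 → H (v.1, v.2 + 1) = H v + sgn v.2 * X v) ∧
      ∀ c u v, GapConn (RootStep L k e c) u v → H u = H v := by
  classical
  obtain ⟨N, hN0, hN⟩ := hL.exists_window
  -- Everything from `A` to the left lies outside the common window, where the layers are vertical,
  -- so no layer carries a point across `A`.
  set A : ℤ := -(max N |M|) - 1 with hAdef
  have hAin : ∀ l z, A ≤ z.2 → A ≤ (L l z).2 := by
    intro l z hz
    by_cases hz' : |z.2| ≤ max N |M|
    · have := hL.window_le hN (le_max_left _ _) (l := l) hz'
      have := (abs_le.1 this).1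
      omega
    · rw [hN l z (lt_of_le_of_lt (le_max_left _ _) (not_le.1 hz'))]
      exact hz
  -- The height of a gap is the number of points of the chosen strands to its left, from `A` on,
  -- with alternating signs.
  set H : ℕ × ℤ → ℤ := fun v => ∑ z ∈ Finset.Ico A v.2, sgn z * X (v.1, z) with hH
  have hnode : ∀ l s (z : ℤ), X (node l (s, z)) = X ((node l (s, 0)).1, z) := fun l s z => rfl
  have hclosed : ∀ l s B C, (∀ z, B ≤ z → z < C → X (node l (s, z)) ≠ 0 →
      ∃ w, L l (s, z) = (s, w) ∧ w ≠ z ∧ B ≤ w ∧ w < C) →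
      ∑ z ∈ Finset.Ico B C, sgn z * X ((node l (s, 0)).1, z) = 0 := by
    intro l s B C hcl
    refine (hL.isLayer l).sum_eq_zero (s := s) (χ := fun z => X ((node l (s, 0)).1, z))
      (fun z h1 h2 h3 => hcl z h1 h2 h3) fun z w hw => ?_
    have := hXinv l (s, z)
    rw [hw] at this
    exact this
  have harc : ∀ l s i j, L l (s, i) = (s, j) → i < j → A ≤ i →
      H (node l (s, i)) = H (node l (s, j + 1)) ∧ H (node l (s, i + 1)) = H (node l (s, j)) := by
    intro l s i j hij hlt hAi
    have hji : L l (s, j) = (s, i) := by rw [← hij, hL.inv]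
    have h1 := hclosed l s i (j + 1) fun z h1 h2 _ => by
      rcases h1.eq_or_lt with rfl | h1
      · exact ⟨j, hij, by omega, by omega, by omega⟩
      rcases (Int.lt_add_one_iff.1 h2).eq_or_lt with rfl | h2
      · exact ⟨i, hji, by omega, by omega, by omega⟩
      obtain ⟨w, h3, h4, h5, h6⟩ := (hL.isLayer l).under _ _ _ hij z h1 h2
      exact ⟨w, h3, h4, by omega, by omega⟩
    have h2 := hclosed l s (i + 1) j fun z h1 h2 _ => by
      obtain ⟨w, h3, h4, h5, h6⟩ := (hL.isLayer l).under _ _ _ hij z (by omega) h2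
      exact ⟨w, h3, h4, by omega, by omega⟩
    simp only [hH, node] at h1 h2 ⊢
    rw [← sum_Ico_add hAi (show i ≤ j + 1 by omega), ← sum_Ico_add (show A ≤ i + 1 by omega)
      (show i + 1 ≤ j by omega), h1, h2, add_zero, add_zero]
    exact ⟨rfl, rfl⟩
  have hmid : ∀ l s i j, L l (s, i) = (!s, j) → 0 < l ∧ l ≤ k := by
    intro l s i j hij
    have h1 : L l (s, i) ≠ (s, i) := by
      rw [hij]
      cases s <;> simp
    constructor
    · rcases Nat.eq_zero_or_pos l with rfl | hl
      · have h2 := hL.bot' i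
        cases s
        · exact absurd (hL.bot i) h1
        · rw [hij] at h2
          simp at h2
      · exact hl
    · by_contra hl
      rcases (show k + 1 ≤ l by omega).eq_or_lt with rfl | hl
      · have h2 := hL.top' i
        cases s
        · rw [hij] at h2
          simp at h2
        · exact absurd (hL.top i) h1
      · exact h1 (hL.beyond l hl _)
  have hline : ∀ l s i j, L l (s, i) = (!s, j) →
      H (node l (s, i)) = H (node l (!s, j)) ∧ H (node l (s, i + 1)) = H (node l (!s, j + 1)) := by
    intro l s i j hij
    have hm := hmid l s i j hij
    have h1 := (hL.isLayer l).sum_line (χ := fun z => X (node l z)) (A := A) (hAin l) (hXinv l) hij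
      fun z hz => absurd hz (hL.mid l hm.1 hm.2 z)
    have h2 : H (node l (s, i)) = H (node l (!s, j)) := h1
    refine ⟨h2, ?_⟩
    have hji : L l (!s, j) = (s, i) := by rw [← hij, hL.inv]
    by_cases hAi : A ≤ i
    · have hAj : A ≤ j := by
        have := hAin l (s, i) hAi
        rwa [hij] at this
      have h3 := hXinv l (s, i)
      rw [hij] at h3
      have h4 := sgn_eq_of_even ((hL.isLayer l).even _ _ _ hij)
      simp only [hH, node] at h2 h3 ⊢
      rw [← sum_Ico_add hAi (show i ≤ i + 1 by omega), ← sum_Ico_add hAj (show j ≤ j + 1 by omega), h2,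
        sum_Ico_succ, sum_Ico_succ, h3, h4]
    · have hAj : ¬ A ≤ j := by
        intro hAj
        have := hAin l (!s, j) hAj
        rw [hji] at this
        exact hAi this
      simp only [hH, node]
      rw [Finset.Ico_eq_empty (by omega), Finset.Ico_eq_empty (by omega)]
      simp
  have hArc : ∀ l s i j, L l (s, i) = (s, j) → j ≠ i → A ≤ i ∧ A ≤ j := by
    intro l s i j hij hne
    have h1 : |i| ≤ N := by
      by_contra hi
      have := hN l (s, i) (by simpa using hi)
      rw [hij] at this
      exact hne this
    have h2 := hL.window_le hN le_rfl (l := l) (z := (s, i)) h1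
    rw [hij] at h2
    have h3 := (abs_le.1 h1).1
    have h4 := (abs_le.1 h2).1
    simp only at h4
    omega
  have hHinv : ∀ c l x y, RootStep L k e c l x y → H (node l x) = H (node l y) := by
    intro c l x y hxy
    cases hxy with
    | gap h hc =>
      cases h with
      | @arc s i j hij hne =>
        have hA2 := hArc l s i j hij hne
        rcases lt_or_gt_of_ne hne with hlt | hlt
        · have hji : L l (s, j) = (s, i) := by rw [← hij, hL.inv]
          exact (harc l s j i hji hlt hA2.2).2.symm
        · exact (harc l s i j hij hlt hA2.1).1
      | left hij => exact (hline l _ _ _ hij).1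
      | right hij => exact (hline l _ _ _ hij).2
    | @root g g' hl hg hg' hc hc' =>
      subst hl
      -- No arc passes over an outer gap, so the chosen points to its left are paired among
      -- themselves; none of them is an end, by `hfixE`.
      have hz : ∀ g, Outer (L (endLayer k e)) (!e) g → H (node (endLayer k e) (!e, g)) = 0 := by
        intro g hg
        refine hclosed (endLayer k e) (!e) A g fun z h1 h2 h3 => ?_
        have hsame : (L (endLayer k e) (!e, z)).1 = !e := by
          cases e
          · exact hL.bot' z
          · exact hL.top' z
        refine ⟨(L (endLayer k e) (!e, z)).2, Prod.ext hsame rfl, fun h4 => ?_, ?_, ?_⟩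
        · exact h3 (hfixE z (Prod.ext hsame h4))
        · exact hAin _ (!e, z) h1
        · by_contra h5
          exact hg z _ (Prod.ext hsame rfl) ⟨h2, not_lt.1 h5⟩
      rw [hz g hg, hz g' hg']
  refine ⟨A, ?_, H, fun v hv => ?_, fun v hv => ?_, fun c u v huv => ?_⟩
  · have := neg_abs_le M
    have := le_max_right N |M|
    omega
  · simp only [hH]
    rw [Finset.Ico_eq_empty (by omega), Finset.sum_empty]
  · simp only [hH]
    rw [← sum_Ico_add hv (show v.2 ≤ v.2 + 1 by omega), sum_Ico_succ]
  · induction huv with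
    | rel u v h => obtain ⟨l, x, y, h, rfl, rfl⟩ := h; exact hHinv c l x y h
    | refl => rfl
    | symm _ _ _ ih => exact ih.symm
    | trans _ _ _ _ _ ih ih' => exact ih.trans ih'

lemma strand_invariant (u : ℕ × ℤ) (l : ℕ) (z : Side) :
    Conn L u (node l z) ↔ Conn L u (node l (L l z)) :=
  ⟨fun h => h.trans (Conn.step l z), fun h => h.trans (Conn.step l z).symm⟩

/-- If the strand of `u` does not end at `e`, its height function is constant on the regions of
either colour. It vanishes far to the left, where both parities occur, hence everywhere; but it
jumps by a sign at `u`. -/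
theorem reaches_of_total (hL : IsStack L k) {e : Bool}
    (h : ∀ c, Total k c (RootStep L k e c)) : Reaches L k e := by
  classical
  intro u hu hu'
  by_contra hno
  push Not at hno
  obtain ⟨A, hAu, H, hH0, hH1, hHconn⟩ := exists_height hL (e := e)
    (X := fun v => if Conn L u v then 1 else 0) (fun l z => by simp only [← strand_invariant u l z])
    (fun x hx => if_neg (hno x hx)) u.2
  have hz : ∀ g, H (u.1, g) = 0 := by
    intro g
    obtain ⟨g', hg', hpar⟩ : ∃ g' ≤ A, Even (g' - g) := by
      by_cases hp : Even (A - g)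
      · exact ⟨A, le_rfl, hp⟩
      · exact ⟨A - 1, by omega, by simp only [Int.even_iff] at *; omega⟩
    rw [hHconn g (u.1, g) (u.1, g') (h g _ _ hu hu' (by simp) hu hu' hpar)]
    exact hH0 _ hg'
  have h1 := hH1 u hAu
  have h2 : H u = 0 := hz u.2
  rw [hz, h2, if_pos Conn.refl] at h1
  simp only [sgn] at h1
  split_ifs at h1 <;> omega

theorem reaches_iff_total (hL : IsStack L k) {e : Bool} :
    Reaches L k e ↔ ∀ c, Total k c (RootStep L k e c) :=
  ⟨total_of_reaches hL, reaches_of_total hL⟩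

end

/-- Orientability becomes connectedness of four graphs on gaps, one for each end and colour. Unlike
the course of the strands, these graphs change only by one edge of each colour under a surgery. -/
theorem orientable_iff_total {a : ArcDiagram} {t : GenMatching} {b : ArcDiagram} :
    Orientable a t b ↔
      ∀ e c, Total t.length c (RootStep (layers a t b) t.length e c) := by
  have hL := isStack_layers a t b
  rw [orientable_iff]
  have : (∀ e, Reaches (layers a t b) t.length e) ↔
      ∀ e c, Total t.length c (RootStep (layers a t b) t.length e c) :=
    forall_congr' fun e => reaches_iff_total hL
  rw [← this]
  constructor
  · rintro h (_ | _) ⟨u, i⟩ hu hu' <;> obtain ⟨j, rfl⟩ : ∃ j, u = j + 1 := ⟨u - 1, by omega⟩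
    · obtain ⟨x, hx, hj⟩ := (h j i (by simpa using hu')).1
      exact ⟨x, by simpa [arcSide, endLayer, ArcDiagram.IsRay] using hx, joined_iff.1 hj⟩
    · obtain ⟨x, hx, hj⟩ := (h j i (by simpa using hu')).2
      refine ⟨x, ?_, joined_iff.1 hj⟩
      simpa [endLayer, layers_last, arcSide, ArcDiagram.IsRay] using hx
  · intro h j i hj
    constructor
    · obtain ⟨x, hx, hc⟩ := h false (j + 1, i) (by simp) (by simpa using hj)
      exact ⟨x, by simpa [arcSide, endLayer, ArcDiagram.IsRay] using hx, joined_iff.2 hc⟩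
    · obtain ⟨x, hx, hc⟩ := h true (j + 1, i) (by simp) (by simpa using hj)
      refine ⟨x, ?_, joined_iff.2 hc⟩
      simpa [endLayer, layers_last, arcSide, ArcDiagram.IsRay] using hx

/-! ### Potentials

A path in the gaps of one colour gives a function on the gaps of the other colour, which jumps where
the path passes by. -/

/-- The jump to the right of the gap `x`. -/
def jump (x o : Side) : ℤ := if x.1 = o.1 ∧ x.2 < o.2 then (if x.1 then -1 else 1) else 0

/-- The potential of the step from `x` to `y` in a layer. -/
def pot (x y o : Side) : ℤ := jump x o - jump y o

lemma pot_swap (x y o : Side) : pot y x o = - pot x y o := by simp [pot]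

/-- `K` is a potential of a path from `u` to `v`, which is constant along `B`. -/
structure IsPot (B : ℕ → Side → Side → Prop) (u v : ℕ × ℤ) (K : ℕ → Side → ℤ) : Prop where
  const : ∀ l o o', B l o o' → K l o = K l o'
  jump : ∀ l o, K (l + 1) (false, o) - K l (true, o) =
    (if u.1 = l + 1 ∧ u.2 < o then 1 else 0) - (if v.1 = l + 1 ∧ v.2 < o then 1 else 0)

namespace IsPot

variable {B : ℕ → Side → Side → Prop} {u v w : ℕ × ℤ} {K K' : ℕ → Side → ℤ}

lemma refl : IsPot B u u 0 := ⟨by simp, by simp⟩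

lemma symm (h : IsPot B u v K) : IsPot B v u (-K) where
  const l o o' ho := by simp [h.const l o o' ho]
  jump l o := by
    have := h.jump l o
    simp only [Pi.neg_apply]
    omega

lemma trans (h : IsPot B u v K) (h' : IsPot B v w K') : IsPot B u w (K + K') where
  const l o o' ho := by simp [h.const l o o' ho, h'.const l o o' ho]
  jump l o := by
    have := h.jump l o
    have := h'.jump l o
    simp only [Pi.add_apply]
    omega

lemma mono {B' : ℕ → Side → Side → Prop} (hB : ∀ l o o', B' l o o' → B l o o')
    (h : IsPot B u v K) : IsPot B' u v K :=
  ⟨fun l o o' ho => h.const l o o' (hB l o o' ho), h.jump⟩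

lemma single {l : ℕ} {x y : Side} (h : ∀ o o', B l o o' → pot x y o = pot x y o') :
    IsPot B (node l x) (node l y) (Pi.single l (pot x y)) where
  const m o o' ho := by
    rcases eq_or_ne m l with rfl | hm
    · simpa using h o o' ho
    · simp [hm]
  jump m o := by
    obtain ⟨s, i⟩ := x
    obtain ⟨r, j⟩ := y
    rcases eq_or_ne m l with rfl | hm
    · cases s <;> cases r <;> simp [pot, KhovanovP.jump, node] <;>
        (split_ifs <;> omega)
    · rcases eq_or_ne (m + 1) l with rfl | hm'
      · cases s <;> cases r <;> simp [pot, KhovanovP.jump, node]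
      · cases s <;> cases r <;> simp [node, hm, hm', Ne.symm hm, Ne.symm hm']

/-- For a closed path the jumps at its two endpoints cancel, so the potential does not depend on the
layer from which a gap is seen. It plays the role of the winding number of the path. -/
lemma closed (h : IsPot B u u K) (l : ℕ) (x : Side) :
    K l x = K (node l x).1 (false, (node l x).2) := by
  obtain ⟨s, i⟩ := x
  cases s
  · rfl
  · have := h.jump l i
    simp only [node_true]
    omega

end IsPot

/-- Each step contributes its own potential in its own layer, and the contributions add up. The
hypothesis says that steps of the two colours do not cross. -/
lemma exists_isPot {A B : ℕ → Side → Side → Prop}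
    (hAB : ∀ l x y o o', A l x y → B l o o' → pot x y o = pot x y o') {u v : ℕ × ℤ}
    (h : GapConn A u v) : ∃ K, IsPot B u v K := by
  induction h with
  | rel u v h =>
    obtain ⟨l, x, y, h, rfl, rfl⟩ := h
    exact ⟨_, .single fun o o' ho => hAB l x y o o' h ho⟩
  | refl => exact ⟨_, .refl⟩
  | symm _ _ _ ih => exact ⟨_, ih.choose_spec.symm⟩
  | trans _ _ _ _ _ ih ih' => exact ⟨_, ih.choose_spec.trans ih'.choose_spec⟩

/-- The relations `T` together with two edges. -/
def AddEdges (T : ℕ → Side → Side → Prop) (a b c d u v : ℕ × ℤ) : Prop :=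
  (∃ l x y, T l x y ∧ u = node l x ∧ v = node l y) ∨ (u = a ∧ v = b) ∨ (u = c ∧ v = d)

lemma iff_of_addEdges {T : ℕ → Side → Side → Prop} {a b c d u v : ℕ × ℤ} {P : ℕ × ℤ → Prop}
    (h : Relation.EqvGen (AddEdges T a b c d) u v)
    (hT : ∀ l x y, T l x y → (P (node l x) ↔ P (node l y))) (hab : P a ↔ P b) (hcd : P c ↔ P d) :
    P u ↔ P v := by
  induction h with
  | rel u v h =>
    rcases h with ⟨l, x, y, h, rfl, rfl⟩ | ⟨rfl, rfl⟩ | ⟨rfl, rfl⟩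
    · exact hT l x y h
    · exact hab
    · exact hcd
  | refl => rfl
  | symm _ _ _ ih => exact ih.symm
  | trans _ _ _ _ _ ih ih' => exact ih.trans ih'

/-- Three gaps of one colour and three gaps of the other colour around a hexagon in a layer. -/
structure Hexagon (A B : Side → Side → Prop) (E₁ O₁₂ E₂ O₂₃ E₃ O₃₁ : Side) : Prop where
  cross : ∀ x y o o', A x y → B o o' → pot x y o = pot x y o'
  crossO : ∀ x y, A x y → pot x y O₁₂ = pot x y O₂₃ ∧ pot x y O₂₃ = pot x y O₃₁
  crossE : ∀ o o', B o o' → pot E₁ E₂ o = pot E₁ E₂ o' ∧ pot E₁ E₃ o = pot E₁ E₃ o'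
  pot₁₂ : pot E₁ E₂ O₁₂ = pot E₁ E₂ O₂₃ + 1 ∧ pot E₁ E₂ O₂₃ = pot E₁ E₂ O₃₁
  pot₂₃ : pot E₂ E₃ O₂₃ = pot E₂ E₃ O₃₁ + 1 ∧ pot E₂ E₃ O₃₁ = pot E₂ E₃ O₁₂
  pot₃₁ : pot E₃ E₁ O₃₁ = pot E₃ E₁ O₁₂ + 1 ∧ pot E₃ E₁ O₁₂ = pot E₃ E₁ O₂₃

lemma Hexagon.crossE₂₃ {A B : Side → Side → Prop} {E₁ O₁₂ E₂ O₂₃ E₃ O₃₁ : Side}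
    (h : Hexagon A B E₁ O₁₂ E₂ O₂₃ E₃ O₃₁) (o o' : Side) (ho : B o o') :
    pot E₂ E₃ o = pot E₂ E₃ o' := by
  have := h.crossE o o' ho
  simp only [pot] at this ⊢
  omega

set_option maxHeartbeats 2000000 in
/-- If the regions of one colour are connected in three of the four resolutions of two hexagons, and
in one of them those of the other colour are connected, then the same holds for the fourth one. -/
theorem square {A B : ℕ → Side → Side → Prop} {p q : ℕ} (hpq : p ≠ q)
    {E₁ O₁₂ E₂ O₂₃ E₃ O₃₁ F₁ P₁₂ F₂ P₂₃ F₃ P₃₁ : Side}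
    (hE : Hexagon (A p) (B p) E₁ O₁₂ E₂ O₂₃ E₃ O₃₁) (hF : Hexagon (A q) (B q) F₁ P₁₂ F₂ P₂₃ F₃ P₃₁)
    (hAB : ∀ l x y o o', A l x y → B l o o' → pot x y o = pot x y o')
    {VA VB : ℕ × ℤ → Prop}
    (hVE₁ : VA (node p E₁)) (hVE₂ : VA (node p E₂)) (hVE₃ : VA (node p E₃))
    (hVF₁ : VA (node q F₁)) (hVF₂ : VA (node q F₂)) (hVF₃ : VA (node q F₃))
    (hVO₁₂ : VB (node p O₁₂)) (hVO₂₃ : VB (node p O₂₃))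
    (hVP₁₂ : VB (node q P₁₂)) (hVP₂₃ : VB (node q P₂₃))
    (h00 : ∀ u v, VA u → VA v →
      Relation.EqvGen (AddEdges A (node p E₁) (node p E₂) (node q F₁) (node q F₂)) u v)
    (h10 : ∀ u v, VA u → VA v →
      Relation.EqvGen (AddEdges A (node p E₁) (node p E₃) (node q F₁) (node q F₂)) u v)
    (h11 : ∀ u v, VA u → VA v →
      Relation.EqvGen (AddEdges A (node p E₁) (node p E₃) (node q F₁) (node q F₃)) u v)
    (hB : ∀ u v, VB u → VB v →
      Relation.EqvGen (AddEdges B (node p O₂₃) (node p O₃₁) (node q P₂₃) (node q P₃₁)) u v) :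
    ∀ u v, VA u → VA v →
      Relation.EqvGen (AddEdges A (node p E₁) (node p E₂) (node q F₁) (node q F₃)) u v := by
  intro u₀ v₀ hu₀ hv₀
  by_contra hno
  -- The component of `u₀` in the fourth resolution, which by assumption does not contain `v₀`.
  set Q : ℕ × ℤ → Prop := fun v =>
    Relation.EqvGen (AddEdges A (node p E₁) (node p E₂) (node q F₁) (node q F₃)) u₀ v with hQ
  have hQiff : ∀ {u v}, AddEdges A (node p E₁) (node p E₂) (node q F₁) (node q F₃) u v →
      (Q u ↔ Q v) := fun h =>
    ⟨fun h' => h'.trans _ _ _ (.rel _ _ h), fun h' => h'.trans _ _ _ (.symm _ _ (.rel _ _ h))⟩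
  have hQA : ∀ l x y, A l x y → (Q (node l x) ↔ Q (node l y)) := fun l x y h =>
    hQiff (Or.inl ⟨l, x, y, h, rfl, rfl⟩)
  have hQE : Q (node p E₁) ↔ Q (node p E₂) := hQiff (Or.inr (Or.inl ⟨rfl, rfl⟩))
  have hQF : Q (node q F₁) ↔ Q (node q F₃) := hQiff (Or.inr (Or.inr ⟨rfl, rfl⟩))
  have hQ0 : Q u₀ := .refl _
  -- The fourth resolution differs from that of `h11` in the first hexagon only, and from that of
  -- `h00` in the second one only. Hence `Q` separates `E₁` from `E₃` and `F₁` from `F₂`.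
  have hQE₃ : ¬ (Q (node p E₁) ↔ Q (node p E₃)) := fun h =>
    hno ((iff_of_addEdges (h11 u₀ v₀ hu₀ hv₀) hQA h hQF).1 hQ0)
  have hQF₂ : ¬ (Q (node q F₁) ↔ Q (node q F₂)) := fun h =>
    hno ((iff_of_addEdges (h00 u₀ v₀ hu₀ hv₀) hQA hQE h).1 hQ0)
  -- connections without the hexagons
  have hconnQ : ∀ {u v}, GapConn A u v → (Q u ↔ Q v) := fun {u v} h =>
    iff_of_addEdges (a := u) (b := u) (c := u) (d := u)
      (h.mono fun _ _ h' => Or.inl h') hQA Iff.rfl Iff.rfl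
  have hcA : ∀ w l x y, A l x y → (GapConn A (node l x) w ↔ GapConn A (node l y) w) :=
    fun w l x y h =>
      have h' : GapConn A (node l x) (node l y) := .rel _ _ ⟨l, x, y, h, rfl, rfl⟩
      ⟨fun h1 => .trans _ _ _ (.symm _ _ h') h1, fun h1 => .trans _ _ _ h' h1⟩
  -- Paths outside the two hexagons do not cross the connections of the other colour through the
  -- hexagons either. Their potentials therefore agree at the three gaps of the other colour around
  -- each hexagon.
  set Bx : ℕ → Side → Side → Prop := fun l o o' => B l o o' ∨
    (l = p ∧ ((o = O₁₂ ∧ o' = O₂₃) ∨ (o = O₂₃ ∧ o' = O₃₁))) ∨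
    (l = q ∧ ((o = P₁₂ ∧ o' = P₂₃) ∨ (o = P₂₃ ∧ o' = P₃₁))) with hBx
  have hABx : ∀ l x y o o', A l x y → Bx l o o' → pot x y o = pot x y o' := by
    rintro l x y o o' hA (h | ⟨rfl, ⟨rfl, rfl⟩ | ⟨rfl, rfl⟩⟩ | ⟨rfl, ⟨rfl, rfl⟩ | ⟨rfl, rfl⟩⟩)
    · exact hAB l x y o o' hA h
    · exact (hE.crossO x y hA).1
    · exact (hE.crossO x y hA).2
    · exact (hF.crossO x y hA).1
    · exact (hF.crossO x y hA).2
  have hpath : ∀ {u v}, GapConn A u v → ∃ K, IsPot B u v K ∧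
      (K p O₁₂ = K p O₂₃ ∧ K p O₂₃ = K p O₃₁) ∧ K q P₁₂ = K q P₂₃ ∧ K q P₂₃ = K q P₃₁ := by
    intro u v h
    obtain ⟨K, hK⟩ := exists_isPot hABx h
    exact ⟨K, hK.mono fun l o o' h => Or.inl h,
      ⟨hK.const _ _ _ (Or.inr (Or.inl ⟨rfl, Or.inl ⟨rfl, rfl⟩⟩)),
        hK.const _ _ _ (Or.inr (Or.inl ⟨rfl, Or.inr ⟨rfl, rfl⟩⟩))⟩,
      hK.const _ _ _ (Or.inr (Or.inr ⟨rfl, Or.inl ⟨rfl, rfl⟩⟩)),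
      hK.const _ _ _ (Or.inr (Or.inr ⟨rfl, Or.inr ⟨rfl, rfl⟩⟩))⟩
  have hE₂₁ : IsPot B (node p E₂) (node p E₁) (Pi.single p (pot E₂ E₁)) := .single fun o o' h => by
    rw [pot_swap E₁, pot_swap E₁, (hE.crossE o o' h).1]
  have hE₃₂ : IsPot B (node p E₃) (node p E₂) (Pi.single p (pot E₃ E₂)) := .single fun o o' h => by
    rw [pot_swap E₂, pot_swap E₂, hE.crossE₂₃ o o' h]
  have hF₃₁ : IsPot B (node q F₃) (node q F₁) (Pi.single q (pot F₃ F₁)) := .single fun o o' h => by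
    rw [pot_swap F₁, pot_swap F₁, (hF.crossE o o' h).2]
  have hF₁₂ : IsPot B (node q F₁) (node q F₂) (Pi.single q (pot F₁ F₂)) := .single fun o o' h =>
    (hF.crossE o o' h).1
  have e12 := hE.pot₁₂
  have e23 := hE.pot₂₃
  have f12 := hF.pot₁₂
  have f31 := hF.pot₃₁
  have s21 := pot_swap E₁ E₂
  have s32 := pot_swap E₂ E₃
  -- Together with the edge from `E₂` to `E₁`, such a path would be a closed curve with `O₁₂` on one
  -- side and `O₂₃`, `O₃₁` on the other one. The connections in `hB` cross neither the path nor this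
  -- edge, so they could not lead from `O₁₂` to `O₂₃`.
  have h12 : ¬ GapConn A (node p E₁) (node p E₂) := by
    intro h
    obtain ⟨K, hK, hKO, hKP⟩ := hpath h
    have hcl := hK.trans hE₂₁
    set K' := K + Pi.single p (pot E₂ E₁) with hK'
    have hp : ∀ o, K' p o = K p o + pot E₂ E₁ o := by simp [hK']
    have hq : ∀ o, K' q o = K q o := by simp [hK', hpq.symm]
    have := iff_of_addEdges (P := fun u => K' u.1 (false, u.2) = K' p O₁₂)
      (hB _ _ hVO₁₂ hVO₂₃) (fun l x y hxy => by
        simp only [← hcl.closed, hcl.const l x y hxy])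
      (by simp only [← hcl.closed, hp, s21]; omega)
      (by simp only [← hcl.closed, hq]; omega)
    simp only [← hcl.closed, hp, s21, true_iff] at this
    omega
  -- the components of the hexagons
  have c3 : ¬ GapConn A (node p E₃) (node p E₂) := fun h => hQE₃ (hQE.trans (hconnQ h).symm)
  have c3' : ¬ GapConn A (node p E₁) (node p E₃) := fun h => hQE₃ (hconnQ h)
  have r2 : GapConn A (node p E₂) (node p E₂) := .refl _
  have r3 : GapConn A (node p E₃) (node p E₃) := .refl _
  -- In the resolutions of `h10` and `h11` the first hexagon does not touch the component of `E₂`,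
  -- so this component must be left through the second hexagon. Together with `hQF₂` this leaves
  -- only one pattern of connections outside the hexagons: `F₁` with `E₂`, `F₂` with `E₃`, `F₃` with
  -- `E₁`.
  have k10 : ¬ (GapConn A (node q F₁) (node p E₂) ↔ GapConn A (node q F₂) (node p E₂)) := fun h =>
    h12 ((iff_of_addEdges (P := fun u => GapConn A u (node p E₂)) (h10 _ _ hVE₁ hVE₂) (hcA _)
      (by simp only [h12, c3]) h).2 r2)
  have k11 : ¬ (GapConn A (node q F₁) (node p E₂) ↔ GapConn A (node q F₃) (node p E₂)) := fun h =>
    h12 ((iff_of_addEdges (P := fun u => GapConn A u (node p E₂)) (h11 _ _ hVE₁ hVE₂) (hcA _)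
      (by simp only [h12, c3]) h).2 r2)
  have hF1 : GapConn A (node q F₁) (node p E₂) := by
    by_contra h
    have h2 : GapConn A (node q F₂) (node p E₂) := by tauto
    have h3 : GapConn A (node q F₃) (node p E₂) := by tauto
    exact hQF₂ (hQF.trans ((hconnQ h3).trans (hconnQ h2).symm))
  have hF3' : ¬ GapConn A (node q F₃) (node p E₂) := by tauto
  have c32 : ¬ GapConn A (node p E₂) (node p E₃) := fun h => c3 (.symm _ _ h)
  have hF2 : GapConn A (node q F₂) (node p E₃) := by
    by_contra h
    have h1 : ¬ GapConn A (node q F₁) (node p E₃) := fun h1 =>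
      c32 (.trans _ _ _ (.symm _ _ hF1) h1)
    exact c3' ((iff_of_addEdges (P := fun u => GapConn A u (node p E₃)) (h00 _ _ hVE₁ hVE₃) (hcA _)
      (by simp only [c3', c32]) (by simp only [h, h1])).2 r3)
  have hF3 : GapConn A (node q F₃) (node p E₁) := by
    have h := (iff_of_addEdges (P := fun u => GapConn A u (node p E₁) ∨ GapConn A u (node p E₂) ∨
      GapConn A u (node p E₃)) (h00 _ _ hVE₂ hVF₃) (fun l x y h => by
        simp only [hcA _ l x y h])
      (by
        have r1 : GapConn A (node p E₁) (node p E₁) := .refl _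
        simp only [r1, r2, true_or, or_true])
      (by simp only [hF1, hF2, true_or, or_true])).1 (Or.inr (Or.inl r2))
    rcases h with h | h | h
    · exact h
    · exact absurd h hF3'
    · exact absurd (hQE.trans ((hconnQ hF1).symm.trans (hQF.trans (hconnQ h)))) hQE₃
  obtain ⟨K₁, h1, h1O, h1P⟩ := hpath (Relation.EqvGen.symm _ _ hF3)
  obtain ⟨K₂, h2, h2O, h2P⟩ := hpath hF1
  obtain ⟨K₃, h3, h3O, h3P⟩ := hpath hF2
  -- This pattern has the same cyclic order at both hexagons, which is impossible in the plane. The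
  -- two closed curves `E₁ F₃ F₁ E₂` and `E₂ F₁ F₂ E₃` make this precise: the pair of their
  -- potentials would have to agree at `O₁₂` and `O₂₃`, or at `P₁₂` and `P₂₃`, against the
  -- prescribed jumps at the hexagons.
  have hU := ((h1.trans hF₃₁).trans h2).trans hE₂₁
  have hX := ((h2.symm.trans hF₁₂).trans h3).trans hE₃₂
  set U := K₁ + Pi.single q (pot F₃ F₁) + K₂ + Pi.single p (pot E₂ E₁) with hUdef
  set X := -K₂ + Pi.single q (pot F₁ F₂) + K₃ + Pi.single p (pot E₃ E₂) with hXdef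
  have hUp : ∀ o, U p o = K₁ p o + K₂ p o - pot E₁ E₂ o := fun o => by
    simp [hUdef, hpq, pot_swap E₁ E₂, sub_eq_add_neg]
  have hUq : ∀ o, U q o = K₁ q o + pot F₃ F₁ o + K₂ q o := fun o => by simp [hUdef, hpq.symm]
  have hXp : ∀ o, X p o = - K₂ p o + K₃ p o - pot E₂ E₃ o := fun o => by
    simp [hXdef, hpq, pot_swap E₂ E₃, sub_eq_add_neg]
  have hXq : ∀ o, X q o = - K₂ q o + pot F₁ F₂ o + K₃ q o := fun o => by simp [hXdef, hpq.symm]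
  have key : ∀ α β : ℤ, ∀ u v, VB u → VB v →
      ((U p O₂₃ = α ∧ X p O₂₃ = β) ↔ (U p O₃₁ = α ∧ X p O₃₁ = β)) →
      ((U q P₂₃ = α ∧ X q P₂₃ = β) ↔ (U q P₃₁ = α ∧ X q P₃₁ = β)) →
      ((U u.1 (false, u.2) = α ∧ X u.1 (false, u.2) = β) ↔
        (U v.1 (false, v.2) = α ∧ X v.1 (false, v.2) = β)) := by
    intro α β u v hu hv ho hp
    refine iff_of_addEdges (P := fun u => U u.1 (false, u.2) = α ∧ X u.1 (false, u.2) = β)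
      (hB u v hu hv) (fun l x y hxy => ?_) ?_ ?_
    · simp only [← hU.closed, ← hX.closed, hU.const l x y hxy, hX.const l x y hxy]
    · simpa only [← hU.closed, ← hX.closed] using ho
    · simpa only [← hU.closed, ← hX.closed] using hp
  have kO := key (U p O₁₂) (X p O₁₂) _ _ hVO₁₂ hVO₂₃
  have kP := key (U q P₁₂) (X q P₁₂) _ _ hVP₁₂ hVP₂₃
  simp only [← hU.closed, ← hX.closed] at kO kP
  simp only [hUp, hUq, hXp, hXq, and_self, true_iff] at kO kP
  omega

/-! ### Paths of different colours do not cross in a layer -/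

section

variable {f g : Side → Side}

lemma Bool.eq_or_eq_not' (r s : Bool) : r = s ∨ r = !s := by cases r <;> cases s <;> simp

namespace IsLayer

lemma arc_inside (hf : IsLayer f) {s : Bool} {i k z w : ℤ} (h : f (s, i) = (s, k))
    (h' : f (s, z) = (s, w)) (h1 : i < z) (h2 : z < k) : i < w ∧ w < k := by
  obtain ⟨v, hv, -, h3, h4⟩ := hf.under _ _ _ h z h1 h2
  rw [h'] at hv
  simp at hv
  omega

lemma arc_symm (hf : IsLayer f) {s : Bool} {i k : ℤ} (h : f (s, i) = (s, k)) :
    f (s, k) = (s, i) := by rw [← h, hf.inv]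

lemma line_symm (hf : IsLayer f) {s : Bool} {i k : ℤ} (h : f (s, i) = (!s, k)) :
    f (!s, k) = (s, i) := by rw [← h, hf.inv]

lemma line_outside (hf : IsLayer f) {s : Bool} {i k z w : ℤ} (h : f (s, i) = (s, k))
    (h' : f (s, z) = (!s, w)) : ¬ (i < z ∧ z < k) ∧ z ≠ i ∧ z ≠ k := by
  refine ⟨fun h1 => ?_, ?_, ?_⟩
  · obtain ⟨v, hv, -⟩ := hf.under _ _ _ h z h1.1 h1.2
    rw [h'] at hv
    cases s <;> simp at hv
  · rintro rfl
    rw [h] at h'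
    cases s <;> simp at h'
  · rintro rfl
    rw [hf.arc_symm h] at h'
    cases s <;> simp at h'

lemma line_mono (hf : IsLayer f) {s : Bool} {i k z w : ℤ} (h : f (s, i) = (!s, k))
    (h' : f (s, z) = (!s, w)) : (i < z ↔ k < w) ∧ (i = z ↔ k = w) := by
  have h1 : i < z → k < w := fun hlt => by
    rcases hf.left _ _ _ h' i hlt with ⟨v, -, hv⟩ | ⟨v, h2, hv⟩ <;> rw [h] at hv
    · cases s <;> simp at hv
    · simp at hv; omega
  have h2 : z < i → w < k := fun hlt => by
    rcases hf.left _ _ _ h z hlt with ⟨v, -, hv⟩ | ⟨v, h2, hv⟩ <;> rw [h'] at hv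
    · cases s <;> simp at hv
    · simp at hv; omega
  have h3 : i = z → k = w := by
    rintro rfl
    rw [h] at h'
    simpa using h'
  omega

/-- A step follows an arc or a line of the layer. As arcs and lines do not cross, both ends of a
step of the other colour lie on the same side of it; the parities decide the borderline cases, in
which both steps follow the same arc or line. -/
lemma cross (hf : IsLayer f) {x y o o' : Side} (h : GapStep f x y) (h' : GapStep f o o')
    (hodd : Odd (o.2 - x.2)) : pot x y o = pot x y o' := by
  -- lines against lines
  have hll : ∀ {s r : Bool} {i k i' k' : ℤ}, f (s, i) = (!s, k) → f (r, i') = (!r, k') →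
      (r = s → ((i < i' ↔ k < k') ∧ (i = i' ↔ k = k'))) ∧
      (r = (!s) → ((i < k' ↔ k < i') ∧ (i = k' ↔ k = i'))) := by
    intro s r i k i' k' h1 h2
    refine ⟨?_, ?_⟩
    · rintro rfl
      exact hf.line_mono h1 h2
    · rintro rfl
      rw [Bool.not_not] at h2
      refine hf.line_mono h1 (z := k') ?_
      rw [← h2, hf.inv]
  -- arcs against lines
  have hal : ∀ {s r : Bool} {i k i' k' : ℤ}, f (s, i) = (s, k) → f (r, i') = (!r, k') →
      (r = s → (¬ (i < i' ∧ i' < k) ∧ ¬ (k < i' ∧ i' < i) ∧ i' ≠ i ∧ i' ≠ k)) ∧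
      (r = (!s) → (¬ (i < k' ∧ k' < k) ∧ ¬ (k < k' ∧ k' < i) ∧ k' ≠ i ∧ k' ≠ k)) := by
    intro s r i k i' k' h1 h2
    refine ⟨?_, ?_⟩
    · rintro rfl
      have h3 := hf.line_outside h1 h2
      have h4 := hf.line_outside (hf.arc_symm h1) h2
      exact ⟨h3.1, h4.1, h3.2⟩
    · rintro rfl
      have h5 := hf.line_symm h2
      rw [Bool.not_not] at h5
      have h3 := hf.line_outside h1 h5
      have h4 := hf.line_outside (hf.arc_symm h1) h5
      exact ⟨h3.1, h4.1, h3.2⟩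
  rw [Int.odd_iff] at hodd
  cases h with
  | @arc s i k h1 hne =>
    have ho := Int.odd_iff.1 (hf.odd _ _ _ h1 hne)
    cases h' with
    | @arc r i' k' h2 hne' =>
      have ho' := Int.odd_iff.1 (hf.odd _ _ _ h2 hne')
      rcases Bool.eq_or_eq_not' r s with rfl | rfl
      · have h1' := hf.arc_symm h1
        have h2' := hf.arc_symm h2
        have a1 := hf.arc_inside h1 h2
        have a2 := hf.arc_inside h1 h2'
        have a3 := hf.arc_inside h1' h2
        have a4 := hf.arc_inside h1' h2'
        have b1 := hf.arc_inside h2 h1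
        have b2 := hf.arc_inside h2 h1'
        have b3 := hf.arc_inside h2' h1
        have b4 := hf.arc_inside h2' h1'
        have c1 : i' = k → k' = i := by
          rintro rfl
          rw [h2] at h1'
          simpa using h1'
        have c2 : k' = i → i' = k := by
          rintro rfl
          rw [h1] at h2'
          simpa using h2'.symm
        have c3 : k' = k → i' = i := by
          rintro rfl
          rw [h2'] at h1'
          simpa using h1'
        simp only at hodd
        cases r <;> simp only [pot, jump, true_and, if_true, Bool.false_eq_true, if_false] <;>
          split_ifs <;> omega
      · cases s <;> simp [pot, jump]
    | @left r i' k' h2 =>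
      have hl := hal h1 h2
      have he := Int.even_iff.1 (hf.even _ _ _ h2)
      rcases Bool.eq_or_eq_not' r s with rfl | rfl <;> simp only [true_imp_iff] at hl hodd <;>
        first
          | (cases r <;> simp [pot, jump] <;> split_ifs <;> omega)
          | (cases s <;> simp [pot, jump] <;> simp only [Bool.not_false, Bool.not_true] at hl <;>
              split_ifs <;> omega)
    | @right r i' k' h2 =>
      have hl := hal h1 h2
      have he := Int.even_iff.1 (hf.even _ _ _ h2)
      rcases Bool.eq_or_eq_not' r s with rfl | rfl <;> simp only [true_imp_iff] at hl hodd <;>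
        first
          | (cases r <;> simp [pot, jump] <;> split_ifs <;> omega)
          | (cases s <;> simp [pot, jump] <;> simp only [Bool.not_false, Bool.not_true] at hl <;>
              split_ifs <;> omega)
  | @left s i k h1 =>
    have he := Int.even_iff.1 (hf.even _ _ _ h1)
    cases h' with
    | @arc r i' k' h2 hne' =>
      have hl := hal h2 h1
      have ho' := Int.odd_iff.1 (hf.odd _ _ _ h2 hne')
      simp only at hodd
      cases r <;> cases s <;> simp at hl <;> simp [pot, jump] <;> split_ifs <;> omega
    | @left r i' k' h2 =>
      have hl := hll h1 h2
      have he' := Int.even_iff.1 (hf.even _ _ _ h2)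
      simp only at hodd
      cases r <;> cases s <;> simp at hl <;> simp [pot, jump] <;> split_ifs <;> omega
    | @right r i' k' h2 =>
      have hl := hll h1 h2
      have he' := Int.even_iff.1 (hf.even _ _ _ h2)
      simp only at hodd
      cases r <;> cases s <;> simp at hl <;> simp [pot, jump] <;> split_ifs <;> omega
  | @right s i k h1 =>
    have he := Int.even_iff.1 (hf.even _ _ _ h1)
    cases h' with
    | @arc r i' k' h2 hne' =>
      have hl := hal h2 h1
      have ho' := Int.odd_iff.1 (hf.odd _ _ _ h2 hne')
      simp only at hodd
      cases r <;> cases s <;> simp at hl <;> simp [pot, jump] <;> split_ifs <;> omega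
    | @left r i' k' h2 =>
      have hl := hll h1 h2
      have he' := Int.even_iff.1 (hf.even _ _ _ h2)
      simp only at hodd
      cases r <;> cases s <;> simp at hl <;> simp [pot, jump] <;> split_ifs <;> omega
    | @right r i' k' h2 =>
      have hl := hll h1 h2
      have he' := Int.even_iff.1 (hf.even _ _ _ h2)
      simp only at hodd
      cases r <;> cases s <;> simp at hl <;> simp [pot, jump] <;> split_ifs <;> omega

lemma even_of_eqvGen (hf : IsLayer f) {x y : Side} (h : Relation.EqvGen (GapStep f) x y) :
    Even (y.2 - x.2) := by
  induction h with
  | rel x y h => exact hf.gapStep_even h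
  | refl => simp
  | symm _ _ _ ih => simp only [Int.even_iff] at ih ⊢; omega
  | trans _ _ _ _ _ ih ih' => simp only [Int.even_iff] at ih ih' ⊢; omega

lemma cross_eqvGen (hf : IsLayer f) {x y o o' : Side} (h : Relation.EqvGen (GapStep f) x y)
    (h' : Relation.EqvGen (GapStep f) o o') (hodd : Odd (o.2 - x.2)) : pot x y o = pot x y o' := by
  have key : ∀ x y, GapStep f x y → Odd (o.2 - x.2) → pot x y o = pot x y o' := by
    intro x y hxy
    clear hodd h
    induction h' with
    | rel o o' h => exact fun hodd => hf.cross hxy h hodd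
    | refl => exact fun _ => rfl
    | symm o o' h ih =>
      intro hodd
      have := hf.even_of_eqvGen h
      exact (ih (by simp only [Int.even_iff, Int.odd_iff] at *; omega)).symm
    | trans o o' o'' h h' ih ih' =>
      intro hodd
      have := hf.even_of_eqvGen h
      exact (ih hodd).trans (ih' (by simp only [Int.even_iff, Int.odd_iff] at *; omega))
  induction h with
  | rel x y h => exact key x y h hodd
  | refl => simp [pot]
  | symm x y h ih =>
    have := hf.even_of_eqvGen h
    rw [pot_swap x y, pot_swap x y, ih (by simp only [Int.even_iff, Int.odd_iff] at *; omega)]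
  | trans x y z h h' ih ih' =>
    have := hf.even_of_eqvGen h
    have h1 := ih hodd
    have h2 := ih' (by simp only [Int.even_iff, Int.odd_iff] at *; omega)
    simp only [pot] at h1 h2 ⊢
    omega

/-- The gaps at the ends of a closed interval are connected. -/
lemma chain {s : Bool} {i j : ℤ} (hij : i ≤ j)
    (h : ∀ z, i ≤ z → z < j → ∃ w, f (s, z) = (s, w) ∧ w ≠ z ∧ i ≤ w ∧ w < j) (hf : IsLayer f) :
    Relation.EqvGen (GapStep f) (s, i) (s, j) := by
  obtain ⟨n, hn⟩ : ∃ n : ℕ, j - i = n := ⟨(j - i).toNat, by omega⟩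
  induction n using Nat.strong_induction_on generalizing i with
  | _ n ih =>
    rcases hij.eq_or_lt with rfl | hlt
    · exact .refl _
    · obtain ⟨w, hw, hne, h1, h2⟩ := h i le_rfl hlt
      refine .trans _ _ _ (.rel _ _ (.arc hw hne)) (ih (j - (w + 1)).toNat (by omega)
        (by omega) (fun z hz hz' => ?_) (by omega))
      obtain ⟨v, hv, hne', h3, h4⟩ := h z (by omega) hz'
      refine ⟨v, hv, hne', ?_, h4⟩
      by_contra hlt'
      have h5 := hf.arc_symm hv
      rcases eq_or_ne v w with rfl | h6
      · rw [hf.arc_symm hw] at h5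
        simp at h5
        omega
      rcases eq_or_ne v i with rfl | h7
      · rw [hw] at h5
        simp at h5
        omega
      have := hf.arc_inside hw h5 (by omega) (by omega)
      omega

end IsLayer

/-! ### Hexagon moves -/

/-- The layer `g` arises from `f` by a surgery of the arcs `c, c'` and `d, d'` and of the line `y, x`
which passes between them. -/
structure HexMove (f g : Side → Side) (y c c' d d' x : ℤ) : Prop where
  lt₁ : y < c
  lt₂ : c < c'
  lt₃ : d < d'
  lt₄ : d' < x
  f₁ : f (false, c) = (false, c')
  f₂ : f (true, d) = (true, d')
  f₃ : f (false, y) = (true, x)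
  g₁ : g (false, y) = (true, d)
  g₂ : g (false, c) = (true, d')
  g₃ : g (false, c') = (true, x)
  same : ∀ z, z ≠ (false, y) → z ≠ (false, c) → z ≠ (false, c') → z ≠ (true, d) → z ≠ (true, d') →
    z ≠ (true, x) → f z = g z
  block₁ : ∀ z, y < z → z < c → ∃ w, f (false, z) = (false, w) ∧ w ≠ z ∧ y < w ∧ w < c
  block₂ : ∀ z, d' < z → z < x → ∃ w, f (true, z) = (true, w) ∧ w ≠ z ∧ d' < w ∧ w < x

/-- Two gaps are connected in both layers. -/
def Both (f g : Side → Side) (x y : Side) : Prop :=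
  Relation.EqvGen (GapStep f) x y ∧ Relation.EqvGen (GapStep g) x y

namespace Both

variable {x y z : Side}

lemma symm (h : Both f g x y) : Both f g y x := ⟨h.1.symm, h.2.symm⟩

end Both

/-- A common relation, with two more edges. -/
def WithEdges (R : Side → Side → Prop) (a b c d : Side) (x y : Side) : Prop :=
  R x y ∨ (x = a ∧ y = b) ∨ (x = c ∧ y = d)

namespace HexMove

variable {y c c' d d' x : ℤ}

section

variable (H : HexMove f g y c c' d d' x) (hf : IsLayer f) (hg : IsLayer g)

include H hf hg

/-- The points strictly between `y` and `c`, `c` and `c'`, `d` and `d'`, `d'` and `x` are paired off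
by arcs that the surgery leaves alone. Such closed intervals connect the gaps at their ends, both
before and after the surgery. -/
lemma both_blocks :
    Both f g (false, c') (false, c + 1) ∧ Both f g (true, d' + 1) (true, x) ∧
      Both f g (true, d') (true, d + 1) ∧ Both f g (false, y + 1) (false, c) := by
  have l₁ := H.lt₁
  have l₂ := H.lt₂
  have l₃ := H.lt₃
  have l₄ := H.lt₄
  refine ⟨⟨.rel _ _ (.arc (hf.arc_symm H.f₁) (by omega)), .symm _ _ (IsLayer.chain (by omega) (fun z h1 h2 => ?_) hg)⟩,
    ⟨IsLayer.chain (by omega) (fun z h1 h2 => ?_) hf, IsLayer.chain (by omega) (fun z h1 h2 => ?_) hg⟩,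
    ⟨.rel _ _ (.arc (hf.arc_symm H.f₂) (by omega)), .symm _ _ (IsLayer.chain (by omega) (fun z h1 h2 => ?_) hg)⟩,
    ⟨IsLayer.chain (by omega) (fun z h1 h2 => ?_) hf, IsLayer.chain (by omega) (fun z h1 h2 => ?_) hg⟩⟩
  · rw [← H.same _ (by simp; omega) (by simp; omega) (by simp; omega) (by simp) (by simp) (by simp)]
    obtain ⟨w, h3, h4, h5, h6⟩ := hf.under _ _ _ H.f₁ z (by omega) h2
    exact ⟨w, h3, h4, by omega, h6⟩
  · obtain ⟨w, h3, h4, h5, h6⟩ := H.block₂ z (by omega) h2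
    exact ⟨w, h3, h4, by omega, h6⟩
  · rw [← H.same _ (by simp) (by simp) (by simp) (by simp; omega) (by simp; omega) (by simp; omega)]
    obtain ⟨w, h3, h4, h5, h6⟩ := H.block₂ z (by omega) h2
    exact ⟨w, h3, h4, by omega, h6⟩
  · rw [← H.same _ (by simp) (by simp) (by simp) (by simp; omega) (by simp; omega) (by simp; omega)]
    obtain ⟨w, h3, h4, h5, h6⟩ := hf.under _ _ _ H.f₂ z (by omega) h2
    exact ⟨w, h3, h4, by omega, h6⟩
  · obtain ⟨w, h3, h4, h5, h6⟩ := H.block₁ z (by omega) h2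
    exact ⟨w, h3, h4, by omega, h6⟩
  · rw [← H.same _ (by simp; omega) (by simp; omega) (by simp; omega) (by simp) (by simp) (by simp)]
    obtain ⟨w, h3, h4, h5, h6⟩ := H.block₁ z (by omega) h2
    exact ⟨w, h3, h4, by omega, h6⟩

lemma both_lines :
    Both f g (false, c' + 1) (true, x + 1) ∧ Both f g (true, d) (false, y) := by
  obtain ⟨-, t4, -, t6⟩ := H.both_blocks hf hg
  have l₂ := H.lt₂
  have l₃ := H.lt₃
  constructor
  · refine ⟨.trans _ _ _ (.symm _ _ (.rel _ _ (.arc H.f₁ (by omega)))) (.trans _ _ _ (.symm _ _ t6.1)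
      (.rel _ _ (.right H.f₃))), .rel _ _ (.right H.g₃)⟩
  · refine ⟨.trans _ _ _ (.rel _ _ (.arc H.f₂ (by omega))) (.trans _ _ _ t4.1
      (.symm _ _ (.rel _ _ (.left H.f₃)))), .symm _ _ (.rel _ _ (.left H.g₁))⟩

/-- Away from the six points of the move a step of `f` is a step of `g`. At these points it is
composed of connections common to both layers and of two edges across the hexagon, one of each
colour. In `split_g` only these two edges are different. -/
lemma split_f {u v : Side} (h : GapStep f u v) : Relation.EqvGen (WithEdges (Both f g)
    (true, x) (false, y) (false, c) (true, x + 1)) u v := by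
  obtain ⟨t2, t4, t5, t6⟩ := H.both_blocks hf hg
  obtain ⟨t1, t3⟩ := H.both_lines hf hg
  have B : ∀ {u v}, Both f g u v → Relation.EqvGen (WithEdges (Both f g)
    (true, x) (false, y) (false, c) (true, x + 1)) u v := fun h => .rel _ _ (Or.inl h)
  have e1 : Relation.EqvGen (WithEdges (Both f g)
    (true, x) (false, y) (false, c) (true, x + 1)) (true, x) (false, y) :=
    .rel _ _ (Or.inr (Or.inl ⟨rfl, rfl⟩))
  have e2 : Relation.EqvGen (WithEdges (Both f g)
    (true, x) (false, y) (false, c) (true, x + 1)) (false, c) (true, x + 1) :=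
    .rel _ _ (Or.inr (Or.inr ⟨rfl, rfl⟩))
  have key : ∀ s i, (∀ v, (∃ j, j ≠ i ∧ f (s, i) = (s, j) ∧ v = (s, j + 1)) → Relation.EqvGen
      (WithEdges (Both f g) (true, x) (false, y) (false, c) (true, x + 1)) (s, i) v) ∧
      (∀ j, f (s, i) = (!s, j) → Relation.EqvGen
      (WithEdges (Both f g) (true, x) (false, y) (false, c) (true, x + 1)) (s, i) (!s, j) ∧
      Relation.EqvGen
      (WithEdges (Both f g) (true, x) (false, y) (false, c) (true, x + 1)) (s, i + 1) (!s, j + 1)) := by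
    intro s i
    have hx := hf.line_symm (s := false) H.f₃
    simp only [Bool.not_false] at hx
    by_cases h1 : (s, i) = (false, y)
    · simp only [Prod.mk.injEq] at h1
      obtain ⟨rfl, rfl⟩ := h1
      simp only [H.f₃]
      refine ⟨by simp, ?_⟩
      rintro j hj
      obtain rfl : x = j := by simpa using hj
      exact ⟨e1.symm, (B t6).trans _ _ _ e2⟩
    by_cases h2 : (s, i) = (false, c)
    · simp only [Prod.mk.injEq] at h2
      obtain ⟨rfl, rfl⟩ := h2
      simp only [H.f₁]
      refine ⟨?_, by simp⟩
      rintro v ⟨j, hj, hj', rfl⟩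
      obtain rfl : c' = j := by simpa using hj'
      exact e2.trans _ _ _ (B t1.symm)
    by_cases h3 : (s, i) = (false, c')
    · simp only [Prod.mk.injEq] at h3
      obtain ⟨rfl, rfl⟩ := h3
      simp only [hf.arc_symm H.f₁]
      refine ⟨?_, by simp⟩
      rintro v ⟨j, hj, hj', rfl⟩
      obtain rfl : c = j := by simpa using hj'
      exact B t2
    by_cases h4 : (s, i) = (true, d)
    · simp only [Prod.mk.injEq] at h4
      obtain ⟨rfl, rfl⟩ := h4
      simp only [H.f₂]
      refine ⟨?_, by simp⟩
      rintro v ⟨j, hj, hj', rfl⟩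
      obtain rfl : d' = j := by simpa using hj'
      exact (B t3).trans _ _ _ (e1.symm.trans _ _ _ (B t4.symm))
    by_cases h5 : (s, i) = (true, d')
    · simp only [Prod.mk.injEq] at h5
      obtain ⟨rfl, rfl⟩ := h5
      simp only [hf.arc_symm H.f₂]
      refine ⟨?_, by simp⟩
      rintro v ⟨j, hj, hj', rfl⟩
      obtain rfl : d = j := by simpa using hj'
      exact B t5
    by_cases h6 : (s, i) = (true, x)
    · simp only [Prod.mk.injEq] at h6
      obtain ⟨rfl, rfl⟩ := h6
      simp only [hx]
      refine ⟨by simp, ?_⟩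
      rintro j hj
      obtain rfl : y = j := by simpa using hj
      exact ⟨e1, ((B t6).trans _ _ _ e2).symm⟩
    have hsame := H.same _ h1 h2 h3 h4 h5 h6
    refine ⟨?_, fun j hj => ?_⟩
    · rintro v ⟨j, hj, hj', rfl⟩
      exact B ⟨.rel _ _ (.arc hj' hj), .rel _ _ (.arc (hsame ▸ hj') hj)⟩
    · exact ⟨B ⟨.rel _ _ (.left hj), .rel _ _ (.left (hsame ▸ hj))⟩,
        B ⟨.rel _ _ (.right hj), .rel _ _ (.right (hsame ▸ hj))⟩⟩
  cases h with
  | arc h hne => exact (key _ _).1 _ ⟨_, hne, h, rfl⟩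
  | left h => exact ((key _ _).2 _ h).1
  | right h => exact ((key _ _).2 _ h).2

lemma split_g {u v : Side} (h : GapStep g u v) : Relation.EqvGen (WithEdges (Both f g)
    (true, x) (false, c') (false, c) (true, d')) u v := by
  obtain ⟨t2, t4, t5, t6⟩ := H.both_blocks hf hg
  obtain ⟨t1, t3⟩ := H.both_lines hf hg
  have B : ∀ {u v}, Both f g u v → Relation.EqvGen (WithEdges (Both f g)
    (true, x) (false, c') (false, c) (true, d')) u v := fun h => .rel _ _ (Or.inl h)
  have e1 : Relation.EqvGen (WithEdges (Both f g)
    (true, x) (false, c') (false, c) (true, d')) (true, x) (false, c') :=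
    .rel _ _ (Or.inr (Or.inl ⟨rfl, rfl⟩))
  have e2 : Relation.EqvGen (WithEdges (Both f g)
    (true, x) (false, c') (false, c) (true, d')) (false, c) (true, d') :=
    .rel _ _ (Or.inr (Or.inr ⟨rfl, rfl⟩))
  -- the three lines
  have k1 : ∀ s i j, g (s, i) = (!s, j) → ((false, i) = ((false, y) : Side) ∧ s = false) → Relation.EqvGen
      (WithEdges (Both f g) (true, x) (false, c') (false, c) (true, d')) (s, i) (!s, j) ∧
      Relation.EqvGen
      (WithEdges (Both f g) (true, x) (false, c') (false, c) (true, d')) (s, i + 1) (!s, j + 1) := by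
    rintro s i j hj ⟨h1, rfl⟩
    obtain rfl : i = y := by simpa using h1
    rw [H.g₁] at hj
    obtain rfl : d = j := by simpa using hj
    exact ⟨B t3.symm, (B t6).trans _ _ _ (e2.trans _ _ _ (B t5))⟩
  have k2 : ∀ s i j, g (s, i) = (!s, j) → ((false, i) = ((false, c) : Side) ∧ s = false) → Relation.EqvGen
      (WithEdges (Both f g) (true, x) (false, c') (false, c) (true, d')) (s, i) (!s, j) ∧
      Relation.EqvGen
      (WithEdges (Both f g) (true, x) (false, c') (false, c) (true, d')) (s, i + 1) (!s, j + 1) := by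
    rintro s i j hj ⟨h1, rfl⟩
    obtain rfl : i = c := by simpa using h1
    rw [H.g₂] at hj
    obtain rfl : d' = j := by simpa using hj
    exact ⟨e2, (B t2.symm).trans _ _ _ (e1.symm.trans _ _ _ (B t4.symm))⟩
  have k3 : ∀ s i j, g (s, i) = (!s, j) → ((false, i) = ((false, c') : Side) ∧ s = false) → Relation.EqvGen
      (WithEdges (Both f g) (true, x) (false, c') (false, c) (true, d')) (s, i) (!s, j) ∧
      Relation.EqvGen
      (WithEdges (Both f g) (true, x) (false, c') (false, c) (true, d')) (s, i + 1) (!s, j + 1) := by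
    rintro s i j hj ⟨h1, rfl⟩
    obtain rfl : i = c' := by simpa using h1
    rw [H.g₃] at hj
    obtain rfl : x = j := by simpa using hj
    exact ⟨e1.symm, B t1⟩
  have hg1 := hg.line_symm (s := false) H.g₁
  have hg2 := hg.line_symm (s := false) H.g₂
  have hg3 := hg.line_symm (s := false) H.g₃
  simp only [Bool.not_false] at hg1 hg2 hg3
  have hline : ∀ s i j, g (s, i) = (!s, j) → Relation.EqvGen
      (WithEdges (Both f g) (true, x) (false, c') (false, c) (true, d')) (s, i) (!s, j) ∧
      Relation.EqvGen
      (WithEdges (Both f g) (true, x) (false, c') (false, c) (true, d')) (s, i + 1) (!s, j + 1) := by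
    intro s i j hj
    by_cases h1 : (s, i) = (false, y)
    · simp only [Prod.mk.injEq] at h1
      exact k1 s i j hj ⟨by rw [h1.2], h1.1⟩
    by_cases h2 : (s, i) = (false, c)
    · simp only [Prod.mk.injEq] at h2
      exact k2 s i j hj ⟨by rw [h2.2], h2.1⟩
    by_cases h3 : (s, i) = (false, c')
    · simp only [Prod.mk.injEq] at h3
      exact k3 s i j hj ⟨by rw [h3.2], h3.1⟩
    by_cases h4 : (s, i) = (true, d)
    · simp only [Prod.mk.injEq] at h4
      obtain ⟨rfl, rfl⟩ := h4
      rw [hg1] at hj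
      obtain rfl : y = j := by simpa using hj
      have := k1 false y _ H.g₁ ⟨rfl, rfl⟩
      exact ⟨this.1.symm, this.2.symm⟩
    by_cases h5 : (s, i) = (true, d')
    · simp only [Prod.mk.injEq] at h5
      obtain ⟨rfl, rfl⟩ := h5
      rw [hg2] at hj
      obtain rfl : c = j := by simpa using hj
      have := k2 false c _ H.g₂ ⟨rfl, rfl⟩
      exact ⟨this.1.symm, this.2.symm⟩
    by_cases h6 : (s, i) = (true, x)
    · simp only [Prod.mk.injEq] at h6
      obtain ⟨rfl, rfl⟩ := h6
      rw [hg3] at hj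
      obtain rfl : c' = j := by simpa using hj
      have := k3 false c' _ H.g₃ ⟨rfl, rfl⟩
      exact ⟨this.1.symm, this.2.symm⟩
    have hsame := H.same _ h1 h2 h3 h4 h5 h6
    rw [← hsame] at hj
    exact ⟨B ⟨.rel _ _ (.left hj), .rel _ _ (.left (hsame ▸ hj))⟩,
      B ⟨.rel _ _ (.right hj), .rel _ _ (.right (hsame ▸ hj))⟩⟩
  cases h with
  | @arc s i j h hne =>
    have hsame : f (s, i) = g (s, i) := by
      apply H.same <;> intro h1 <;> rw [h1] at h <;> simp only [Prod.mk.injEq] at h1 <;>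
        simp [H.g₁, H.g₂, H.g₃, hg1, hg2, hg3, h1] at h
    exact B ⟨.rel _ _ (.arc (hsame ▸ h) hne), .rel _ _ (.arc h hne)⟩
  | left h => exact (hline _ _ _ h).1
  | right h => exact (hline _ _ _ h).2

end

end HexMove

end

/-! ### The square of two hexagon moves -/

/-- Gaps with parity `c` which are connected in both layers. -/
def PGap (f g : Side → Side) (c : ℤ) (x y : Side) : Prop := Even (x.2 - c) ∧ Both f g x y

section

variable {f g : Side → Side}

/-- Connections preserve the colour, so a connection of gaps of one colour never uses the added edge
of the other colour. -/
lemma eqvGen_of_parity (hf : IsLayer f) {a b a' b' : Side} {c : ℤ} {u v : Side}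
    (h : Relation.EqvGen (WithEdges (Both f g) a b a' b') u v) (hab : Even (b.2 - a.2))
    (hab' : Even (b'.2 - a'.2)) (ha' : ¬ Even (a'.2 - c)) (hu : Even (u.2 - c)) :
    Relation.EqvGen (fun x y => PGap f g c x y ∨ (x = a ∧ y = b)) u v := by
  suffices H : (Even (u.2 - c) ↔ Even (v.2 - c)) ∧ (Even (u.2 - c) →
      Relation.EqvGen (fun x y => PGap f g c x y ∨ (x = a ∧ y = b)) u v) from H.2 hu
  clear hu
  induction h with
  | rel x y h =>
    rcases h with h | ⟨rfl, rfl⟩ | ⟨rfl, rfl⟩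
    · have := hf.even_of_eqvGen h.1
      refine ⟨by simp only [Int.even_iff] at *; omega, fun hx => .rel _ _ (Or.inl ⟨hx, h⟩)⟩
    · exact ⟨by simp only [Int.even_iff] at *; omega, fun hx => .rel _ _ (Or.inr ⟨rfl, rfl⟩)⟩
    · exact ⟨by simp only [Int.even_iff] at *; omega, fun hx => absurd hx ha'⟩
  | refl => exact ⟨Iff.rfl, fun _ => .refl _⟩
  | symm _ _ _ ih => exact ⟨ih.1.symm, fun hx => (ih.2 (ih.1.2 hx)).symm⟩
  | trans _ _ _ _ _ ih ih' =>
    exact ⟨ih.1.trans ih'.1, fun hx => (ih.2 hx).trans _ _ _ (ih'.2 (ih.1.1 hx))⟩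

/-- Paths outside the hexagon exist in both resolutions. Each of the required non-crossings is thus
an instance of `cross_eqvGen` in the layer which contains the edge in question: `f` joins `E₁` with
`E₂` and `O₂₃` with `O₃₁`, while `g` joins `E₁` with `E₃` and `O₁₂` with `O₂₃`. -/
lemma hexagon_of_conn (hf : IsLayer f) (hg : IsLayer g) {E₁ O₁₂ E₂ O₂₃ E₃ O₃₁ : Side} {c : ℤ}
    (h₁ : Even (E₁.2 - c)) (ho : ¬ Even (O₂₃.2 - c))
    (e₁₂ : Relation.EqvGen (GapStep f) E₁ E₂) (e₁₃ : Relation.EqvGen (GapStep g) E₁ E₃)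
    (o₃ : Relation.EqvGen (GapStep f) O₂₃ O₃₁) (o₂ : Relation.EqvGen (GapStep g) O₁₂ O₂₃)
    (pot₁₂ : pot E₁ E₂ O₁₂ = pot E₁ E₂ O₂₃ + 1 ∧ pot E₁ E₂ O₂₃ = pot E₁ E₂ O₃₁)
    (pot₂₃ : pot E₂ E₃ O₂₃ = pot E₂ E₃ O₃₁ + 1 ∧ pot E₂ E₃ O₃₁ = pot E₂ E₃ O₁₂)
    (pot₃₁ : pot E₃ E₁ O₃₁ = pot E₃ E₁ O₁₂ + 1 ∧ pot E₃ E₁ O₁₂ = pot E₃ E₁ O₂₃) :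
    Hexagon (PGap f g c) (PGap f g (c + 1)) E₁ O₁₂ E₂ O₂₃ E₃ O₃₁ where
  cross x y o o' hxy hoo' := by
    refine hf.cross_eqvGen hxy.2.1 hoo'.2.1 ?_
    have h1 := hxy.1
    have h2 := hoo'.1
    simp only [Int.even_iff, Int.odd_iff] at *
    omega
  crossO x y hxy := by
    have h1 := hxy.1
    have h2 := hg.even_of_eqvGen o₂
    refine ⟨hg.cross_eqvGen hxy.2.2 o₂ ?_, hf.cross_eqvGen hxy.2.1 o₃ ?_⟩ <;>
    · simp only [Int.even_iff, Int.odd_iff] at *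
      omega
  crossE o o' hoo' := by
    have h1 := hoo'.1
    refine ⟨hf.cross_eqvGen e₁₂ hoo'.2.1 ?_, hg.cross_eqvGen e₁₃ hoo'.2.2 ?_⟩ <;>
    · simp only [Int.even_iff, Int.odd_iff] at *
      omega
  pot₁₂ := pot₁₂
  pot₂₃ := pot₂₃
  pot₃₁ := pot₃₁

/-- The gaps of both colours around a hexagon move. -/
structure HexGaps (f g : Side → Side) (c : ℤ) (E₁ O₁₂ E₂ O₂₃ E₃ O₃₁ : Side) : Prop where
  hexagon : Hexagon (PGap f g c) (PGap f g (c + 1)) E₁ O₁₂ E₂ O₂₃ E₃ O₃₁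
  evenE : Even (E₁.2 - c) ∧ Even (E₂.2 - c) ∧ Even (E₃.2 - c)
  evenO : Even (O₁₂.2 - (c + 1)) ∧ Even (O₂₃.2 - (c + 1)) ∧ Even (O₃₁.2 - (c + 1))
  e₁₂ : Relation.EqvGen (GapStep f) E₁ E₂
  e₁₃ : Relation.EqvGen (GapStep g) E₁ E₃
  split_f : ∀ x y, GapStep f x y → Even (x.2 - c) →
    Relation.EqvGen (fun x y => PGap f g c x y ∨ (x = E₁ ∧ y = E₂)) x y
  split_g : ∀ x y, GapStep g x y → Even (x.2 - c) →
    Relation.EqvGen (fun x y => PGap f g c x y ∨ (x = E₁ ∧ y = E₃)) x y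
  split_o : ∀ x y, GapStep f x y → Even (x.2 - (c + 1)) →
    Relation.EqvGen (fun x y => PGap f g (c + 1) x y ∨ (x = O₂₃ ∧ y = O₃₁)) x y
  split_o' : ∀ x y, GapStep g x y → Even (x.2 - (c + 1)) →
    Relation.EqvGen (fun x y => PGap f g (c + 1) x y ∨ (x = O₂₃ ∧ y = O₁₂)) x y

lemma withEdges_comm {R : Side → Side → Prop} {a b a' b' u v : Side}
    (h : Relation.EqvGen (WithEdges R a b a' b') u v) : Relation.EqvGen (WithEdges R a' b' a b) u v :=
  h.mono fun _ _ h => h.imp id Or.symm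

/-- The corners of the hexagon, in cyclic order, are `(true, x)`, `(true, d')`, `(false, y)`,
`(false, c)`, `(false, c')`, `(true, x + 1)`, with alternating colours. Passing to the other colour
rotates this list by three places. -/
theorem HexMove.exists_hexGaps {y c c' d d' x : ℤ} (H : HexMove f g y c c' d d' x)
    (hf : IsLayer f) (hg : IsLayer g) (r : ℤ) :
    ∃ E₁ O₁₂ E₂ O₂₃ E₃ O₃₁, HexGaps f g r E₁ O₁₂ E₂ O₂₃ E₃ O₃₁ := by
  have l₁ := H.lt₁
  have l₂ := H.lt₂
  have l₃ := H.lt₃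
  have l₄ := H.lt₄
  have p1 := hf.even false _ _ H.f₃
  have p2 := hf.odd _ _ _ H.f₁ (by omega)
  have p3 := hg.even false _ _ H.g₂
  have p4 := hg.even false _ _ H.g₃
  obtain ⟨t1, t3⟩ := H.both_lines hf hg
  have w40 : Relation.EqvGen (GapStep f) (true, x) (false, y) := .symm _ _ (.rel _ _ (.left H.f₃))
  have w13 : Relation.EqvGen (GapStep f) (false, c) (true, x + 1) :=
    (Relation.EqvGen.rel _ _ (.arc H.f₁ (by omega))).trans _ _ _ t1.1
  have w42 : Relation.EqvGen (GapStep g) (true, x) (false, c') := .symm _ _ (.rel _ _ (.left H.g₃))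
  have w15 : Relation.EqvGen (GapStep g) (false, c) (true, d') := .rel _ _ (.left H.g₂)
  simp only [Int.even_iff, Int.odd_iff] at p1 p2 p3 p4
  by_cases hr : Even (y - r)
  · refine ⟨(true, x), (true, d'), (false, y), (false, c), (false, c'), (true, x + 1),
      hexagon_of_conn hf hg ?_ ?_ w40 w42 w13 w15.symm ?_ ?_ ?_, ?_, ?_, w40, w42,
      fun u v h hu => eqvGen_of_parity hf (H.split_f hf hg h) ?_ ?_ ?_ hu,
      fun u v h hu => eqvGen_of_parity hf (H.split_g hf hg h) ?_ ?_ ?_ hu,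
      fun u v h hu => eqvGen_of_parity hf (withEdges_comm (H.split_f hf hg h)) ?_ ?_ ?_ hu,
      fun u v h hu => eqvGen_of_parity hf (withEdges_comm (H.split_g hf hg h)) ?_ ?_ ?_ hu⟩
    all_goals first
      | (simp only [Int.even_iff] at hr ⊢; omega)
      | (simp only [pot, jump]; simp; (try split_ifs) <;> omega)
  · refine ⟨(false, c), (false, c'), (true, x + 1), (true, x), (true, d'), (false, y),
      hexagon_of_conn hf hg ?_ ?_ w13 w15 w40 w42.symm ?_ ?_ ?_, ?_, ?_, w13, w15,
      fun u v h hu => eqvGen_of_parity hf (withEdges_comm (H.split_f hf hg h)) ?_ ?_ ?_ hu,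
      fun u v h hu => eqvGen_of_parity hf (withEdges_comm (H.split_g hf hg h)) ?_ ?_ ?_ hu,
      fun u v h hu => eqvGen_of_parity hf (H.split_f hf hg h) ?_ ?_ ?_ hu,
      fun u v h hu => eqvGen_of_parity hf (H.split_g hf hg h) ?_ ?_ ?_ hu⟩
    all_goals first
      | (simp only [Int.even_iff] at hr ⊢; omega)
      | (simp only [pot, jump]; simp; (try split_ifs) <;> omega)

end

section

variable {L L' : ℕ → Side → Side} {k : ℕ} {e : Bool} {c : ℤ} {l : ℕ}

lemma IsStack.no_line (hL : IsStack L k) (hl : l = endLayer k e) {s : Bool} {i j : ℤ} :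
    L l (s, i) ≠ (!s, j) := by
  intro h
  subst hl
  cases e
  · cases s
    · rw [show endLayer k false = 0 from rfl, hL.bot] at h
      simp at h
    · have := hL.bot' i
      rw [show endLayer k false = 0 from rfl] at h
      rw [h] at this
      simp at this
  · cases s
    · have := hL.top' i
      rw [show endLayer k true = k + 1 from rfl] at h
      rw [h] at this
      simp at this
    · rw [show endLayer k true = k + 1 from rfl, hL.top] at h
      simp at h

lemma RootStep.congr {x y : Side} (h : RootStep L k e c l x y) (hl : L l = L' l) :
    RootStep L' k e c l x y := by
  cases h with
  | gap h hc => exact .gap (hl ▸ h) hc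
  | root h1 hg hg' hc hc' => exact .root h1 (hl ▸ hg) (hl ▸ hg') hc hc'

lemma outer_arc (hL : IsStack L k) {s r : Bool} {i j o : ℤ} (h : L l (s, i) = (s, j)) (hne : j ≠ i)
    (ho : Outer (L l) r o) (hodd : Odd (o - i)) :
    jump (s, i) (r, o) = jump (s, j + 1) (r, o) ∧ jump (r, o) (s, i) = jump (r, o) (s, j + 1) := by
  rcases Bool.eq_or_eq_not' r s with rfl | rfl
  · have h1 := ho i j h
    have h2 := ho j i ((hL.isLayer l).arc_symm h)
    have h3 := (hL.isLayer l).odd _ _ _ h hne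
    simp only [Int.odd_iff] at hodd h3
    constructor <;> simp only [jump, true_and] <;> split_ifs <;> omega
  · cases s <;> simp [jump]

/-- The two colours are rooted at opposite ends, so the two identifications of outer gaps do not
meet. An identification does not cross an arc step, because an outer gap is not under an arc. -/
lemma rootStep_cross (hL : IsStack L k) {x y o o' : Side} (h : RootStep L k e c l x y)
    (h' : RootStep L k (!e) (c + 1) l o o') : pot x y o = pot x y o' := by
  cases h with
  | gap h hc =>
    cases h' with
    | gap h' hc' =>
      refine (hL.isLayer l).cross h h' ?_
      simp only [Int.even_iff, Int.odd_iff] at *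
      omega
    | @root g g' hl hg hg' hc1 hc2 =>
      cases h with
      | arc h hne =>
        have h1 := outer_arc hL h hne hg (by simp only [Int.even_iff, Int.odd_iff] at *; omega)
        have h2 := outer_arc hL h hne hg' (by simp only [Int.even_iff, Int.odd_iff] at *; omega)
        rw [pot, pot, h1.1, h2.1, sub_self, sub_self]
      | left h => exact absurd h (hL.no_line hl)
      | right h => exact absurd h (hL.no_line hl)
  | @root g g' hl hg hg' hc1 hc2 =>
    cases h' with
    | gap h' hc =>
      cases h' with
      | arc h hne =>
        have h1 := outer_arc hL h hne hg (by simp only [Int.even_iff, Int.odd_iff] at *; omega)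
        have h2 := outer_arc hL h hne hg' (by simp only [Int.even_iff, Int.odd_iff] at *; omega)
        rw [pot, pot, h1.2, h2.2]
      | left h => exact absurd h (hL.no_line hl)
      | right h => exact absurd h (hL.no_line hl)
    | root hl' => cases e <;> simp [endLayer] at hl hl' <;> omega

lemma gapConn_map {R : ℕ → Side → Side → Prop} {S : ℕ × ℤ → ℕ × ℤ → Prop}
    (h : ∀ l x y, R l x y → Relation.EqvGen S (node l x) (node l y)) {u v : ℕ × ℤ}
    (huv : GapConn R u v) : Relation.EqvGen S u v := by
  induction huv with
  | rel u v h' => obtain ⟨l, x, y, hR, rfl, rfl⟩ := h'; exact h l x y hR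
  | refl => exact .refl _
  | symm _ _ _ ih => exact ih.symm
  | trans _ _ _ _ _ ih ih' => exact ih.trans _ _ _ ih'

lemma eqvGen_node {R : Side → Side → Prop} {S : ℕ × ℤ → ℕ × ℤ → Prop}
    (h : ∀ x y, R x y → Relation.EqvGen S (node l x) (node l y)) {x y : Side}
    (hxy : Relation.EqvGen R x y) : Relation.EqvGen S (node l x) (node l y) := by
  induction hxy with
  | rel x y h' => exact h x y h'
  | refl => exact .refl _
  | symm _ _ _ ih => exact ih.symm
  | trans _ _ _ _ _ ih ih' => exact ih.trans _ _ _ ih'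

/-- The relation with two layers replaced. -/
def replace (R : ℕ → Side → Side → Prop) (p q : ℕ) (A B : Side → Side → Prop) (l : ℕ) :
    Side → Side → Prop := if l = p then A else if l = q then B else R l

lemma replace_left {R : ℕ → Side → Side → Prop} {p q : ℕ} {A B : Side → Side → Prop} :
    replace R p q A B p = A := if_pos rfl

lemma replace_right {R : ℕ → Side → Side → Prop} {p q : ℕ} {A B : Side → Side → Prop}
    (h : p ≠ q) : replace R p q A B q = B := by simp [replace, h.symm]

lemma replace_other {R : ℕ → Side → Side → Prop} {p q : ℕ} {A B : Side → Side → Prop}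
    (h : l ≠ p) (h' : l ≠ q) : replace R p q A B l = R l := by simp [replace, h, h']

lemma mid_ne_endLayer {p : ℕ} (h : 0 < p) (h' : p ≤ k) : p ≠ endLayer k e := by
  cases e <;> simp [endLayer] <;> omega

variable {p q : ℕ} {f h : Side → Side} {A B : Side → Side → Prop} {a b a' b' : Side}

lemma addEdges_of_gapConn (hp : 0 < p ∧ p ≤ k) (hq : 0 < q ∧ q ≤ k) (hpq : p ≠ q)
    (hLp : L' p = f) (hLq : L' q = h) (hL : ∀ l, l ≠ p → l ≠ q → L' l = L l)
    (hf : ∀ x y, GapStep f x y → Even (x.2 - c) →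
      Relation.EqvGen (fun x y => A x y ∨ (x = a ∧ y = b)) x y)
    (hh : ∀ x y, GapStep h x y → Even (x.2 - c) →
      Relation.EqvGen (fun x y => B x y ∨ (x = a' ∧ y = b')) x y) {u v : ℕ × ℤ}
    (huv : GapConn (RootStep L' k e c) u v) :
    Relation.EqvGen (AddEdges (replace (RootStep L k e c) p q A B) (node p a) (node p b)
      (node q a') (node q b')) u v := by
  refine gapConn_map (fun l x y hxy => ?_) huv
  by_cases h1 : l = p
  · subst h1
    cases hxy with
    | gap hg hc =>
      rw [hLp] at hg
      refine eqvGen_node (fun x y hxy => ?_) (hf x y hg hc)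
      rcases hxy with hxy | ⟨rfl, rfl⟩
      · exact .rel _ _ (Or.inl ⟨l, x, y, by rwa [replace_left], rfl, rfl⟩)
      · exact .rel _ _ (Or.inr (Or.inl ⟨rfl, rfl⟩))
    | root hl => exact absurd hl (mid_ne_endLayer hp.1 hp.2)
  by_cases h2 : l = q
  · subst h2
    cases hxy with
    | gap hg hc =>
      rw [hLq] at hg
      refine eqvGen_node (fun x y hxy => ?_) (hh x y hg hc)
      rcases hxy with hxy | ⟨rfl, rfl⟩
      · exact .rel _ _ (Or.inl ⟨l, x, y, by rwa [replace_right hpq], rfl, rfl⟩)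
      · exact .rel _ _ (Or.inr (Or.inr ⟨rfl, rfl⟩))
    | root hl => exact absurd hl (mid_ne_endLayer hq.1 hq.2)
  · exact .rel _ _ (Or.inl ⟨l, x, y, by rw [replace_other h1 h2]; exact hxy.congr (hL l h1 h2), rfl, rfl⟩)

lemma gapConn_of_eqvGen (hf : IsLayer (L' l)) {x y : Side}
    (h : Relation.EqvGen (GapStep (L' l)) x y) (hx : Even (x.2 - c)) :
    GapConn (RootStep L' k e c) (node l x) (node l y) := by
  induction h with
  | rel x y h => exact .rel _ _ ⟨l, x, y, .gap h hx, rfl, rfl⟩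
  | refl => exact .refl _
  | symm x y h ih =>
    have := hf.even_of_eqvGen h
    exact (ih (by simp only [Int.even_iff] at *; omega)).symm
  | trans x y z h h' ih ih' =>
    have := hf.even_of_eqvGen h
    exact (ih hx).trans _ _ _ (ih' (by simp only [Int.even_iff] at *; omega))

end

/-- The matchings differ by a hexagon move. -/
def HexPair (m m' : Matching) : Prop :=
  ∀ c, ∃ E₁ O₁₂ E₂ O₂₃ E₃ O₃₁, HexGaps m.inv m'.inv c E₁ O₁₂ E₂ O₂₃ E₃ O₃₁

lemma HexMove.hexPair {m m' : Matching} {y c c' d d' x : ℤ}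
    (H : HexMove m.inv m'.inv y c c' d d' x) : HexPair m m' :=
  H.exists_hexGaps m.isLayer_inv m'.isLayer_inv

lemma layers_set {a b : ArcDiagram} {t : GenMatching} {p : ℕ} {m m' : Matching} (h : t[p]? = some m) :
    layers a (t.set p m') b (p + 1) = m'.inv ∧
      ∀ l, l ≠ p + 1 → layers a (t.set p m') b l = layers a t b l := by
  have hp : p < t.length := (List.getElem?_eq_some_iff.1 h).1
  constructor
  · refine layers_succ ?_
    simp [hp]
  · rintro (_ | l) hl
    · rfl
    · have hl' : p ≠ l := by omega
      simp only [layers, List.map_set, List.getElem?_cons_succ]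
      by_cases hlt : l < t.length
      · rw [List.getElem?_append_left (by simpa using hlt),
          List.getElem?_append_left (by simpa using hlt), List.getElem?_set_ne hl']
      · rw [List.getElem?_append_right (by simpa using hlt),
          List.getElem?_append_right (by simpa using hlt)]
        simp

lemma valid_node {k p : ℕ} (hp : 0 < p ∧ p ≤ k) (z : Side) :
    1 ≤ (node p z).1 ∧ (node p z).1 ≤ k + 1 := by
  simp only [node]
  split_ifs <;> omega

set_option maxHeartbeats 1000000 in
-- `square` is applied for each end `e` and each colour `c`. The regions of the other colour are
-- taken with the opposite end, which is what planarity requires, and their connectedness comes from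
-- the corner `h00`.
theorem square_orientable {a b : ArcDiagram} {t : GenMatching} {p q : ℕ} {m m' n n' : Matching}
    (hp : t[p]? = some m) (hq : t[q]? = some n) (hpq : p ≠ q) (hm : HexPair m m')
    (hn : HexPair n n') (h00 : Orientable a t b) (h10 : Orientable a (t.set p m') b)
    (h11 : Orientable a ((t.set p m').set q n') b) : Orientable a (t.set q n') b := by
  have hplt : p < t.length := (List.getElem?_eq_some_iff.1 hp).1
  have hqlt : q < t.length := (List.getElem?_eq_some_iff.1 hq).1
  have hq' : (t.set p m')[q]? = some n := by rw [List.getElem?_set_ne hpq, hq]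
  rw [orientable_iff_total] at h00 h10 h11 ⊢
  simp only [List.length_set] at h10 h11 ⊢
  set k := t.length with hk
  have hp' : 0 < p + 1 ∧ p + 1 ≤ k := ⟨by omega, by omega⟩
  have hq'' : 0 < q + 1 ∧ q + 1 ≤ k := ⟨by omega, by omega⟩
  have hpq' : p + 1 ≠ q + 1 := by omega
  intro e c
  have hL := isStack_layers a t b
  have s10 := layers_set (a := a) (b := b) (m' := m') hp
  have s01 := layers_set (a := a) (b := b) (m' := n') hq
  have s11 := layers_set (a := a) (b := b) (m' := n') hq'
  obtain ⟨E₁, O₁₂, E₂, O₂₃, E₃, O₃₁, hE⟩ := hm c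
  obtain ⟨F₁, P₁₂, F₂, P₂₃, F₃, P₃₁, hF⟩ := hn c
  intro u v hu hu' hu'' hv hv' hv''
  have key := square hpq'
    (A := replace (RootStep (layers a t b) k e c) (p + 1) (q + 1) (PGap m.inv m'.inv c)
      (PGap n.inv n'.inv c))
    (B := replace (RootStep (layers a t b) k (!e) (c + 1)) (p + 1) (q + 1)
      (PGap m.inv m'.inv (c + 1)) (PGap n.inv n'.inv (c + 1)))
    (by rw [replace_left, replace_left]; exact hE.hexagon)
    (by rw [replace_right hpq', replace_right hpq']; exact hF.hexagon)
    (fun l x y o o' hA hB => by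
      by_cases h1 : l = p + 1
      · subst h1
        rw [replace_left] at hA hB
        exact hE.hexagon.cross x y o o' hA hB
      by_cases h2 : l = q + 1
      · subst h2
        rw [replace_right hpq'] at hA hB
        exact hF.hexagon.cross x y o o' hA hB
      rw [replace_other h1 h2] at hA hB
      exact rootStep_cross hL hA hB)
    (VA := fun u => (1 ≤ u.1 ∧ u.1 ≤ k + 1) ∧ Even (u.2 - c))
    (VB := fun u => (1 ≤ u.1 ∧ u.1 ≤ k + 1) ∧ Even (u.2 - (c + 1)))
    ⟨valid_node hp' _, hE.evenE.1⟩ ⟨valid_node hp' _, hE.evenE.2.1⟩ ⟨valid_node hp' _, hE.evenE.2.2⟩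
    ⟨valid_node hq'' _, hF.evenE.1⟩ ⟨valid_node hq'' _, hF.evenE.2.1⟩
    ⟨valid_node hq'' _, hF.evenE.2.2⟩
    ⟨valid_node hp' _, hE.evenO.1⟩ ⟨valid_node hp' _, hE.evenO.2.1⟩
    ⟨valid_node hq'' _, hF.evenO.1⟩ ⟨valid_node hq'' _, hF.evenO.2.1⟩
    (fun u v hu hv => addEdges_of_gapConn hp' hq'' hpq' (layers_succ hp) (layers_succ hq)
      (fun _ _ _ => rfl) hE.split_f hF.split_f (h00 e c u v hu.1.1 hu.1.2 hu.2 hv.1.1 hv.1.2 hv.2))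
    (fun u v hu hv => addEdges_of_gapConn hp' hq'' hpq' s10.1
      (by rw [s10.2 _ hpq'.symm, layers_succ hq])
      (fun l h1 _ => s10.2 l h1) hE.split_g hF.split_f
      (h10 e c u v hu.1.1 hu.1.2 hu.2 hv.1.1 hv.1.2 hv.2))
    (fun u v hu hv => addEdges_of_gapConn hp' hq'' hpq' (by rw [s11.2 _ hpq', s10.1]) s11.1
      (fun l h1 h2 => by rw [s11.2 l h2, s10.2 l h1]) hE.split_g hF.split_g
      (h11 e c u v hu.1.1 hu.1.2 hu.2 hv.1.1 hv.1.2 hv.2))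
    (fun u v hu hv => addEdges_of_gapConn hp' hq'' hpq' (layers_succ hp) (layers_succ hq)
      (fun _ _ _ => rfl) hE.split_o hF.split_o
      (h00 (!e) (c + 1) u v hu.1.1 hu.1.2 hu.2 hv.1.1 hv.1.2 hv.2))
    u v ⟨⟨hu, hu'⟩, hu''⟩ ⟨⟨hv, hv'⟩, hv''⟩
  have hLp : layers a (t.set q n') b (p + 1) = m.inv := by rw [s01.2 _ hpq', layers_succ hp]
  have hLay := (isStack_layers a (t.set q n') b).isLayer
  have H : ∀ u v, AddEdges (replace (RootStep (layers a t b) k e c) (p + 1) (q + 1)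
      (PGap m.inv m'.inv c) (PGap n.inv n'.inv c)) (node (p + 1) E₁) (node (p + 1) E₂)
      (node (q + 1) F₁) (node (q + 1) F₃) u v →
      GapConn (RootStep (layers a (t.set q n') b) k e c) u v := by
    rintro u v (⟨l, x, y, hxy, rfl, rfl⟩ | ⟨rfl, rfl⟩ | ⟨rfl, rfl⟩)
    · by_cases h1 : l = p + 1
      · subst h1
        rw [replace_left] at hxy
        exact gapConn_of_eqvGen (hLay _) (by rw [hLp]; exact hxy.2.1) hxy.1
      by_cases h2 : l = q + 1
      · subst h2
        rw [replace_right hpq'] at hxy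
        exact gapConn_of_eqvGen (hLay _) (by rw [s01.1]; exact hxy.2.2) hxy.1
      rw [replace_other h1 h2] at hxy
      exact .rel _ _ ⟨l, x, y, hxy.congr (s01.2 l h2).symm, rfl, rfl⟩
    · exact gapConn_of_eqvGen (hLay _) (by rw [hLp]; exact hE.e₁₂) hE.evenE.1
    · exact gapConn_of_eqvGen (hLay _) (by rw [s01.1]; exact hF.e₁₃) hF.evenE.1
  clear hu hu' hu'' hv hv' hv''
  induction key with
  | rel u v h => exact H u v h
  | refl => exact .refl _
  | symm _ _ _ ih => exact ih.symm
  | trans _ _ _ _ _ ih ih' => exact ih.trans _ _ _ ih'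

/-! ### Reflection -/

/-- The horizontal mirror image. -/
def Matching.flip (m : Matching) : Matching where
  bot := m.top
  top := m.bot
  arcs_eq := m.arcs_eq.symm

/-- The reflection of the boundary lines. -/
def flipSide (z : Side) : Side := (!z.1, z.2)

@[simp] lemma flipSide_flipSide (z : Side) : flipSide (flipSide z) = z := by simp [flipSide]

lemma Matching.side_flip (m : Matching) (s : Bool) : m.flip.side s = m.side !s := by
  cases s <;> rfl

lemma Matching.inv_flip (m : Matching) (z : Side) :
    m.flip.inv z = flipSide (m.inv (flipSide z)) := by
  obtain ⟨s, i⟩ := z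
  rw [show flipSide (s, i) = (!s, i) from rfl]
  by_cases h : (m.side !s).IsRay i
  · rw [m.inv_ray h, m.flip.inv_ray (by rwa [m.side_flip])]
    simp [flipSide, m.side_flip]
  · rw [m.inv_arc h, m.flip.inv_arc (by rwa [m.side_flip])]
    simp [flipSide, m.side_flip]

@[simp] lemma Matching.flip_flip (m : Matching) : m.flip.flip = m := rfl

lemma gapStep_flip {m : Matching} {x y : Side} (h : GapStep m.inv x y) :
    GapStep m.flip.inv (flipSide x) (flipSide y) := by
  cases h with
  | arc h hne => exact .arc (s := !_) (by rw [m.inv_flip]; simp [flipSide, h]) hne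
  | left h => exact .left (s := !_) (by rw [m.inv_flip]; simp [flipSide, h])
  | right h => exact .right (s := !_) (by rw [m.inv_flip]; simp [flipSide, h])

lemma eqvGen_gapStep_flip {m : Matching} {x y : Side} (h : Relation.EqvGen (GapStep m.inv) x y) :
    Relation.EqvGen (GapStep m.flip.inv) (flipSide x) (flipSide y) := by
  induction h with
  | rel x y h => exact .rel _ _ (gapStep_flip h)
  | refl => exact .refl _
  | symm _ _ _ ih => exact ih.symm
  | trans _ _ _ _ _ ih ih' => exact ih.trans _ _ _ ih'

lemma pGap_flip {m m' : Matching} {c : ℤ} {x y : Side} (h : PGap m.inv m'.inv c x y) :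
    PGap m'.flip.inv m.flip.inv c (flipSide x) (flipSide y) :=
  ⟨h.1, eqvGen_gapStep_flip h.2.2, eqvGen_gapStep_flip h.2.1⟩

lemma pot_flip (x y o : Side) : pot (flipSide x) (flipSide y) o = - pot x y (flipSide o) := by
  obtain ⟨s, i⟩ := x
  obtain ⟨r, j⟩ := y
  obtain ⟨r', k⟩ := o
  cases s <;> cases r <;> cases r' <;> simp [pot, jump, flipSide] <;> split_ifs <;> simp

lemma pGap_unflip {m m' : Matching} {c : ℤ} {x y : Side} (h : PGap m'.flip.inv m.flip.inv c x y) :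
    PGap m.inv m'.inv c (flipSide x) (flipSide y) := pGap_flip h

lemma split_flip {m m' : Matching} {f : Matching} {c : ℤ} {a b : Side}
    (h : ∀ x y, GapStep f.inv x y → Even (x.2 - c) →
      Relation.EqvGen (fun x y => PGap m.inv m'.inv c x y ∨ (x = a ∧ y = b)) x y) (x y : Side)
    (hxy : GapStep f.flip.inv x y) (hx : Even (x.2 - c)) :
    Relation.EqvGen (fun x y => PGap m'.flip.inv m.flip.inv c x y ∨
      (x = flipSide a ∧ y = flipSide b)) x y := by
  have key : ∀ x y, Relation.EqvGen (fun x y => PGap m.inv m'.inv c x y ∨ (x = a ∧ y = b)) x y →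
      Relation.EqvGen (fun x y => PGap m'.flip.inv m.flip.inv c x y ∨
      (x = flipSide a ∧ y = flipSide b)) (flipSide x) (flipSide y) := by
    intro x y h
    induction h with
    | rel x y h =>
      rcases h with h | ⟨rfl, rfl⟩
      · exact .rel _ _ (Or.inl (pGap_flip h))
      · exact .rel _ _ (Or.inr ⟨rfl, rfl⟩)
    | refl => exact .refl _
    | symm _ _ _ ih => exact ih.symm
    | trans _ _ _ _ _ ih ih' => exact ih.trans _ _ _ ih'
  have := key _ _ (h (flipSide x) (flipSide y) (gapStep_flip hxy) hx)
  simpa using this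

/-- Reflection reverses the orientation of the hexagon and the sign of the potentials. Exchanging
the two layers swaps the second and third corners of each hexagon and so restores the cyclic order.
-/
lemma HexPair.flip {m m' : Matching} (h : HexPair m m') : HexPair m'.flip m.flip := by
  intro c
  obtain ⟨E₁, O₁₂, E₂, O₂₃, E₃, O₃₁, hE⟩ := h c
  have H := hE.hexagon
  have h12 := H.pot₁₂
  have h23 := H.pot₂₃
  have h31 := H.pot₃₁
  have s13 := pot_swap E₁ E₃
  have s12 := pot_swap E₁ E₂
  have s23 := pot_swap E₂ E₃
  refine ⟨flipSide E₁, flipSide O₃₁, flipSide E₃, flipSide O₂₃, flipSide E₂, flipSide O₁₂,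
    ⟨?_, ?_, ?_, ?_, ?_, ?_, ?_⟩, ⟨hE.evenE.1, hE.evenE.2.2, hE.evenE.2.1⟩,
    ⟨hE.evenO.2.2, hE.evenO.2.1, hE.evenO.1⟩, eqvGen_gapStep_flip hE.e₁₃,
    eqvGen_gapStep_flip hE.e₁₂, split_flip hE.split_g, split_flip hE.split_f,
    split_flip hE.split_o', split_flip hE.split_o⟩
  · intro x y o o' hxy ho
    have := H.cross _ _ _ _ (pGap_unflip hxy) (pGap_unflip ho)
    have h1 := pot_flip (flipSide x) (flipSide y)
    simp only [flipSide_flipSide] at h1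
    rw [h1, h1, this]
  · intro x y hxy
    have := H.crossO _ _ (pGap_unflip hxy)
    have h1 := pot_flip (flipSide x) (flipSide y)
    simp only [flipSide_flipSide] at h1
    simp only [h1, flipSide_flipSide]
    omega
  · intro o o' ho
    have := H.crossE _ _ (pGap_unflip ho)
    simp only [pot_flip]
    omega
  all_goals
    simp only [pot_flip, flipSide_flipSide]
    simp only [s13, s12, s23] at *
    omega

/-! ### Removing an outermost cup of the middle section -/

namespace ArcDiagram

lemma idx_shift (a : ArcDiagram) (i : ℤ) : a.shift.idx i = a.idx (i - 1) + 1 := by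
  have : {k | k < i ∧ a.shift.partner k ≠ k} =
      (fun k => k + 1) '' {k | k < i - 1 ∧ a.partner k ≠ k} := by
    ext k
    simp only [shift, Set.mem_ofPred_eq, Set.mem_image]
    constructor
    · rintro ⟨h1, h2⟩
      exact ⟨k - 1, ⟨by omega, by omega⟩, by omega⟩
    · rintro ⟨j, ⟨h1, h2⟩, rfl⟩
      simp only [add_sub_cancel_right]
      omega
  simp only [idx, below, this]
  rw [Set.ncard_image_of_injective _ (add_left_injective 1)]
  ring

lemma isRay_shift {a : ArcDiagram} {i : ℤ} : a.shift.IsRay i ↔ a.IsRay (i - 1) := by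
  simp only [IsRay, shift]
  omega

lemma idx_congr {a b : ArcDiagram} {i : ℤ} (h : ∀ k < i, (a.partner k = k ↔ b.partner k = k)) :
    a.idx i = b.idx i := by
  have : {k | k < i ∧ a.partner k ≠ k} = {k | k < i ∧ b.partner k ≠ k} := by
    ext k
    simp only [Set.mem_ofPred_eq]
    constructor <;> rintro ⟨h1, h2⟩ <;> have := h k h1 <;> tauto
  simp only [idx, below, this]

lemma idx_sub_congr {a b : ArcDiagram} {i j : ℤ} (hij : i ≤ j)
    (h : ∀ k, i ≤ k → k < j → (a.partner k = k ↔ b.partner k = k)) :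
    a.idx j - a.idx i = b.idx j - b.idx i := by
  induction j, hij using Int.leInduction with
  | base => simp
  | succ j hj ih =>
    have h1 := ih fun k hk hk' => h k hk (by omega)
    have h2 := h j hj (by omega)
    by_cases hr : a.partner j = j
    · rw [a.idx_succ_ray hr, b.idx_succ_ray (h2.1 hr)]
      omega
    · rw [a.idx_succ_arc hr, b.idx_succ_arc (fun h' => hr (h2.2 h'))]
      omega

/-- `r'` arises from `r` by turning the outermost arc `p, q` into two rays. -/
structure Step (r r' : ArcDiagram) (p q : ℤ) : Prop where
  lt : p < q
  arc : r.partner p = q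
  left : r'.IsRay p
  right : r'.IsRay q
  same : ∀ i, i ≠ p → i ≠ q → r'.partner i = r.partner i

end ArcDiagram

open ArcDiagram in
-- With `v` the number of rays at `p`, the line number `v` runs from `y ≤ p` at the bottom to `x >
-- q` at the top, so it passes between the cap and the cup. After the arc is opened, `p` and `q`
-- carry the rays `v` and `v + 1`, and the rays further to the right are renumbered by `2`. Hence
-- the new lines are `y` to `p`, `p + 1` to `q` and `q + 1` to `x`, and all other lines remain.
theorem hexPair_middle {r r' : ArcDiagram} {p q : ℤ} (h : r.Step r' p q) :
    HexPair (Matching.middle r) (Matching.middle r') := by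
  have hpq := h.lt
  have hqp : r.partner q = p := by rw [← h.arc, r.partner_partner]
  -- there are no arcs around
  have hout : ∀ i, i < p → r.partner i < p := by
    intro i hi
    by_contra hlt
    have h1 : r.partner i ≠ p := fun h1 => by
      have := r.partner_partner i
      rw [h1, h.arc] at this
      omega
    have h2 := h.same i (by omega) (by omega)
    have h3 := r'.noncrossing i p hi (by omega)
    exact h3.1 h.left
  set v := r.idx p with hv
  set x := r.rayAt v with hx
  have hxr : r.IsRay x := r.isRay_rayAt v
  have hxi : r.idx x = v := r.idx_rayAt v
  set y := r.shift.rayAt v with hy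
  have hyr : r.shift.IsRay y := r.shift.isRay_rayAt v
  have hyi : r.shift.idx y = v := r.shift.idx_rayAt v
  have hpq_arc : ∀ z, p ≤ z → z ≤ q → r.partner z ≠ z := by
    intro z h1 h2
    rcases h1.eq_or_lt with rfl | h1
    · rw [h.arc]; omega
    rcases h2.eq_or_lt with rfl | h2
    · rw [hqp]; omega
    exact (r.inside h1 (by rw [h.arc]; exact h2)).1
  have hxq : q < x := by
    have h1 : ¬ x < p := fun h1 => by
      have := r.idx_lt hxr h1
      omega
    by_contra h2
    exact hpq_arc x (by omega) (by omega) hxr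
  have hpx : ∀ z, p ≤ z → z < x → r.partner z ≠ z := by
    intro z h1 h2 h3
    have := r.idx_lt h3 h2
    have := r.idx_mono h1
    omega
  have hyp : y < p + 1 := by
    apply r.shift.lt_of_idx_lt
    rw [hyi, r.idx_shift]
    simp [hv]
  have hyp_arc : ∀ z, y < z → z < p + 1 → r.shift.partner z ≠ z := by
    intro z h1 h2 h3
    have h4 := r.shift.idx_lt h3 h2
    have h5 := r.shift.idx_lt hyr h1
    rw [r.idx_shift (p + 1), add_sub_cancel_right] at h4
    omega
  -- the numbering of the rays
  have hidx : ∀ i, i ≤ p → r'.idx i = r.idx i := fun i hi =>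
    idx_congr fun k hk => by rw [h.same k (by omega) (by omega)]
  have hidxp : r'.idx (p + 1) = v + 1 := by rw [r'.idx_succ_ray h.left, hidx p le_rfl]
  have hidxq : r'.idx q = v + 1 := by
    rw [← hidxp]
    exact r'.idx_eq_of_arcs (by omega) fun z h1 h2 => by
      rw [h.same z (by omega) (by omega)]
      exact hpq_arc z (by omega) (by omega)
  have hidxq' : r'.idx (q + 1) = v + 2 := by rw [r'.idx_succ_ray h.right, hidxq]; ring
  have hidxr : r.idx (q + 1) = v := r.idx_eq_of_arcs (by omega) fun z h1 h2 =>
    hpq_arc z h1 (by omega)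
  have hidx2 : ∀ i, q < i → r'.idx i = r.idx i + 2 := by
    intro i hi
    have := idx_sub_congr (a := r') (b := r) (show q + 1 ≤ i by omega) fun k hk hk' => by
      rw [h.same k (by omega) (by omega)]
    omega
  set m := Matching.middle r with hm
  set m' := Matching.middle r' with hm'
  have hb : m.side false = r.shift := rfl
  have ht : m.side true = r := rfl
  have hb' : m'.side false = r'.shift := rfl
  have ht' : m'.side true = r' := rfl
  have hsp : ∀ i, r.shift.partner i = r.partner (i - 1) + 1 := fun i => rfl
  have hsp' : ∀ i, r'.shift.partner i = r'.partner (i - 1) + 1 := fun i => rfl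
  have hraysame : ∀ z, z ≠ p → z ≠ q → r.IsRay z → r'.IsRay z := fun z h1 h2 h3 => by
    rw [IsRay, h.same z h1 h2]
    exact h3
  have hraysame' : ∀ z, z ≠ p + 1 → z ≠ q + 1 → r.shift.IsRay z → r'.shift.IsRay z :=
    fun z h1 h2 h3 => by
      rw [isRay_shift] at h3 ⊢
      exact hraysame _ (by omega) (by omega) h3
  have hline : ∀ {z w}, m.inv (false, z) = (true, w) ↔ r.shift.IsRay z ∧ r.IsRay w ∧
      r.shift.idx z = r.idx w := fun {z w} => m.inv_diff (s := false)
  have hline' : ∀ {z w}, m'.inv (false, z) = (true, w) ↔ r'.shift.IsRay z ∧ r'.IsRay w ∧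
      r'.shift.idx z = r'.idx w := fun {z w} => m'.inv_diff (s := false)
  have hlines : ∀ z w, m.inv (false, z) = (true, w) → z ≠ y → m'.inv (false, z) = (true, w) := by
    intro z w hzw hzy
    obtain ⟨h1, h2, h3⟩ := hline.1 hzw
    have hz1 : z ≠ p + 1 := by
      rintro rfl
      rw [isRay_shift, add_sub_cancel_right] at h1
      exact hpq_arc p le_rfl (by omega) h1
    have hz2 : z ≠ q + 1 := by
      rintro rfl
      rw [isRay_shift, add_sub_cancel_right] at h1
      exact hpq_arc q (by omega) le_rfl h1
    have hw : ¬ (p ≤ w ∧ w ≤ q) := fun hw => hpq_arc w hw.1 hw.2 h2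
    refine hline'.2 ⟨hraysame' z hz1 hz2 h1, hraysame w (by omega) (by omega) h2, ?_⟩
    rw [idx_shift]
    rcases lt_or_gt_of_ne hzy with hlt | hgt
    · have h4 := r.shift.idx_lt h1 hlt
      have h5 : w < p := r.lt_of_idx_lt (by omega)
      rw [hidx _ (by omega), hidx _ (by omega), ← idx_shift, h3]
    · have h4 := r.shift.idx_lt hyr hgt
      have h5 : x < w := r.lt_of_idx_lt (by omega)
      have h6 : p + 1 < z := by
        by_contra h6
        exact hyp_arc z hgt (by omega) h1
      have h7 : q + 1 < z := by
        by_contra h7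
        rw [isRay_shift] at h1
        exact hpq_arc (z - 1) (by omega) (by omega) h1
      rw [hidx2 _ (by omega), hidx2 _ (by omega), ← h3, r.idx_shift]
      ring
  refine (HexMove.hexPair (y := y) (c := p + 1) (c' := q + 1) (d := p) (d' := q) (x := x)
    ⟨hyp, by omega, hpq, hxq, ?_, ?_, ?_, ?_, ?_, ?_, ?_, ?_, ?_⟩)
  · rw [m.inv_arc, hb, hsp, add_sub_cancel_right, h.arc]
    rw [hb, isRay_shift, add_sub_cancel_right]
    exact hpq_arc p le_rfl (by omega)
  · rw [m.inv_arc, ht, h.arc]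
    exact hpq_arc p le_rfl (by omega)
  · exact hline.2 ⟨hyr, hxr, by rw [hyi, hxi]⟩
  · refine hline'.2 ⟨hraysame' y (by omega) (by omega) hyr, h.left, ?_⟩
    rw [idx_shift, hidx _ (by omega), hidx _ le_rfl, ← idx_shift, hyi]
  · refine hline'.2 ⟨?_, h.right, ?_⟩
    · rw [isRay_shift, add_sub_cancel_right]; exact h.left
    · rw [idx_shift, add_sub_cancel_right, hidx _ le_rfl, hidxq]
  · refine hline'.2 ⟨?_, hraysame x (by omega) (by omega) hxr, ?_⟩
    · rw [isRay_shift, add_sub_cancel_right]; exact h.right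
    · rw [idx_shift, add_sub_cancel_right, hidxq, hidx2 _ hxq, hxi]
      ring
  · rintro ⟨s, z⟩ h1 h2 h3 h4 h5 h6
    by_cases hr : (m.side s).IsRay z
    · have h7 := m.inv_ray hr
      cases s
      · have h8 := hlines _ _ h7 (by simpa using h1)
        exact h7.trans h8.symm
      · simp only [Bool.not_true] at h7
        set w := (m.side false).rayAt ((m.side true).idx z) with hw
        have h8 : m.inv (false, w) = (true, z) := by rw [← h7, m.isLayer_inv.inv]
        have h9 := hlines _ _ h8 (by
          rintro h9
          rw [h9, (hline (z := y) (w := x)).2 ⟨hyr, hxr, by rw [hyi, hxi]⟩] at h8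
          exact h6 h8.symm)
        rw [h7, ← h9, m'.isLayer_inv.inv]
    · rw [m.inv_arc hr]
      cases s
      · rw [hb, isRay_shift] at hr
        have h7 : r'.partner (z - 1) = r.partner (z - 1) :=
          h.same _ (by simp at h2; omega) (by simp at h3; omega)
        rw [m'.inv_arc, hb, hb', hsp, hsp', h7]
        rw [hb', isRay_shift, IsRay, h7]
        exact hr
      · rw [ht] at hr
        have h7 : r'.partner z = r.partner z := h.same _ (by simpa using h4) (by simpa using h5)
        rw [m'.inv_arc, ht, ht', h7]
        rw [ht', IsRay, h7]
        exact hr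
  · intro z h1 h2
    have h3 := hyp_arc z h1 h2
    refine ⟨_, m.inv_arc h3, h3, ?_, ?_⟩ <;> simp only [hb]
    · by_contra hlt
      have h4 : r.shift.partner z ≠ y := fun h4 => by
        have := r.shift.partner_partner z
        rw [h4, hyr] at this
        omega
      have := r.shift.partner_lt_ray hyr (z := r.shift.partner z) (by omega)
      rw [r.shift.partner_partner] at this
      omega
    · have := hsp z
      rcases (show z ≤ p by omega).eq_or_lt with rfl | hlt
      · have := hout (z - 1) (by omega)
        omega
      · have := hout (z - 1) (by omega)
        omega
  · intro z h1 h2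
    have h3 := hpx z (by omega) h2
    refine ⟨_, m.inv_arc h3, h3, ?_, r.partner_lt_ray hxr h2⟩
    simp only [ht]
    by_contra hlt
    have h4 : r.partner z ≠ p := fun h4 => by
      have := r.partner_partner z
      rw [h4, h.arc] at this
      omega
    have h5 : r.partner z ≠ q := fun h5 => by
      have := r.partner_partner z
      rw [h5, hqp] at this
      omega
    rcases lt_or_gt_of_ne h4 with h6 | h6
    · have := hout _ h6
      rw [r.partner_partner] at this
      omega
    · have := r.inside h6 (by rw [h.arc]; omega)
      rw [r.partner_partner, h.arc] at this
      omega

/-! ### Lower reductions -/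

/-- All strands of `a t` end at the top. -/
def Full (a : ArcDiagram) (t : GenMatching) : Prop :=
  ∀ j i, j ≤ t.length → ∃ y, Joined a t .empty (j, i) (t.length, y)

lemma isRay_empty (y : ℤ) : ArcDiagram.empty.IsRay y := rfl

section

variable {a b a' : ArcDiagram} {t u : GenMatching}

lemma full_iff : Full a t ↔ ¬ HasCircle a t .empty ∧ ¬ HasBottomLine a t .empty := by
  constructor
  · intro h
    constructor
    · rintro ⟨j, i, hj, -, h2⟩
      obtain ⟨y, hy⟩ := h j i hj
      exact h2 y (isRay_empty y) hy
    · rintro ⟨x, x', hne, hx, hx', hj⟩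
      obtain ⟨y, hy⟩ := h 0 x (Nat.zero_le _)
      rcases exists_end_of_bottom (t := t) (b := .empty) hx with ⟨_, _, _, _, hno⟩ | ⟨_, _, _, hu, -⟩
      · exact hno y (isRay_empty y) hy
      · exact hne (hu x' hx' hj).symm
  · rintro ⟨h1, h2⟩ j i hj
    by_contra hno
    push Not at hno
    have : ∃ x, a.IsRay x ∧ Joined a t .empty (j, i) (0, x) := by
      by_contra h
      push Not at h
      exact h1 ⟨j, i, hj, h, fun y _ => hno y⟩
    obtain ⟨x, hx, hjx⟩ := this
    rcases exists_end_of_bottom (t := t) (b := .empty) hx with ⟨x', hne, hx', hj', -⟩ | ⟨y, -, hj', -⟩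
    · exact h2 ⟨x, x', hne.symm, hx, hx', hj'⟩
    · exact hno y (hjx.trans hj')

lemma isLowerReduction_iff : IsLowerReduction a t a' ↔ Full a t ∧ ∀ x y, x ≠ y →
    (Joined a t .empty (t.length, x) (t.length, y) ↔ a'.partner x = y) := by
  rw [full_iff, and_assoc]
  rfl

lemma IsLowerReduction.full (h : IsLowerReduction a t a') : Full a t :=
  (isLowerReduction_iff.1 h).1

lemma IsLowerReduction.joined_iff (h : IsLowerReduction a t a') {x y : ℤ} (hxy : x ≠ y) :
    Joined a t .empty (t.length, x) (t.length, y) ↔ a'.partner x = y := h.2.2 x y hxy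

/-- A horizontal bound for the arcs. -/
lemma exists_bound (a : ArcDiagram) (t : GenMatching) (b : ArcDiagram) :
    ∃ N : ℤ, 0 ≤ N ∧ ∀ p q, Joined a t b p q → N < |p.2| → q.2 = p.2 := by
  have hL := isStack_layers a t b
  obtain ⟨N, hN0, hN⟩ := hL.exists_window
  refine ⟨N, hN0, fun p q hpq hp => ?_⟩
  refine ((joined_iff.1 hpq).iff_of_invariant (P := fun v => v.2 = p.2) fun l z => ?_).1 rfl
  simp only [node]
  constructor
  · intro h
    rw [hN l z (by rw [h]; exact hp), h]
  · intro h
    have := hN l (layers a t b l z) (by rw [h]; exact hp)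
    rw [hL.inv] at this
    rw [this, h]

/-- Two top points are partners if they lie on the same strand. The reduction is planar because a
strand from `x` to `x'` without bottom ends has a height function that is constant and nonzero
between `x` and `x'`, and different on either side. The height of the gap beside another strand does
not change along it, so a strand starting between `x` and `x'` ends between them, and it cannot go
down to the bottom, where outer gaps have height zero. -/
theorem exists_isLowerReduction (h : Full a t) : ∃ a', IsLowerReduction a t a' := by
  classical
  set k := t.length with hk
  set P : ℤ → ℤ → Prop := fun x y => y ≠ x ∧ Joined a t .empty (k, x) (k, y) with hP
  have huniq : ∀ {x y z}, P x y → P x z → y = z := by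
    rintro x y z ⟨h1, h2⟩ ⟨h3, h4⟩
    rcases exists_end_of_top (a := a) (t := t) (isRay_empty x) with ⟨y', -, -, -, -, hu⟩ | ⟨_, _, _, hu⟩
    · have := hu y (isRay_empty y) h2
      have := hu z (isRay_empty z) h4
      omega
    · exact absurd (hu y (isRay_empty y) h2) h1
  set π : ℤ → ℤ := fun x => if h : ∃ y, P x y then h.choose else x with hπ
  have hπ1 : ∀ {x y}, P x y → π x = y := by
    intro x y hxy
    have he : ∃ y, P x y := ⟨y, hxy⟩
    simp only [hπ, dif_pos he]
    exact huniq he.choose_spec hxy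
  have hπ2 : ∀ {x}, π x ≠ x → P x (π x) := by
    intro x hx
    by_cases he : ∃ y, P x y
    · simp only [hπ, dif_pos he]
      exact he.choose_spec
    · simp [hπ, he] at hx
  obtain ⟨N, hN0, hN⟩ := exists_bound a t .empty
  refine ⟨⟨π, fun x => ?_, ?_, ?_⟩, isLowerReduction_iff.2 ⟨h, fun x y hxy => ?_⟩⟩
  · by_cases hx : π x = x
    · rw [hx, hx]
    · have := hπ2 hx
      exact hπ1 ⟨hx ∘ Eq.symm, this.2.symm⟩
  · refine (Set.finite_Icc (-N) N).subset fun x hx => ?_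
    have := hπ2 hx
    by_contra h1
    have h2 := hN _ _ this.2 (by
      rw [Set.mem_Icc, ← abs_le] at h1
      exact not_le.1 h1)
    exact this.1 h2
  · -- planarity
    intro x z hxz hzx'
    set x' := π x with hx'
    have hPx : P x x' := hπ2 (by omega)
    have hL := isStack_layers a t .empty
    have hnb : ∀ w, a.IsRay w → ¬ Joined a t .empty (k, x) (0, w) := by
      rcases exists_end_of_top (a := a) (t := t) (isRay_empty x) with ⟨_, _, _, _, hno, -⟩ | ⟨_, _, _, hu⟩
      · exact hno
      · exact absurd (hu x' (isRay_empty x') hPx.2) hPx.1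
    have hPiff : ∀ w, Joined a t .empty (k, x) (k, w) → w = x ∨ w = x' := by
      intro w hw
      by_cases hwx : w = x
      · exact Or.inl hwx
      · exact Or.inr (huniq ⟨hwx, hw⟩ hPx)
    set L := layers a t .empty with hLdef
    obtain ⟨A, hAx, H, hH0, hH1, hHc⟩ := exists_height hL (e := false)
      (X := fun v => if Conn L (k + 1, x) v then 1 else 0)
      (fun l z => by simp only [← strand_invariant (k + 1, x) l z])
      (fun w hw => if_neg fun hc => hnb w
        (by simpa [endLayer, hLdef, arcSide, ArcDiagram.IsRay] using hw) (KhovanovP.joined_iff.2 hc)) x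
    have hX : ∀ w, Conn L (k + 1, x) (k + 1, w) ↔ (w = x ∨ w = x') := fun w =>
      ⟨fun hc => hPiff w (KhovanovP.joined_iff.2 hc), by
        rintro (rfl | rfl)
        · exact Conn.refl
        · exact KhovanovP.joined_iff.1 hPx.2⟩
    have hxx' : x < x' := by omega
    have hstep : ∀ g, A ≤ g → H (k + 1, g + 1) = H (k + 1, g) +
        sgn g * (if g = x ∨ g = x' then 1 else 0) := by
      intro g hg
      rw [hH1 (k + 1, g) hg]
      simp only [hX]
    have ha : ∀ g, g ≤ x → H (k + 1, g) = 0 := by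
      intro g hg
      rcases le_total g A with h1 | h1
      · exact hH0 _ h1
      · induction g, h1 using Int.leInduction with
        | base => exact hH0 _ le_rfl
        | succ g hg' ih =>
          rw [hstep g hg', ih (by omega), if_neg (by omega)]
          simp
    have hb : ∀ g, x + 1 ≤ g → g ≤ x' → H (k + 1, g) = sgn x := by
      intro g h1 h2
      induction g, h1 using Int.leInduction with
      | base => rw [hstep x hAx, ha x le_rfl, if_pos (Or.inl rfl)]; simp
      | succ g hg' ih => rw [hstep g (by omega), ih (by omega), if_neg (by omega)]; simp
    have hc : ∀ g, x' + 1 ≤ g → H (k + 1, g) = sgn x + sgn x' := by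
      intro g h1
      induction g, h1 using Int.leInduction with
      | base => rw [hstep x' (by omega), hb x' (by omega) le_rfl, if_pos (Or.inr rfl), mul_one]
      | succ g hg' ih => rw [hstep g (by omega), ih, if_neg (by omega)]; simp
    have hHz := hb z (by omega) (by omega)
    have hbz : beside z z = z := beside_self (by simp)
    have hs : ∀ g, sgn g ≠ 0 := fun g => by simp only [sgn]; split_ifs <;> omega
    rcases exists_end_of_top (a := a) (t := t) (isRay_empty z) with ⟨z', hne, -, hj, -, -⟩ | ⟨w, hw, hj, -⟩
    · rw [show π z = z' from hπ1 ⟨hne, hj⟩]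
      have h1 := hHc _ _ _ (gapConn_beside hL false z (KhovanovP.joined_iff.1 hj))
      have hz'x : z' ≠ x := fun h1 => by
        have := hPiff z (by rw [← h1]; exact hj.symm)
        omega
      have hz'x' : z' ≠ x' := fun h1 => by
        have := hPiff z (hPx.2.trans (by rw [← h1]; exact hj.symm))
        omega
      have h2 : H (k + 1, beside z z) = H (k + 1, beside z z') := h1
      rw [hbz, hHz] at h2
      have h3 : beside z z' = z' ∨ beside z z' = z' + 1 := by
        simp only [beside]; split_ifs <;> simp
      refine ⟨hne, ?_, ?_⟩
      · by_contra hlt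
        rw [ha _ (by omega)] at h2
        exact hs x h2
      · by_contra hlt
        rw [hc _ (by omega)] at h2
        exact hs x' (by omega)
    · exfalso
      have h1 := hHc _ _ _ (gapConn_beside hL false z (KhovanovP.joined_iff.1 hj))
      have h2 : H (k + 1, beside z z) = H (1, beside z w) := h1
      rw [hbz, hHz] at h2
      -- A ray of `a` far to the left: the gap beside it is still at most `A`, even if it is the one
      -- to the right, and has height zero. It is identified with the gap beside `w`.
      obtain ⟨M, hM0, hM⟩ := a.exists_window
      have hray : a.IsRay (min (A - 1) (-M - 1)) := by
        by_contra hr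
        have := hM _ hr
        omega
      have hfix : ∀ w, a.IsRay w → L (endLayer k false) (!false, w) = (!false, w) := fun w hw => by
        simpa [endLayer, hLdef, arcSide, ArcDiagram.IsRay] using hw
      have h3 := hHc z _ _ (.rel _ _ ⟨endLayer k false, (!false, beside z w),
        (!false, beside z (min (A - 1) (-M - 1))),
        .root rfl (outer_beside hL z (hfix w hw)) (outer_beside hL z (hfix _ hray))
          (even_beside _ _) (even_beside _ _), rfl, rfl⟩)
      have h4 : H (1, beside z w) = H (1, beside z (min (A - 1) (-M - 1))) := h3
      rw [h4, hH0] at h2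
      · exact hs x h2
      · simp only [beside]
        split_ifs <;> omega
  · constructor
    · intro hj
      exact hπ1 ⟨hxy.symm, hj⟩
    · rintro rfl
      exact (hπ2 hxy.symm).2

/-! ### Composition -/

lemma Joined.map {a₁ b₁ a₂ b₂ : ArcDiagram} {t₁ t₂ : GenMatching} (F : ℕ × ℤ → ℕ × ℤ)
    (hF : ∀ p q, Edge a₁ t₁ b₁ p q → Joined a₂ t₂ b₂ (F p) (F q)) {p q : ℕ × ℤ}
    (h : Joined a₁ t₁ b₁ p q) : Joined a₂ t₂ b₂ (F p) (F q) := by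
  induction h with
  | rel p q h => exact hF p q h
  | refl => exact .refl
  | symm _ _ _ ih => exact ih.symm
  | trans _ _ _ _ _ ih ih' => exact ih.trans ih'

lemma Joined.iff_of_edge {P : ℕ × ℤ → Prop} (hP : ∀ p q, Edge a t b p q → (P p ↔ P q))
    {p q : ℕ × ℤ} (h : Joined a t b p q) : P p ↔ P q := by
  induction h with
  | rel p q h => exact hP p q h
  | refl => rfl
  | symm _ _ _ ih => exact ih.symm
  | trans _ _ _ _ _ ih ih' => exact ih.trans ih'

lemma getElem?_append_of_some {j : ℕ} {m : Matching} (h : t[j]? = some m) : (t ++ u)[j]? = some m := by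
  rw [List.getElem?_append_left (List.getElem?_eq_some_iff.1 h).1, h]

lemma Joined.append (h : Joined a t .empty p q) : Joined a (t ++ u) b p q := by
  refine Joined.map id (fun p q h => ?_) h
  cases h with
  | cup i => exact .rel _ _ (.cup i)
  | layerCap h i => exact .rel _ _ (.layerCap (getElem?_append_of_some h) i)
  | layerCup h i => exact .rel _ _ (.layerCup (getElem?_append_of_some h) i)
  | layerLine h h' => exact .rel _ _ (.layerLine (getElem?_append_of_some h) h')
  | cap i => exact .refl

lemma IsLowerReduction.joined_append (h : IsLowerReduction a t a') {p q : ℕ × ℤ}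
    (hj : Joined a' u b p q) :
    Joined a (t ++ u) b (t.length + p.1, p.2) (t.length + q.1, q.2) := by
  have hg : ∀ {j : ℕ} {m : Matching}, u[j]? = some m → (t ++ u)[t.length + j]? = some m := by
    intro j m h
    rw [List.getElem?_append_right (by omega), Nat.add_sub_cancel_left, h]
  refine Joined.map (fun p => (t.length + p.1, p.2)) (fun p q h' => ?_) hj
  cases h' with
  | cup i =>
    by_cases hi : a'.partner i = i
    · rw [hi]; exact .refl
    · exact ((h.joined_iff (Ne.symm hi)).2 rfl).append
  | layerCap h i => exact .rel _ _ (.layerCap (hg h) i)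
  | layerCup h i => exact .rel _ _ (.layerCup (hg h) i)
  | layerLine h h' => exact .rel _ _ (.layerLine (hg h) h')
  | cap i =>
    have := Edge.cap (a := a) (t := t ++ u) (b := b) i
    rw [List.length_append] at this
    exact .rel _ _ this

/-- A strand of `a' u b`, regarded as a strand of `a t u b`. -/
def Lifted (a : ArcDiagram) (t : GenMatching) (C : ℕ × ℤ → Prop) (p : ℕ × ℤ) : Prop :=
  (p.1 ≤ t.length ∧ ∃ i', Joined a t .empty p (t.length, i') ∧ C (0, i')) ∨
    (t.length ≤ p.1 ∧ C (p.1 - t.length, p.2))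

/-- The parts of a strand below the line between `t` and `u` connect points of this line exactly as
`a'` does, so a union `C` of strands of `a' u b` lifts to a union of strands of the whole diagram.
-/
lemma IsLowerReduction.lifted_iff (h : IsLowerReduction a t a') {C : ℕ × ℤ → Prop}
    (hC : ∀ p q, Edge a' u b p q → (C p ↔ C q)) {p q : ℕ × ℤ} (hpq : Joined a (t ++ u) b p q) :
    Lifted a t C p ↔ Lifted a t C q := by
  have hcup : ∀ i i', Joined a t .empty (t.length, i) (t.length, i') → (C (0, i) ↔ C (0, i')) := by
    intro i i' hj
    by_cases hi : i = i'
    · rw [hi]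
    · have := (h.joined_iff hi).1 hj
      rw [← this]
      exact hC _ _ (.cup i)
  have h1 : ∀ p : ℕ × ℤ, p.1 ≤ t.length →
      (Lifted a t C p ↔ ∃ i', Joined a t .empty p (t.length, i') ∧ C (0, i')) := by
    rintro ⟨j, i⟩ hp
    simp only at hp
    constructor
    · rintro (h | ⟨h2, h3⟩)
      · exact h.2
      · simp only at h2 h3
        obtain rfl : j = t.length := le_antisymm hp h2
        exact ⟨i, .refl, by simpa using h3⟩
    · exact fun h => Or.inl ⟨hp, h⟩
  have h2 : ∀ p : ℕ × ℤ, t.length ≤ p.1 → (Lifted a t C p ↔ C (p.1 - t.length, p.2)) := by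
    rintro ⟨j, i⟩ hp
    simp only at hp
    constructor
    · rintro (⟨h2, i', h3, h4⟩ | h)
      · simp only at h2
        obtain rfl : j = t.length := le_antisymm h2 hp
        simpa using (hcup _ _ h3).2 h4
      · exact h.2
    · exact fun h => Or.inr ⟨hp, h⟩
  have low : ∀ p q : ℕ × ℤ, p.1 ≤ t.length → q.1 ≤ t.length → Joined a t .empty p q →
      (Lifted a t C p ↔ Lifted a t C q) := by
    intro p q hp hq hj
    rw [h1 p hp, h1 q hq]
    constructor <;> rintro ⟨i', h3, h4⟩
    · exact ⟨i', hj.symm.trans h3, h4⟩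
    · exact ⟨i', hj.trans h3, h4⟩
  refine hpq.iff_of_edge fun p q he => ?_
  cases he with
  | cup i => exact low _ _ (Nat.zero_le _) (Nat.zero_le _) (.rel _ _ (.cup i))
  | @layerCap j m hm i =>
    by_cases hj : j < t.length
    · rw [List.getElem?_append_left hj] at hm
      exact low _ _ hj.le hj.le (.rel _ _ (.layerCap hm i))
    · rw [List.getElem?_append_right (not_lt.1 hj)] at hm
      rw [h2 _ (not_lt.1 hj), h2 _ (not_lt.1 hj)]
      exact hC _ _ (.layerCap hm i)
  | @layerCup j m hm i =>
    by_cases hj : j < t.length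
    · rw [List.getElem?_append_left hj] at hm
      exact low _ _ hj hj (.rel _ _ (.layerCup hm i))
    · rw [List.getElem?_append_right (not_lt.1 hj)] at hm
      rw [h2 _ (by simp; omega), h2 _ (by simp; omega)]
      simp only [show j + 1 - t.length = (j - t.length) + 1 by omega]
      exact hC _ _ (.layerCup hm i)
  | @layerLine j m hm i i' hi =>
    by_cases hj : j < t.length
    · rw [List.getElem?_append_left hj] at hm
      exact low _ _ hj.le hj (.rel _ _ (.layerLine hm hi))
    · rw [List.getElem?_append_right (not_lt.1 hj)] at hm
      rw [h2 _ (by simp; omega), h2 _ (by simp; omega)]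
      simp only [show j + 1 - t.length = (j - t.length) + 1 by omega]
      exact hC _ _ (.layerLine hm hi)
  | cap i =>
    rw [h2 _ (by simp), h2 _ (by simp)]
    simp only [List.length_append, Nat.add_sub_cancel_left]
    exact hC _ _ (.cap i)

lemma joined_edge {p q r : ℕ × ℤ} (h : Edge a t b p q) : Joined a t b r p ↔ Joined a t b r q :=
  ⟨fun h' => h'.trans (.rel _ _ h), fun h' => h'.trans (.symm (.rel _ _ h))⟩

/-- A ray of the reduction comes from the bottom. -/
lemma IsLowerReduction.exists_bottom (h : IsLowerReduction a t a') {x : ℤ} (hx : a'.IsRay x) :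
    ∃ x', a.IsRay x' ∧ Joined a t .empty (t.length, x) (0, x') := by
  rcases exists_end_of_top (a := a) (t := t) (isRay_empty x) with ⟨y', hne, -, hj, -⟩ | ⟨x', hx', hj, -⟩
  · have := (h.joined_iff hne.symm).1 hj
    rw [hx] at this
    exact absurd this.symm hne
  · exact ⟨x', hx', hj⟩

lemma IsLowerReduction.isRay (h : IsLowerReduction a t a') {x x' : ℤ} (hx' : a.IsRay x')
    (hj : Joined a t .empty (0, x') (t.length, x)) : a'.IsRay x := by
  by_contra hx
  have h1 := (h.joined_iff (Ne.symm hx)).2 rfl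
  rcases exists_end_of_bottom (t := t) (b := .empty) hx' with ⟨_, _, _, _, hno⟩ | ⟨y, _, _, -, hu⟩
  · exact hno x (isRay_empty x) hj
  · have h2 := hu x (isRay_empty x) hj
    have h3 := hu _ (isRay_empty _) (hj.trans h1)
    exact hx (h3.trans h2.symm)

/-- All strands of `a t` reach its top line, and `a'` records how they connect the points there.
Whether a strand reaches the bottom or the top can therefore be tested above this line. -/
theorem IsLowerReduction.orientable_iff (h : IsLowerReduction a t a') :
    Orientable a (t ++ u) b ↔ Orientable a' u b := by
  rw [KhovanovP.orientable_iff, KhovanovP.orientable_iff]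
  constructor
  · intro H j i hj
    obtain ⟨⟨x, hx, hjx⟩, y, hy, hjy⟩ := H (t.length + j) i (by simp [hj])
    have hl := fun {q} => h.lifted_iff (u := u) (b := b) (C := Joined a' u b (j, i))
      (fun p q h => joined_edge h) (p := (t.length + j, i)) (q := q)
    have h0 : Lifted a t (Joined a' u b (j, i)) (t.length + j, i) :=
      Or.inr ⟨by simp, by simpa using Joined.refl⟩
    constructor
    · rcases (hl hjx).1 h0 with ⟨-, i', h1, h2⟩ | ⟨h1, h2⟩
      · exact ⟨i', h.isRay hx h1, h2⟩
      -- For empty `t` the bottom line is itself the line between the two parts.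
      · have ht : t.length = 0 := by simpa using h1
        simp only [ht] at h2
        refine ⟨x, h.isRay hx ?_, h2⟩
        rw [ht]
        exact .refl
    · refine ⟨y, hy, ?_⟩
      rcases (hl hjy).1 h0 with ⟨h1, i', h2, h3⟩ | ⟨h1, h2⟩
      · have hu : u.length = 0 := by simp at h1; simp [h1]
        have h4 : Joined a t .empty (t.length, y) (t.length, i') := by
          rwa [List.length_append, hu] at h2
        rw [hu]
        by_cases hyi : y = i'
        · rw [hyi]; exact h3
        · have := (h.joined_iff hyi).1 h4
          refine h3.trans (.symm (.rel _ _ ?_))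
          rw [← this]
          exact .cup y
      · simpa using h2
  · intro H
    have hup : ∀ j i, j ≤ u.length →
        (∃ x, a.IsRay x ∧ Joined a (t ++ u) b (t.length + j, i) (0, x)) ∧
        ∃ y, b.IsRay y ∧ Joined a (t ++ u) b (t.length + j, i) ((t ++ u).length, y) := by
      intro j i hj
      obtain ⟨⟨x, hx, hjx⟩, y, hy, hjy⟩ := H j i hj
      obtain ⟨x', hx', hjx'⟩ := h.exists_bottom hx
      refine ⟨⟨x', hx', (h.joined_append hjx).trans hjx'.append⟩, y, hy, ?_⟩
      rw [List.length_append]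
      exact h.joined_append hjy
    intro j i hj
    by_cases hjt : t.length ≤ j
    · have := hup (j - t.length) i (by simp at hj; omega)
      rwa [show t.length + (j - t.length) = j by omega] at this
    · obtain ⟨y, hy⟩ := h.full j i (by omega)
      have hy' : Joined a (t ++ u) b (j, i) (t.length + 0, y) := hy.append
      obtain ⟨⟨x, hx, hjx⟩, z, hz, hjz⟩ := hup 0 y (Nat.zero_le _)
      exact ⟨⟨x, hx, hy'.trans hjx⟩, z, hz, hy'.trans hjz⟩

lemma full_of_orientable (h : Orientable a (t ++ u) b) : Full a t := by
  rw [full_iff]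
  constructor
  · rintro ⟨j, i, hj, h1, h2⟩
    -- the strand does not leave `t`
    obtain ⟨⟨x, hx, hjx⟩, -⟩ := (orientable_iff.1 h) j i (by simp; omega)
    have hinv : ∀ p q, Edge a (t ++ u) b p q →
        ((p.1 ≤ t.length ∧ Joined a t .empty (j, i) p) ↔ (q.1 ≤ t.length ∧ Joined a t .empty (j, i) q)) := by
      have hup : ∀ p q : ℕ × ℤ, t.length ≤ p.1 → t.length ≤ q.1 →
          ((p.1 ≤ t.length ∧ Joined a t .empty (j, i) p) ↔
            (q.1 ≤ t.length ∧ Joined a t .empty (j, i) q)) := by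
        have : ∀ p : ℕ × ℤ, t.length ≤ p.1 → ¬ (p.1 ≤ t.length ∧ Joined a t .empty (j, i) p) := by
          rintro ⟨j', i'⟩ hp ⟨hp', hjp⟩
          simp only at hp hp'
          obtain rfl : j' = t.length := le_antisymm hp' hp
          exact h2 i' (isRay_empty i') hjp
        exact fun p q hp hq => ⟨fun h => absurd h (this p hp), fun h => absurd h (this q hq)⟩
      have hlow : ∀ p q : ℕ × ℤ, p.1 ≤ t.length → q.1 ≤ t.length → Edge a t .empty p q →
          ((p.1 ≤ t.length ∧ Joined a t .empty (j, i) p) ↔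
            (q.1 ≤ t.length ∧ Joined a t .empty (j, i) q)) := fun p q hp hq he => by
        rw [joined_edge he]
        simp only [hp, hq]
      intro p q he
      cases he with
      | cup i => exact hlow _ _ (Nat.zero_le _) (Nat.zero_le _) (.cup i)
      | @layerCap l m hm i =>
        by_cases hl : l < t.length
        · rw [List.getElem?_append_left hl] at hm
          exact hlow _ _ hl.le hl.le (.layerCap hm i)
        · exact hup _ _ (not_lt.1 hl) (not_lt.1 hl)
      | @layerCup l m hm i =>
        by_cases hl : l < t.length
        · rw [List.getElem?_append_left hl] at hm
          exact hlow _ _ hl hl (.layerCup hm i)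
        · exact hup _ _ (by simp; omega) (by simp; omega)
      | @layerLine l m hm i i' hi =>
        by_cases hl : l < t.length
        · rw [List.getElem?_append_left hl] at hm
          exact hlow _ _ hl.le hl (.layerLine hm hi)
        · exact hup _ _ (by simp; omega) (by simp; omega)
      | cap i => exact hup _ _ (by simp) (by simp)
    exact h1 x hx ((hjx.iff_of_edge hinv).1 ⟨hj, .refl⟩).2
  · rintro ⟨x, y, hne, hx, hy, hj⟩
    exact h.2.1 ⟨x, y, hne, hx, hy, hj.append⟩

lemma exists_reduction_of_orientable (h : Orientable a (t ++ u) b) :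
    ∃ a', IsLowerReduction a t a' ∧ Orientable a' u b := by
  obtain ⟨a', ha'⟩ := exists_isLowerReduction (full_of_orientable h)
  exact ⟨a', ha', ha'.orientable_iff.1 h⟩

theorem IsLowerReduction.append_iff (h : IsLowerReduction a t a') {a'' : ArcDiagram} :
    IsLowerReduction a (t ++ u) a'' ↔ IsLowerReduction a' u a'' := by
  have key : ∀ {x y}, Joined a (t ++ u) .empty ((t ++ u).length, x) ((t ++ u).length, y) ↔
      Joined a' u .empty (u.length, x) (u.length, y) := by
    intro x y
    rw [List.length_append]
    constructor
    · intro hj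
      have hl := h.lifted_iff (u := u) (b := .empty) (C := Joined a' u .empty (u.length, x))
        (fun p q h => joined_edge h) hj
      rcases hl.1 (Or.inr ⟨by simp, by simpa using Joined.refl⟩) with ⟨h1, i', h2, h3⟩ | ⟨h1, h2⟩
      · have hu : u.length = 0 := by simp at h1; simp [h1]
        rw [hu] at h2 h3 ⊢
        by_cases hyi : y = i'
        · rw [hyi]; exact h3
        · have := (h.joined_iff hyi).1 h2
          refine h3.trans (.symm (.rel _ _ ?_))
          rw [← this]
          exact .cup y
      · simpa using h2
    · exact fun hj => h.joined_append hj
  rw [isLowerReduction_iff, isLowerReduction_iff]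
  have hfull : Full a (t ++ u) ↔ Full a' u := by
    constructor
    · intro H j i hj
      obtain ⟨y, hy⟩ := H (t.length + j) i (by simp [hj])
      have hl := h.lifted_iff (u := u) (b := .empty) (C := Joined a' u .empty (j, i))
        (fun p q h => joined_edge h) hy
      rcases hl.1 (Or.inr ⟨by simp, by simpa using Joined.refl⟩) with ⟨h1, i', h2, h3⟩ | ⟨h1, h2⟩
      · have hu : u.length = 0 := by simp at h1; simp [h1]
        exact ⟨i', by rw [hu]; exact h3⟩
      · exact ⟨y, by simpa using h2⟩
    · intro H
      have hup : ∀ j i, j ≤ u.length →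
          ∃ y, Joined a (t ++ u) .empty (t.length + j, i) ((t ++ u).length, y) := by
        intro j i hj
        obtain ⟨y, hy⟩ := H j i hj
        exact ⟨y, by rw [List.length_append]; exact h.joined_append hy⟩
      intro j i hj
      by_cases hjt : t.length ≤ j
      · have := hup (j - t.length) i (by simp at hj; omega)
        rwa [show t.length + (j - t.length) = j by omega] at this
      · obtain ⟨y, hy⟩ := h.full j i (by omega)
        have hy' : Joined a (t ++ u) .empty (j, i) (t.length + 0, y) := hy.append
        obtain ⟨z, hz⟩ := hup 0 y (Nat.zero_le _)
        exact ⟨z, hy'.trans hz⟩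
  rw [hfull]
  exact and_congr_right fun _ => forall₂_congr fun x y => by rw [key]

end

/-! ### Mirror images of stacked diagrams -/

/-- The horizontal mirror image. -/
def flipAll (t : GenMatching) : GenMatching := (t.map Matching.flip).reverse

@[simp] lemma length_flipAll (t : GenMatching) : (flipAll t).length = t.length := by simp [flipAll]

@[simp] lemma flipAll_flipAll (t : GenMatching) : flipAll (flipAll t) = t := by
  simp [flipAll, List.map_reverse, Function.comp_def]

@[simp] lemma flipAll_append (t u : GenMatching) : flipAll (t ++ u) = flipAll u ++ flipAll t := by
  simp [flipAll]

@[simp] lemma flipAll_singleton (m : Matching) : flipAll [m] = [m.flip] := rfl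

section

variable {a b c : ArcDiagram} {t u : GenMatching}

lemma getElem?_flipAll {j : ℕ} {m : Matching} (h : t[j]? = some m) :
    (flipAll t)[t.length - (j + 1)]? = some m.flip := by
  have hj : j < t.length := (List.getElem?_eq_some_iff.1 h).1
  rw [flipAll, List.getElem?_reverse (by simp; omega), List.length_map,
    show t.length - 1 - (t.length - (j + 1)) = j by omega, List.getElem?_map, h]
  rfl

lemma Joined.flip {p q : ℕ × ℤ} (h : Joined a t b p q) :
    Joined b (flipAll t) a (t.length - p.1, p.2) (t.length - q.1, q.2) := by
  refine Joined.map (fun p => (t.length - p.1, p.2)) (fun p q h => ?_) h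
  cases h with
  | cup i =>
    have := Edge.cap (a := b) (t := flipAll t) (b := a) i
    rw [length_flipAll] at this
    exact .rel _ _ this
  | @layerCap j m h i =>
    have hj : j < t.length := (List.getElem?_eq_some_iff.1 h).1
    have := Edge.layerCup (a := b) (b := a) (getElem?_flipAll h) i
    rw [show t.length - (j + 1) + 1 = t.length - j by omega] at this
    exact .rel _ _ this
  | @layerCup j m h i => exact .rel _ _ (Edge.layerCap (getElem?_flipAll h) i)
  | @layerLine j m h i i' h' =>
    have hj : j < t.length := (List.getElem?_eq_some_iff.1 h).1
    have := Edge.layerLine (a := b) (b := a) (getElem?_flipAll h) (i := i') (i' := i)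
      ⟨h'.2.1, h'.1, h'.2.2.symm⟩
    rw [show t.length - (j + 1) + 1 = t.length - j by omega] at this
    exact .symm (.rel _ _ this)
  | cap i =>
    simp only [Nat.sub_self]
    exact .rel _ _ (.cup i)

lemma joined_flip_iff {j j' : ℕ} {i i' : ℤ} (hj : j ≤ t.length) (hj' : j' ≤ t.length) :
    Joined b (flipAll t) a (t.length - j, i) (t.length - j', i') ↔ Joined a t b (j, i) (j', i') := by
  constructor
  · intro h
    have := h.flip
    simp only [flipAll_flipAll, length_flipAll] at this
    rwa [Nat.sub_sub_self hj, Nat.sub_sub_self hj'] at this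
  · exact fun h => h.flip

lemma Orientable.flip (h : Orientable a t b) : Orientable b (flipAll t) a := by
  rw [orientable_iff] at h ⊢
  intro j i hj
  rw [length_flipAll] at hj ⊢
  obtain ⟨⟨x, hx, hjx⟩, y, hy, hjy⟩ := h (t.length - j) i (Nat.sub_le _ _)
  have h1 := hjx.flip
  have h2 := hjy.flip
  simp only [Nat.sub_sub_self hj, Nat.sub_zero, Nat.sub_self] at h1 h2
  exact ⟨⟨y, hy, h2⟩, x, hx, h1⟩

lemma orientable_flip : Orientable b (flipAll t) a ↔ Orientable a t b :=
  ⟨fun h => by simpa using h.flip, fun h => h.flip⟩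

lemma HasCircle.flip (h : HasCircle a t b) : HasCircle b (flipAll t) a := by
  obtain ⟨j, i, hj, h1, h2⟩ := h
  refine ⟨t.length - j, i, by simp, fun y hy hjy => h2 y hy ?_, fun x hx hjx => h1 x hx ?_⟩
  · rw [← joined_flip_iff hj le_rfl, Nat.sub_self]
    exact hjy
  · rw [← joined_flip_iff hj (Nat.zero_le _)]
    simpa using hjx

lemma hasCircle_flip : HasCircle b (flipAll t) a ↔ HasCircle a t b :=
  ⟨fun h => by simpa using h.flip, fun h => h.flip⟩

lemma hasBottomLine_flip : HasBottomLine b (flipAll t) a ↔ HasTopLine a t b := by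
  have key : ∀ x y, Joined b (flipAll t) a (0, x) (0, y) ↔
      Joined a t b (t.length, x) (t.length, y) := fun x y => by
    rw [← joined_flip_iff le_rfl le_rfl, Nat.sub_self]
  simp only [HasBottomLine, HasTopLine, key]

/-- This provides the upper version of every statement about lower reductions. -/
lemma isUpperReduction_iff : IsUpperReduction t b c ↔ IsLowerReduction b (flipAll t) c := by
  have key : ∀ x y, Joined b (flipAll t) .empty ((flipAll t).length, x) ((flipAll t).length, y) ↔
      Joined .empty t b (0, x) (0, y) := fun x y => by
    rw [← joined_flip_iff (Nat.zero_le _) (Nat.zero_le _), Nat.sub_zero, length_flipAll]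
  simp only [IsUpperReduction, IsLowerReduction, hasCircle_flip, hasBottomLine_flip, key]

theorem IsUpperReduction.orientable_iff {b' : ArcDiagram} (h : IsUpperReduction u b b') :
    Orientable a (t ++ u) b ↔ Orientable a t b' := by
  rw [isUpperReduction_iff] at h
  rw [← orientable_flip, flipAll_append, h.orientable_iff, orientable_flip]

theorem IsUpperReduction.append_iff {b' : ArcDiagram} (h : IsUpperReduction u b b') :
    IsUpperReduction (t ++ u) b c ↔ IsUpperReduction t b' c := by
  rw [isUpperReduction_iff] at h
  rw [isUpperReduction_iff, isUpperReduction_iff, flipAll_append, h.append_iff]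

lemma exists_upperReduction_of_orientable (h : Orientable a (t ++ u) b) :
    ∃ b', IsUpperReduction u b b' ∧ Orientable a t b' := by
  rw [← orientable_flip, flipAll_append] at h
  obtain ⟨b', h1, h2⟩ := exists_reduction_of_orientable h
  exact ⟨b', isUpperReduction_iff.2 h1, orientable_flip.1 h2⟩

/-! ### Translations -/

lemma ArcDiagram.shift_partner_add (a : ArcDiagram) (i : ℤ) :
    a.shift.partner (i + 1) = a.partner i + 1 := by simp [ArcDiagram.shift]

lemma ArcDiagram.shift_empty : ArcDiagram.empty.shift = .empty := by
  apply ArcDiagram.ext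
  funext i
  simp [ArcDiagram.shift, ArcDiagram.empty]

/-- The matching moved one step to the right. -/
def Matching.shift (m : Matching) : Matching where
  bot := m.bot.shift
  top := m.top.shift
  arcs_eq := by simp [ArcDiagram.arcs_shift, m.arcs_eq]

/-- All layers moved one step to the right. -/
def shiftAll (t : GenMatching) : GenMatching := t.map Matching.shift

@[simp] lemma length_shiftAll (t : GenMatching) : (shiftAll t).length = t.length := by simp [shiftAll]

lemma ddag_eq (t : GenMatching) : t.ddag = shiftAll (flipAll t) := by
  simp only [GenMatching.ddag, shiftAll, flipAll, List.map_reverse, List.map_map]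
  rfl

lemma Matching.joins_shift (m : Matching) {i i' : ℤ} :
    m.shift.Joins i i' ↔ m.Joins (i - 1) (i' - 1) := by
  have h1 := m.bot.idx_shift i
  have h2 := m.top.idx_shift i'
  simp only [ArcDiagram.idx] at h1 h2
  simp only [Matching.Joins, Matching.shift, ArcDiagram.isRay_shift]
  exact and_congr_right fun _ => and_congr_right fun _ => by omega

lemma joined_shift {p q : ℕ × ℤ} :
    Joined a.shift (shiftAll t) b.shift (p.1, p.2 + 1) (q.1, q.2 + 1) ↔ Joined a t b p q := by
  constructor
  · intro h
    have := Joined.map (a₂ := a) (t₂ := t) (b₂ := b) (fun p => (p.1, p.2 - 1)) (fun p q h => ?_) h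
    · simpa using this
    · have hg : ∀ {j : ℕ} {m : Matching}, (shiftAll t)[j]? = some m →
          ∃ m', t[j]? = some m' ∧ m = m'.shift := by
        intro j m h
        simp only [shiftAll, List.getElem?_map, Option.map_eq_some_iff] at h
        obtain ⟨m', h1, h2⟩ := h
        exact ⟨m', h1, h2.symm⟩
      cases h with
      | cup i =>
        have := Edge.cup (a := a) (t := t) (b := b) (i - 1)
        have h2 : Joined a t b _ _ := .rel _ _ this
        simpa [ArcDiagram.shift] using h2
      | layerCap h i =>
        obtain ⟨m', h1, rfl⟩ := hg h
        have := Edge.layerCap (a := a) (b := b) h1 (i - 1)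
        have h2 : Joined a t b _ _ := .rel _ _ this
        simpa [ArcDiagram.shift, Matching.shift] using h2
      | layerCup h i =>
        obtain ⟨m', h1, rfl⟩ := hg h
        have := Edge.layerCup (a := a) (b := b) h1 (i - 1)
        have h2 : Joined a t b _ _ := .rel _ _ this
        simpa [ArcDiagram.shift, Matching.shift] using h2
      | layerLine h h' =>
        obtain ⟨m', h1, rfl⟩ := hg h
        exact .rel _ _ (Edge.layerLine h1 (m'.joins_shift.1 h'))
      | cap i =>
        have := Edge.cap (a := a) (t := t) (b := b) (i - 1)
        have h2 : Joined a t b _ _ := .rel _ _ this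
        simpa [ArcDiagram.shift] using h2
  · refine Joined.map (fun p => (p.1, p.2 + 1)) fun p q h => ?_
    have hg : ∀ {j : ℕ} {m : Matching}, t[j]? = some m → (shiftAll t)[j]? = some m.shift := by
      intro j m h
      simp [shiftAll, h]
    cases h with
    | cup i =>
      have := Edge.cup (a := a.shift) (t := shiftAll t) (b := b.shift) (i + 1)
      rw [ArcDiagram.shift_partner_add] at this
      exact .rel _ _ this
    | @layerCap j m h i =>
      have := Edge.layerCap (a := a.shift) (b := b.shift) (hg h) (i + 1)
      rw [show m.shift.bot.partner (i + 1) = m.bot.partner i + 1 from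
        ArcDiagram.shift_partner_add _ _] at this
      exact .rel _ _ this
    | @layerCup j m h i =>
      have := Edge.layerCup (a := a.shift) (b := b.shift) (hg h) (i + 1)
      rw [show m.shift.top.partner (i + 1) = m.top.partner i + 1 from
        ArcDiagram.shift_partner_add _ _] at this
      exact .rel _ _ this
    | layerLine h h' =>
      exact .rel _ _ (Edge.layerLine (hg h) ((Matching.joins_shift _).2 (by simpa using h')))
    | cap i =>
      have := Edge.cap (a := a.shift) (t := shiftAll t) (b := b.shift) (i + 1)
      rw [ArcDiagram.shift_partner_add, length_shiftAll] at this
      exact .rel _ _ this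

lemma isLowerReduction_shift :
    IsLowerReduction a.shift (shiftAll t) c.shift ↔ IsLowerReduction a t c := by
  rw [isLowerReduction_iff, isLowerReduction_iff]
  simp only [Full, length_shiftAll]
  constructor
  · rintro ⟨h1, h2⟩
    refine ⟨fun j i hj => ?_, fun x y hxy => ?_⟩
    · obtain ⟨y, hy⟩ := h1 j (i + 1) hj
      refine ⟨y - 1, joined_shift.1 ?_⟩
      rw [ArcDiagram.shift_empty]
      simpa using hy
    · have := h2 (x + 1) (y + 1) (by omega)
      rw [ArcDiagram.shift_partner_add, add_left_inj] at this
      rw [← this, ← joined_shift, ArcDiagram.shift_empty]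
  · rintro ⟨h1, h2⟩
    refine ⟨fun j i hj => ?_, fun x y hxy => ?_⟩
    · obtain ⟨y, hy⟩ := h1 j (i - 1) hj
      refine ⟨y + 1, ?_⟩
      have := joined_shift.2 hy
      rw [ArcDiagram.shift_empty] at this
      simpa using this
    · have := h2 (x - 1) (y - 1) (by omega)
      rw [← joined_shift, ArcDiagram.shift_empty] at this
      simp only [sub_add_cancel] at this
      rw [this, ArcDiagram.shift]
      simp only
      omega

/-! ### Reductions of a single layer -/

/-- A strand has at most two ends, so once the arcs and the rays of `c` are realised by strands
there is no room for further connections. -/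
theorem isLowerReduction_of (hfull : Full a t)
    (harcs : ∀ x, c.partner x ≠ x → Joined a t .empty (t.length, x) (t.length, c.partner x))
    (hrays : ∀ x, c.IsRay x → ∃ x', a.IsRay x' ∧ Joined a t .empty (t.length, x) (0, x')) :
    IsLowerReduction a t c := by
  rw [isLowerReduction_iff]
  refine ⟨hfull, fun x y hxy => ⟨fun hj => ?_, ?_⟩⟩
  · rcases exists_end_of_top (a := a) (t := t) (isRay_empty x) with
      ⟨y', hne, -, hj', hno, hu⟩ | ⟨_, _, _, hu⟩
    · by_cases hx : c.partner x = x
      · obtain ⟨x', hx', hjx⟩ := hrays x hx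
        exact absurd hjx (hno x' hx')
      · have h1 := hu _ (isRay_empty _) (harcs x hx)
        have h2 := hu y (isRay_empty _) hj
        omega
    · exact absurd (hu y (isRay_empty y) hj).symm hxy
  · rintro rfl
    exact harcs x hxy.symm

/-- For an arc from `i` to `j`, induction on its length connects `i + 1` with `j` through the arcs
under it. With `i ~ j` and `i + 1 ~ j + 1` this gives `i ~ i + 1` and `j ~ j + 1`. Points with the
same number of rays to their left are separated by such steps only. -/
lemma ArcDiagram.eqv_of_idx {r : ArcDiagram} {E : ℤ → ℤ → Prop} (hE : Equivalence E)
    (h1 : ∀ i, E i (r.partner i)) (h2 : ∀ i, E (i + 1) (r.partner i + 1)) {i j : ℤ}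
    (hij : r.idx i = r.idx j) : E i j := by
  have chain : ∀ g g', g ≤ g' → (∀ z, g ≤ z → z < g' → E z (z + 1)) → E g g' := by
    intro g g' hg h
    induction g', hg using Int.leInduction with
    | base => exact hE.refl _
    | succ k hk ih => exact hE.trans (ih fun z hz hz' => h z hz (by omega)) (h k hk (by omega))
  have key : ∀ n : ℕ, ∀ i, i < r.partner i → r.partner i - i ≤ n →
      E i (i + 1) ∧ E (r.partner i) (r.partner i + 1) := by
    intro n
    induction n using Nat.strong_induction_on with
    | _ n ih =>
      intro i hi hn
      have h3 : E (i + 1) (r.partner i) := by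
        refine chain _ _ (by omega) fun z hz hz' => ?_
        obtain ⟨h4, h5, h6⟩ := r.inside (show i < z by omega) hz'
        rcases lt_or_gt_of_ne h4 with h7 | h7
        · have := ih (z - r.partner z).toNat (by omega) (r.partner z)
            (by rwa [r.partner_partner]) (by rw [r.partner_partner]; omega)
          rw [r.partner_partner] at this
          exact this.2
        · exact (ih (r.partner z - z).toNat (by omega) z h7 (by omega)).1
      have h4 : E i (i + 1) := hE.trans (h1 i) (hE.symm h3)
      exact ⟨h4, hE.trans (hE.symm (h1 i)) (hE.trans h4 (h2 i))⟩
  have hs : ∀ z, r.partner z ≠ z → E z (z + 1) := by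
    intro z hz
    rcases lt_or_gt_of_ne hz with h | h
    · have := key (z - r.partner z).toNat (r.partner z) (by rwa [r.partner_partner])
        (by rw [r.partner_partner]; omega)
      rw [r.partner_partner] at this
      exact this.2
    · exact (key (r.partner z - z).toNat z h (by omega)).1
  wlog hle : i ≤ j generalizing i j
  · exact hE.symm (this hij.symm (by omega))
  refine chain i j hle fun z hz hz' => hs z fun hr => ?_
  have h3 := r.idx_lt hr hz'
  have h4 := r.idx_mono hz
  omega

lemma equivalence_joined (a : ArcDiagram) (t : GenMatching) (b : ArcDiagram) (j : ℕ) :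
    Equivalence fun x y => Joined a t b (j, x) (j, y) :=
  ⟨fun _ => .refl, fun h => h.symm, fun h h' => h.trans h'⟩

/-- The arcs of `r` and their translates form zigzags, which connect all points with the same value
of `r.idx`. Each zigzag is left by exactly one line of the layer, directly above the ray of `m.top`
at which the line ends. Thus the layer is straightened to vertical lines, apart from cups of `m.top`
that `a` already contains. -/
lemma isLowerReduction_layer {r : ArcDiagram} {m : Matching}
    (h1 : ∀ i, Joined a [m] .empty (0, i) (0, r.partner i))
    (h2 : ∀ i, Joined a [m] .empty (0, i + 1) (0, r.partner i + 1))
    (hl : ∀ i j, m.Joins i j → r.idx i = r.idx j) (he : ∀ v, ∃ i j, m.Joins i j ∧ r.idx i = v)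
    (hsub : m.top.IsSubdiagram a) : IsLowerReduction a [m] a := by
  have hm : ([m] : GenMatching)[0]? = some m := rfl
  have hE : ∀ {i j}, r.idx i = r.idx j → Joined a [m] .empty (0, i) (0, j) := fun h =>
    ArcDiagram.eqv_of_idx (equivalence_joined a [m] .empty 0) h1 h2 h
  have hline : ∀ {i j}, m.Joins i j → Joined a [m] .empty (0, i) (1, j) := fun h =>
    .rel _ _ (.layerLine hm h)
  have hvert : ∀ j, m.top.IsRay j → Joined a [m] .empty (1, j) (0, j) := by
    intro j hj
    have h3 : m.Joins (m.bot.rayAt (m.top.idx j)) j :=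
      ⟨m.bot.isRay_rayAt _, hj, m.bot.idx_rayAt _⟩
    exact (hline h3).symm.trans (hE (hl _ _ h3))
  refine isLowerReduction_of (fun j i hj => ?_) (fun x hx => ?_) fun x hx => ?_
  · simp only [List.length_singleton] at hj ⊢
    rcases Nat.le_one_iff_eq_zero_or_eq_one.1 hj with rfl | rfl
    · obtain ⟨i', j', h3, h4⟩ := he (r.idx i)
      exact ⟨j', (hE h4.symm).trans (hline h3)⟩
    · exact ⟨i, .refl⟩
  · by_cases h3 : m.top.partner x = x
    · have h4 : m.top.partner (a.partner x) = a.partner x := by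
        by_contra h5
        rcases hsub (a.partner x) with h6 | h6
        · exact h5 h6
        · rw [a.partner_partner] at h6
          have := m.top.partner_partner (a.partner x)
          rw [h6, h3] at this
          exact hx this.symm
      exact (hvert x h3).trans ((Joined.symm (.symm (.rel _ _ (.cup x)))).trans (hvert _ h4).symm)
    · rcases hsub x with h4 | h4
      · exact absurd h4 h3
      · rw [← h4]
        exact .rel _ _ (.layerCup hm x)
  · refine ⟨x, hx, hvert x ?_⟩
    rcases hsub x with h4 | h4
    · exact h4
    · rw [ArcDiagram.IsRay, h4]
      exact hx

lemma ArcDiagram.idx_shift_ray {r : ArcDiagram} {i : ℤ} (h : r.shift.IsRay i) :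
    r.shift.idx i = r.idx i := by
  rw [ArcDiagram.isRay_shift] at h
  rw [r.idx_shift, ← r.idx_succ_ray h, sub_add_cancel]

theorem isLowerReduction_middle {r : ArcDiagram} (h : r.IsSubdiagram a) :
    IsLowerReduction a [Matching.middle r] a := by
  have hm : ([Matching.middle r] : GenMatching)[0]? = some (Matching.middle r) := rfl
  refine isLowerReduction_layer (r := r) (fun i => ?_) (fun i => ?_) (fun i j hij => ?_) (fun v => ?_) h
  · rcases h i with h1 | h1 <;> rw [h1]
    · exact .refl
    · exact .rel _ _ (.cup i)
  · rw [← r.shift_partner_add]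
    exact .rel _ _ (.layerCap hm (i + 1))
  · have h3 : r.shift.idx i = r.idx j := hij.2.2
    rw [← h3, ArcDiagram.idx_shift_ray hij.1]
  · refine ⟨r.shift.rayAt v, r.rayAt v, ⟨r.shift.isRay_rayAt v, r.isRay_rayAt v, ?_⟩, ?_⟩
    · exact (r.shift.idx_rayAt v).trans (r.idx_rayAt v).symm
    · rw [← ArcDiagram.idx_shift_ray (r.shift.isRay_rayAt v), r.shift.idx_rayAt]

theorem isLowerReduction_middle_flip {r : ArcDiagram} (h : r.shift.IsSubdiagram a) :
    IsLowerReduction a [(Matching.middle r).flip] a := by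
  have hm : ([(Matching.middle r).flip] : GenMatching)[0]? = some (Matching.middle r).flip := rfl
  refine isLowerReduction_layer (r := r) (fun i => ?_) (fun i => ?_) (fun i j hij => ?_) (fun v => ?_) h
  · exact .rel _ _ (.layerCap hm i)
  · rw [← r.shift_partner_add]
    rcases h (i + 1) with h1 | h1 <;> rw [h1]
    · exact .refl
    · exact .rel _ _ (.cup (i + 1))
  · have h3 : r.idx i = r.shift.idx j := hij.2.2
    rw [h3, ArcDiagram.idx_shift_ray hij.2.1]
  · exact ⟨r.rayAt v, r.shift.rayAt v, ⟨r.isRay_rayAt v, r.shift.isRay_rayAt v,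
      (r.idx_rayAt v).trans (r.shift.idx_rayAt v).symm⟩, r.idx_rayAt v⟩

theorem isUpperReduction_middle {r : ArcDiagram} (h : r.shift.IsSubdiagram b) :
    IsUpperReduction [Matching.middle r] b b := by
  rw [isUpperReduction_iff, flipAll_singleton]
  exact isLowerReduction_middle_flip h

theorem isUpperReduction_middle_flip {r : ArcDiagram} (h : r.IsSubdiagram b) :
    IsUpperReduction [(Matching.middle r).flip] b b := by
  rw [isUpperReduction_iff, flipAll_singleton]
  exact isLowerReduction_middle h

/-- If `a` and `m.bot` only form propagating lines, everything below the rays of `m.top`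
straightens, and the cups of `m.top` remain. -/
theorem isLowerReduction_cut {m : Matching} (h : Orientable a [] m.bot) :
    IsLowerReduction a [m] m.top := by
  have hm : ([m] : GenMatching)[0]? = some m := rfl
  rw [orientable_iff] at h
  have hsub : ∀ {p q}, Joined a [] m.bot p q → Joined a [m] .empty p q := fun h => by
    refine Joined.map id (fun p q h => ?_) h
    cases h with
    | cup i => exact .rel _ _ (.cup i)
    | layerCap h => simp at h
    | layerCup h => simp at h
    | layerLine h => simp at h
    | cap i => exact .rel _ _ (.layerCap hm i)
  refine isLowerReduction_of (fun j i hj => ?_) (fun x hx => .rel _ _ (.layerCup hm x)) fun x hx => ?_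
  · simp only [List.length_singleton] at hj ⊢
    rcases Nat.le_one_iff_eq_zero_or_eq_one.1 hj with rfl | rfl
    · obtain ⟨-, y, hy, hjy⟩ := h 0 i le_rfl
      exact ⟨m.top.rayAt (m.bot.idx y), (hsub hjy).trans (.rel _ _ (.layerLine hm
        ⟨hy, m.top.isRay_rayAt _, (m.top.idx_rayAt _).symm⟩))⟩
    · exact ⟨i, .refl⟩
  · obtain ⟨⟨y, hy, hjy⟩, -⟩ := h 0 (m.bot.rayAt (m.top.idx x)) le_rfl
    exact ⟨y, hy, .trans (.symm (.rel _ _ (.layerLine hm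
      ⟨m.bot.isRay_rayAt _, hx, m.bot.idx_rayAt _⟩))) (hsub hjy)⟩

theorem isUpperReduction_cut {m : Matching} (h : Orientable m.top [] b) :
    IsUpperReduction [m] b m.bot := by
  rw [isUpperReduction_iff, flipAll_singleton]
  exact isLowerReduction_cut (m := m.flip) (show Orientable b [] m.top from h.flip)

theorem orientable_self (a : ArcDiagram) : Orientable a [] a.shift := by
  rw [orientable_iff]
  intro j i hj
  obtain rfl : j = 0 := by simpa using hj
  have hE : ∀ {i j}, a.idx i = a.idx j → Joined a [] a.shift (0, i) (0, j) := fun h => by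
    refine ArcDiagram.eqv_of_idx (r := a) (equivalence_joined a [] a.shift 0) (fun i => ?_) (fun i => ?_) h
    · exact .rel _ _ (.cup i)
    · rw [← a.shift_partner_add]
      exact .rel _ _ (.cap (i + 1))
  refine ⟨⟨a.rayAt (a.idx i), a.isRay_rayAt _, hE (a.idx_rayAt _).symm⟩,
    a.shift.rayAt (a.idx i), a.shift.isRay_rayAt _, hE ?_⟩
  rw [← ArcDiagram.idx_shift_ray (a.shift.isRay_rayAt _), a.shift.idx_rayAt]

/-! ### The number of arcs -/

/-- The propagating lines give a bijection between the rays of `a` and those of `b` that is vertical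
outside a window. Within the window the number of rays determines the number of arcs. -/
theorem Orientable.arcs_eq (h : Orientable a t b) : a.arcs = b.arcs := by
  obtain ⟨N, hN0, hN⟩ := exists_bound a t b
  obtain ⟨A, hA0, hA⟩ := a.exists_window
  obtain ⟨B, hB0, hB⟩ := b.exists_window
  set M := max N (max A B) with hM
  have hcount : ∀ c : ArcDiagram, (∀ i, c.partner i ≠ i → -M ≤ i ∧ i ≤ M) →
      ({i | c.IsRay i} ∩ Set.Icc (-M) M).ncard + 2 * c.arcs = (2 * M + 1).toNat := by
    intro c hc
    have h1 : {i | c.partner i ≠ i} ⊆ Set.Icc (-M) M := fun i hi => hc i hi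
    have h2 : {i | c.IsRay i} ∩ Set.Icc (-M) M = Set.Icc (-M) M \ {i | c.partner i ≠ i} := by
      ext i
      simp only [Set.mem_inter_iff, Set.mem_ofPred_eq, ArcDiagram.IsRay, Set.mem_sdiff, not_not]
      tauto
    rw [h2, Set.ncard_sdiff h1 c.finite_arcs, c.ncard_nonray]
    have h3 := Set.ncard_le_ncard h1 (Set.finite_Icc _ _)
    rw [c.ncard_nonray] at h3
    rw [Nat.sub_add_cancel h3]
    rw [← Finset.coe_Icc, Set.ncard_coe_finset, Int.card_Icc]
    congr 1
    ring
  have ha := hcount a fun i hi => by have := hA i hi; omega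
  have hb := hcount b fun i hi => by have := hB i hi; omega
  rw [orientable_iff] at h
  have hmem : ∀ {p q}, Joined a t b p q → p.2 ∈ Set.Icc (-M) M → q.2 ∈ Set.Icc (-M) M := by
    intro p q hpq hp
    rw [Set.mem_Icc, ← abs_le] at hp ⊢
    by_contra hq
    have := hN _ _ hpq.symm (by omega)
    rw [this] at hp
    exact hq hp
  have huniq : ∀ {x y x' y'}, a.IsRay x → b.IsRay y → a.IsRay x' → b.IsRay y' →
      Joined a t b (0, x) (t.length, y) → Joined a t b (0, x') (t.length, y') → (x = x' ↔ y = y') := by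
    intro x y x' y' hx hy hx' hy' h1 h2
    rcases exists_end_of_bottom (t := t) (b := b) hx with ⟨_, _, _, _, hno⟩ | ⟨z, _, _, hu, hu'⟩
    · exact absurd h1 (hno y hy)
    · constructor
      · rintro rfl
        exact (hu' y hy h1).trans (hu' y' hy' h2).symm
      · rintro rfl
        exact (hu x' hx' (h1.trans h2.symm)).symm
  have : ({i | a.IsRay i} ∩ Set.Icc (-M) M).ncard = ({i | b.IsRay i} ∩ Set.Icc (-M) M).ncard := by
    choose F hF hF' using fun x => (h 0 x (Nat.zero_le _)).2
    refine Set.ncard_congr (fun x _ => F x) (fun x hx => ⟨hF x, hmem (hF' x) hx.2⟩)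
      (fun x x' hx hx' e => (huniq hx.1 (hF x) hx'.1 (hF x') (hF' x) (hF' x')).2 e) fun y hy => ?_
    obtain ⟨x, hx, hj⟩ := (h t.length y le_rfl).1
    refine ⟨x, ⟨hx, hmem hj hy.2⟩, ?_⟩
    exact (huniq hx (hF x) hx hy.1 (hF' x) hj.symm).1 rfl
  omega

lemma IsLowerReduction.arcs_eq (h : IsLowerReduction a t c) : c.arcs = a.arcs := by
  have := (h.orientable_iff (u := []) (b := c.shift)).2 (orientable_self c)
  rw [List.append_nil] at this
  rw [this.arcs_eq, c.arcs_shift]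

lemma IsUpperReduction.arcs_eq (h : IsUpperReduction t b c) : c.arcs = b.arcs :=
  (isUpperReduction_iff.1 h).arcs_eq

end

/-! ### Subdiagrams -/

namespace ArcDiagram

lemma IsSubdiagram.refl (a : ArcDiagram) : a.IsSubdiagram a := fun _ => .inr rfl

lemma empty_isSubdiagram (a : ArcDiagram) : empty.IsSubdiagram a := fun _ => .inl rfl

lemma IsSubdiagram.trans {a b c : ArcDiagram} (h : a.IsSubdiagram b) (h' : b.IsSubdiagram c) :
    a.IsSubdiagram c := fun i => by
  rcases h i with h1 | h1
  · exact .inl h1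
  · rw [h1]
    exact h' i

lemma IsSubdiagram.shift {a b : ArcDiagram} (h : a.IsSubdiagram b) : a.shift.IsSubdiagram b.shift :=
  fun i => by
    simp only [ArcDiagram.shift]
    rcases h (i - 1) with h1 | h1 <;> rw [h1]
    · left; omega
    · right; rfl

lemma Step.isSubdiagram {r r' : ArcDiagram} {p q : ℤ} (h : r.Step r' p q) : r'.IsSubdiagram r :=
  fun i => by
    by_cases h1 : i = p
    · exact .inl (h1 ▸ h.left)
    by_cases h2 : i = q
    · exact .inl (h2 ▸ h.right)
    exact .inr (h.same i h1 h2)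

/-- The arc starting at the leftmost endpoint is outermost, since an arc around it would start
further to the left. -/
lemma exists_step {r : ArcDiagram} (hr : r ≠ empty) : ∃ (r' : ArcDiagram) (p q : ℤ), r.Step r' p q := by
  have hne : ∃ i, r.partner i ≠ i := by
    by_contra! h
    exact hr (ArcDiagram.ext (funext h))
  obtain ⟨p, hp, hmin⟩ := Set.exists_min_image _ id r.finite_arcs hne
  simp only [Set.mem_ofPred_eq, id] at hp hmin
  have hpq : p < r.partner p := lt_of_le_of_ne (hmin _ (r.partner_ne hp)) hp.symm
  have hqp := r.partner_partner p
  have hsame : ∀ z, z ≠ p → z ≠ r.partner p → r.partner z ≠ p ∧ r.partner z ≠ r.partner p :=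
    fun z h1 h2 => ⟨fun h => h2 (by rw [← h, r.partner_partner]), fun h => h1 (r.partner_inj h)⟩
  refine ⟨⟨fun z => if z = p ∨ z = r.partner p then z else r.partner z, fun z => ?_, ?_,
    fun i k hik hk => ?_⟩, p, r.partner p, hpq, rfl, if_pos (.inl rfl),
    if_pos (.inr rfl), fun z h1 h2 => ?_⟩
  · by_cases h : z = p ∨ z = r.partner p
    · simp [h]
    · have := hsame z (fun h' => h (.inl h')) (fun h' => h (.inr h'))
      simp [h, this.1, this.2, r.partner_partner]
  · refine r.finite_arcs.subset fun z hz => ?_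
    simp only [Set.mem_ofPred_eq] at hz ⊢
    split_ifs at hz <;> simp_all
  · by_cases h : i = p ∨ i = r.partner p
    · rw [if_pos h] at hk; omega
    rw [if_neg h] at hk ⊢
    obtain ⟨h1, h2, h3⟩ := r.inside hik hk
    have h4 := hmin i (by omega)
    rw [if_neg]
    · exact ⟨h1, h2, h3⟩
    · rintro (rfl | rfl)
      · omega
      · omega
  · simp [h1, h2]

/-- A shortest missing arc can be restored, because all arcs under it are present. -/
lemma IsSubdiagram.exists_step {s a : ArcDiagram} (hs : s.IsSubdiagram a) (hne : s ≠ a) :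
    ∃ (s' : ArcDiagram) (p q : ℤ), s'.Step s p q ∧ s'.IsSubdiagram a := by
  have hfin : {i | i < a.partner i ∧ s.partner i = i}.Finite :=
    a.finite_arcs.subset fun i hi => ne_of_gt hi.1
  have hex : {i | i < a.partner i ∧ s.partner i = i}.Nonempty := by
    have : ∃ i, s.partner i ≠ a.partner i := by
      by_contra! h
      exact hne (ArcDiagram.ext (funext h))
    obtain ⟨i, hi⟩ := this
    have h1 : s.partner i = i := (hs i).resolve_right hi
    rcases lt_trichotomy i (a.partner i) with h | h | h
    · exact ⟨i, h, h1⟩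
    · omega
    · refine ⟨a.partner i, by rwa [a.partner_partner], ?_⟩
      rcases hs (a.partner i) with h2 | h2
      · exact h2
      · rw [a.partner_partner] at h2
        have := s.partner_partner (a.partner i)
        rw [h2, h1] at this
        omega
  obtain ⟨p, ⟨hp1, hp2⟩, hmin⟩ := Set.exists_min_image _ (fun i => a.partner i - i) hfin hex
  set q := a.partner p with hq
  have hqp : a.partner q = p := a.partner_partner p
  have hsq : s.partner q = q := by
    rcases hs q with h2 | h2
    · exact h2
    · have := s.partner_partner q
      rw [h2, hqp, hp2] at this
      omega
  have hsne : ∀ z, z ≠ p → z ≠ q → s.partner z ≠ p ∧ s.partner z ≠ q := fun z h1 h2 =>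
    ⟨fun h => h1 (s.partner_inj (h.trans hp2.symm)), fun h => h2 (s.partner_inj (h.trans hsq.symm))⟩
  have hin : ∀ z, p < z → z < q → s.partner z = a.partner z := by
    intro z h1 h2
    refine (hs z).resolve_left fun h => ?_
    obtain ⟨h3, h4, h5⟩ := a.inside h1 h2
    rcases lt_or_gt_of_ne h3 with h6 | h6
    · have := hmin (a.partner z) ⟨by rwa [a.partner_partner], ?_⟩
      · rw [a.partner_partner] at this; omega
      · rcases hs (a.partner z) with h7 | h7
        · exact h7
        · rw [a.partner_partner] at h7
          have := s.partner_partner (a.partner z)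
          rw [h7, h] at this
          omega
    · have := hmin z ⟨h6, h⟩
      omega
  refine ⟨⟨fun z => if z = p then q else if z = q then p else s.partner z, fun z => ?_, ?_,
    fun i k hik hk => ?_⟩, p, q, ⟨hp1, by simp, hp2, hsq, fun z h1 h2 => ?_⟩, fun z => ?_⟩
  · by_cases h1 : z = p
    · have : q ≠ p := by omega
      simp [h1, this]
    by_cases h2 : z = q
    · simp [h2, show q ≠ p by omega]
    have := hsne z h1 h2
    simp [h1, h2, this.1, this.2, s.partner_partner]
  · refine a.finite_arcs.subset fun z hz => ?_
    simp only [Set.mem_ofPred_eq] at hz ⊢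
    split_ifs at hz with h1 h2
    · rw [h1]; omega
    · rw [h2]; omega
    · rwa [← (hs z).resolve_left hz]
  · by_cases h1 : i = p
    · rw [if_pos h1] at hk ⊢
      have h2 := hin k (by omega) hk
      have h3 := a.inside (show p < k by omega) hk
      rw [if_neg (by omega), if_neg (by omega), h2]
      omega
    rw [if_neg h1] at hk ⊢
    by_cases h2 : i = q
    · rw [if_pos h2] at hk; omega
    rw [if_neg h2] at hk ⊢
    obtain ⟨h3, h4, h5⟩ := s.inside hik hk
    rw [if_neg, if_neg]
    · exact ⟨h3, h4, h5⟩
    · rintro rfl; exact h3 hsq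
    · rintro rfl; exact h3 hp2
  · simp [h1, h2]
  · change (if z = p then q else if z = q then p else s.partner z) = z ∨
      (if z = p then q else if z = q then p else s.partner z) = a.partner z
    split_ifs with h1 h2
    · right; rw [h1]
    · right; rw [h2, hqp]
    · exact hs z

lemma subdiagram_induction {a : ArcDiagram} {P : ArcDiagram → Prop} (h0 : P empty)
    (hs : ∀ r r' p q, r.IsSubdiagram a → r.Step r' p q → P r' → P r) {r : ArcDiagram}
    (hr : r.IsSubdiagram a) : P r := by
  generalize hn : {i | r.partner i ≠ i}.ncard = n
  induction n using Nat.strong_induction_on generalizing r with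
  | _ n ih =>
    by_cases h : r = empty
    · exact h ▸ h0
    · obtain ⟨r', p, q, h1⟩ := exists_step h
      refine hs r r' p q hr h1 (ih _ ?_ (h1.isSubdiagram.trans hr) rfl)
      rw [← hn]
      refine Set.ncard_lt_ncard ⟨fun i hi => ?_, fun h2 => ?_⟩ r.finite_arcs
      · rcases h1.isSubdiagram i with h3 | h3
        · exact absurd h3 hi
        · rw [Set.mem_ofPred_eq, ← h3]
          exact hi
      · have h3 : p ∈ {i | r.partner i ≠ i} := by
          have := h1.arc; have := h1.lt
          simp only [Set.mem_ofPred_eq]; omega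
        exact h2 h3 h1.left

lemma subdiagram_induction_down {a : ArcDiagram} {P : ArcDiagram → Prop} (h0 : P a)
    (hs : ∀ r r' p q, r.IsSubdiagram a → r.Step r' p q → P r → P r') {r : ArcDiagram}
    (hr : r.IsSubdiagram a) : P r := by
  have hfin : ∀ s : ArcDiagram, s.IsSubdiagram a → {i | s.partner i ≠ a.partner i}.Finite :=
    fun s hs => a.finite_arcs.subset fun i hi => by
      simp only [Set.mem_ofPred_eq] at hi ⊢
      rcases hs i with h1 | h1
      · rw [h1] at hi; exact hi.symm
      · exact absurd h1 hi
  generalize hn : {i | r.partner i ≠ a.partner i}.ncard = n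
  induction n using Nat.strong_induction_on generalizing r with
  | _ n ih =>
    by_cases h : r = a
    · exact h ▸ h0
    · obtain ⟨s, p, q, h1, h2⟩ := hr.exists_step h
      refine hs s r p q h2 h1 (ih _ ?_ h2 rfl)
      rw [← hn]
      have h4 : s.partner p ≠ p := by have := h1.arc; have := h1.lt; omega
      refine Set.ncard_lt_ncard ⟨fun i hi => ?_, fun h3 => ?_⟩ (hfin r hr)
      · simp only [Set.mem_ofPred_eq] at hi ⊢
        have h3 : s.partner i = i := (h2 i).resolve_right hi
        rcases h1.isSubdiagram i with h5 | h5
        · rw [h5]; exact fun h6 => hi (h3.trans h6)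
        · rw [h5]; exact hi
      · have h5 : s.partner p = a.partner p := (h2 p).resolve_left h4
        refine h3 (a := p) ?_ h5
        simp only [Set.mem_ofPred_eq]
        rw [h1.left, ← h5]
        exact h4.symm

end ArcDiagram

/-! ### Associativity of the surgery procedures -/

section

variable {a b c d : ArcDiagram} {u t v : GenMatching} {m m' f f' : Matching}

lemma orientable_square (hm : HexPair m m') (hf : HexPair f f')
    (h00 : Orientable a (u ++ m :: (t ++ f :: v)) b) (h10 : Orientable a (u ++ m' :: (t ++ f :: v)) b)
    (h11 : Orientable a (u ++ m' :: (t ++ f' :: v)) b) :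
    Orientable a (u ++ m :: (t ++ f' :: v)) b := by
  have e1 : ∀ x y z, (u ++ x :: (t ++ y :: v)).set u.length z = u ++ z :: (t ++ y :: v) := by
    intro x y z
    simp
  have e2 : ∀ x y z, (u ++ x :: (t ++ y :: v)).set (u.length + (t.length + 1)) z =
      u ++ x :: (t ++ z :: v) := by
    intro x y z
    rw [List.set_append_right _ _ (by omega), Nat.add_sub_cancel_left, List.set_cons_succ,
      List.set_append_right _ _ le_rfl, Nat.sub_self, List.set_cons_zero]
  rw [← e2 m f]
  refine square_orientable (p := u.length) (m := m) (m' := m') (n := f) (by simp) ?_ (by omega)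
    hm hf h00 (by rwa [e1]) (by rwa [e1, e2])
  rw [List.getElem?_append_right (by omega), Nat.add_sub_cancel_left, List.getElem?_cons_succ,
    List.getElem?_append_right le_rfl, Nat.sub_self, List.getElem?_cons_zero]

lemma orientable_square' (hm : HexPair m m') (hf : HexPair f f')
    (h00 : Orientable a (u ++ m :: (t ++ f :: v)) b) (h01 : Orientable a (u ++ m :: (t ++ f' :: v)) b)
    (h11 : Orientable a (u ++ m' :: (t ++ f' :: v)) b) :
    Orientable a (u ++ m' :: (t ++ f :: v)) b := by
  have e1 : ∀ x y z, (u ++ x :: (t ++ y :: v)).set u.length z = u ++ z :: (t ++ y :: v) := by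
    intro x y z
    simp
  have e2 : ∀ x y z, (u ++ x :: (t ++ y :: v)).set (u.length + (t.length + 1)) z =
      u ++ x :: (t ++ z :: v) := by
    intro x y z
    rw [List.set_append_right _ _ (by omega), Nat.add_sub_cancel_left, List.set_cons_succ,
      List.set_append_right _ _ le_rfl, Nat.sub_self, List.set_cons_zero]
  rw [← e1 m f]
  refine square_orientable (q := u.length) (n := m) (n' := m') (m := f) (m' := f')
    (p := u.length + (t.length + 1)) ?_ (by simp) (by omega) hf hm h00 (by rwa [e2])
    (by rwa [e2, e1])
  rw [List.getElem?_append_right (by omega), Nat.add_sub_cancel_left, List.getElem?_cons_succ,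
    List.getElem?_append_right le_rfl, Nat.sub_self, List.getElem?_cons_zero]

/-- The surgery procedures which remove the middle section of `a u b b t c` do not give zero. -/
def Surg (u t : GenMatching) (a b c : ArcDiagram) : Prop :=
  ∀ r : ArcDiagram, r.IsSubdiagram b → Orientable a (u ++ Matching.middle r :: t) c

lemma orientable_append_cons_of_lower (h : Orientable a u c) (r : ArcDiagram) (h' : ∀ a', IsLowerReduction a u a' → r.IsSubdiagram a') :
    Orientable a (u ++ Matching.middle r :: t) b ↔ Orientable a (u ++ t) b := by
  obtain ⟨a', h1, -⟩ := exists_reduction_of_orientable (u := []) (by simpa using h)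
  rw [h1.orientable_iff, h1.orientable_iff]
  exact (isLowerReduction_middle (h' _ h1)).orientable_iff (u := t)

lemma orientable_append_cons_of_upper (h : Orientable c t b) (r : ArcDiagram)
    (h' : ∀ b', IsUpperReduction t b b' → r.shift.IsSubdiagram b') :
    Orientable a (u ++ Matching.middle r :: t) b ↔ Orientable a (u ++ t) b := by
  obtain ⟨b', h1, -⟩ := exists_upperReduction_of_orientable (t := []) (by simpa using h)
  have h2 : IsUpperReduction ([Matching.middle r] ++ t) b b' :=
    h1.append_iff.2 (isUpperReduction_middle (h' _ h1))
  rw [h1.orientable_iff]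
  exact h2.orientable_iff

/-- Below an unsurgered middle section the picture straightens, so it may be cut there, and only the
upper factor remains. -/
lemma orientable_cut_lower (h : Orientable a u b.shift) :
    Orientable a (u ++ Matching.middle b :: t) c ↔ Orientable b t c := by
  obtain ⟨a', h1, h2⟩ := exists_reduction_of_orientable (u := []) (by simpa using h)
  rw [h1.orientable_iff]
  exact (isLowerReduction_cut (m := Matching.middle b) h2).orientable_iff (u := t)

lemma orientable_cut_upper (h : Orientable b t c) :
    Orientable a (u ++ Matching.middle b :: t) c ↔ Orientable a u b.shift := by
  obtain ⟨b', h1, h2⟩ := exists_upperReduction_of_orientable (t := []) (by simpa using h)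
  have h3 : IsUpperReduction ([Matching.middle b] ++ t) c b.shift :=
    h1.append_iff.2 (isUpperReduction_cut (m := Matching.middle b) h2)
  exact h3.orientable_iff

lemma Surg.orientable (h : Surg u t a b c) (h' : Orientable a u b.shift) :
    Orientable a (u ++ t) c := by
  have := h .empty b.empty_isSubdiagram
  rwa [orientable_append_cons_of_lower h' _ fun a' _ => a'.empty_isSubdiagram] at this

/-- Both conjunctions are equivalent to the orientability of all pictures with middle sections given
by `r ⊆ b` and `s ⊆ c`. The left one concerns the sides `s = c` and `r = ∅` of this grid, the right
one the sides `r = b` and `s = ∅`. From two such sides the grid is filled by squares of surgeries,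
each of which has three known corners. -/
theorem surg_assoc (h1 : Orientable a u b.shift) (h3 : Orientable c v d) :
    Surg u t a b c.shift ∧ Surg (u ++ t) v a c d ↔ Surg t v b c d ∧ Surg u (t ++ v) a b d := by
  have hA : ∀ r, Orientable a (u ++ Matching.middle r :: (t ++ Matching.middle c :: v)) d ↔
      Orientable a (u ++ Matching.middle r :: t) c.shift := fun r => by
    rw [← orientable_cut_upper h3, List.append_assoc, List.cons_append]
  have hB : ∀ s, Orientable a (u ++ Matching.middle b :: (t ++ Matching.middle s :: v)) d ↔
      Orientable b (t ++ Matching.middle s :: v) d := fun s => orientable_cut_lower h1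
  have hC : ∀ s, Orientable a (u ++ Matching.middle .empty :: (t ++ Matching.middle s :: v)) d ↔
      Orientable a (u ++ t ++ Matching.middle s :: v) d := fun s => by
    rw [orientable_append_cons_of_lower h1 _ fun a' _ => a'.empty_isSubdiagram, List.append_assoc]
  have hD : ∀ r, Orientable a (u ++ Matching.middle r :: (t ++ Matching.middle .empty :: v)) d ↔
      Orientable a (u ++ Matching.middle r :: (t ++ v)) d := fun r => by
    have := orientable_append_cons_of_upper (a := a) (u := u ++ Matching.middle r :: t) h3 .empty
      fun b' _ => by rw [ArcDiagram.shift_empty]; exact b'.empty_isSubdiagram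
    simpa only [List.append_assoc, List.cons_append] using this
  suffices (∀ r, r.IsSubdiagram b → ∀ s, s.IsSubdiagram c →
      Orientable a (u ++ Matching.middle r :: (t ++ Matching.middle s :: v)) d) ↔
      Surg u t a b c.shift ∧ Surg (u ++ t) v a c d by
    rw [← this]
    constructor
    · intro H
      exact ⟨fun s hs => (hB s).1 (H b (.refl b) s hs),
        fun r hr => (hD r).1 (H r hr .empty c.empty_isSubdiagram)⟩
    · rintro ⟨H1, H2⟩
      suffices ∀ s, s.IsSubdiagram c → ∀ r, r.IsSubdiagram b →
          Orientable a (u ++ Matching.middle r :: (t ++ Matching.middle s :: v)) d from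
        fun r hr s hs => this s hs r hr
      intro s hs
      -- The grid is filled from the corner `(b, ∅)`: `s` grows from `∅`, and for each `s` the
      -- diagram `r` shrinks from `b`. The new corner `(r', s)` completes the square of `(r, s)`,
      -- `(r, s')` and `(r', s')`.
      refine ArcDiagram.subdiagram_induction (a := c) (P := fun s => ∀ r, r.IsSubdiagram b →
        Orientable a (u ++ Matching.middle r :: (t ++ Matching.middle s :: v)) d)
        (fun r hr => (hD r).2 (H2 r hr)) (fun s s' p q hs hss' ih r hr => ?_) hs
      refine ArcDiagram.subdiagram_induction_down (a := b) (P := fun r => r.IsSubdiagram b →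
        Orientable a (u ++ Matching.middle r :: (t ++ Matching.middle s :: v)) d)
        (fun _ => (hB s).2 (H1 s hs)) (fun r r' p q hr hrr' hd hr' => ?_) hr hr
      exact orientable_square' (hexPair_middle hrr') (hexPair_middle hss') (hd hr) (ih r hr)
        (ih r' hr')
  constructor
  · intro H
    exact ⟨fun r hr => (hA r).1 (H r hr c (.refl c)),
      fun s hs => (hC s).1 (H .empty b.empty_isSubdiagram s hs)⟩
  · rintro ⟨H1, H2⟩
    intro r hr
    refine ArcDiagram.subdiagram_induction (a := b) (P := fun r => ∀ s, s.IsSubdiagram c →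
      Orientable a (u ++ Matching.middle r :: (t ++ Matching.middle s :: v)) d)
      (fun s hs => (hC s).2 (H2 s hs)) (fun r r' p q hr hrr' ih s hs => ?_) hr
    refine ArcDiagram.subdiagram_induction_down (a := c) (P := fun s => s.IsSubdiagram c →
      Orientable a (u ++ Matching.middle r :: (t ++ Matching.middle s :: v)) d)
      (fun _ => (hA r).2 (H1 r hr)) (fun s s' p q hs hss' hd hs' => ?_) hs hs
    exact orientable_square (hexPair_middle hrr') (hexPair_middle hss') (hd hs) (ih s hs)
      (ih s' hs')

lemma surg_unit_left (h : Orientable a t b) : Surg [] t a a b := fun _ hr =>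
  ((isLowerReduction_middle hr).orientable_iff (u := t)).2 h

lemma surg_unit_right (h : Orientable a t b.shift) : Surg t [] a b b.shift := fun _ hr =>
  (isUpperReduction_middle hr.shift).orientable_iff.2 h

end

/-! ### The bimodule axioms -/

section

variable {n : ℕ} {t : GenMatching}

lemma lift_basisVec {V : Type} [AddCommGroup V] [Module ℂ V] (f : Basis n t → V) (p : Basis n t) :
    lift f (basisVec p) = f p := by
  change Finsupp.linearCombination ℂ f (Finsupp.single p 1) = f p
  rw [Finsupp.linearCombination_single, one_smul]

/-- An orientable diagram as an element of the basis. -/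
def Basis.of {l m : Lam n} (h : Orientable l.cup t m.cap) : Basis n t := ⟨(l, m), h⟩

lemma diag_of {l m : Lam n} (h : Orientable l.cup t m.cap) : diag t l m = basisVec (.of h) :=
  dif_pos h

lemma diag_of_not {l m : Lam n} (h : ¬ Orientable l.cup t m.cap) : diag t l m = 0 := dif_neg h

lemma basisVec_eq (p : Basis n t) : basisVec p = diag t p.1.1 p.1.2 := (diag_of p.2).symm

open Classical in
lemma lact_basisVec (p : Basis n []) (q : Basis n t) : lact n t (basisVec p) (basisVec q) =
    if p.1.2 = q.1.1 ∧ Surg [] t p.1.1.cup p.1.2.cup q.1.2.cap then diag t p.1.1 q.1.2 else 0 :=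
  (LinearMap.congr_fun (lift_basisVec _ p) (basisVec q)).trans (lift_basisVec _ q)

open Classical in
lemma ract_basisVec (p : Basis n t) (q : Basis n []) : ract n t (basisVec p) (basisVec q) =
    if p.1.2 = q.1.1 ∧ Surg t [] p.1.1.cup p.1.2.cup q.1.2.cap then diag t p.1.1 q.1.2 else 0 :=
  (LinearMap.congr_fun (lift_basisVec _ p) (basisVec q)).trans (lift_basisVec _ q)

variable {k l l' m m' s : Lam n}

lemma lact_diag (h : Orientable k.cup [] l.cap) (h' : Orientable l.cup t m.cap)
    (hs : Surg [] t k.cup l.cup m.cap) : lact n t (diag [] k l) (diag t l m) = diag t k m := by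
  rw [diag_of h, diag_of h', lact_basisVec]
  exact if_pos ⟨rfl, hs⟩

lemma ract_diag (h : Orientable k.cup t l.cap) (h' : Orientable l.cup [] m.cap)
    (hs : Surg t [] k.cup l.cup m.cap) : ract n t (diag t k l) (diag [] l m) = diag t k m := by
  rw [diag_of h, diag_of h', ract_basisVec]
  exact if_pos ⟨rfl, hs⟩

lemma lact_diag_zero (hs : ¬ (l = l' ∧ Surg [] t k.cup l.cup m.cap)) :
    lact n t (diag [] k l) (diag t l' m) = 0 := by
  by_cases h1 : Orientable k.cup [] l.cap
  · by_cases h2 : Orientable l'.cup t m.cap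
    · rw [diag_of h1, diag_of h2, lact_basisVec]
      exact if_neg hs
    · rw [diag_of_not h2, map_zero]
  · rw [diag_of_not h1, map_zero, LinearMap.zero_apply]

lemma ract_diag_zero (hs : ¬ (l = l' ∧ Surg t [] k.cup l.cup m.cap)) :
    ract n t (diag t k l) (diag [] l' m) = 0 := by
  by_cases h1 : Orientable k.cup t l.cap
  · by_cases h2 : Orientable l'.cup [] m.cap
    · rw [diag_of h1, diag_of h2, ract_basisVec]
      exact if_neg hs
    · rw [diag_of_not h2, map_zero]
  · rw [diag_of_not h1, map_zero, LinearMap.zero_apply]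

/-- Both sides are either zero or the same basis vector, so only the conditions for being nonzero
have to be compared; this is `surg_assoc`. The two similar lemmas below differ in the position of
`t`. -/
lemma mul_lact_diag (h1 : Orientable k.cup [] l.cap) (h2 : Orientable l'.cup [] m.cap)
    (h3 : Orientable m'.cup t s.cap) :
    lact n t (lact n [] (diag [] k l) (diag [] l' m)) (diag t m' s) =
      lact n t (diag [] k l) (lact n t (diag [] l' m) (diag t m' s)) := by
  by_cases H : (l = l' ∧ Surg [] [] k.cup l.cup m.cap) ∧ m = m' ∧ Surg [] t k.cup m.cup s.cap
  · obtain ⟨⟨rfl, h4⟩, rfl, h5⟩ := H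
    obtain ⟨h6, h7⟩ := (surg_assoc (u := []) (t := []) h1 h3).1 ⟨h4, h5⟩
    have h8 : Orientable l.cup t s.cap := h6.orientable h2
    rw [lact_diag h1 h2 h4, lact_diag (h4.orientable h1) h3 h5, lact_diag h2 h3 h6,
      lact_diag h1 h8 h7]
  · trans 0
    · by_cases h4 : l = l' ∧ Surg [] [] k.cup l.cup m.cap
      · obtain ⟨rfl, h4⟩ := h4
        rw [lact_diag h1 h2 h4, lact_diag_zero fun h5 => H ⟨⟨rfl, h4⟩, h5⟩]
      · rw [lact_diag_zero h4, map_zero, LinearMap.zero_apply]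
    · by_cases h4 : m = m' ∧ Surg [] t l'.cup m.cup s.cap
      · obtain ⟨rfl, h4⟩ := h4
        rw [lact_diag h2 h3 h4, lact_diag_zero]
        rintro ⟨rfl, h5⟩
        obtain ⟨h6, h7⟩ := (surg_assoc (u := []) (t := []) h1 h3).2 ⟨h4, h5⟩
        exact H ⟨⟨rfl, h6⟩, rfl, h7⟩
      · rw [lact_diag_zero h4, map_zero]

lemma lact_ract_diag (h1 : Orientable k.cup [] l.cap) (h2 : Orientable l'.cup t m.cap)
    (h3 : Orientable m'.cup [] s.cap) :
    ract n t (lact n t (diag [] k l) (diag t l' m)) (diag [] m' s) =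
      lact n t (diag [] k l) (ract n t (diag t l' m) (diag [] m' s)) := by
  have key := fun h1 h3 => surg_assoc (u := []) (v := []) (t := t) (a := k.cup) (b := l'.cup)
    (c := m.cup) (d := s.cap) h1 h3
  rw [List.append_nil] at key
  by_cases H : (l = l' ∧ Surg [] t k.cup l.cup m.cap) ∧ m = m' ∧ Surg t [] k.cup m.cup s.cap
  · obtain ⟨⟨rfl, h4⟩, rfl, h5⟩ := H
    obtain ⟨h6, h7⟩ := (key h1 h3).1 ⟨h4, h5⟩
    have h8 := h6.orientable h2
    rw [List.append_nil] at h8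
    have h9 : Orientable k.cup t m.cap := h4.orientable h1
    rw [lact_diag h1 h2 h4, ract_diag h9 h3 h5, ract_diag h2 h3 h6,
      lact_diag h1 h8 h7]
  · trans 0
    · by_cases h4 : l = l' ∧ Surg [] t k.cup l.cup m.cap
      · obtain ⟨rfl, h4⟩ := h4
        rw [lact_diag h1 h2 h4, ract_diag_zero fun h5 => H ⟨⟨rfl, h4⟩, h5⟩]
      · rw [lact_diag_zero h4, map_zero, LinearMap.zero_apply]
    · by_cases h4 : m = m' ∧ Surg t [] l'.cup m.cup s.cap
      · obtain ⟨rfl, h4⟩ := h4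
        rw [ract_diag h2 h3 h4, lact_diag_zero]
        rintro ⟨rfl, h5⟩
        obtain ⟨h6, h7⟩ := (key h1 h3).2 ⟨h4, h5⟩
        exact H ⟨⟨rfl, h6⟩, rfl, h7⟩
      · rw [ract_diag_zero h4, map_zero]

lemma ract_mul_diag (h1 : Orientable k.cup t l.cap) (h2 : Orientable l'.cup [] m.cap)
    (h3 : Orientable m'.cup [] s.cap) :
    ract n t (ract n t (diag t k l) (diag [] l' m)) (diag [] m' s) =
      ract n t (diag t k l) (lact n [] (diag [] l' m) (diag [] m' s)) := by
  have key := fun h1 h3 => surg_assoc (u := t) (v := []) (t := []) (a := k.cup) (b := l'.cup)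
    (c := m.cup) (d := s.cap) h1 h3
  rw [List.append_nil] at key
  by_cases H : (l = l' ∧ Surg t [] k.cup l.cup m.cap) ∧ m = m' ∧ Surg t [] k.cup m.cup s.cap
  · obtain ⟨⟨rfl, h4⟩, rfl, h5⟩ := H
    obtain ⟨h6, h7⟩ := (key h1 h3).1 ⟨h4, h5⟩
    have h8 := h4.orientable h1
    rw [List.append_nil] at h8
    rw [ract_diag h1 h2 h4, ract_diag h8 h3 h5, lact_diag h2 h3 h6,
      ract_diag h1 (h6.orientable h2) h7]
  · trans 0
    · by_cases h4 : l = l' ∧ Surg t [] k.cup l.cup m.cap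
      · obtain ⟨rfl, h4⟩ := h4
        rw [ract_diag h1 h2 h4, ract_diag_zero fun h5 => H ⟨⟨rfl, h4⟩, h5⟩]
      · rw [ract_diag_zero h4, map_zero, LinearMap.zero_apply]
    · by_cases h4 : m = m' ∧ Surg [] [] l'.cup m.cup s.cap
      · obtain ⟨rfl, h4⟩ := h4
        rw [lact_diag h2 h3 h4, ract_diag_zero]
        rintro ⟨rfl, h5⟩
        obtain ⟨h6, h7⟩ := (key h1 h3).2 ⟨h4, h5⟩
        exact H ⟨⟨rfl, h6⟩, rfl, h7⟩
      · rw [lact_diag_zero h4, map_zero]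

lemma e_lact_self (l m : Lam n) : lact n t (e l) (diag t l m) = diag t l m := by
  by_cases h : Orientable l.cup t m.cap
  · exact lact_diag (orientable_self _) h (surg_unit_left h)
  · rw [diag_of_not h, map_zero]

lemma ract_e_self (l m : Lam n) : ract n t (diag t l m) (e m) = diag t l m := by
  by_cases h : Orientable l.cup t m.cap
  · exact ract_diag h (orientable_self _) (surg_unit_right h)
  · rw [diag_of_not h, map_zero, LinearMap.zero_apply]

theorem isBimodule (n : ℕ) (t : GenMatching) : IsBimodule n t where
  mul_lact a b x := by
    induction a using G_induction with
    | zero => simp [mul]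
    | add a a' ha ha' =>
      simp only [mul, map_add, LinearMap.add_apply] at ha ha' ⊢
      rw [ha, ha']
    | basis c p =>
      simp only [mul, map_smul, LinearMap.smul_apply]
      congr 1
      induction b using G_induction with
      | zero => simp
      | add b b' hb hb' => simp only [map_add, LinearMap.add_apply, hb, hb']
      | basis c q =>
        simp only [map_smul, LinearMap.smul_apply]
        congr 1
        induction x using G_induction with
        | zero => simp
        | add x x' hx hx' => simp only [map_add, hx, hx']
        | basis c r =>
          simp only [map_smul]
          congr 1
          rw [basisVec_eq p, basisVec_eq q, basisVec_eq r]
          exact mul_lact_diag p.2 q.2 r.2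
  lact_ract a x b := by
    induction a using G_induction with
    | zero => simp
    | add a a' ha ha' => simp only [map_add, LinearMap.add_apply, ha, ha']
    | basis c p =>
      simp only [map_smul, LinearMap.smul_apply]
      congr 1
      induction x using G_induction with
      | zero => simp
      | add b b' hb hb' => simp only [map_add, LinearMap.add_apply, hb, hb']
      | basis c q =>
        simp only [map_smul, LinearMap.smul_apply]
        congr 1
        induction b using G_induction with
        | zero => simp
        | add x x' hx hx' => simp only [map_add, hx, hx']
        | basis c r =>
          simp only [map_smul]
          congr 1
          rw [basisVec_eq p, basisVec_eq q, basisVec_eq r]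
          exact lact_ract_diag p.2 q.2 r.2
  ract_mul x a b := by
    induction x using G_induction with
    | zero => simp
    | add a a' ha ha' => simp only [map_add, LinearMap.add_apply, ha, ha']
    | basis c p =>
      simp only [map_smul, LinearMap.smul_apply]
      congr 1
      induction a using G_induction with
      | zero => simp [mul]
      | add b b' hb hb' =>
        simp only [mul, map_add, LinearMap.add_apply] at hb hb' ⊢
        rw [hb, hb']
      | basis c q =>
        simp only [mul, map_smul, LinearMap.smul_apply]
        congr 1
        induction b using G_induction with
        | zero => simp
        | add x x' hx hx' => simp only [map_add, hx, hx']
        | basis c r =>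
          simp only [map_smul]
          congr 1
          rw [basisVec_eq p, basisVec_eq q, basisVec_eq r]
          exact (ract_mul_diag p.2 q.2 r.2).symm
  e_lact_self := e_lact_self
  e_lact_of_ne _ _ _ h := lact_diag_zero fun h' => h h'.1
  ract_e_self := ract_e_self
  ract_e_of_ne _ _ _ h := ract_diag_zero fun h' => h h'.1

end

/-! ### Operations on arc diagrams, and the first difference of two arc diagrams -/

namespace ArcDiagram

/-- The diagram moved one step to the left. -/
def unshift (a : ArcDiagram) : ArcDiagram where
  partner i := a.partner (i + 1) - 1
  partner_partner i := by simp [a.partner_partner]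
  finite_arcs := by
    refine (a.finite_arcs.image (fun i => i - 1)).subset fun i hi => ⟨i + 1, ?_, by simp⟩
    simp only [Set.mem_ofPred_eq] at hi ⊢
    omega
  noncrossing i k h h' := by
    have := a.noncrossing (i + 1) (k + 1) (by omega) (by omega)
    omega

@[simp] lemma shift_unshift (a : ArcDiagram) : a.unshift.shift = a := by
  apply ArcDiagram.ext
  funext i
  simp [shift, unshift]

@[simp] lemma unshift_shift (a : ArcDiagram) : a.shift.unshift = a := by
  apply ArcDiagram.ext
  funext i
  simp [shift, unshift]

lemma shift_injective : Function.Injective shift := fun a b h => by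
  rw [← a.unshift_shift, h, b.unshift_shift]

lemma arcs_unshift (a : ArcDiagram) : a.unshift.arcs = a.arcs := by
  rw [← a.unshift.arcs_shift, shift_unshift]

/-- The arcs of `a` in a closed interval. -/
def restrict (a : ArcDiagram) (g g' : ℤ) (h : ∀ z, g ≤ z → z < g' → g ≤ a.partner z ∧ a.partner z < g') :
    ArcDiagram where
  partner z := if g ≤ z ∧ z < g' then a.partner z else z
  partner_partner z := by
    by_cases hz : g ≤ z ∧ z < g'
    · rw [if_pos hz, if_pos (h z hz.1 hz.2), a.partner_partner]
    · rw [if_neg hz, if_neg hz]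
  finite_arcs := a.finite_arcs.subset fun z hz => by
    simp only [Set.mem_ofPred_eq] at hz ⊢
    split_ifs at hz
    exacts [hz, absurd rfl hz]
  noncrossing i k hik hk := by
    by_cases hi : g ≤ i ∧ i < g'
    · rw [if_pos hi] at hk ⊢
      have := h i hi.1 hi.2
      rw [if_pos (by omega)]
      exact a.noncrossing i k hik hk
    · rw [if_neg hi] at hk
      omega

lemma restrict_isSubdiagram (a : ArcDiagram) {g g' : ℤ} (h) : (a.restrict g g' h).IsSubdiagram a := by
  intro z
  simp only [restrict]
  split_ifs <;> simp

lemma restrict_of_mem {a : ArcDiagram} {g g' z : ℤ} (h) (hz : g ≤ z) (hz' : z < g') :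
    (a.restrict g g' h).partner z = a.partner z := if_pos ⟨hz, hz'⟩

lemma restrict_of_notMem {a : ArcDiagram} {g g' z : ℤ} (h) (hz : ¬ (g ≤ z ∧ z < g')) :
    (a.restrict g g' h).partner z = z := if_neg hz

/-- The diagram with an additional arc between neighbouring rays. -/
def insertArc (a : ArcDiagram) (p : ℤ) (h : a.IsRay p) (h' : a.IsRay (p + 1)) : ArcDiagram where
  partner z := if z = p then p + 1 else if z = p + 1 then p else a.partner z
  partner_partner z := by
    have hne : ∀ z, z ≠ p → z ≠ p + 1 → a.partner z ≠ p ∧ a.partner z ≠ p + 1 := fun z h1 h2 =>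
      ⟨fun e => h1 (a.partner_inj (e.trans h.symm)), fun e => h2 (a.partner_inj (e.trans h'.symm))⟩
    by_cases h1 : z = p
    · simp [h1]
    by_cases h2 : z = p + 1
    · simp [h2]
    have := hne z h1 h2
    simp [h1, h2, this.1, this.2, a.partner_partner]
  finite_arcs := by
    refine (a.finite_arcs.union (Set.toFinite {p, p + 1})).subset fun z hz => ?_
    simp only [Set.mem_ofPred_eq, Set.mem_union, Set.mem_insert_iff, Set.mem_singleton_iff] at hz ⊢
    split_ifs at hz <;> simp_all
  noncrossing i k hik hk := by
    by_cases h1 : i = p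
    · rw [if_pos h1] at hk; omega
    rw [if_neg h1] at hk ⊢
    by_cases h2 : i = p + 1
    · rw [if_pos h2] at hk; omega
    rw [if_neg h2] at hk ⊢
    have h3 := a.inside hik hk
    rw [if_neg, if_neg]
    · exact h3
    · rintro rfl; exact h3.1 h'
    · rintro rfl; exact h3.1 h

/-- A right end is determined by the kinds of the points to the left. -/
lemma partner_eq_of_kinds {a b : ArcDiagram} {z : ℤ}
    (h : ∀ i < z, (i < a.partner i ↔ i < b.partner i) ∧ (a.partner i < i ↔ b.partner i < i)) {k : ℤ}
    (hk : k < z) (hak : a.partner k < k) : b.partner k = a.partner k := by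
  obtain ⟨N, -, hN⟩ := a.exists_window
  have hk0 := (hN k (by omega)).1
  generalize hn : (k + N).toNat = n
  induction n using Nat.strong_induction_on generalizing k with
  | _ n ih =>
    have hbk := (h k hk).2.1 hak
    by_contra hne
    rcases lt_or_gt_of_ne hne with h1 | h1
    · have h2 := b.inside h1 (by rwa [b.partner_partner])
      rw [b.partner_partner] at h2
      have h3 : a.partner k < b.partner (a.partner k) := by
        rw [← (h _ (by omega)).1, a.partner_partner]
        exact hak
      set k' := b.partner (a.partner k) with hk'
      have h4 : b.partner k' = a.partner k := b.partner_partner _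
      have h5 : a.partner k' < k' := by
        rw [(h k' (by omega)).2]; omega
      have := ih (k' + N).toNat (by have := (hN k' (by omega)).1; omega) (k := k') (by omega) h5
        (hN k' (by omega)).1 rfl
      rw [h4] at this
      have := a.partner_inj this
      omega
    · have h2 := a.inside h1 (by rwa [a.partner_partner])
      rw [a.partner_partner] at h2
      have h3 : b.partner k < a.partner (b.partner k) := by
        rw [(h _ (by omega)).1, b.partner_partner]
        exact hbk
      set k' := a.partner (b.partner k) with hk'
      have h4 : a.partner k' = b.partner k := a.partner_partner _
      have := ih (k' + N).toNat (by have := (hN k' (by omega)).1; omega) (k := k') (by omega)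
        (by omega) (hN k' (by omega)).1 rfl
      rw [h4] at this
      have := b.partner_inj this
      omega

/-- At the first place where two arc diagrams have different kinds of points, there is a block
`r + 1, …, z - 1` of common arcs such that, in one of the diagrams, `r` and `z` are joined or carry
rays, and, in the other one, `z` is a left end. -/
lemma exists_block {a b : ArcDiagram} (hab : a ≠ b) : ∃ c d : ArcDiagram,
    (c = a ∧ d = b ∨ c = b ∧ d = a) ∧ ∃ r z, r < z ∧
      (∀ k, r < k → k < z → d.partner k ≠ k ∧ d.partner k = c.partner k ∧
        r < d.partner k ∧ d.partner k < z) ∧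
      (c.partner r = z ∨ c.IsRay r ∧ c.IsRay z) ∧ z < d.partner z := by
  obtain ⟨N, -, hN⟩ := a.exists_window
  obtain ⟨M, -, hM⟩ := b.exists_window
  -- The kind of a point is: left end, right end or ray. An arc diagram is determined by the kinds
  -- of all points, and `z` below is the first place where the kinds differ.
  set P : ℤ → Prop := fun i => ¬ ((i < a.partner i ↔ i < b.partner i) ∧
    (a.partner i < i ↔ b.partner i < i)) with hP
  have hex : ∃ i, P i := by
    by_contra h'
    have h := fun i => not_not.1 (not_exists.1 h' i)
    refine hab (ArcDiagram.ext (funext fun k => ?_))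
    have key : ∀ k, a.partner k < k → b.partner k = a.partner k := fun k hk =>
      partner_eq_of_kinds (z := k + 1) (fun i _ => h i) (by omega) hk
    rcases lt_trichotomy (a.partner k) k with h1 | h1 | h1
    · exact (key k h1).symm
    · have := h k; omega
    · have h2 := key (a.partner k) (by rwa [a.partner_partner])
      rw [a.partner_partner] at h2
      rw [← h2, b.partner_partner, h2]
  obtain ⟨z, hz, hmin⟩ := Int.exists_least_of_bdd (P := P) ⟨min (-N) (-M), fun i hi => by
    by_contra hlt
    have h1 : a.partner i = i := by
      by_contra h1; have := hN i h1; omega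
    have h2 : b.partner i = i := by
      by_contra h2; have := hM i h2; omega
    simp [hP, h1, h2] at hi⟩ hex
  have hkind : ∀ i < z, (i < a.partner i ↔ i < b.partner i) ∧ (a.partner i < i ↔ b.partner i < i) :=
    fun i hi => by
      by_contra h
      have := hmin i h
      omega
  have main : ∀ c d : ArcDiagram, (∀ i < z, (i < c.partner i ↔ i < d.partner i) ∧
      (c.partner i < i ↔ d.partner i < i)) →
      (c.partner z < z ∧ ¬ d.partner z < z ∨ c.partner z = z ∧ z < d.partner z) →
      ∃ r z, r < z ∧ (∀ k, r < k → k < z → d.partner k ≠ k ∧ d.partner k = c.partner k ∧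
        r < d.partner k ∧ d.partner k < z) ∧
      (c.partner r = z ∨ c.IsRay r ∧ c.IsRay z) ∧ z < d.partner z := by
    intro c d hk hcd
    have hblock : ∀ r, r < z → (∀ k, r < k → k < z → c.partner k ≠ k ∧ r < c.partner k ∧
        c.partner k < z) → ∀ k, r < k → k < z → d.partner k ≠ k ∧ d.partner k = c.partner k ∧
        r < d.partner k ∧ d.partner k < z := by
      intro r hr h k h1 h2
      obtain ⟨h3, h4, h5⟩ := h k h1 h2
      have : d.partner k = c.partner k := by
        rcases lt_or_gt_of_ne h3 with h6 | h6
        · exact partner_eq_of_kinds hk h2 h6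
        · have := partner_eq_of_kinds hk h5 (by rwa [c.partner_partner])
          rw [c.partner_partner] at this
          rw [← this, d.partner_partner, this]
      rw [this]
      exact ⟨h3, rfl, h4, h5⟩
    rcases hcd with ⟨h1, h2⟩ | ⟨h1, h2⟩
    · refine ⟨c.partner z, z, h1, hblock _ h1 fun k h3 h4 => ?_, .inl (c.partner_partner z), ?_⟩
      · have := c.inside h3 (by rwa [c.partner_partner])
        rwa [c.partner_partner] at this
      -- In `d` the point `r` is a left end as well, but its arc closes neither before `z` nor at
      -- `z`. So this arc passes over `z`, and `z` must be a left end in `d`.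
      · set r := c.partner z with hr
        have h3 : r < d.partner r := by
          rw [← (hk r h1).1, hr, c.partner_partner]
          exact h1
        have h4 : c.partner r = z := c.partner_partner z
        have h5 : d.partner r ≠ z := fun h5 => h2 (by rw [← h5, d.partner_partner, h5]; exact h1)
        have h6 : ¬ d.partner r < z := fun h6 => by
          have h7 := partner_eq_of_kinds (k := d.partner r) hk h6
            (by rw [(hk _ h6).2, d.partner_partner]; exact h3)
          rw [d.partner_partner] at h7
          have : c.partner r = d.partner r := by rw [h7, c.partner_partner, ← h7]
          omega
        have h7 := d.inside h1 (by omega)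
        omega
    · set r := c.rayAt (c.idx z - 1) with hr
      have hrr : c.IsRay r := c.isRay_rayAt _
      have hri : c.idx r = c.idx z - 1 := c.idx_rayAt _
      have hrz : r < z := c.lt_of_idx_lt (by omega)
      refine ⟨r, z, hrz, hblock r hrz fun k h3 h4 => ⟨fun h5 => ?_, ?_, c.partner_lt_ray h1 h4⟩,
        .inr ⟨hrr, h1⟩, h2⟩
      · have h6 := c.idx_lt hrr h3
        have h7 := c.idx_lt h5 h4
        omega
      · by_contra h5
        rcases (not_lt.1 h5).eq_or_lt with h6 | h6
        · have := c.partner_inj (h6.trans hrr.symm)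
          omega
        · have := c.partner_lt_ray hrr h6
          rw [c.partner_partner] at this
          omega
  by_cases h1 : a.partner z < z
  · by_cases h2 : b.partner z < z
    · exfalso; simp only [hP] at hz; omega
    · exact ⟨a, b, .inl ⟨rfl, rfl⟩, main a b hkind (.inl ⟨h1, h2⟩)⟩
  · by_cases h2 : b.partner z < z
    · exact ⟨b, a, .inr ⟨rfl, rfl⟩, main b a (fun i hi => ⟨(hkind i hi).1.symm, (hkind i hi).2.symm⟩)
        (.inl ⟨h2, h1⟩)⟩
    · by_cases h3 : a.partner z = z
      · refine ⟨a, b, .inl ⟨rfl, rfl⟩, main a b hkind (.inr ⟨h3, ?_⟩)⟩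
        simp only [hP] at hz; omega
      · refine ⟨b, a, .inr ⟨rfl, rfl⟩, main b a (fun i hi => ⟨(hkind i hi).1.symm,
          (hkind i hi).2.symm⟩) (.inr ?_)⟩
        simp only [hP] at hz; omega

end ArcDiagram

/-! ### Cap diagrams are distinguished by the cup diagrams orientable with them -/

section

variable {a b c d : ArcDiagram} {t : GenMatching}

/-- Below `m b` its upper reduction, read as a cup diagram, gives an orientable picture by
`orientable_self`. The lower reduction of this cup diagram with `m` then contains the cups of
`m.top`. -/
lemma exists_bottom_orientable {m : Matching} (h : Full b [m.flip]) :
    ∃ k, (∀ i, m.top.partner i ≠ i → k.partner i = m.top.partner i) ∧ Orientable k [] b := by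
  obtain ⟨c, hc⟩ := exists_isLowerReduction h
  rw [show [m.flip] = flipAll [m] from rfl, ← isUpperReduction_iff] at hc
  have h1 : Orientable c.unshift ([] ++ [m]) b := by
    rw [hc.orientable_iff]
    simpa using orientable_self c.unshift
  obtain ⟨k, h2, h3⟩ := exists_reduction_of_orientable (u := []) (t := [m]) (by simpa using h1)
  refine ⟨k, fun i hi => (h2.joined_iff hi.symm).1 ?_, h3⟩
  exact .rel _ _ (.layerCup rfl i)

/-- At the first difference, `b` has no connection between the interval from `r` to `z` and the
points outside, whereas `g` has an arc that leaves it at `z`. A cup diagram `k` that pairs off this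
interval encloses a component without bottom end together with `b`. With `g` the cups can be chosen
such that the interval becomes one zigzag that leaves at `z`, and the rest of `k` comes from a
reduction. -/
theorem exists_distinguishing (hcd : c ≠ d) :
    ∃ k, ¬ (Orientable k [] c ↔ Orientable k [] d) := by
  obtain ⟨b, g, hbg, r, z, hrz, hblock, hb, hg⟩ := ArcDiagram.exists_block hcd
  suffices ∃ k, ¬ Orientable k [] b ∧ Orientable k [] g by
    obtain ⟨k, h1, h2⟩ := this
    refine ⟨k, ?_⟩
    rcases hbg with ⟨rfl, rfl⟩ | ⟨rfl, rfl⟩ <;> tauto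
  -- The common arcs between `r` and `z`, moved one step to the left: they form zigzags with the
  -- original arcs. The extra arc from `z - 1` to `z` in `τ` then connects the zigzag to `z`.
  set ρ := (g.restrict (r + 1) z fun k h1 h2 => by have := hblock k (by omega) h2; omega).unshift
    with hρ
  have hρ1 : ∀ i, r ≤ i → i < z - 1 → ρ.partner i = g.partner (i + 1) - 1 := fun i h1 h2 => by
    simp only [hρ, ArcDiagram.unshift]
    rw [ArcDiagram.restrict_of_mem _ (by omega) (by omega)]
  have hρ2 : ∀ i, ¬ (r ≤ i ∧ i < z - 1) → ρ.partner i = i := fun i h1 => by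
    simp only [hρ, ArcDiagram.unshift]
    rw [ArcDiagram.restrict_of_notMem _ (by omega)]
    omega
  have hρ3 : ∀ i, ρ.partner i + 1 = g.partner (i + 1) ∨ ρ.partner i = i := fun i => by
    by_cases h : r ≤ i ∧ i < z - 1
    · left; rw [hρ1 i h.1 h.2]; omega
    · exact .inr (hρ2 i h)
  set τ := ρ.insertArc (z - 1) (hρ2 _ (by omega)) (hρ2 _ (by omega)) with hτ
  have hτ1 : ∀ i, τ.partner i = if i = z - 1 then z - 1 + 1 else if i = z - 1 + 1 then z - 1
      else ρ.partner i := fun i => rfl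
  have hτ2 : ∀ i, r ≤ i → i ≤ z → τ.partner i ≠ i ∧ r ≤ τ.partner i ∧ τ.partner i ≤ z := by
    intro i h1 h2
    rw [hτ1]
    split_ifs with h3 h4
    · omega
    · omega
    · rw [hρ1 i h1 (by omega)]
      have := hblock (i + 1) (by omega) (by omega)
      omega
  have hτ3 : ∀ i, ¬ (r ≤ i ∧ i ≤ z) → τ.IsRay i := by
    intro i h1
    rw [ArcDiagram.IsRay, hτ1, if_neg (by omega), if_neg (by omega), hρ2 i (by omega)]
  set m : Matching := ⟨τ, τ, rfl⟩ with hm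
  have hmf : ([m.flip] : GenMatching)[0]? = some m := rfl
  have hray : ∀ i, τ.IsRay i → Joined g [m.flip] .empty (0, i) (1, i) := fun i hi =>
    .rel _ _ (.layerLine hmf ⟨hi, hi, rfl⟩)
  have hE := equivalence_joined g [m.flip] .empty 0
  have hτE : ∀ i, Joined g [m.flip] .empty (0, i) (0, τ.partner i) := fun i =>
    .rel _ _ (.layerCap hmf i)
  have hidx : ∀ {i}, r ≤ i → i ≤ z - 1 → Joined g [m.flip] .empty (0, i) (0, z - 1) := by
    intro i h1 h2
    refine ArcDiagram.eqv_of_idx (r := ρ) hE (fun i => ?_) (fun i => ?_) ?_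
    · by_cases h : r ≤ i ∧ i < z - 1
      · have := hτE i
        rwa [hτ1, if_neg (by omega), if_neg (by omega)] at this
      · rw [hρ2 i h]
        exact .refl
    · rcases hρ3 i with h | h <;> rw [h]
      · exact .rel _ _ (.cup (i + 1))
      · exact .refl
    · refine (ρ.idx_eq_of_arcs h2 fun k h3 h4 => ?_).symm
      rw [hρ1 k (by omega) h4]
      have := hblock (k + 1) (by omega) (by omega)
      omega
  have hz1 : Joined g [m.flip] .empty (0, z - 1) (0, z) := by
    have := hτE (z - 1)
    rwa [hτ1, if_pos rfl, sub_add_cancel] at this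
  have hfull : Full g [m.flip] := by
    intro j i hj
    simp only [List.length_singleton] at hj ⊢
    rcases Nat.le_one_iff_eq_zero_or_eq_one.1 hj with rfl | rfl
    · by_cases h : r ≤ i ∧ i ≤ z
      · refine ⟨g.partner z, ?_⟩
        have h1 : Joined g [m.flip] .empty (0, i) (0, z) := by
          rcases h.2.eq_or_lt with rfl | h2
          · exact .refl
          · exact (hidx h.1 (by omega)).trans hz1
        exact (h1.trans (.rel _ _ (.cup z))).trans (hray _ (hτ3 _ (by omega)))
      · exact ⟨i, hray i (hτ3 i h)⟩
    · exact ⟨i, .refl⟩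
  obtain ⟨k, hk, hko⟩ := exists_bottom_orientable hfull
  refine ⟨k, fun hkb => ?_, hko⟩
  have hkτ : ∀ i, r ≤ i → i ≤ z → k.partner i = τ.partner i := fun i h1 h2 => hk i (hτ2 i h1 h2).1
  have hmem : ∀ i, r ≤ i → i ≤ z → (r ≤ k.partner i ∧ k.partner i ≤ z) ∧
      r ≤ b.partner i ∧ b.partner i ≤ z := by
    intro i h1 h2
    refine ⟨by rw [hkτ i h1 h2]; exact (hτ2 i h1 h2).2, ?_⟩
    by_cases h3 : i = r
    · rcases hb with h4 | ⟨h4, -⟩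
      · rw [h3, h4]; omega
      · rw [h3, h4]; omega
    by_cases h5 : i = z
    · rcases hb with h4 | ⟨-, h4⟩
      · rw [h5, ← h4, b.partner_partner, h4]; omega
      · rw [h5, h4]; omega
    have := hblock i (by omega) (by omega)
    omega
  obtain ⟨⟨x, hx, hj⟩, -⟩ := orientable_iff.1 hkb 0 r (Nat.zero_le _)
  have hP := Joined.iff_of_edge (P := fun p => r ≤ p.2 ∧ p.2 ≤ z) (fun p q h => ?_) hj
  · have h1 := hP.1 ⟨le_rfl, hrz.le⟩
    refine (hτ2 x h1.1 h1.2).1 ?_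
    rw [← hkτ x h1.1 h1.2]
    exact hx
  · cases h with
    | cup i =>
      refine ⟨fun h => (hmem _ h.1 h.2).1, fun h => ?_⟩
      have := (hmem _ h.1 h.2).1
      rwa [k.partner_partner] at this
    | layerCap h => simp at h
    | layerCup h => simp at h
    | layerLine h => simp at h
    | cap i =>
      refine ⟨fun h => (hmem _ h.1 h.2).2, fun h => ?_⟩
      have := (hmem _ h.1 h.2).2
      rwa [b.partner_partner] at this

lemma Surg.swap (h : Surg [] [] a b a.shift) (hab : Orientable a [] b.shift) :
    Surg [] [] b a b.shift :=
  ((surg_assoc (u := []) (t := []) (v := []) hab hab).1 ⟨h, surg_unit_left hab⟩).1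

/-- If `(a b̄)(b ā) = e_a`, then multiplication by `a b̄` from the right cannot kill `c ā`, since a
further multiplication by `b ā` gives `c ā` back. -/
lemma Surg.orientable_imp (h : Surg [] [] a b a.shift) (hba : Orientable b [] a.shift)
    (hca : Orientable c [] a.shift) : Orientable c [] b.shift :=
  ((surg_assoc (u := []) (t := []) (v := []) hca hba).2 ⟨h, surg_unit_right hca⟩).1.orientable hca

/-- If `(a b̄)(b ā)` is nonzero, then the cup diagrams orientable with `ā` and with `b̄` are the
same. This makes the coefficient of an idempotent multiplicative and the surgery order
antisymmetric. -/
theorem Surg.eq (h : Surg [] [] a b a.shift) (hab : Orientable a [] b.shift)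
    (hba : Orientable b [] a.shift) : a = b := by
  by_contra hne
  obtain ⟨k, hk⟩ := exists_distinguishing (c := a.shift) (d := b.shift)
    fun h => hne (ArcDiagram.shift_injective h)
  exact hk ⟨fun h1 => h.orientable_imp hba h1, fun h1 => (h.swap hab).orientable_imp hab h1⟩

end

/-! ### The one-dimensional modules are well defined -/

section

variable {n : ℕ} {t : GenMatching}

lemma Basis.exists_of (p : Basis n t) : ∃ (k m : Lam n) (h : Orientable k.cup t m.cap),
    p = .of h := ⟨p.1.1, p.1.2, p.2, rfl⟩

open Classical in
lemma coeff_diag {l k m : Lam n} (h : Orientable k.cup [] m.cap) :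
    coeff l (diag [] k m) = if k = l ∧ m = l then (1 : ℂ) else 0 := by
  rw [diag_of h]
  exact (lift_basisVec _ _).trans (if_congr Prod.mk_inj rfl rfl)

/-- The coefficient of `e_λ` is a character. -/
theorem isCharacter (l : Lam n) : IsCharacter l := by
  classical
  refine ⟨?_, fun a b => ?_⟩
  · rw [e, coeff_diag (orientable_self _), if_pos ⟨rfl, rfl⟩]
  induction a using G_induction with
  | zero => simp [mul]
  | add a a' ha ha' =>
    simp only [mul, map_add, LinearMap.add_apply] at ha ha' ⊢
    rw [ha, ha']
    ring
  | basis x p =>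
    induction b using G_induction with
    | zero => simp [mul]
    | add b b' hb hb' =>
      simp only [mul, map_add] at hb hb' ⊢
      rw [hb, hb']
      ring
    | basis y q =>
      suffices coeff l (lact n [] (basisVec p) (basisVec q)) =
          coeff l (basisVec p) * coeff l (basisVec q) by
        simp only [mul, map_smul, LinearMap.smul_apply, this, smul_eq_mul]
        ring
      obtain ⟨k, m, hp, rfl⟩ := p.exists_of
      obtain ⟨m', s, hq, rfl⟩ := q.exists_of
      rw [← diag_of hp, ← diag_of hq, coeff_diag hp, coeff_diag hq]
      by_cases h : m = m' ∧ Surg [] [] k.cup m.cup s.cap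
      · obtain ⟨rfl, h⟩ := h
        rw [lact_diag hp hq h, coeff_diag (h.orientable hp)]
        by_cases hk : k = l ∧ s = l
        · obtain ⟨rfl, rfl⟩ := hk
          -- A product of two basis diagrams that is an idempotent has that idempotent as both
          -- factors.
          have : s = m := Subtype.ext (h.eq hp hq)
          simp [this]
        · rw [if_neg hk]
          by_cases hm : k = l ∧ m = l
          · rw [if_pos hm, if_neg fun h' => hk ⟨hm.1, h'.2⟩, mul_zero]
          · rw [if_neg hm, zero_mul]
      · rw [lact_diag_zero h, map_zero]
        by_cases hk : k = l ∧ m = l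
        · obtain ⟨rfl, rfl⟩ := hk
          rw [if_pos ⟨rfl, rfl⟩, one_mul, if_neg]
          rintro ⟨rfl, rfl⟩
          exact h ⟨rfl, surg_unit_left hq⟩
        · rw [if_neg hk, zero_mul]

theorem wellDefined (n : ℕ) : WellDefined n := ⟨isBimodule n, isCharacter⟩

end

/-! ### Finiteness, and the surgery order on the cup diagrams orientable with a fixed cap diagram -/

namespace ArcDiagram

lemma finite_of_window (M : ℤ) : {a : ArcDiagram | ∀ i, a.partner i ≠ i → |i| ≤ M}.Finite := by
  have hmem : ∀ a : {a : ArcDiagram | ∀ i, a.partner i ≠ i → |i| ≤ M}, ∀ i : Set.Icc (-M) M,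
      a.1.partner i ∈ Set.Icc (-M) M := by
    intro a i
    by_cases h : a.1.partner i = i
    · rw [h]; exact i.2
    · exact abs_le.1 (a.2 _ (a.1.partner_ne h))
  refine Set.finite_coe_iff.1 (Finite.of_injective
    (fun a (i : Set.Icc (-M) M) => (⟨a.1.partner i, hmem a i⟩ : Set.Icc (-M) M)) fun a b h => ?_)
  refine Subtype.ext (ArcDiagram.ext (funext fun i => ?_))
  by_cases hi : |i| ≤ M
  · exact congrArg Subtype.val (congr_fun h ⟨i, abs_le.1 hi⟩)
  · have ha := not_imp_comm.1 (a.2 i) hi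
    have hb := not_imp_comm.1 (b.2 i) hi
    rw [ha, hb]

lemma abs_partner_sub_le (a : ArcDiagram) (i : ℤ) : |a.partner i - i| ≤ 2 * a.arcs := by
  have key : ∀ i, i < a.partner i → a.partner i - i ≤ 2 * a.arcs := by
    intro i hi
    have h1 : Set.Ioo i (a.partner i) ⊆ {i | a.partner i ≠ i} := fun z hz => (a.inside hz.1 hz.2).1
    have h2 : Set.Ico i (a.partner i) ⊆ {i | a.partner i ≠ i} := fun z hz => by
      rcases hz.1.eq_or_lt with rfl | h
      · exact ne_of_gt hi
      · exact h1 ⟨h, hz.2⟩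
    have h3 := Set.ncard_le_ncard h2 a.finite_arcs
    rw [a.ncard_nonray, ← Finset.coe_Ico, Set.ncard_coe_finset, Int.card_Ico] at h3
    omega
  rcases lt_trichotomy i (a.partner i) with h | h | h
  · rw [abs_of_pos (by omega)]; exact key i h
  · rw [← h]; simp
  · have := key (a.partner i) (by rwa [a.partner_partner])
    rw [a.partner_partner] at this
    rw [abs_of_neg (by omega)]
    omega

lemma eq_of_arcs_subset {a b : ArcDiagram} (hab : a.arcs = b.arcs)
    (h : ∀ i, i < b.partner i → a.partner i = b.partner i) : a = b := by
  have h1 : {i | i < b.partner i} = {i | i < a.partner i} := by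
    refine Set.eq_of_subset_of_ncard_le (fun i hi => ?_) hab.le
      (a.finite_arcs.subset fun i hi => ne_of_gt hi)
    rw [Set.mem_ofPred_eq, h i hi]
    exact hi
  have h2 : ∀ i, i < b.partner i ↔ i < a.partner i := fun i => Set.ext_iff.1 h1 i
  have h3 : ∀ i, i < a.partner i → b.partner i = a.partner i := fun i hi =>
    (h i ((h2 i).2 hi)).symm
  refine ArcDiagram.ext (funext fun i => ?_)
  rcases lt_trichotomy i (a.partner i) with h4 | h4 | h4
  · exact (h3 i h4).symm
  · rcases lt_trichotomy i (b.partner i) with h5 | h5 | h5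
    · exact h i h5
    · omega
    · have := h (b.partner i) (by rwa [b.partner_partner])
      rw [b.partner_partner] at this
      rw [← this, a.partner_partner, this]
  · have := h3 (a.partner i) (by rwa [a.partner_partner])
    rw [a.partner_partner] at this
    rw [← this, b.partner_partner, this]

end ArcDiagram

section

variable {a a' a'' b : ArcDiagram}

/-- An arc of `a` between two rays of `b` would be a line with both ends at the top. So every arc of
`a` touches an arc of `b`, and its length is bounded by the number of arcs. -/
lemma finite_orientable (b : ArcDiagram) : {a | Orientable a [] b}.Finite := by
  obtain ⟨N, hN0, hN⟩ := b.exists_window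
  refine (ArcDiagram.finite_of_window (N + 2 * b.arcs)).subset fun a ha i hi => ?_
  have h1 := a.abs_partner_sub_le i
  rw [Orientable.arcs_eq ha] at h1
  by_cases h2 : b.partner i = i
  · by_cases h3 : b.partner (a.partner i) = a.partner i
    · exact absurd ⟨i, a.partner i, hi.symm, h2, h3, .rel _ _ (.cup i)⟩ ha.2.2
    · have := hN _ h3
      rw [abs_le] at h1 ⊢
      omega
  · have := hN _ h2
    rw [abs_le]
    omega

lemma Surg.orientable_left (h : Surg [] [] a' a b) (hab : Orientable a [] b) :
    Orientable a' [] a.shift :=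
  (orientable_cut_upper (u := []) hab).1 (h a (.refl a))

lemma Surg.orientable_right (h : Surg [] [] a' a b) (hab : Orientable a [] b) :
    Orientable a' [] b := by
  have := h .empty a.empty_isSubdiagram
  exact (orientable_append_cons_of_upper (u := []) hab .empty fun b' _ => by
    rw [ArcDiagram.shift_empty]; exact b'.empty_isSubdiagram).1 this

/-- For fixed `b`, the relation that `(a' ā)(a b)` is nonzero is an order on the diagrams `a`
orientable with `b`. Transitivity is an instance of associativity, and `Surg.antisymm` combines it
with `Surg.eq`. -/
lemma Surg.trans (h : Surg [] [] a' a b) (h' : Surg [] [] a'' a' b) (hab : Orientable a [] b) :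
    Surg [] [] a'' a b :=
  ((surg_assoc (u := []) (t := []) (v := []) (h'.orientable_left (h.orientable_right hab)) hab).2
    ⟨h, h'⟩).2

lemma Surg.antisymm (h : Surg [] [] a' a b) (h' : Surg [] [] a a' b) (hab : Orientable a [] b) :
    a' = a := by
  have h1 := h.orientable_left hab
  have h2 := h'.orientable_left (h.orientable_right hab)
  exact (((surg_assoc (u := []) (t := []) (v := []) h2 hab).2 ⟨h, h'⟩).1.eq h2 h1).symm

/-- Unless `a = b.shift`, some arc of `b.shift` is missing in `a`; a shortest one is added by a
surgery. This gives a diagram `a'` strictly below `a`. -/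
lemma exists_surg_ne (hab : Orientable a [] b) (hne : a ≠ b.shift) :
    ∃ a', a' ≠ a ∧ Surg [] [] a' a b := by
  have hex : {i | i < b.partner i ∧ a.partner (i + 1) ≠ b.partner i + 1}.Nonempty := by
    by_contra h
    refine hne (ArcDiagram.eq_of_arcs_subset (by rw [b.arcs_shift, hab.arcs_eq]) fun i hi => ?_)
    by_contra h'
    refine h ⟨i - 1, ?_, ?_⟩
    · simp only [ArcDiagram.shift] at hi; omega
    · simpa [ArcDiagram.shift] using h'
  -- Because the missing arc is shortest, the arcs under it, `s₀` translated by one, already belong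
  -- to `a`.
  obtain ⟨p, ⟨hp1, hp2⟩, hmin⟩ := Set.exists_min_image _ (fun i => b.partner i - i)
    (b.finite_arcs.subset fun i hi => ne_of_gt hi.1) hex
  set q := b.partner p with hq
  have hqp : b.partner q = p := b.partner_partner p
  have hin : ∀ z, p < z → z < q → b.partner z ≠ z ∧ p < b.partner z ∧ b.partner z < q :=
    fun z h1 h2 => b.inside h1 h2
  set s := b.restrict p (q + 1) fun z h1 h2 => by
    by_cases h3 : z = p
    · rw [h3]; omega
    by_cases h4 : z = q
    · rw [h4]; omega
    have := hin z (by omega) (by omega)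
    omega with hs
  set s₀ := b.restrict (p + 1) q fun z h1 h2 => by
    have := hin z (by omega) h2
    omega with hs₀
  have hstep : s.Step s₀ p q := by
    refine ⟨hp1, ArcDiagram.restrict_of_mem _ le_rfl (by omega),
      ArcDiagram.restrict_of_notMem _ (by omega), ArcDiagram.restrict_of_notMem _ (by omega),
      fun z h1 h2 => ?_⟩
    by_cases h3 : p < z ∧ z < q
    · rw [hs, hs₀, ArcDiagram.restrict_of_mem _ (by omega) (by omega),
        ArcDiagram.restrict_of_mem _ (by omega) (by omega)]
    · rw [hs, hs₀, ArcDiagram.restrict_of_notMem _ (by omega),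
        ArcDiagram.restrict_of_notMem _ (by omega)]
  have hs₀a : s₀.shift.IsSubdiagram a := by
    have key : ∀ i, p < i → i < q → i < b.partner i → a.partner (i + 1) = b.partner i + 1 := by
      intro i h1 h2 h3
      by_contra h4
      have := hmin i ⟨h3, h4⟩
      have := hin i h1 h2
      omega
    intro i
    simp only [ArcDiagram.shift]
    by_cases h : p < i - 1 ∧ i - 1 < q
    · right
      rw [hs₀, ArcDiagram.restrict_of_mem _ (by omega) (by omega)]
      obtain ⟨h1, h2, h3⟩ := hin _ h.1 h.2
      rcases lt_or_gt_of_ne h1 with h4 | h4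
      · have := key _ h2 h3 (by rwa [b.partner_partner])
        rw [b.partner_partner, sub_add_cancel] at this
        rw [← this, a.partner_partner, this]
      · have := key _ h.1 h.2 h4
        rw [sub_add_cancel] at this
        exact this.symm
    · left
      rw [hs₀, ArcDiagram.restrict_of_notMem _ (by omega), sub_add_cancel]
  have hlow := isLowerReduction_middle_flip hs₀a
  have hup : IsUpperReduction [(Matching.middle s).flip] b b :=
    isUpperReduction_middle_flip (b.restrict_isSubdiagram _)
  -- Seen from `b`, the inserted layer is a zigzag that can be straightened. Seen from `a`, it adds
  -- the arc from `p + 1` to `q + 1`; with `s₀` instead of `s` it would not change `a` either. The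
  -- squares for the step from `s` to `s₀` thus control the surgeries of `a`.
  have h0 : Orientable a ([] ++ [(Matching.middle s).flip]) b := hup.orientable_iff.2 hab
  obtain ⟨a', ha', -⟩ := exists_reduction_of_orientable (u := []) (t := [(Matching.middle s).flip]) h0
  have hpair := (hexPair_middle hstep).flip
  refine ⟨a', fun h => hp2 ?_, fun r hr => ?_⟩
  · rw [← h]
    refine (ha'.joined_iff (by omega)).1 (.rel _ _ ?_)
    have := Edge.layerCup (a := a) (b := .empty) (j := 0) (m := (Matching.middle s).flip)
      (t := [(Matching.middle s).flip]) rfl (p + 1)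
    rwa [show (Matching.middle s).flip.top.partner (p + 1) = q + 1 by
      rw [← hstep.arc]; exact s.shift_partner_add p] at this
  · rw [List.nil_append, ← ha'.orientable_iff]
    have hm₀ : ∀ r, r.IsSubdiagram a →
        Orientable a ([] ++ (Matching.middle s₀).flip :: ([] ++ Matching.middle r :: [])) b :=
      fun r hr => hlow.orientable_iff.2 ((isLowerReduction_middle hr).orientable_iff.2 hab)
    refine ArcDiagram.subdiagram_induction (a := a) (P := fun r =>
      Orientable a ([] ++ (Matching.middle s).flip :: ([] ++ Matching.middle r :: [])) b) ?_
      (fun r r' p q hr hrr' ih => ?_) hr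
    · refine (orientable_append_cons_of_upper (u := [(Matching.middle s).flip]) hab .empty
        fun b' _ => ?_).2 h0
      rw [ArcDiagram.shift_empty]; exact b'.empty_isSubdiagram
    · exact orientable_square' hpair (hexPair_middle hrr') (hm₀ r hr)
        (hm₀ r' (hrr'.isSubdiagram.trans hr)) ih

/-- By `exists_surg_ne` only `b.shift` can be minimal in the finite ordered set of the diagrams
orientable with `b`. The induction is on the number of elements below `a`. -/
theorem surg_shift (hab : Orientable a [] b) : Surg [] [] b.shift a b := by
  have hfin : ∀ a, {a' | Orientable a' [] b ∧ Surg [] [] a' a b}.Finite := fun a =>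
    (finite_orientable b).subset fun _ h => h.1
  generalize hn : {a' | Orientable a' [] b ∧ Surg [] [] a' a b}.ncard = n
  induction n using Nat.strong_induction_on generalizing a with
  | _ n ih =>
    by_cases h : a = b.shift
    · rw [h] at hab ⊢
      exact surg_unit_left hab
    · obtain ⟨a', h1, h2⟩ := exists_surg_ne hab h
      have h3 := h2.orientable_right hab
      refine h2.trans (ih _ ?_ h3 rfl) hab
      rw [← hn]
      refine Set.ncard_lt_ncard ⟨fun c hc => ⟨hc.1, h2.trans hc.2 hab⟩, fun h4 => h1 ?_⟩ (hfin a)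
      exact h2.antisymm (h4 (a := a) ⟨hab, surg_unit_left hab⟩).2 hab

lemma orientable_shift_self (hab : Orientable a [] b) : Orientable b.shift [] b :=
  (surg_shift hab).orientable_right hab

end

/-! ### Modules with a basis of weight vectors -/

lemma cls_eq_add {n : ℕ} {M' M M'' : KMod n} (h' : FiniteDimensional ℂ M'.carrier)
    (h : FiniteDimensional ℂ M.carrier) (h'' : FiniteDimensional ℂ M''.carrier)
    (H : KMod.IsExtension M' M M'') : cls M h = cls M' h' + cls M'' h'' := by
  change QuotientAddGroup.mk _ = QuotientAddGroup.mk (_ + _)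
  rw [QuotientAddGroup.eq_iff_sub_mem, ← sub_sub]
  exact AddSubgroup.subset_closure ⟨⟨M', h'⟩, ⟨M, h⟩, ⟨M'', h''⟩, H, rfl⟩

lemma cls_eq_zero {n : ℕ} {M : KMod n} (h : FiniteDimensional ℂ M.carrier)
    (H : Subsingleton M.carrier) : cls M h = 0 := by
  have := cls_eq_add h h h ⟨0, 0, fun _ _ => Subsingleton.elim _ _, fun _ _ => Subsingleton.elim _ _,
    fun _ _ _ => Subsingleton.elim _ _, fun x => ⟨x, Subsingleton.elim _ _⟩,
    Subsingleton.elim _ _⟩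
  simpa using this

namespace KMod

variable {n : ℕ}

/-- The quotient by a submodule. -/
def quot (M : KMod n) (N : Submodule ℂ M.carrier) (hN : M.IsSub N) : KMod n where
  carrier := M.carrier ⧸ N
  act :=
    { toFun := fun a => N.mapQ N (M.act a) (hN a)
      map_add' := fun a b => by
        ext v
        simp
      map_smul' := fun c a => by
        ext v
        simp }
  act_mul a b v := by
    obtain ⟨v, rfl⟩ := Submodule.Quotient.mk_surjective _ v
    change Submodule.Quotient.mk (M.act (mul a b) v) = Submodule.Quotient.mk (M.act a (M.act b v))
    rw [M.act_mul]
  locally_unital := by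
    rw [eq_top_iff]
    have h : (⊤ : Submodule ℂ (M.carrier ⧸ N)) = Submodule.map N.mkQ ⊤ := by
      rw [Submodule.map_top, Submodule.range_mkQ]
    rw [h, ← M.locally_unital, Submodule.map_iSup]
    refine iSup_mono fun l => ?_
    rintro _ ⟨_, ⟨v, rfl⟩, rfl⟩
    exact ⟨Submodule.Quotient.mk v, rfl⟩

/-- The linear map from `L(λ̄)` to `M` given by a vector of `M`. -/
def ofL (hw : WellDefined n) (l : Lam n) {M : KMod n} (v : M.carrier) :
    (L hw l).carrier →ₗ[ℂ] M.carrier := LinearMap.toSpanSingleton ℂ M.carrier v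

section

variable (hw : WellDefined n) {l : Lam n} {M : KMod n} {v : M.carrier}

lemma isHom_ofL (h : ∀ a, M.act a v = coeff l a • v) : (L hw l).IsHom M (ofL hw l v) :=
  fun a (x : ℂ) => by
    change (coeff l a * x) • v = M.act a (x • v)
    rw [map_smul, h, smul_smul, mul_comm]

lemma ofL_injective (h : v ≠ 0) : Function.Injective (ofL hw l v) :=
  LinearMap.ker_eq_bot.1 (LinearMap.ker_toSpanSingleton ℂ h)

lemma range_ofL (l : Lam n) (v : M.carrier) :
    LinearMap.range (ofL hw l v) = Submodule.span ℂ {v} :=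
  (LinearMap.span_singleton_eq_range ℂ M.carrier v).symm

end

/-- `M` has a basis of weight vectors `v μ`, for `μ` in `I`, on which the diagrams act by zero or by
moving one basis vector to another one. -/
structure IsThin (M : KMod n) (I : Finset (Lam n)) (v : Lam n → M.carrier) : Prop where
  span : Submodule.span ℂ (v '' I) = ⊤
  card_le : I.card ≤ Module.finrank ℂ M.carrier
  act_e : ∀ m ∈ I, M.act (e m) (v m) = v m
  act_diag : ∀ k l, ∀ m ∈ I, M.act (diag [] k l) (v m) = 0 ∨
    l = m ∧ k ∈ I ∧ M.act (diag [] k l) (v m) = v k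

namespace IsThin

variable {M : KMod n} {I : Finset (Lam n)} {v : Lam n → M.carrier} {k l m : Lam n}

lemma finiteDimensional (h : M.IsThin I v) : FiniteDimensional ℂ M.carrier :=
  ⟨Submodule.fg_def.2 ⟨_, I.finite_toSet.image v, h.span⟩⟩

/-- If one of the vectors were zero, fewer vectors than the dimension would span. -/
lemma ne_zero (h : M.IsThin I v) (hm : m ∈ I) : v m ≠ 0 := by
  classical
  intro h0
  have h1 : Submodule.span ℂ (v '' (I.erase m : Finset (Lam n))) = ⊤ := by
    rw [eq_top_iff, ← h.span, Submodule.span_le]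
    rintro _ ⟨k, hk, rfl⟩
    by_cases hkm : k = m
    · rw [hkm, h0]; exact Submodule.zero_mem _
    · exact Submodule.subset_span ⟨k, Finset.mem_erase.2 ⟨hkm, hk⟩, rfl⟩
  rw [← Finset.coe_image] at h1
  have h2 := finrank_span_finset_le_card (R := ℂ) ((I.erase m).image v)
  rw [Set.finrank, h1, finrank_top] at h2
  have h3 := h2.trans Finset.card_image_le
  have h4 := h.card_le
  rw [Finset.card_erase_of_mem hm] at h3
  have := Finset.card_pos.2 ⟨m, hm⟩
  omega

lemma act_diag_of_ne (h : M.IsThin I v) (hm : m ∈ I) (hlm : l ≠ m) :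
    M.act (diag [] k l) (v m) = 0 :=
  (h.act_diag k l m hm).resolve_right fun h' => hlm h'.1

lemma act_diag_of_ne_zero (h : M.IsThin I v) (hm : m ∈ I) (h' : M.act (diag [] k l) (v m) ≠ 0) :
    l = m ∧ k ∈ I ∧ M.act (diag [] k l) (v m) = v k := (h.act_diag k l m hm).resolve_left h'

/-- Two successive nonzero moves are the action of a nonzero product of two basis diagrams. If they
return to the starting vector, this product is an idempotent and `Surg.eq` makes both moves trivial.
So the moves define an order on the weights. -/
lemma act_trans (h : M.IsThin I v) (hm : m ∈ I) (h1 : M.act (diag [] l m) (v m) ≠ 0)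
    (h2 : M.act (diag [] k l) (v l) ≠ 0) :
    M.act (diag [] k m) (v m) ≠ 0 ∧ (k = m → l = m) := by
  obtain ⟨-, hl, h3⟩ := h.act_diag_of_ne_zero hm h1
  rw [← h3, ← M.act_mul] at h2
  have ho1 : Orientable l.cup [] m.cap := by
    by_contra ho
    rw [diag_of_not ho, map_zero, LinearMap.zero_apply] at h1
    exact h1 rfl
  have ho2 : Orientable k.cup [] l.cap := by
    by_contra ho
    rw [diag_of_not ho, mul, map_zero, LinearMap.zero_apply, map_zero, LinearMap.zero_apply] at h2
    exact h2 rfl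
  by_cases hs : Surg [] [] k.cup l.cup m.cap
  · rw [mul, lact_diag ho2 ho1 hs] at h2
    refine ⟨h2, ?_⟩
    rintro rfl
    exact (Subtype.ext (hs.eq ho2 ho1)).symm
  · rw [mul, lact_diag_zero fun h => hs h.2, map_zero, LinearMap.zero_apply] at h2
    exact absurd rfl h2

lemma exists_minimal (h : M.IsThin I v) (hI : I.Nonempty) :
    ∃ m ∈ I, ∀ k, k ≠ m → M.act (diag [] k m) (v m) = 0 := by
  set R : I → I → Prop := fun k m => k ≠ m ∧ M.act (diag [] k.1 m.1) (v m) ≠ 0 with hR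
  have : IsTrans I R := ⟨fun a b c hab hbc => by
    have := h.act_trans c.2 hbc.2 hab.2
    exact ⟨fun hac => hbc.1 (Subtype.ext (this.2 (congrArg Subtype.val hac))), this.1⟩⟩
  have : Std.Irrefl R := ⟨fun a ha => ha.1 rfl⟩
  have hwf : WellFounded R := Finite.wellFounded_of_trans_of_irrefl R
  obtain ⟨m, -, hm⟩ := hwf.has_min Set.univ ⟨⟨hI.choose, hI.choose_spec⟩, trivial⟩
  refine ⟨m, m.2, fun k hk => ?_⟩
  by_contra h1
  obtain ⟨-, hkI, -⟩ := h.act_diag_of_ne_zero m.2 h1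
  exact hm ⟨k, hkI⟩ trivial ⟨fun h2 => hk (congrArg Subtype.val h2), h1⟩

/-- A minimal weight vector spans a one-dimensional submodule. -/
lemma act_minimal (h : M.IsThin I v) (hm : m ∈ I)
    (hmin : ∀ k, k ≠ m → M.act (diag [] k m) (v m) = 0) (a : K n) :
    M.act a (v m) = coeff m a • v m := by
  induction a using G_induction with
  | zero => simp
  | add a b ha hb => simp [ha, hb, add_smul]
  | basis c p =>
    obtain ⟨k, l, hp, rfl⟩ := p.exists_of
    rw [← diag_of hp, map_smul, map_smul, LinearMap.smul_apply, coeff_diag hp, smul_assoc]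
    congr 1
    by_cases hl : l = m
    · subst hl
      by_cases hk : k = l
      · subst hk
        rw [if_pos ⟨rfl, rfl⟩, one_smul]
        exact h.act_e k hm
      · simp [hk, hmin k hk]
    · rw [h.act_diag_of_ne hm hl, if_neg fun h' => hl h'.2, zero_smul]

lemma exists_coord (h : M.IsThin I v) (hm : m ∈ I) :
    ∃ f : M.carrier →ₗ[ℂ] ℂ, (∀ x, M.act (e m) x = f x • v m) ∧ f (v m) = 1 ∧
      ∀ k ∈ I, k ≠ m → f (v k) = 0 := by
  have h1 : ∀ x, M.act (e m) x ∈ Submodule.span ℂ {v m} := by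
    intro x
    have hx : x ∈ Submodule.span ℂ (v '' I) := by rw [h.span]; trivial
    induction hx using Submodule.span_induction with
    | mem x hx =>
      obtain ⟨k, hk, rfl⟩ := hx
      by_cases hkm : k = m
      · rw [hkm, h.act_e m hm]
        exact Submodule.mem_span_singleton_self _
      · rw [e, h.act_diag_of_ne hk (Ne.symm hkm)]
        exact Submodule.zero_mem _
    | zero => simp
    | add x y _ _ hx hy => rw [map_add]; exact Submodule.add_mem _ hx hy
    | smul c x _ hx => rw [map_smul]; exact Submodule.smul_mem _ _ hx
  have h0 := h.ne_zero hm
  set f : M.carrier →ₗ[ℂ] ℂ := (LinearEquiv.coord ℂ M.carrier (v m) h0).toLinearMap ∘ₗ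
    (M.act (e m)).codRestrict _ h1 with hf
  have hf1 : ∀ x, M.act (e m) x = f x • v m := fun x =>
    (LinearEquiv.coord_apply_smul ℂ M.carrier (v m) h0 ⟨_, h1 x⟩).symm
  refine ⟨f, hf1, ?_, fun k hk hkm => ?_⟩
  · have := hf1 (v m)
    rw [h.act_e m hm] at this
    have h2 : (f (v m) - 1) • v m = 0 := by rw [sub_smul, ← this, one_smul, sub_self]
    exact sub_eq_zero.1 ((smul_eq_zero.1 h2).resolve_right h0)
  · have := hf1 (v k)
    rw [e, h.act_diag_of_ne hk (Ne.symm hkm)] at this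
    exact (smul_eq_zero.1 this.symm).resolve_right h0

/-- A minimal weight vector spans a submodule `L(μ̄)`, and the quotient has the remaining weight
vectors as a basis of the same kind. -/
theorem cls_eq (hw : WellDefined n) (h : M.IsThin I v) (hfd : FiniteDimensional ℂ M.carrier) :
    cls M hfd = ∑ m ∈ I, cls (L hw m) (L_finiteDimensional hw m) := by
  classical
  generalize hc : I.card = c
  induction c generalizing M I with
  | zero =>
    rw [Finset.card_eq_zero] at hc
    subst hc
    rw [Finset.sum_empty]
    refine cls_eq_zero hfd ?_
    have := h.span
    rw [Finset.coe_empty, Set.image_empty, Submodule.span_empty] at this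
    exact (Submodule.subsingleton_iff ℂ).1 (subsingleton_of_bot_eq_top this)
  | succ c ih =>
    obtain ⟨m, hm, hmin⟩ := h.exists_minimal (Finset.card_pos.1 (by omega))
    have hact := h.act_minimal hm hmin
    have hsub : M.IsSub (Submodule.span ℂ {v m}) := by
      intro a x hx
      obtain ⟨y, rfl⟩ := Submodule.mem_span_singleton.1 hx
      rw [map_smul, hact, smul_smul]
      exact Submodule.smul_mem _ _ (Submodule.mem_span_singleton_self _)
    set N := Submodule.span ℂ {v m} with hN
    have hq : FiniteDimensional ℂ (M.quot N hsub).carrier :=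
      inferInstanceAs (FiniteDimensional ℂ (M.carrier ⧸ N))
    have hcard : (I.erase m).card = c := by rw [Finset.card_erase_of_mem hm, hc]; rfl
    have hthin : (M.quot N hsub).IsThin (I.erase m) fun k => N.mkQ (v k) := by
      refine ⟨?_, ?_, fun k hk => ?_, fun j k l hl => ?_⟩
      · have h1 : Submodule.map N.mkQ (Submodule.span ℂ (v '' I)) = ⊤ := by
          rw [h.span, Submodule.map_top, Submodule.range_mkQ]
        change Submodule.span ℂ ((fun k => N.mkQ (v k)) '' (I.erase m : Finset (Lam n))) = ⊤
        rw [eq_top_iff, ← h1, Submodule.map_span, Submodule.span_le]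
        rintro _ ⟨_, ⟨k, hk, rfl⟩, rfl⟩
        by_cases hkm : k = m
        · have : N.mkQ (v k) = 0 := by
            rw [hkm, Submodule.mkQ_apply, Submodule.Quotient.mk_eq_zero]
            exact Submodule.mem_span_singleton_self _
          rw [this]
          exact Submodule.zero_mem _
        · exact Submodule.subset_span ⟨k, Finset.mem_erase.2 ⟨hkm, hk⟩, rfl⟩
      · have h1 := N.finrank_quotient_add_finrank
        have h2 : Module.finrank ℂ N = 1 := finrank_span_singleton (h.ne_zero hm)
        have h3 := h.card_le
        change _ ≤ Module.finrank ℂ (M.carrier ⧸ N)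
        omega
      · change N.mkQ (M.act (e k) (v k)) = _
        rw [h.act_e k (Finset.mem_of_mem_erase hk)]
      · have hl' := Finset.mem_erase.1 hl
        change N.mkQ (M.act (diag [] j k) (v l)) = 0 ∨
          k = l ∧ j ∈ I.erase m ∧ N.mkQ (M.act (diag [] j k) (v l)) = N.mkQ (v j)
        rcases h.act_diag j k l hl'.2 with h1 | ⟨h1, h2, h3⟩
        · left; rw [h1, map_zero]
        · by_cases hjm : j = m
          · left
            rw [h3, hjm, Submodule.mkQ_apply, Submodule.Quotient.mk_eq_zero]
            exact Submodule.mem_span_singleton_self _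
          · exact .inr ⟨h1, Finset.mem_erase.2 ⟨hjm, h2⟩, by rw [h3]⟩
    rw [← Finset.add_sum_erase _ _ hm, ← ih hthin hq hcard]
    exact cls_eq_add _ _ _ ⟨ofL hw m (v m), N.mkQ, isHom_ofL hw hact, fun _ _ => rfl,
      ofL_injective hw (h.ne_zero hm), N.mkQ_surjective, (range_ofL hw m _).trans N.ker_mkQ.symm⟩

lemma eq_top_of_mem (h : M.IsThin I v) (hgen : ∀ k ∈ I, v k = M.act (diag [] k m) (v m))
    {N : Submodule ℂ M.carrier} (hN : M.IsSub N) (hm : v m ∈ N) : N = ⊤ := by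
  rw [eq_top_iff, ← h.span, Submodule.span_le]
  rintro _ ⟨k, hk, rfl⟩
  rw [hgen k hk]
  exact hN _ _ hm

/-- A module generated by a weight vector is indecomposable, with irreducible head. -/
theorem head (hw : WellDefined n) (h : M.IsThin I v) (hm : m ∈ I)
    (hgen : ∀ k ∈ I, v k = M.act (diag [] k m) (v m)) :
    M.IsIndecomposable ∧ M.HeadIso (L hw m) := by
  obtain ⟨f, hf, hf1, hf0⟩ := h.exists_coord hm
  -- A proper submodule does not contain the generator `v m`. As `e m` maps `x` to `f x • v m`, it
  -- lies in the kernel of `f`, which therefore is the largest proper submodule.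
  have hprop : ∀ N, M.IsSub N → N ≠ ⊤ → N ≤ LinearMap.ker f := by
    intro N hN hne x hx
    by_contra hfx
    refine hne (h.eq_top_of_mem hgen hN ?_)
    have h1 := hN (e m) x hx
    rw [hf] at h1
    exact (Submodule.smul_mem_iff N hfx).1 h1
  have hne : LinearMap.ker f ≠ ⊤ := fun h1 => by
    have : v m ∈ LinearMap.ker f := by rw [h1]; trivial
    rw [LinearMap.mem_ker, hf1] at this
    exact one_ne_zero this
  have hhom : ∀ a x, f (M.act a x) = coeff m a * f x := by
    intro a x
    have hx : x ∈ Submodule.span ℂ (v '' I) := by rw [h.span]; trivial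
    induction hx using Submodule.span_induction with
    | zero => simp
    | add x y _ _ hx hy => rw [map_add, map_add, hx, hy, map_add, mul_add]
    | smul c x _ hx => rw [map_smul, map_smul, hx, map_smul, smul_eq_mul, smul_eq_mul]; ring
    | mem x hx =>
      obtain ⟨l, hl, rfl⟩ := hx
      induction a using G_induction with
      | zero => simp
      | add a b ha hb => simp only [map_add, LinearMap.add_apply, ha, hb, add_mul]
      | basis c p =>
        obtain ⟨j, k, hp, rfl⟩ := p.exists_of
        rw [← diag_of hp, map_smul, map_smul, LinearMap.smul_apply, map_smul, coeff_diag hp,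
          smul_mul_assoc]
        congr 1
        rcases h.act_diag j k l hl with h1 | ⟨rfl, h2, h3⟩
        · rw [h1, map_zero]
          by_cases hjk : j = m ∧ k = m
          · obtain ⟨rfl, rfl⟩ := hjk
            by_cases hlk : l = k
            · rw [hlk] at h1
              exact absurd (h1.symm.trans (h.act_e k hm)).symm (h.ne_zero hm)
            · rw [hf0 l hl hlk]; simp
          · simp [hjk]
        · rw [h3]
          by_cases hj : j = m
          · subst hj
            by_cases hk : k = j
            · simp [hk]
            -- The vector `v k` arises from `v j` by a move; moving it back to `v j` would
            -- contradict the antisymmetry in `act_trans`.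
            · exfalso
              have h4 : M.act (diag [] k j) (v j) ≠ 0 := by
                rw [← hgen k hl]; exact h.ne_zero hl
              exact hk ((h.act_trans hm h4 (by rw [h3]; exact h.ne_zero hm)).2 rfl)
          · simp [hj, hf0 j h2 hj]
  have hker : M.IsSub (LinearMap.ker f) := fun a x hx => by
    rw [LinearMap.mem_ker] at hx ⊢
    rw [hhom, hx, mul_zero]
  have hrad : M.radical = LinearMap.ker f := by
    refine le_antisymm (sInf_le ⟨hker, hne, fun N hN hle => ?_⟩) (le_sInf fun N hN => ?_)
    · by_cases hN' : N = ⊤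
      · exact .inr hN'
      · exact .inl (le_antisymm (hprop N hN hN') hle)
    · rcases hN.2.2 _ hker (hprop N hN.1 hN.2.1) with h1 | h1
      · exact h1.le
      · exact absurd h1 hne
  refine ⟨⟨⟨v m, 0, h.ne_zero hm⟩, fun A B hA hB hAB => ?_⟩, f, hhom, fun (c : ℂ) => ⟨c • v m, ?_⟩,
    hrad.symm⟩
  · by_contra! hcon
    have hA' : A ≠ ⊤ := fun h1 => hcon.2 (by
      have := hAB.inf_eq_bot
      rwa [h1, top_inf_eq] at this)
    have hB' : B ≠ ⊤ := fun h1 => hcon.1 (by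
      have := hAB.inf_eq_bot
      rwa [h1, inf_top_eq] at this)
    refine hne (top_le_iff.1 ?_)
    rw [← hAB.sup_eq_top]
    exact sup_le (hprop A hA hA') (hprop B hB hB')
  · exact (map_smul f c (v m)).trans (by rw [hf1, smul_eq_mul, mul_one])

/-- A module in which all weight vectors can be moved to a given one has irreducible socle. -/
theorem socle (hw : WellDefined n) (h : M.IsThin I v) (hm : m ∈ I)
    (hcogen : ∀ k ∈ I, M.act (diag [] m k) (v k) = v m) : M.SocleIso (L hw m) := by
  have hmin : ∀ k, k ≠ m → M.act (diag [] k m) (v m) = 0 := by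
    intro k hk
    by_contra h1
    obtain ⟨-, hkI, -⟩ := h.act_diag_of_ne_zero hm h1
    exact hk ((h.act_trans hm h1 (by rw [hcogen k hkI]; exact h.ne_zero hm)).2 rfl)
  have hact := h.act_minimal hm hmin
  have hsub : M.IsSub (Submodule.span ℂ {v m}) := by
    intro a x hx
    obtain ⟨y, rfl⟩ := Submodule.mem_span_singleton.1 hx
    rw [map_smul, hact, smul_smul]
    exact Submodule.smul_mem _ _ (Submodule.mem_span_singleton_self _)
  have hle : ∀ N, M.IsSub N → N ≠ ⊥ → Submodule.span ℂ {v m} ≤ N := by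
    intro N hN hne
    rw [Submodule.span_singleton_le_iff_mem]
    obtain ⟨x, hx, hx0⟩ := Submodule.exists_mem_ne_zero_of_ne_bot hne
    -- Every vector is the sum of its weight components, each of which is a multiple of a weight
    -- vector, so a nonzero submodule contains some `v k` and with it `v m`.
    obtain ⟨k, hk, hk0⟩ : ∃ k ∈ I, M.act (e k) x ≠ 0 := by
      by_contra! h1
      refine hx0 ?_
      have key : ∀ y, y = ∑ k ∈ I, M.act (e k) y := by
        intro y
        have hy : y ∈ Submodule.span ℂ (v '' I) := by rw [h.span]; trivial
        induction hy using Submodule.span_induction with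
        | zero => simp
        | add x y _ _ hx hy =>
          simp only [map_add, Finset.sum_add_distrib]
          rw [← hx, ← hy]
        | smul c x _ hx =>
          simp only [map_smul]
          rw [← Finset.smul_sum, ← hx]
        | mem x hx =>
          obtain ⟨l, hl, rfl⟩ := hx
          have h2 : ∀ j ∈ I, j ≠ l → M.act (e j) (v l) = 0 := fun j _ hj => h.act_diag_of_ne hl hj
          exact ((Finset.sum_eq_single_of_mem l hl h2).trans (h.act_e l hl)).symm
      rw [key x]
      exact Finset.sum_eq_zero h1
    obtain ⟨f, hf, -⟩ := h.exists_coord hk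
    have h1 := hN (e k) x hx
    rw [hf] at h1 hk0
    have h2 := (Submodule.smul_mem_iff N (left_ne_zero_of_smul hk0)).1 h1
    rw [← hcogen k hk]
    exact hN _ _ h2
  have hne : Submodule.span ℂ {v m} ≠ ⊥ := by
    rw [Ne, Submodule.span_singleton_eq_bot]
    exact h.ne_zero hm
  have hsoc : M.socle = Submodule.span ℂ {v m} := by
    refine le_antisymm (sSup_le fun N hN => ?_) (le_sSup ⟨hsub, hne, fun N hN hle' => ?_⟩)
    · rcases hN.2.2 _ hsub (hle N hN.1 hN.2.1) with h1 | h1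
      · exact absurd h1 hne
      · exact h1.symm.le
    · by_cases hN' : N = ⊥
      · exact .inl hN'
      · exact .inr (le_antisymm hle' (hle N hN hN'))
  exact ⟨ofL hw m (v m), isHom_ofL hw hact, ofL_injective hw (h.ne_zero hm),
    (range_ofL hw m _).trans hsoc.symm⟩

end IsThin

lemma isIrreducible_L (hw : WellDefined n) (l : Lam n) : (L hw l).IsIrreducible := by
  refine ⟨inferInstanceAs (Nontrivial ℂ), fun N _ => ?_⟩
  exact eq_bot_or_eq_top (α := Submodule ℂ ℂ) N

end KMod

/-! ### The modules `θ_t L(λ̄)` -/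

lemma flipAll_shiftAll (t : GenMatching) : flipAll (shiftAll t) = shiftAll (flipAll t) := by
  simp only [flipAll, shiftAll, List.map_reverse, List.map_map]
  rfl

section

variable {a b c d : ArcDiagram} {t : GenMatching} {n : ℕ} {k l m : Lam n}

/-- Reflection and translation turn the condition on `t‡ μ̄` into one on `μ̲ t`, in which the
weights of `θ_t L(λ̄)` are described. -/
lemma isUpperReduction_ddag :
    IsUpperReduction t.ddag b.shift c.shift ↔ IsLowerReduction b t c := by
  rw [isUpperReduction_iff, ddag_eq, flipAll_shiftAll, flipAll_flipAll, isLowerReduction_shift]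

lemma isLowerReduction_ddag :
    IsLowerReduction b.shift t.ddag c.shift ↔ IsUpperReduction t b c := by
  rw [ddag_eq, isLowerReduction_shift, isUpperReduction_iff]

lemma IsLowerReduction.orientable_self (h : IsLowerReduction a t b) : Orientable a t b.shift := by
  have := (h.orientable_iff (u := []) (b := b.shift)).2 (KhovanovP.orientable_self b)
  rwa [List.append_nil] at this

lemma IsLowerReduction.surg_iff (h : IsLowerReduction a t b) :
    Surg t [] a c d ↔ Surg [] [] b c d := by
  unfold Surg
  simp only [h.orientable_iff, List.nil_append]

lemma IsUpperReduction.surg_iff (h : IsUpperReduction t d b) :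
    Surg [] t a c d ↔ Surg [] [] a c b := by
  unfold Surg
  refine forall₂_congr fun r _ => ?_
  exact h.orientable_iff (t := [Matching.middle r])

lemma exists_lower (h : Orientable m.cup t b) :
    ∃ k : Lam n, IsLowerReduction m.cup t k.cup ∧ Orientable k.cup [] b := by
  obtain ⟨a', h1, h2⟩ := exists_reduction_of_orientable (u := []) (by rwa [List.append_nil])
  exact ⟨⟨a', h1.arcs_eq.trans m.2⟩, h1, h2⟩

lemma exists_upper (h : Orientable a t l.cap) :
    ∃ k : Lam n, IsUpperReduction t l.cap k.cap ∧ Orientable a [] k.cap := by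
  obtain ⟨b', h1, h2⟩ := exists_upperReduction_of_orientable (t := []) (by rwa [List.nil_append])
  refine ⟨⟨b'.unshift, ?_⟩, ?_⟩
  · rw [b'.arcs_unshift, h1.arcs_eq]
    exact l.1.arcs_shift.trans l.2
  · simpa [Lam.cap] using And.intro h1 h2

/-- The weights of `θ_t L(λ̄)`. -/
def weights (t : GenMatching) (l : Lam n) : Set (Lam n) := {m | IsLowerReduction m.cup t l.cup}

/-- All weights are orientable with the same cap diagram, the upper reduction of `t λ̄`. -/
lemma finite_weights (t : GenMatching) (l : Lam n) : (weights t l).Finite := by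
  rcases (weights t l).eq_empty_or_nonempty with h | ⟨m, hm⟩
  · rw [h]; exact Set.finite_empty
  · obtain ⟨k, hk, -⟩ := exists_upper hm.orientable_self
    refine ((finite_orientable k.cap).preimage Subtype.val_injective.injOn).subset fun m hm => ?_
    exact (hk.orientable_iff (t := [])).1 hm.orientable_self

end

section

variable {n : ℕ} (hw : WellDefined n) (t : GenMatching) (l : Lam n) {k m : Lam n}

/-- The generator of `L(λ̄)`. -/
def oneL : (L hw l).carrier := (1 : ℂ)

/-- The class of `μ̲ t λ̄ ⊗ 1`. -/
def thetaVec (m : Lam n) : (theta hw t (L hw l)).carrier :=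
  Submodule.Quotient.mk (diag t m l ⊗ₜ[ℂ] oneL hw l)

lemma act_oneL (a : K n) : (L hw l).act a (oneL hw l) = coeff l a • oneL hw l := rfl

lemma theta_balanced (x : G n t) (a : K n) :
    (Submodule.Quotient.mk (ract n t x a ⊗ₜ[ℂ] oneL hw l) : (theta hw t (L hw l)).carrier) =
      coeff l a • Submodule.Quotient.mk (x ⊗ₜ[ℂ] oneL hw l) := by
  have h : (Submodule.Quotient.mk (ract n t x a ⊗ₜ[ℂ] oneL hw l) :
      (G n t ⊗[ℂ] (L hw l).carrier) ⧸ balanced t (L hw l)) =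
      Submodule.Quotient.mk (x ⊗ₜ[ℂ] (L hw l).act a (oneL hw l)) :=
    (Submodule.Quotient.eq _).2 (Submodule.subset_span ⟨x, a, oneL hw l, rfl⟩)
  rw [act_oneL, TensorProduct.tmul_smul] at h
  exact h

/-- If the lower reduction `κ̲` of `μ̲ t` is not `λ̲`, then `μ̲ t λ̄` is the product of `μ̲ t κ̄`
and `κ̲ λ̄`, and the second factor acts as zero on `L(λ̄)`. -/
lemma thetaVec_eq_zero (hm : m ∉ weights t l) : thetaVec hw t l m = 0 := by
  by_cases ho : Orientable m.cup t l.cap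
  · obtain ⟨k, hk, hko⟩ := exists_lower ho
    have hkl : k ≠ l := fun h => hm (h ▸ hk)
    have h1 : Surg t [] m.cup k.cup l.cap := hk.surg_iff.2 (surg_unit_left hko)
    have h2 := theta_balanced hw t l (diag t m k) (diag [] k l)
    rw [ract_diag hk.orientable_self hko h1, coeff_diag hko, if_neg fun h => hkl h.1] at h2
    exact h2.trans (zero_smul ℂ _)
  · rw [thetaVec, diag_of_not ho, TensorProduct.zero_tmul]
    rfl

lemma theta_act (a : K n) (x : G n t) :
    (theta hw t (L hw l)).act a (Submodule.Quotient.mk (x ⊗ₜ[ℂ] oneL hw l)) =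
      Submodule.Quotient.mk (lact n t a x ⊗ₜ[ℂ] oneL hw l) :=
  thetaAct_mk hw t (L hw l) a x (oneL hw l)

lemma theta_mk_zero : (Submodule.Quotient.mk ((0 : G n t) ⊗ₜ[ℂ] oneL hw l) :
    (theta hw t (L hw l)).carrier) = 0 := by
  rw [TensorProduct.zero_tmul]
  rfl

lemma theta_act_vec (h : Orientable k.cup [] m.cap) (h' : Orientable m.cup t l.cap)
    (hs : Surg [] t k.cup m.cup l.cap) :
    (theta hw t (L hw l)).act (diag [] k m) (thetaVec hw t l m) = thetaVec hw t l k := by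
  rw [thetaVec, theta_act, lact_diag h h' hs, thetaVec]

lemma span_thetaVec : Submodule.span ℂ (thetaVec hw t l '' weights t l) = ⊤ := by
  have hmem : ∀ m, thetaVec hw t l m ∈ Submodule.span ℂ (thetaVec hw t l '' weights t l) := by
    intro m
    by_cases hm : m ∈ weights t l
    · exact Submodule.subset_span ⟨m, hm, rfl⟩
    · rw [thetaVec_eq_zero hw t l hm]
      exact Submodule.zero_mem _
  rw [eq_top_iff]
  rintro z -
  obtain ⟨z, rfl⟩ := Submodule.Quotient.mk_surjective _ z
  induction z using TensorProduct.induction_on with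
  | zero => exact Submodule.zero_mem _
  | add z w hz hw => exact Submodule.add_mem _ hz hw
  | tmul x v =>
    obtain ⟨c, rfl⟩ : ∃ c : ℂ, v = c • oneL hw l := ⟨v, (mul_one (show ℂ from v)).symm⟩
    rw [TensorProduct.tmul_smul]
    suffices h : (Submodule.Quotient.mk (x ⊗ₜ[ℂ] oneL hw l) : (theta hw t (L hw l)).carrier) ∈
        Submodule.span ℂ (thetaVec hw t l '' weights t l) from Submodule.smul_mem _ c h
    clear c
    induction x using G_induction with
    | zero => rw [TensorProduct.zero_tmul]; exact Submodule.zero_mem _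
    | add x y hx hy => rw [TensorProduct.add_tmul]; exact Submodule.add_mem _ hx hy
    | basis c p =>
      obtain ⟨m, k, hp, rfl⟩ := p.exists_of
      rw [← diag_of hp, ← TensorProduct.smul_tmul']
      suffices h : (Submodule.Quotient.mk (diag t m k ⊗ₜ[ℂ] oneL hw l) :
          (theta hw t (L hw l)).carrier) ∈ Submodule.span ℂ (thetaVec hw t l '' weights t l) from
        Submodule.smul_mem _ c h
      by_cases hkl : k = l
      · rw [hkl]
        exact hmem m
      · have h := theta_balanced hw t l (diag t m k) (e k)
        rw [ract_e_self, e, coeff_diag (orientable_self _), if_neg fun h => hkl h.1, zero_smul] at h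
        exact h ▸ Submodule.zero_mem _

open Classical in
/-- The coordinates on `θ_t L(λ̄)`. -/
def coordG : G n t →ₗ[ℂ] Lam n →₀ ℂ :=
  lift fun p => if p.1.2 = l ∧ p.1.1 ∈ weights t l then Finsupp.single p.1.1 1 else 0

lemma coordG_diag (hm : m ∈ weights t l) : coordG t l (diag t m l) = Finsupp.single m 1 := by
  rw [diag_of hm.orientable_self]
  exact (lift_basisVec _ _).trans (if_pos ⟨rfl, hm⟩)

lemma coordG_diag_zero (h : ¬ (k = l ∧ m ∈ weights t l)) : coordG t l (diag t m k) = 0 := by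
  by_cases ho : Orientable m.cup t k.cap
  · rw [diag_of ho]
    exact (lift_basisVec _ _).trans (if_neg h)
  · rw [diag_of_not ho, map_zero]

/-- This makes the coordinates well defined on the tensor product, and so proves that the weight
vectors are independent. If a product from the right is `μ̲ t λ̄` for a weight `μ`, then reducing
`μ̲ t` to `λ̲` and applying `Surg.eq` shows that the right factor is `e_λ`. -/
lemma coordG_ract (x : G n t) (a : K n) : coordG t l (ract n t x a) = coeff l a • coordG t l x := by
  induction x using G_induction with
  | zero => simp
  | add x y hx hy => simp only [map_add, LinearMap.add_apply, hx, hy, smul_add]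
  | basis c p =>
    rw [map_smul, LinearMap.smul_apply, map_smul, map_smul, smul_comm]
    congr 1
    induction a using G_induction with
    | zero => simp
    | add x y hx hy => simp only [map_add, hx, hy, add_smul]
    | basis c q =>
      rw [map_smul, map_smul, map_smul, smul_assoc]
      congr 1
      obtain ⟨m, k, hp, rfl⟩ := p.exists_of
      obtain ⟨k', s, hq, rfl⟩ := q.exists_of
      rw [← diag_of hp, ← diag_of hq, coeff_diag hq]
      by_cases h : k = k' ∧ Surg t [] m.cup k.cup s.cap
      · obtain ⟨rfl, hs⟩ := h
        rw [ract_diag hp hq hs]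
        by_cases h1 : s = l ∧ m ∈ weights t l
        · obtain ⟨rfl, hm⟩ := h1
          have hm' : IsLowerReduction m.cup t s.cup := hm
          have h2 : Orientable s.cup [] k.cap :=
            (hm'.orientable_iff (u := [])).1 (by rwa [List.append_nil])
          have h3 : s = k := Subtype.ext ((hm'.surg_iff.1 hs).eq h2 hq)
          subst h3
          rw [if_pos ⟨rfl, rfl⟩, one_smul]
        · rw [coordG_diag_zero t l h1]
          by_cases h2 : k = l ∧ s = l
          · obtain ⟨rfl, rfl⟩ := h2
            rw [coordG_diag_zero t _ h1, smul_zero]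
          · rw [if_neg h2, zero_smul]
      · rw [ract_diag_zero h, map_zero]
        by_cases h1 : k' = l ∧ s = l
        · obtain ⟨rfl, rfl⟩ := h1
          rw [coordG_diag_zero, smul_zero]
          rintro ⟨rfl, -⟩
          exact h ⟨rfl, surg_unit_right hp⟩
        · rw [if_neg h1, zero_smul]

/-- The coordinates on `θ_t L(λ̄)`. -/
def coordTheta : (theta hw t (L hw l)).carrier →ₗ[ℂ] Lam n →₀ ℂ :=
  (balanced t (L hw l)).liftQ
    (TensorProduct.lift ((LinearMap.lsmul ℂ (Lam n →₀ ℂ)).flip.comp (coordG t l) :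
      G n t →ₗ[ℂ] ℂ →ₗ[ℂ] Lam n →₀ ℂ)) (by
    refine Submodule.span_le.2 ?_
    rintro _ ⟨x, a, v, rfl⟩
    rw [SetLike.mem_coe, LinearMap.mem_ker, map_sub, sub_eq_zero]
    change (show ℂ from v) • coordG t l (ract n t x a) = (coeff l a * (show ℂ from v)) • coordG t l x
    rw [coordG_ract, smul_smul, mul_comm])

lemma coordTheta_thetaVec (hm : m ∈ weights t l) :
    coordTheta hw t l (thetaVec hw t l m) = Finsupp.single m 1 := by
  change (1 : ℂ) • coordG t l (diag t m l) = _
  rw [coordG_diag t l hm, one_smul]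

theorem isThin_theta :
    (theta hw t (L hw l)).IsThin (finite_weights t l).toFinset (thetaVec hw t l) := by
  have hspan : Submodule.span ℂ (thetaVec hw t l '' (finite_weights t l).toFinset) = ⊤ := by
    rw [Set.Finite.coe_toFinset]
    exact span_thetaVec hw t l
  have hfd : FiniteDimensional ℂ (theta hw t (L hw l)).carrier :=
    ⟨Submodule.fg_def.2 ⟨_, (Finset.finite_toSet _).image _, hspan⟩⟩
  refine ⟨hspan, ?_, fun m hm => ?_, fun j k m hm => ?_⟩
  · have h1 : LinearIndependent ℂ
        fun m : (finite_weights t l).toFinset => thetaVec hw t l m := by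
      refine LinearIndependent.of_comp (coordTheta hw t l) ?_
      have h2 : (coordTheta hw t l ∘ fun m : (finite_weights t l).toFinset => thetaVec hw t l m) =
          (fun m : Lam n => Finsupp.single m (1 : ℂ)) ∘ Subtype.val := funext fun m =>
        coordTheta_thetaVec hw t l ((Set.Finite.mem_toFinset _).1 m.2)
      rw [h2]
      exact (Finsupp.linearIndependent_single_one ℂ (Lam n)).comp _ Subtype.val_injective
    simpa using h1.fintype_card_le_finrank
  · have hm₁ : m ∈ weights t l := (Set.Finite.mem_toFinset _).1 hm
    have hm' : IsLowerReduction m.cup t l.cup := hm₁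
    exact theta_act_vec hw t l (orientable_self _) hm'.orientable_self
      (surg_unit_left hm'.orientable_self)
  · have hm₁ : m ∈ weights t l := (Set.Finite.mem_toFinset _).1 hm
    have hm' : IsLowerReduction m.cup t l.cup := hm₁
    by_cases ho : Orientable j.cup [] k.cap
    · by_cases h : k = m ∧ Surg [] t j.cup k.cup l.cap
      · obtain ⟨rfl, hs⟩ := h
        have h1 := theta_act_vec hw t l ho hm'.orientable_self hs
        by_cases hj : j ∈ weights t l
        · exact .inr ⟨rfl, (Set.Finite.mem_toFinset _).2 hj, h1⟩
        · left
          rw [h1, thetaVec_eq_zero hw t l hj]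
      · left
        rw [thetaVec, theta_act, lact_diag_zero h]
        exact theta_mk_zero hw t l
    · left
      rw [diag_of_not ho, map_zero, LinearMap.zero_apply]

/-- By replacing `t λ̄` by its upper reduction `ν̄`, the product of `μ̲ ν̄` and `ν̲ t λ̄` becomes
that of `μ̲ ν̄` with the idempotent `ν̲ ν̄`. -/
lemma thetaVec_generated {v : Lam n} (hv : IsUpperReduction t l.cap v.cap) (hm : m ∈ weights t l) :
    (theta hw t (L hw l)).act (diag [] m v) (thetaVec hw t l v) = thetaVec hw t l m := by
  have h1 : Orientable m.cup [] v.cap := (hv.orientable_iff (t := [])).1 hm.orientable_self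
  exact theta_act_vec hw t l h1 ((hv.orientable_iff (t := [])).2 (orientable_self _))
    (hv.surg_iff.2 (surg_unit_right h1))

/-- Otherwise the vector belonging to `ν̲` would be zero, although it generates the nonzero vectors
of all weights. -/
lemma mem_weights_of_upper {v : Lam n} (hv : IsUpperReduction t l.cap v.cap)
    (hne : (weights t l).Nonempty) : v ∈ weights t l := by
  obtain ⟨m, hm⟩ := hne
  by_contra h
  have h1 := thetaVec_generated (wellDefined n) t l hv hm
  rw [thetaVec_eq_zero _ t l h, map_zero] at h1
  exact (isThin_theta (wellDefined n) t l).ne_zero ((Set.Finite.mem_toFinset _).2 hm) h1.symm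

lemma nontrivial_theta : Nontrivial (theta hw t (L hw l)).carrier ↔ (weights t l).Nonempty := by
  constructor
  · intro h
    by_contra h0
    have h1 := span_thetaVec hw t l
    rw [Set.not_nonempty_iff_eq_empty.1 h0, Set.image_empty, Submodule.span_empty] at h1
    exact bot_ne_top h1
  · rintro ⟨m, hm⟩
    exact ⟨_, 0, (isThin_theta hw t l).ne_zero ((Set.Finite.mem_toFinset _).2 hm)⟩

/-- The weight of the socle of `θ_t L(λ̄)`. -/
theorem exists_socle_weight (hne : (weights t l).Nonempty) :
    ∃ k ∈ weights t l, IsLowerReduction l.cup t.ddag k.cup ∧ ∀ m ∈ weights t l,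
      (theta hw t (L hw l)).act (diag [] k m) (thetaVec hw t l m) = thetaVec hw t l k := by
  -- As `d.shift` is `λ̲`, this makes `λ̲` the least element in the surgery order for `d`. The cap
  -- diagram `d` replaces `λ̄` until the candidate for the socle has been found.
  set d := l.cup.unshift with hd
  have hds : d.shift = l.cup := l.cup.shift_unshift
  have hld : Orientable l.cup [] d := by
    have h := orientable_self d.unshift
    rw [d.shift_unshift] at h
    exact hds ▸ orientable_shift_self h
  have hmd : ∀ m ∈ weights t l, Orientable m.cup t d := fun m hm => by
    have hm' : IsLowerReduction m.cup t l.cup := hm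
    have := (hm'.orientable_iff (u := [])).2 hld
    rwa [List.append_nil] at this
  obtain ⟨m₀, hm₀⟩ := hne
  obtain ⟨c, hc, hc₀⟩ := exists_upperReduction_of_orientable (t := [])
    (by rw [List.nil_append]; exact hmd m₀ hm₀)
  have hck : IsLowerReduction l.cup t.ddag c.shift := by
    rw [← hds, isLowerReduction_ddag]
    exact hc
  set k : Lam n := ⟨c.shift, hck.arcs_eq.trans l.2⟩ with hk
  have hmc : ∀ m ∈ weights t l, Orientable m.cup [] c := fun m hm =>
    (hc.orientable_iff (t := [])).1 (hmd m hm)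
  -- For the upper reduction `c` of `t d` the least element is `c.shift`, so all weights can be
  -- moved to it.
  have hkm : ∀ m ∈ weights t l, Surg [] [] k.cup m.cup c := fun m hm => surg_shift (hmc m hm)
  -- Associativity transports the surgeries from `t d` to `t λ̄`.
  have key : ∀ m ∈ weights t l, Orientable k.cup [] m.cap ∧ Surg [] t k.cup m.cup l.cap ∧
      Surg t [] k.cup l.cup d := by
    intro m hm
    have hm' : IsLowerReduction m.cup t l.cup := hm
    have h1 := (hkm m hm).orientable_left (hmc m hm)
    have h2 := surg_assoc (u := []) (t := t) (v := []) h1 hld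
    rw [List.append_nil] at h2
    exact ⟨h1, h2.2 ⟨hm'.surg_iff.2 (surg_unit_left hld), hc.surg_iff.2 (hkm m hm)⟩⟩
  -- The lower reduction `a` of `k t` lies below `λ̲` in the surgery order for `d`, and `λ̲` is the
  -- least element, hence `a = λ̲`.
  have hkw : k ∈ weights t l := by
    obtain ⟨h1, h2, h3⟩ := key m₀ hm₀
    have hko : Orientable k.cup t l.cap := h2.orientable h1
    obtain ⟨a, ha, hal⟩ := exists_lower hko
    have h4 := ha.surg_iff.1 h3
    have h5 : Surg [] [] l.cup a.cup d := hds ▸ surg_shift (h4.orientable_right hld)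
    have h6 : l = a := Subtype.ext (h5.antisymm h4 (h4.orientable_right hld))
    rw [← h6] at ha
    exact ha
  refine ⟨k, hkw, hck, fun m hm => ?_⟩
  obtain ⟨h1, h2, -⟩ := key m hm
  exact theta_act_vec hw t l h1 hm.orientable_self h2

lemma exists_upper_of_full (h1 : ¬ HasCircle .empty t l.cap) (h2 : ¬ HasTopLine .empty t l.cap) :
    ∃ v : Lam n, IsUpperReduction t l.cap v.cap := by
  rw [← hasCircle_flip] at h1
  rw [← hasBottomLine_flip] at h2
  obtain ⟨c, hc⟩ := exists_isLowerReduction (full_iff.2 ⟨h1, h2⟩)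
  rw [← isUpperReduction_iff] at hc
  refine ⟨⟨c.unshift, ?_⟩, by simpa [Lam.cap] using hc⟩
  rw [c.arcs_unshift, hc.arcs_eq]
  exact l.1.arcs_shift.trans l.2

end

end KhovanovP

end

/-! ### The main theorem -/

theorem mainTheorem12 (n : ℕ) (t : KhovanovP.GenMatching) (l : KhovanovP.Lam n) :
    -- the algebra `Kₙ`, the bimodules `G_t` and the modules `L(μ̄)` are well-defined, and
    ∃ h : KhovanovP.WellDefined n,
      -- (i) `θ_t L(λ̄)` is finite dimensional, the index set is finite, and `[θ_t L(λ̄)] = ∑ [L(μ̄)]`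
      (∃ (hfd : FiniteDimensional ℂ
            (KhovanovP.theta h t (KhovanovP.L h l)).carrier)
          (hfin : {m : KhovanovP.Lam n |
            ¬ KhovanovP.HasCircle .empty t.ddag m.cap ∧
            ¬ KhovanovP.HasTopLine .empty t.ddag m.cap ∧
            KhovanovP.IsUpperReduction t.ddag m.cap l.cap}.Finite),
        KhovanovP.cls (KhovanovP.theta h t (KhovanovP.L h l)) hfd =
          ∑ m ∈ hfin.toFinset,
            KhovanovP.cls (KhovanovP.L h m) (KhovanovP.L_finiteDimensional h m)) ∧
      -- (ii) the criterion for `θ_t L(λ̄) ≠ 0`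
      (Nontrivial (KhovanovP.theta h t (KhovanovP.L h l)).carrier ↔
        ¬ KhovanovP.HasCircle .empty t l.cap ∧
        ¬ KhovanovP.HasTopLine .empty t l.cap ∧
        KhovanovP.IsUpperReduction (t.ddag ++ t) l.cap l.cap) ∧
      -- (iii), (iv) indecomposability, head and socle
      (Nontrivial (KhovanovP.theta h t (KhovanovP.L h l)).carrier →
        (KhovanovP.theta h t (KhovanovP.L h l)).IsIndecomposable ∧
        (∃ v : KhovanovP.Lam n, KhovanovP.IsUpperReduction t l.cap v.cap ∧
          (KhovanovP.L h v).IsIrreducible ∧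
          (KhovanovP.theta h t (KhovanovP.L h l)).HeadIso (KhovanovP.L h v)) ∧
        (∃ v : KhovanovP.Lam n, KhovanovP.IsLowerReduction l.cup t.ddag v.cup ∧
          (KhovanovP.L h v).IsIrreducible ∧
          (KhovanovP.theta h t (KhovanovP.L h l)).SocleIso (KhovanovP.L h v))) := by
  have hw := KhovanovP.wellDefined n
  have hset : {m : KhovanovP.Lam n | ¬ KhovanovP.HasCircle .empty t.ddag m.cap ∧
      ¬ KhovanovP.HasTopLine .empty t.ddag m.cap ∧
      KhovanovP.IsUpperReduction t.ddag m.cap l.cap} = KhovanovP.weights t l := by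
    ext m
    refine ⟨fun h => KhovanovP.isUpperReduction_ddag.1 h.2.2, fun h => ?_⟩
    have h' := KhovanovP.isUpperReduction_ddag.2 h
    exact ⟨h'.1, h'.2.1, h'⟩
  have hthin := KhovanovP.isThin_theta hw t l
  have hnt := KhovanovP.nontrivial_theta hw t l
  refine ⟨hw, ⟨hthin.finiteDimensional, hset ▸ KhovanovP.finite_weights t l, ?_⟩, ?_, fun hne => ?_⟩
  · rw [hthin.cls_eq hw]
    refine Finset.sum_congr ?_ fun _ _ => rfl
    ext m
    rw [Set.Finite.mem_toFinset, Set.Finite.mem_toFinset, hset]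
  · rw [hnt]
    constructor
    · rintro ⟨m, hm⟩
      obtain ⟨v, hv, -⟩ := KhovanovP.exists_upper
        (KhovanovP.IsLowerReduction.orientable_self (show KhovanovP.IsLowerReduction m.cup t l.cup from hm))
      -- After replacing `t λ̄` by its upper reduction `ν̄`, the criterion says precisely that `ν`
      -- is a weight.
      refine ⟨hv.1, hv.2.1, hv.append_iff.2 ?_⟩
      exact KhovanovP.isUpperReduction_ddag.2 (KhovanovP.mem_weights_of_upper t l hv ⟨m, hm⟩)
    · rintro ⟨h1, h2, h3⟩
      obtain ⟨v, hv⟩ := KhovanovP.exists_upper_of_full t l h1 h2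
      exact ⟨v, KhovanovP.isUpperReduction_ddag.1 (hv.append_iff.1 h3)⟩
  · have hwt := hnt.1 hne
    obtain ⟨m, hm⟩ := hwt
    obtain ⟨v, hv, -⟩ := KhovanovP.exists_upper
      (KhovanovP.IsLowerReduction.orientable_self (show KhovanovP.IsLowerReduction m.cup t l.cup from hm))
    have hvw := KhovanovP.mem_weights_of_upper t l hv ⟨m, hm⟩
    obtain ⟨h1, h2⟩ := hthin.head hw ((Set.Finite.mem_toFinset _).2 hvw) fun k hk =>
      (KhovanovP.thetaVec_generated hw t l hv ((Set.Finite.mem_toFinset _).1 hk)).symm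
    obtain ⟨k, hk, hkd, hks⟩ := KhovanovP.exists_socle_weight hw t l ⟨m, hm⟩
    exact ⟨h1, ⟨v, hv, KhovanovP.KMod.isIrreducible_L hw v, h2⟩, k, hkd,
      KhovanovP.KMod.isIrreducible_L hw k, hthin.socle hw ((Set.Finite.mem_toFinset _).2 hk)
        fun j hj => hks j ((Set.Finite.mem_toFinset _).1 hj)⟩
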